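/- Let $k$ be a field, $X$ a smooth projective geometrically integral curve over $k$ with canonical sheaf $\omega_X$, $D\subset X(k)$ a finite set (also viewed as a reduced divisor) and $r\ge 1$. For each $x\in D$ let a composition $r=m^1(x)+\dots+m^{\sigma_x}(x)$ into positive integers be given. Let $n_1\ge\dots\ge n_{\sigma}$ ($\sigma=\sigma_x$) be its parts in decreasing order, $\mu_1\ge\mu_2\ge\cdots$, $\mu_j=\#\{\ell: n_\ell\ge j\}$, the conjugate partition, $\gamma_j=\gamma_j(x)$, $1\le j\le r$, the integer $l$ with $\mu_1+\dots+\mu_{l-1}<j\le\mu_1+\dots+\mu_l$, and $N_i=n_{i+1}+\dots+n_\sigma$ for $0\le i\le\sigma$ (so $N_\sigma=0$); put $n_{\sigma+1}=0$. Let $a=(a_1,\dots,a_r)\in\prod_{j=1}^r H^0\big(X,\omega_X^{\otimes j}(\sum_{x\in D}(j-\gamma_j(x))x)\big)$, let $X_a$ be the spectral curve $\theta^r+a_1\theta^{r-1}+\dots+a_r=0$ in the total space of $\omega_X(D)$, suppose that $X_a$ is integral, and let $\tilde X_a$ be its normalization, with projection $\tilde\pi_a:\tilde X_a\to X$. Fix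 $x\in D$ and a formal coordinate $t$ at $x$, so that $\hat{\mathcal O}_{X,x}=k[[t]]$, and write $a_j=c_jt^{\gamma_j}(dt/t)^{\otimes j}$ with $c_j\in k[[t]]$. For $0\le i\le\sigma$ put $$F_i=\lambda^{N_i}+\sum_{\ell=1}^r c_\ell\,u_i^{\gamma_\ell}\lambda^{i\gamma_\ell+N_i-\ell},\qquad A^{(i)}=k[[t]][\lambda,u_i]/(t-\lambda^iu_i,\;F_i).$$ Suppose that $a$ is generic at $x$: $c_\ell(0)\ne0$ for $1\le\ell\le r$, and for $1\le i\le\sigma$ all nonzero roots in $\bar k$ of the polynomial $F_i|_{t=\lambda=0}\in k[u_i]$ are simple. Then the following hold. There is exactly one point of $X_a$ over $x$, and $A^{(0)}$ is, as an algebra over $\mathcal O_{X,x}$, the completion of the local ring of $X_a$ at this point. For $0\le i<\sigma$, the chart of the blow-up of $\mathrm{Spec}\,A^{(i)}$ along the ideal $(\lambda,u_i)$ on which $\lambda$ generates the inverse image ideal is $\mathrm{Spec}\,A^{(i+1)}$, with $u_{i+1}=u_i/\lambda$, and this chart contains the whole exceptional divisor. (a) For $0\le i\le\sigma$, $\mathrm{Spec}\,A^{(i)}$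 is smooth over $k$ (that is, its local rings are geometrically regular over $k$) outside the point $(\lambda,u_i)=(0,0)$; it is non-smooth at that point if $n_{i+1}\ge2$, and it is smooth everywhere if $n_{i+1}\le1$. In particular $\mathrm{Spec}\,A^{(\sigma)}$ is smooth. (b) There are finitely many points of $\tilde X_a$ over $x$; their local rings are discrete valuation rings and their residue fields are separable over $k$. The set of ramification indices $e(y)$ of $\tilde\pi_a$ at these points $y$ is the set of nonzero parts of the conjugate partition $\mu$, and, for every $i\ge1$, the points $y$ over $x$ with $e(y)=i$ satisfy $$\sum_{e(y)=i}[\kappa(y):k]=\#\{\ell:\mu_\ell=i\}.$$ (c) For every $i\ge1$ there is a line bundle on $\tilde X_a$ (defined over $k$) of degree $\#\{\ell:\mu_\ell=i\}$ over $k$. If $\#\{\ell:\mu_\ell=i\}=1$, there is a $k$-rational point of $\tilde X_a$ over $x$. -/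

import Mathlib

open CategoryTheory AlgebraicGeometry TopologicalSpace
open scoped TensorProduct PowerSeries

universe u

namespace ParabolicSpectral

noncomputable section

section Combinatorics

/-! A parabolic type of rank `r` at a marked point is a composition `m = (m^1, …, m^σ)` of `r`. -/

variable {r : ℕ}

/-- The parts of `m` in decreasing order `n_1 ≥ n_2 ≥ ⋯ ≥ n_σ`. -/
def sortedParts (m : Composition r) : List ℕ := m.blocks.insertionSort (· ≥ ·)

/-- The part `n_i`, for `1 ≤ i ≤ σ`; for `i > σ` this is `0`. -/
def sortedPart (m : Composition r) (i : ℕ) : ℕ := (sortedParts m).getD (i - 1) 0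

/-- `N_i = n_{i+1} + ⋯ + n_σ`. -/
def tailSum (m : Composition r) (i : ℕ) : ℕ := ((sortedParts m).drop i).sum

/-- The conjugate partition `μ_j = #{ℓ : n_ℓ ≥ j}`, for `j ≥ 1`. -/
def dualPart (m : Composition r) (j : ℕ) : ℕ := (sortedParts m).countP (j ≤ ·)

/-- The level function: for `1 ≤ j ≤ r`, `γ_j` is the unique `l` with
`μ_1 + ⋯ + μ_{l-1} < j ≤ μ_1 + ⋯ + μ_l`. -/
def level (m : Composition r) (j : ℕ) : ℕ :=
  sInf {l | j ≤ ∑ t ∈ Finset.Icc 1 l, dualPart m t}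

/-- `#{ℓ : μ_ℓ = i}`, for `i ≥ 1` (the conjugate partition has at most `r` nonzero parts). -/
def partMult (m : Composition r) (i : ℕ) : ℕ :=
  ((Finset.Icc 1 r).filter fun l => dualPart m l = i).card

end Combinatorics

section LocalRings

variable {k : Type u} [Field k] {r : ℕ} (m : Composition r) (c : ℕ → k⟦X⟧)

/-- The equation `λ^{N_i} + ∑_{ℓ=1}^r c_ℓ u^{γ_ℓ} λ^{i γ_ℓ + N_i - ℓ}` in `k[[t]][λ, u]`, where
`λ` is the variable `0` and `u` the variable `1`. For `0 ≤ i ≤ σ` all exponents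
`i γ_ℓ + N_i - ℓ` are nonnegative. -/
def localEq (i : ℕ) : MvPolynomial (Fin 2) k⟦X⟧ :=
  MvPolynomial.X 0 ^ tailSum m i + ∑ l ∈ Finset.Icc 1 r,
    MvPolynomial.C (c l) * MvPolynomial.X 1 ^ level m l *
      MvPolynomial.X 0 ^ (i * level m l + tailSum m i - l)

/-- The ring `A^{(i)} = k[[t]][λ, u_i] / (t - λ^i u_i, localEq i)`. -/
abbrev BlowupRing (i : ℕ) : Type u :=
  MvPolynomial (Fin 2) k⟦X⟧ ⧸ (Ideal.span
    {MvPolynomial.C PowerSeries.X - MvPolynomial.X 0 ^ i * MvPolynomial.X 1, localEq m c i})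

/-- The class of `λ` in `A^{(i)}`. -/
def lam (i : ℕ) : BlowupRing m c i := Ideal.Quotient.mk _ (MvPolynomial.X 0)

/-- The class of `u_i` in `A^{(i)}`. -/
def uvar (i : ℕ) : BlowupRing m c i := Ideal.Quotient.mk _ (MvPolynomial.X 1)

/-- The polynomial in `u` obtained from `localEq i` by setting `t = 0` and `λ = 0`. -/
def fibrePoly (i : ℕ) : Polynomial k :=
  MvPolynomial.eval₂Hom (Polynomial.C.comp (PowerSeries.constantCoeff (R := k)))
    ![0, Polynomial.X] (localEq m c i)

/-- Genericity of the local coefficients: `c_ℓ(0) ≠ 0` for `1 ≤ ℓ ≤ r`, and for `1 ≤ i ≤ σ` the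
nonzero roots of `fibrePoly i` in an algebraic closure of `k` are simple. -/
def IsGeneric : Prop :=
  (∀ l ∈ Finset.Icc 1 r, PowerSeries.constantCoeff (c l) ≠ 0) ∧
  ∀ i ∈ Finset.Icc 1 m.length, ∀ z : AlgebraicClosure k, z ≠ 0 →
    Polynomial.aeval z (fibrePoly m c i) = 0 →
      Polynomial.aeval z (Polynomial.derivative (fibrePoly m c i)) ≠ 0

/-- The affine blow-up algebra `R[I/a]`, for `a ∈ I`: the `R`-subalgebra of `R[1/a]` generated by
the fractions `x/a` with `x ∈ I`. If `I = (a, b)`, the blow-up of `Spec R` along `I` is the union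
of its open charts `Spec R[I/a]` and `Spec R[I/b]`; in the chart `Spec R[I/a]` the exceptional
divisor is `a = 0`, and the complement of the chart `Spec R[I/b]` is `b/a = 0`. -/
def affineBlowup {R : Type u} [CommRing R] (I : Ideal R) (a : R) :
    Subalgebra R (Localization.Away a) :=
  Algebra.adjoin R {z | ∃ x ∈ I, z * algebraMap R _ a = algebraMap R _ x}

/-- The blow-up of `Spec R` along `(a, b)` is given by the `B`-algebra `S` with elements `a', b'`:
the chart `R[(a, b)/a]` is `S`, with `a' ↦ a` and `b' ↦ b/a`, and it contains the exceptional
divisor, since in the other chart `R[(a, b)/b]` the functions `b` and `v = a/b` have no common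
zero. -/
def IsBlowupStep (B : Type u) {R S : Type u} [CommRing B] [CommRing R] [CommRing S] [Algebra B R]
    [Algebra B S] (a b : R) (a' b' : S) : Prop :=
  (∃ e : S ≃ₐ[B] affineBlowup (Ideal.span {a, b}) a,
    (e a' : Localization.Away a) = algebraMap R _ a ∧
    (e b' : Localization.Away a) * algebraMap R _ a = algebraMap R _ b) ∧
  ∃ v : affineBlowup (Ideal.span {a, b}) b,
    v * algebraMap R _ b = algebraMap R _ a ∧ Ideal.span {algebraMap R _ b, v} = ⊤

/-- The ring homomorphism `ψ` exhibits `S` as the completion of the local ring `R`: `S` is complete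
for the topology defined by `𝔪_R S`, and `R/𝔪_R^n → S/𝔪_R^n S` is bijective for all `n`. -/
def IsCompletionMap {R S : Type u} [CommRing R] [IsLocalRing R] [CommRing S] (ψ : R →+* S) : Prop :=
  IsAdicComplete ((IsLocalRing.maximalIdeal R).map ψ) S ∧
  (∀ (n : ℕ) (y : S), ∃ x : R, y - ψ x ∈ (IsLocalRing.maximalIdeal R).map ψ ^ n) ∧
  ∀ (n : ℕ) (x : R), ψ x ∈ (IsLocalRing.maximalIdeal R).map ψ ^ n →
    x ∈ IsLocalRing.maximalIdeal R ^ n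

/-- Smoothness over `k` of the (Noetherian, not finite type) scheme `Spec A` at a prime `p`: the
local ring `A_p` is geometrically regular over `k`. -/
def IsSmoothAt (k : Type u) [Field k] (A : Type u) [CommRing A] [Algebra k A]
    (p : Ideal A) [p.IsPrime] : Prop :=
  ∀ (k' : Type u) [Field k'] [Algebra k k'] [FiniteDimensional k k'],
    IsRegularRing (k' ⊗[k] Localization.AtPrime p)

end LocalRings

section Preliminaries

variable {X : Scheme.{u}}

lemma germ_basicOpen {U : X.Opens} (g : Γ(X, U)) (f : Γ(X, U)) {x : X} (hx : x ∈ X.basicOpen g) :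
    X.presheaf.germ (X.basicOpen g) x hx (X.presheaf.map (homOfLE (X.basicOpen_le g)).op f) =
      X.presheaf.germ U x (X.basicOpen_le g hx) f :=
  X.presheaf.germ_res_apply _ _ _ _

lemma exists_basicOpen {U : X.Opens} (hU : IsAffineOpen U) (g : Γ(X, U))
    (f : Γ(X, X.basicOpen g)) : ∃ (n : ℕ) (b : Γ(X, U)),
      f * X.presheaf.map (homOfLE (X.basicOpen_le g)).op g ^ n =
        X.presheaf.map (homOfLE (X.basicOpen_le g)).op b := by
  have := hU.isLocalization_basicOpen g
  obtain ⟨⟨b, ⟨_, n, rfl⟩⟩, h⟩ := IsLocalization.surj (Submonoid.powers g) f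
  exact ⟨n, b, by simpa [RingHom.algebraMap_toAlgebra] using h⟩

lemma isLocalization_of_eq {W V : X.Opens} (hW : IsCompact (W : Set X))
    (hW' : IsQuasiSeparated (W : Set X)) (f : Γ(X, W)) (hV : V ≤ W) (e : V = X.basicOpen f) :
    letI := (X.presheaf.map (homOfLE hV).op).hom.toAlgebra
    IsLocalization.Away f Γ(X, V) := by
  subst e
  exact isLocalization_basicOpen_of_qcqs hW hW' f

/-- Localization of a subring, inside a localization of the ambient ring. -/
lemma isLocalization_subring {A B : Type u} [CommRing A] [CommRing B] (φ : A →+* B)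
    (a : A) (hφ : letI := φ.toAlgebra; IsLocalization.Away a B) (S : Subring A) (T : Subring B)
    (ha : a ∈ S) (ψ : S →+* T) (hψ : ∀ x, (ψ x : B) = φ x)
    (hinv : ∃ b ∈ T, φ a * b = 1) (hT : ∀ z ∈ T, ∃ (n : ℕ), ∃ x ∈ S, z * φ a ^ n = φ x) :
    letI := ψ.toAlgebra
    IsLocalization.Away (⟨a, ha⟩ : S) T := by
  let := φ.toAlgebra
  let := ψ.toAlgebra
  have hφ : IsLocalization.Away a B := hφ
  constructor; constructor
  · rintro ⟨_, n, rfl⟩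
    obtain ⟨b, hb, e⟩ := hinv
    have : IsUnit (ψ ⟨a, ha⟩) := .of_mul_eq_one ⟨b, hb⟩ (Subtype.ext (by simpa [hψ] using e))
    have h := this.pow n
    rwa [← map_pow] at h
  · rintro ⟨z, hz⟩
    obtain ⟨n, x, hx, e⟩ := hT z hz
    refine ⟨⟨⟨x, hx⟩, ⟨_, n, rfl⟩⟩, Subtype.ext ?_⟩
    simpa [RingHom.algebraMap_toAlgebra, hψ] using e
  · rintro ⟨x, hx⟩ ⟨y, hy⟩ h
    have h' : φ x = φ y := by
      have := congrArg Subtype.val h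
      simpa [RingHom.algebraMap_toAlgebra, hψ] using this
    obtain ⟨⟨_, n, rfl⟩, e⟩ := IsLocalization.exists_of_eq (M := Submonoid.powers a) (S := B) h'
    exact ⟨⟨_, n, rfl⟩, Subtype.ext (by simpa using e)⟩

end Preliminaries

section Curve

variable {k : Type u} [Field k] (X : Scheme.{u}) [X.Over (Spec (.of k))]

/-- The local rings (and the function field) of a `k`-scheme are `k`-algebras. -/
instance (priority := low) stalkAlgebra (x : X) : Algebra k (X.presheaf.stalk x) :=
  ((Scheme.ΓSpecIso (.of k)).inv ≫ (X ↘ Spec (.of k)).appTop ≫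
    X.presheaf.germ ⊤ x trivial).hom.toAlgebra

variable [IsIntegral X]

variable (k) in
/-- The space `(Ω_{K/k})^{⊗ j}` of rational `j`-differentials, `K` the function field of `X`. -/
abbrev RatDiff (j : ℕ) : Type u :=
  ⨂[X.functionField]^j (Ω[X.functionField⁄k])

variable {X}

/-- The value `w(δ, …, δ)` of a rational `j`-differential on a rational vector field. -/
def contract (j : ℕ) (δ : Derivation k X.functionField X.functionField) :
    RatDiff k X j →ₗ[X.functionField] X.functionField :=
  PiTensorProduct.lift ((MultilinearMap.mkPiAlgebra X.functionField (Fin j)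
    X.functionField).compLinearMap fun _ => δ.liftKaehlerDifferential)

/-- The stalk at `y` of `ω_X^{⊗ j}(n y)`, as a group of rational `j`-differentials: sums of
`f · dg_1 ⊗ ⋯ ⊗ dg_j` with `g_i` in the local ring at `y` and `f ∈ 𝔪_y^{-n}`. -/
def stalkDiff (j n : ℕ) (y : X) : AddSubgroup (RatDiff k X j) :=
  AddSubgroup.closure
    {w | ∃ (f : X.functionField) (g : Fin j → X.presheaf.stalk y),
      (∀ h ∈ IsLocalRing.maximalIdeal (X.presheaf.stalk y) ^ n,
        f * algebraMap _ X.functionField h ∈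
          (algebraMap (X.presheaf.stalk y) X.functionField).range) ∧
      w = f • PiTensorProduct.tprod X.functionField
        fun i => KaehlerDifferential.D k X.functionField (algebraMap _ _ (g i))}

/-- The tuple `(a_1, …, a_r)` belongs to the parabolic Hitchin base
`∏_{j=1}^r H⁰(X, ω_X^{⊗ j} ⊗ 𝒪_X(∑_{x ∈ D} (j - γ_j(x)) x))`, for the parabolic type `m(x)` at
`x ∈ D`. (Always `γ_j ≤ j`; the values `m x` for `x ∉ D` and `a_j` for `j = 0` or `j > r` play
no role.) -/
def IsHitchinPoint (D : Finset X) {r : ℕ} (m : X → Composition r) (a : ∀ j, RatDiff k X j) : Prop :=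
  ∀ j ∈ Finset.Icc 1 r,
    (∀ x ∈ D, a j ∈ stalkDiff j (j - level (m x) j) x) ∧ ∀ y ∉ D, a j ∈ stalkDiff j 0 y

/-- Local coefficients at a rational point `x`. The `k`-algebra map `φ : 𝒪_{X,x} → k[[t]]`, with
`𝔪_x k[[t]] = (t)`, is a formal coordinate `t` at `x`, and `a_j = c_j t^{γ_j} (dt/t)^{⊗ j}` in the
formal neighbourhood of `x`. To express this we use an auxiliary uniformizer `s` of `𝒪_{X,x}`,
the vector field `ε = s ∂/∂s`, and `a_j = α (ds/s)^{⊗ j}`, `ds/s = (t (ds/dt) / s) dt/t`. -/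
def IsLocalExpansion {r : ℕ} (m : Composition r) (a : ∀ j, RatDiff k X j) (x : X)
    (φ : X.presheaf.stalk x →ₐ[k] k⟦X⟧) (c : ℕ → k⟦X⟧) : Prop :=
  (IsLocalRing.maximalIdeal (X.presheaf.stalk x)).map φ = Ideal.span {PowerSeries.X} ∧
  ∃ (s : X.presheaf.stalk x) (ε : Derivation k X.functionField X.functionField),
    IsLocalRing.maximalIdeal (X.presheaf.stalk x) = Ideal.span {s} ∧
    ε (algebraMap _ _ s) = algebraMap _ _ s ∧
    ∀ j ∈ Finset.Icc 1 r, ∃ α : X.presheaf.stalk x,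
      algebraMap _ X.functionField α = contract j ε (a j) ∧
      φ α * (PowerSeries.X * PowerSeries.derivative k (φ s)) ^ j =
        c j * PowerSeries.X ^ level m j * φ s ^ j

/-- The rational vector field `δ` is a section over `U` of `T_X(-D)`, the dual of `ω_X(D)`: it
maps `𝒪_X(U)` to the functions on `U` that vanish at the points of `D`. -/
def LogField (D : Finset X) (U : X.Opens)
    (δ : Derivation k X.functionField X.functionField) : Prop :=
  ∀ (hη : genericPoint X ∈ U) (f : Γ(X, U)), ∃ g : Γ(X, U),
    X.presheaf.germ U _ hη g = δ (X.presheaf.germ U _ hη f) ∧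
    ∀ x ∈ D, ∀ hx : x ∈ U,
      X.presheaf.germ U x hx g ∈ IsLocalRing.maximalIdeal (X.presheaf.stalk x)

/-- The characteristic polynomial `T^r + ∑_j a_j(δ, …, δ) T^{r-j}`. It is the equation
`θ^r + a_1 θ^{r-1} + ⋯ + a_r = 0` of the spectral curve at the generic point of `X`, written for
the coordinate `T = ⟨θ, δ⟩`, where `θ` is the tautological section. -/
def charPoly (r : ℕ) (a : ∀ j, RatDiff k X j) (δ : Derivation k X.functionField X.functionField) :
    Polynomial X.functionField :=
  Polynomial.X ^ r + ∑ j ∈ Finset.Icc 1 r,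
    Polynomial.C (contract j δ (a j)) * Polynomial.X ^ (r - j)

/-- The generic fibre of the spectral curve. -/
abbrev GenericFibre (r : ℕ) (a : ∀ j, RatDiff k X j)
    (δ : Derivation k X.functionField X.functionField) : Scheme.{u} :=
  Spec (.of (AdjoinRoot (charPoly r a δ)))

/-- The projection of the generic fibre to `X`. -/
def genericFibreMap (r : ℕ) (a : ∀ j, RatDiff k X j)
    (δ : Derivation k X.functionField X.functionField) : GenericFibre r a δ ⟶ X :=
  Spec.map (CommRingCat.ofHom (AdjoinRoot.of (charPoly r a δ))) ≫ X.fromSpecStalk (genericPoint X)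

/-- Restriction of global functions on the generic fibre to an open subset. -/
def restrictFun (r : ℕ) (a : ∀ j, RatDiff k X j)
    (δ : Derivation k X.functionField X.functionField) (V : (GenericFibre r a δ).Opens) :
    AdjoinRoot (charPoly r a δ) →+* Γ(GenericFibre r a δ, V) :=
  ((Scheme.ΓSpecIso (.of (AdjoinRoot (charPoly r a δ)))).inv ≫
    (GenericFibre r a δ).presheaf.map (homOfLE le_top).op).hom

/-- The coordinate ring of the part of the spectral curve over an affine open `U`, i.e.
`Sym_{𝒪(U)} (ω_X(D)^∨(U)) / (characteristic polynomial)`. Being locally free over `𝒪(U)`, it is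
the subring of the ring of functions on the generic fibre that is generated by `𝒪(U)` and the
`⟨θ, h δ⟩ = h T` with `h δ` a section of `ω_X(D)^∨ = T_X(-D)` over `U`. -/
def spectralRing (D : Finset X) (r : ℕ) (a : ∀ j, RatDiff k X j)
    (δ : Derivation k X.functionField X.functionField) (U : X.Opens) :
    Subring Γ(GenericFibre r a δ, genericFibreMap r a δ ⁻¹ᵁ U) :=
  Subring.closure (Set.range ((genericFibreMap r a δ).app U).hom ∪
    {z | ∃ h : X.functionField, LogField D U (h • δ) ∧
      z = restrictFun r a δ _ (AdjoinRoot.of _ h * AdjoinRoot.root _)})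


lemma LogField.basicOpen {D : Finset X} {U : X.Opens} (hU : IsAffineOpen U)
    {δ : Derivation k X.functionField X.functionField} (h : LogField D U δ) (g : Γ(X, U)) :
    LogField D (X.basicOpen g) δ := by
  intro hη f
  have hη' := X.basicOpen_le g hη
  obtain ⟨n, b, hb⟩ := exists_basicOpen hU g f
  obtain ⟨b', hb', hbD⟩ := h hη' b
  obtain ⟨c', hc', hcD⟩ := h hη' (g ^ n)
  have hu : IsUnit (X.presheaf.map (homOfLE (X.basicOpen_le g)).op g ^ n) :=
    (RingedSpace.isUnit_res_basicOpen _ g).pow n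
  obtain ⟨w, hw⟩ := hu.exists_left_inv
  let ρ := (X.presheaf.map (homOfLE (X.basicOpen_le g)).op).hom
  refine ⟨w * (ρ b' - f * ρ c'), ?_, ?_⟩
  · have e1 := congr(X.presheaf.germ _ _ hη $hb)
    have e2 := congr(X.presheaf.germ _ _ hη $hw)
    have e3 : X.presheaf.germ _ _ hη (ρ b') = X.presheaf.germ _ _ hη' b' := germ_basicOpen _ _ _
    have e4 : X.presheaf.germ _ _ hη (ρ c') = X.presheaf.germ _ _ hη' c' := germ_basicOpen _ _ _
    simp only [map_mul, map_pow, germ_basicOpen, map_sub, map_one, e3, e4] at e1 e2 ⊢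
    rw [hb', hc', ← e1, map_pow, Derivation.leibniz]
    simp only [smul_eq_mul]
    linear_combination (δ (X.presheaf.germ _ _ hη f)) * e2
  · intro x hxD hx
    have e3 : X.presheaf.germ _ _ hx (ρ b') = X.presheaf.germ _ _ (X.basicOpen_le g hx) b' :=
      germ_basicOpen _ _ _
    have e4 : X.presheaf.germ _ _ hx (ρ c') = X.presheaf.germ _ _ (X.basicOpen_le g hx) c' :=
      germ_basicOpen _ _ _
    simp only [map_mul, map_sub, e3, e4]
    exact Ideal.mul_mem_left _ _ (Ideal.sub_mem _ (hbD x hxD _)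
      (Ideal.mul_mem_left _ _ (hcD x hxD _)))

lemma LogField.exists_pow_smul [LocallyOfFiniteType (X ↘ Spec (.of k))] {D : Finset X}
    {U : X.Opens} (hU : IsAffineOpen U) {δ : Derivation k X.functionField X.functionField}
    (hη : genericPoint X ∈ U) (g : Γ(X, U)) (hg : genericPoint X ∈ X.basicOpen g)
    (h : LogField D (X.basicOpen g) δ) :
    ∃ n, LogField D U (X.presheaf.germ U _ hη g ^ n • δ) := by
  let φ : k →+* Γ(X, U) := ((Scheme.ΓSpecIso (.of k)).inv ≫
    (X ↘ Spec (.of k)).appLE ⊤ U le_top).hom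
  have hφ : φ.FiniteType := by
    have h1 := (X ↘ Spec (.of k)).finiteType_appLE (isAffineOpen_top _) hU le_top
    refine RingHom.FiniteType.comp h1 (RingHom.FiniteType.of_surjective _ ?_)
    exact (ConcreteCategory.bijective_of_isIso (Scheme.ΓSpecIso (.of k)).inv).2
  have hφ' (c : k) : X.presheaf.germ U _ hη (φ c) = algebraMap k X.functionField c := by
    have e : ((Scheme.ΓSpecIso (.of k)).inv ≫ (X ↘ Spec (.of k)).appLE ⊤ U le_top) ≫
        X.presheaf.germ U _ hη = (Scheme.ΓSpecIso (.of k)).inv ≫ (X ↘ Spec (.of k)).appTop ≫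
          X.presheaf.germ ⊤ (genericPoint X) trivial := by
      simp only [Scheme.Hom.appLE, Category.assoc]
      rw [X.presheaf.germ_res]
      rfl
    exact congr($(e).hom c)
  -- the good functions
  let P (n : ℕ) (f : Γ(X, U)) : Prop := ∃ b : Γ(X, U),
    X.presheaf.germ U _ hη b = X.presheaf.germ U _ hη g ^ n * δ (X.presheaf.germ U _ hη f) ∧
    ∀ x ∈ D, ∀ hx : x ∈ U,
      X.presheaf.germ U x hx b ∈ IsLocalRing.maximalIdeal (X.presheaf.stalk x)
  have hP (f : Γ(X, U)) : ∃ n, P n f := by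
    obtain ⟨f', hf', hfD⟩ := h hg (X.presheaf.map (homOfLE (X.basicOpen_le g)).op f)
    obtain ⟨n, b, hb⟩ := exists_basicOpen hU g f'
    refine ⟨n + 1, g * b, ?_, ?_⟩
    · have e1 := congr(X.presheaf.germ _ _ hg $hb)
      simp only [map_mul, map_pow, germ_basicOpen] at e1 hf' ⊢
      rw [← e1, hf']
      ring
    · intro x hxD hx
      by_cases hxg : x ∈ X.basicOpen g
      · have e1 := congr(X.presheaf.germ _ _ hxg $hb)
        simp only [map_mul, map_pow, germ_basicOpen] at e1 ⊢
        rw [← e1]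
        exact Ideal.mul_mem_left _ _ (Ideal.mul_mem_right _ _ (hfD x hxD hxg))
      · rw [map_mul]
        refine Ideal.mul_mem_right _ _ ?_
        rw [Scheme.mem_basicOpen _ _ _ hx] at hxg
        exact (IsLocalRing.mem_maximalIdeal _).mpr hxg
  have hmono {n m : ℕ} (hnm : n ≤ m) {f} (hf : P n f) : P m f := by
    obtain ⟨b, hb, hbD⟩ := hf
    refine ⟨g ^ (m - n) * b, ?_, fun x hxD hx => ?_⟩
    · rw [map_mul, map_pow, hb, ← mul_assoc, ← pow_add, Nat.sub_add_cancel hnm]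
    · rw [map_mul]; exact Ideal.mul_mem_left _ _ (hbD x hxD hx)
  algebraize [φ]
  obtain ⟨s, hs⟩ := hφ
  choose N hN using hP
  refine ⟨s.sup N, fun _ f => ?_⟩
  suffices H : P (s.sup N) f from H
  have hf : f ∈ Algebra.adjoin k (s : Set Γ(X, U)) := hs ▸ trivial
  induction hf using Algebra.adjoin_induction with
  | mem f hf => exact hmono (Finset.le_sup hf) (hN f)
  | algebraMap c =>
    refine ⟨0, ?_, by simp⟩
    change _ = _ * δ (X.presheaf.germ U _ hη (φ c))
    rw [hφ', Derivation.map_algebraMap]; simp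
  | add f₁ f₂ _ _ h1 h2 =>
    obtain ⟨b1, hb1, hD1⟩ := h1
    obtain ⟨b2, hb2, hD2⟩ := h2
    refine ⟨b1 + b2, by simp [hb1, hb2, mul_add], fun x hxD hx => ?_⟩
    rw [map_add]; exact Ideal.add_mem _ (hD1 x hxD hx) (hD2 x hxD hx)
  | mul f₁ f₂ _ _ h1 h2 =>
    obtain ⟨b1, hb1, hD1⟩ := h1
    obtain ⟨b2, hb2, hD2⟩ := h2
    refine ⟨f₁ * b2 + f₂ * b1, ?_, fun x hxD hx => ?_⟩
    · simp only [map_add, map_mul, hb1, hb2, Derivation.leibniz, smul_eq_mul]; ring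
    · rw [map_add, map_mul, map_mul]
      exact Ideal.add_mem _ (Ideal.mul_mem_left _ _ (hD2 x hxD hx))
        (Ideal.mul_mem_left _ _ (hD1 x hxD hx))

section SpectralCurve

variable (D : Finset X) (r : ℕ) (a : ∀ j, RatDiff k X j)
  (δ : Derivation k X.functionField X.functionField)

lemma spectralRing_le {U : X.Opens} (hU : IsAffineOpen U) (g : Γ(X, U)) {V : X.Opens}
    (hV : V ≤ U) (e : X.basicOpen g = V) :
    spectralRing D r a δ U ≤ (spectralRing D r a δ V).comap
      ((GenericFibre r a δ).presheaf.map
        (homOfLE ((genericFibreMap r a δ).preimage_mono hV)).op).hom := by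
  subst e
  rw [spectralRing, Subring.closure_le]
  rintro _ (⟨f, rfl⟩ | ⟨h, hh, rfl⟩)
  · refine Subring.subset_closure (Or.inl ⟨X.presheaf.map (homOfLE hV).op f, ?_⟩)
    exact congr($((genericFibreMap r a δ).naturality (homOfLE hV).op).hom f)
  · refine Subring.subset_closure (Or.inr ⟨h, hh.basicOpen hU g, ?_⟩)
    rfl

/-- The `𝒪_X`-algebra whose relative spectrum is the spectral curve. -/
def spectralDiagram : X.AffineZariskiSiteᵒᵖ ⥤ CommRingCat.{u} where
  obj U := .of (spectralRing D r a δ U.unop.1)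
  map {U V} i := CommRingCat.ofHom
    (((GenericFibre r a δ).presheaf.map (homOfLE ((genericFibreMap r a δ).preimage_mono
        (Scheme.AffineZariskiSite.toOpens_mono i.unop.le))).op).hom.restrict _ _
      (by
        obtain ⟨g, hg⟩ := i.unop.le
        exact fun z hz => spectralRing_le D r a δ U.unop.2 g
          (Scheme.AffineZariskiSite.toOpens_mono i.unop.le) hg hz))
  map_id U := by
    refine CommRingCat.hom_ext (RingHom.ext fun x => Subtype.ext ?_)
    exact congr($((GenericFibre r a δ).presheaf.map_id _).hom x.1)
  map_comp {U V W} i j := by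
    refine CommRingCat.hom_ext (RingHom.ext fun x => Subtype.ext ?_)
    have := (GenericFibre r a δ).presheaf.map_comp
      (homOfLE ((genericFibreMap r a δ).preimage_mono
        (Scheme.AffineZariskiSite.toOpens_mono i.unop.le))).op
      (homOfLE ((genericFibreMap r a δ).preimage_mono
        (Scheme.AffineZariskiSite.toOpens_mono j.unop.le))).op
    exact congr($(this).hom x.1)

/-- The structure map of the `𝒪_X`-algebra `spectralDiagram`. -/
def spectralDiagramMap :
    (Scheme.AffineZariskiSite.toOpensFunctor X).op ⋙ X.presheaf ⟶ spectralDiagram D r a δ where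
  app U := CommRingCat.ofHom (((genericFibreMap r a δ).app U.unop.1).hom.codRestrict
    (spectralRing D r a δ U.unop.1) fun f => Subring.subset_closure (Or.inl ⟨f, rfl⟩))
  naturality U V i := by
    refine CommRingCat.hom_ext (RingHom.ext fun f => Subtype.ext ?_)
    exact congr($((genericFibreMap r a δ).naturality
      (homOfLE (Scheme.AffineZariskiSite.toOpens_mono i.unop.le)).op).hom f)

lemma genericFibreMap_app {U : X.Opens} (hη : genericPoint X ∈ U) (f : Γ(X, U)) :
    (genericFibreMap r a δ).app U f =
      restrictFun r a δ _ (AdjoinRoot.of _ (X.presheaf.germ U _ hη f)) := by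
  have e : (genericFibreMap r a δ).app U = X.presheaf.germ U _ hη ≫
      CommRingCat.ofHom (AdjoinRoot.of (charPoly r a δ)) ≫
      (Scheme.ΓSpecIso (.of (AdjoinRoot (charPoly r a δ)))).inv ≫
        (GenericFibre r a δ).presheaf.map (homOfLE le_top).op := by
    rw [genericFibreMap, Scheme.Hom.comp_app, Scheme.fromSpecStalk_app hη]
    simp only [Category.assoc]
    have h := Scheme.ΓSpecIso_inv_naturality_assoc (CommRingCat.ofHom
      (AdjoinRoot.of (charPoly r a δ))) ((GenericFibre r a δ).presheaf.map
        (homOfLE (le_top (a := genericFibreMap r a δ ⁻¹ᵁ U))).op)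
    rw [Scheme.Hom.naturality]
    exact congr(X.presheaf.germ U _ hη ≫ $h.symm)
  exact congr($(e).hom f)

lemma spectralRing_exists_pow [LocallyOfFiniteType (X ↘ Spec (.of k))] {U : X.Opens}
    (hU : IsAffineOpen U) (g : Γ(X, U))
    (z : Γ(GenericFibre r a δ, genericFibreMap r a δ ⁻¹ᵁ X.basicOpen g))
    (hz : z ∈ spectralRing D r a δ (X.basicOpen g)) :
    ∃ n : ℕ, ∃ y ∈ spectralRing D r a δ U,
      z * (GenericFibre r a δ).presheaf.map (homOfLE ((genericFibreMap r a δ).preimage_mono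
        (X.basicOpen_le g))).op ((genericFibreMap r a δ).app U g) ^ n =
      (GenericFibre r a δ).presheaf.map (homOfLE ((genericFibreMap r a δ).preimage_mono
        (X.basicOpen_le g))).op y := by
  have nat (f : Γ(X, U)) : (GenericFibre r a δ).presheaf.map
      (homOfLE ((genericFibreMap r a δ).preimage_mono
        (X.basicOpen_le g))).op ((genericFibreMap r a δ).app U f) =
      (genericFibreMap r a δ).app _ (X.presheaf.map (homOfLE (X.basicOpen_le g)).op f) :=
    congr($((genericFibreMap r a δ).naturality (homOfLE (X.basicOpen_le g)).op).hom f).symm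
  have hres (w : AdjoinRoot (charPoly r a δ)) : (GenericFibre r a δ).presheaf.map
      (homOfLE ((genericFibreMap r a δ).preimage_mono (X.basicOpen_le g))).op
        (restrictFun r a δ _ w) = restrictFun r a δ _ w := rfl
  set ρ := ((GenericFibre r a δ).presheaf.map
      (homOfLE ((genericFibreMap r a δ).preimage_mono (X.basicOpen_le g))).op).hom with hρ
  set p := (genericFibreMap r a δ).app U
  have hpg : p g ∈ spectralRing D r a δ U := Subring.subset_closure (Or.inl ⟨g, rfl⟩)
  have shift {z} {n m : ℕ} (hnm : n ≤ m) (h : ∃ y ∈ spectralRing D r a δ U, z * ρ (p g) ^ n = ρ y) :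
      ∃ y ∈ spectralRing D r a δ U, z * ρ (p g) ^ m = ρ y := by
    obtain ⟨y, hy, e⟩ := h
    refine ⟨y * p g ^ (m - n), mul_mem hy (pow_mem hpg _), ?_⟩
    rw [map_mul, ← e, map_pow, mul_assoc, ← pow_add, Nat.add_sub_cancel' hnm]
  change ∃ n : ℕ, ∃ y ∈ spectralRing D r a δ U, z * ρ (p g) ^ n = ρ y
  induction hz using Subring.closure_induction with
  | mem z hz =>
    obtain ⟨f, rfl⟩ | ⟨h, hh, rfl⟩ := hz
    · obtain ⟨n, b, hb⟩ := exists_basicOpen hU g f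
      refine ⟨n, p b, Subring.subset_closure (Or.inl ⟨b, rfl⟩), ?_⟩
      have e1 : ρ (p g) = _ := nat g
      have e2 : ρ (p b) = _ := nat b
      rw [e1, e2, ← hb, map_mul, map_pow]
    · by_cases hg : genericPoint X ∈ X.basicOpen g
      · obtain ⟨n, hn⟩ := hh.exists_pow_smul hU (X.basicOpen_le g hg) g hg
        rw [smul_smul] at hn
        refine ⟨n, _, Subring.subset_closure (Or.inr ⟨_, hn, rfl⟩), ?_⟩
        have e1 : p g = _ := genericFibreMap_app r a δ (X.basicOpen_le g hg) g
        have e2 (w) : ρ (restrictFun r a δ _ w) = _ := hres w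
        rw [e1, e2, e2, ← map_pow, ← map_mul, ← map_pow, mul_right_comm, ← map_mul, mul_comm h]
      · have hbot : X.basicOpen g = ⊥ := by
          by_contra hne
          obtain ⟨y, hy⟩ := (Opens.ne_bot_iff_nonempty _).mp hne
          exact hg (((genericPoint_spec X).mem_open_set_iff (X.basicOpen g).isOpen).mpr
            ⟨y, trivial, hy⟩)
        have : Subsingleton Γ(GenericFibre r a δ, genericFibreMap r a δ ⁻¹ᵁ X.basicOpen g) := by
          rw [hbot]
          exact (inferInstance : Subsingleton Γ(GenericFibre r a δ, ⊥))
        exact ⟨0, 0, zero_mem _, Subsingleton.elim _ _⟩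
  | zero => exact ⟨0, 0, zero_mem _, by simp⟩
  | one => exact ⟨0, 1, one_mem _, by simp⟩
  | add x y _ _ hx hy =>
    obtain ⟨n, hx⟩ := hx
    obtain ⟨m, hy⟩ := hy
    obtain ⟨x', hx', ex⟩ := shift (le_max_left n m) hx
    obtain ⟨y', hy', ey⟩ := shift (le_max_right n m) hy
    exact ⟨max n m, x' + y', add_mem hx' hy', by rw [add_mul, ex, ey, map_add]⟩
  | neg x _ hx =>
    obtain ⟨n, x', hx', ex⟩ := hx
    exact ⟨n, -x', neg_mem hx', by rw [neg_mul, ex, map_neg]⟩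
  | mul x y _ _ hx hy =>
    obtain ⟨n, x', hx', ex⟩ := hx
    obtain ⟨m, y', hy', ey⟩ := hy
    exact ⟨n + m, x' * y', mul_mem hx' hy', by rw [map_mul, ← ex, ← ey]; ring⟩

lemma coequifibered_spectralDiagramMap [LocallyOfFiniteType (X ↘ Spec (.of k))] :
    (spectralDiagramMap D r a δ).Coequifibered := by
  refine Scheme.AffineZariskiSite.coequifibered_iff_forall_isLocalizationAway.mpr fun U g ↦ ?_
  have : IsNoetherianRing (AdjoinRoot (charPoly r a δ)) :=
    inferInstanceAs (IsNoetherianRing (_ ⧸ _))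
  have hloc := isLocalization_of_eq (X := GenericFibre r a δ)
    (W := genericFibreMap r a δ ⁻¹ᵁ U.1) (NoetherianSpace.isCompact _)
    (isQuasiSeparated_univ.of_subset (Set.subset_univ _)) ((genericFibreMap r a δ).app U.1 g)
    ((genericFibreMap r a δ).preimage_mono (X.basicOpen_le g))
    ((genericFibreMap r a δ).preimage_basicOpen g)
  refine isLocalization_subring _ _ hloc _ _ _ _ (fun _ => rfl) ?_
    (spectralRing_exists_pow D r a δ U.2 g)
  have hu : IsUnit (X.presheaf.map (homOfLE (X.basicOpen_le g)).op g) :=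
    RingedSpace.isUnit_res_basicOpen _ g
  obtain ⟨w, hw⟩ := hu.exists_right_inv
  refine ⟨(genericFibreMap r a δ).app _ w, Subring.subset_closure (Or.inl ⟨w, rfl⟩), ?_⟩
  have nat : (GenericFibre r a δ).presheaf.map
      (homOfLE ((genericFibreMap r a δ).preimage_mono
        (X.basicOpen_le g))).op ((genericFibreMap r a δ).app U.1 g) =
      (genericFibreMap r a δ).app _ (X.presheaf.map (homOfLE (X.basicOpen_le g)).op g) :=
    congr($((genericFibreMap r a δ).naturality (homOfLE (X.basicOpen_le g)).op).hom g).symm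
  have := congr((genericFibreMap r a δ).app _ $hw)
  rw [map_mul, map_one] at this
  exact (congr($nat * (genericFibreMap r a δ).app _ w)).trans this

variable [LocallyOfFiniteType (X ↘ Spec (.of k))]

/-- The spectral curve `X_a`, finite over `X`, of a tuple `a` of sections of `ω_X(D)^{⊗ j}`,
`1 ≤ j ≤ r`: the zero locus of the characteristic polynomial in the total space of `ω_X(D)`.
The nonzero rational vector field `δ` only serves as a coordinate at the generic point. -/
def spectralCurve : Scheme.{u} :=
  (Scheme.AffineZariskiSite.relativeGluingData
    (coequifibered_spectralDiagramMap D r a δ)).glued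

/-- The projection `π_a : X_a → X`. -/
def spectralCurveMap : spectralCurve D r a δ ⟶ X :=
  (Scheme.AffineZariskiSite.relativeGluingData
    (coequifibered_spectralDiagramMap D r a δ)).toBase

end SpectralCurve

section Normalization

variable (Y : Scheme.{u}) [IsIntegral Y]

/-- The normalization of an integral scheme, i.e. its normalization in its function field. -/
def normalization : Scheme.{u} := (Y.fromSpecStalk (genericPoint Y)).normalization

/-- The projection of the normalization. -/
def normalizationMap : normalization Y ⟶ Y := (Y.fromSpecStalk (genericPoint Y)).fromNormalization

instance normalization_isIntegral : IsIntegral (normalization Y) := by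
  unfold normalization; infer_instance

end Normalization

section NormalizedSpectralCurve

variable (D : Finset X) (r : ℕ) (a : ∀ j, RatDiff k X j)
  (δ : Derivation k X.functionField X.functionField) [LocallyOfFiniteType (X ↘ Spec (.of k))]
  [IsIntegral (spectralCurve D r a δ)]

/-- The normalization `X̃_a` of the integral spectral curve `X_a`. -/
abbrev normCurve : Scheme.{u} := normalization (spectralCurve D r a δ)

/-- The projection `X̃_a → X_a → X`. -/
def normCurveMap : normCurve D r a δ ⟶ X :=
  normalizationMap (spectralCurve D r a δ) ≫ spectralCurveMap D r a δ

/-- The structure morphism `X̃_a → Spec k`. -/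
def normCurveStr : normCurve D r a δ ⟶ Spec (.of k) :=
  normCurveMap D r a δ ≫ (X ↘ Spec (.of k))

end NormalizedSpectralCurve

end Curve

section Points

variable {Y Z : Scheme.{u}}

/-- The ramification index of `f : Y ⟶ Z` at `y`: the largest `n` with `𝔪_{f(y)} 𝒪_{Y,y} ⊆ 𝔪_y^n`. -/
def ramificationIndex (f : Y ⟶ Z) (y : Y) : ℕ :=
  sSup {n | (IsLocalRing.maximalIdeal (Z.presheaf.stalk (f y))).map (f.stalkMap y).hom ≤
    IsLocalRing.maximalIdeal (Y.presheaf.stalk y) ^ n}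

/-- The residue field extension `κ(f(y)) → κ(y)` is separable. -/
def IsResiduallySeparable (f : Y ⟶ Z) (y : Y) : Prop :=
  letI := (f.residueFieldMap y).hom.toAlgebra
  Algebra.IsSeparable (Z.residueField (f y)) (Y.residueField y)

/-- The order of vanishing at `y` of a nonzero rational function `f = a/b`, `a, b ∈ 𝒪_{Y,y}`, is
`length(𝒪_{Y,y}/a) - length(𝒪_{Y,y}/b)`. -/
def IsOrder [IsIntegral Y] (y : Y) (f : Y.functionField) (n : ℤ) : Prop :=
  ∃ (a b : Y.presheaf.stalk y) (p q : ℕ), a ≠ 0 ∧ b ≠ 0 ∧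
    f * algebraMap _ _ b = algebraMap _ _ a ∧
    Ring.ord _ a = p ∧ Ring.ord _ b = q ∧ n = (p : ℤ) - q

variable (Y) in
/-- A line bundle on `Y`, given by an open cover and transition functions. -/
structure LineBundle where
  ι : Type u
  U : ι → Y.Opens
  cover : ∀ y : Y, ∃ i, y ∈ U i
  g : ∀ i j, Γ(Y, U i ⊓ U j)ˣ
  cocycle : ∀ i j l,
    Y.presheaf.map (homOfLE (inf_le_left : U i ⊓ U j ⊓ U l ≤ U i ⊓ U j)).op (g i j) *
      Y.presheaf.map (homOfLE (inf_le_inf_right (U l) inf_le_right :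
        U i ⊓ U j ⊓ U l ≤ U j ⊓ U l)).op (g j l) =
      Y.presheaf.map (homOfLE (inf_le_inf_right (U l) inf_le_left :
        U i ⊓ U j ⊓ U l ≤ U i ⊓ U l)).op (g i l)

/-- The line bundle `L` on the integral curve `Y`, proper over the field `k`, has degree `d` over
`k`: it has a nonzero rational section `s` with `∑_y ord_y(s) [κ(y) : k] = d`. Here `s` is given
by its local representatives `s_i` in the function field, with `s_i = g_{ij} s_j`, and `v y` is
the order of `s` at `y`. -/
def LineBundle.HasDegree [IsIntegral Y] (L : LineBundle Y) {k : Type u} [Field k]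
    (f : Y ⟶ Spec (.of k)) (d : ℤ) : Prop :=
  ∃ (s : L.ι → Y.functionField) (v : Y → ℤ),
    (∀ i, s i ≠ 0) ∧
    (∀ i j, ∀ h : genericPoint Y ∈ L.U i ⊓ L.U j, s i = Y.presheaf.germ _ _ h (L.g i j) * s j) ∧
    (∀ i, ∀ y ∈ L.U i, IsOrder y (s i) (v y)) ∧
    v.support.Finite ∧ ∑ᶠ y, v y * (f.residueDegree y : ℤ) = d

end Points

end

end ParabolicSpectral

open ParabolicSpectral

/-! Near a marked point everything is governed by one plane equation `λ^r + ∑ c_l s^{γ_l} λ^{r-l} =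
0` over a discrete valuation ring `O` with uniformizer `s`. The combinatorial input is the formula
`μ_1 + ⋯ + μ_g = ∑ min(g, n_ℓ) ≤ i g + N_i`, with equality exactly when the first `i` parts are `≥
g` and the others are `≤ g` (`dualSum_le`, `dualSum_eq_iff`). So the exponents of `λ` in `F_i` are
nonnegative, and the terms of `F_i` without `λ` sit at `l = μ_1 + ⋯ + μ_g` with `n_{i+1} ≤ g ≤ n_i`.
For `i ≥ 1`, setting `s = λ = 0` turns `F_i` into `u^{n_{i+1}} h_i`, where `h_i(0) ≠ 0` and `deg h_i
= n_i - n_{i+1} = #{ℓ : μ_ℓ = i}`; genericity makes `h_i` separable.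

Blow-ups: substituting `u = λ u'` gives `F_i = λ^{n_{i+1}} F_{i+1}` (`evalEq_mul`). In the other
chart, `λ = v u`, the strict transform has a unit as its only term outside the ideal `(u, v)`
(`coeff_mem_of_mem`), so the exceptional divisor does not leave the first chart.

Smoothness: the data are collected in `IsChartDatum`, which is stable under finite extensions of
`k`, so it suffices to prove regularity. At a prime containing `λ`, the fibre `λ = 0` has a simple
root unless the prime is the origin and `n_{i+1} ≥ 2`; hence the nonzerodivisor `λ` generates the
maximal ideal and the local ring is a discrete valuation ring (`IsChartDatum.maximalIdeal_atPrime`).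
At a prime not containing `λ` the local ring is a field: a valuation ring of the residue field
dominating `O` is followed through the blow-ups to a chart where `u` is a unit
(`IsChartDatum.exists_isUnit_of_valuationRing`), and the local ring there is a domain with
uniformizer `λ`. At the origin with `n_{i+1} ≥ 2` all terms of the equation have order at least two,
which produces two independent tangent vectors in dimension at most one.

Normalization: the same valuative argument attaches to each point of `X̃_a` over `x` a unique `i`
with `s = λ^i u`, `u` a unit, and the minimal polynomial `g` of the residue of `u`, an irreducible
factor of `h_i` (`IsPlace`). This is a bijection onto such pairs (`IsChartDatum.exists_bijOn`). As
`λ` is a uniformizer, the ramification index is `i`; the residue field is `κ[u]/(g)`, separable over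
`κ`, and the degrees add up to `deg h_i`. The reduced divisor of the points with ramification index
`i` has the required degree, and a point of degree one is rational.

It remains to recognise the equation on the spectral curve. At `x` the sheaf `T_X(-D)` is generated
by `ε = s ∂/∂s`, so the local ring of `X_a` is the `0`-th chart over `𝒪_{X,x}`
(`IsLogUniformizer.exists_chartRing_hom`). Writing `s = t v` and `ds/s = w dt/t` with units `v`, `w`
compares it with `A^{(0)}` (`exists_localCoeff`, `IsChartDatum.exists_isCompletionMap`). -/

namespace ParabolicSpectral

/-! ### Partitions, the conjugate partition and the level function -/

section Combinatorics

variable {r : ℕ} (m : Composition r)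

lemma sortedParts_perm : (sortedParts m).Perm m.blocks := List.perm_insertionSort _ _

lemma sortedParts_sum : (sortedParts m).sum = r := by
  rw [(sortedParts_perm m).sum_eq, m.blocks_sum]

lemma sortedParts_length : (sortedParts m).length = m.length := by
  exact (sortedParts_perm m).length_eq

lemma sortedParts_pos {a : ℕ} (ha : a ∈ sortedParts m) : 1 ≤ a :=
  m.one_le_blocks ((sortedParts_perm m).mem_iff.mp ha)

lemma sortedParts_pairwise : (sortedParts m).Pairwise (· ≥ ·) :=
  List.pairwise_insertionSort _ _

lemma sortedPart_succ (i : ℕ) : sortedPart m (i + 1) = (sortedParts m).getD i 0 := rfl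

lemma sortedPart_succ_of_lt {i : ℕ} (hi : i < m.length) :
    sortedPart m (i + 1) = (sortedParts m)[i]'(by rwa [sortedParts_length]) := by
  rw [sortedPart_succ, List.getD_eq_getElem]

lemma sortedPart_succ_of_le {i : ℕ} (hi : m.length ≤ i) : sortedPart m (i + 1) = 0 := by
  rw [sortedPart_succ, List.getD_eq_default]
  rwa [sortedParts_length]

lemma one_le_sortedPart_succ {i : ℕ} (hi : i < m.length) : 1 ≤ sortedPart m (i + 1) := by
  rw [sortedPart_succ_of_lt m hi]
  exact sortedParts_pos m (List.getElem_mem _)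

lemma sortedPart_succ_anti {i j : ℕ} (hij : i ≤ j) :
    sortedPart m (j + 1) ≤ sortedPart m (i + 1) := by
  rcases lt_or_ge j m.length with hj | hj
  · rw [sortedPart_succ_of_lt m hj, sortedPart_succ_of_lt m (hij.trans_lt hj)]
    rcases hij.eq_or_lt with rfl | h
    · exact le_rfl
    · exact List.pairwise_iff_getElem.mp (sortedParts_pairwise m) _ _ _ _ h
  · rw [sortedPart_succ_of_le m hj]; exact Nat.zero_le _

lemma le_sortedPart_of_mem_take {i a : ℕ} (ha : a ∈ (sortedParts m).take (i + 1)) :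
    sortedPart m (i + 1) ≤ a := by
  obtain ⟨j, hj, rfl⟩ := List.mem_iff_getElem.mp ha
  simp only [List.length_take, lt_min_iff, sortedParts_length] at hj
  rw [List.getElem_take, ← sortedPart_succ_of_lt m hj.2]
  exact sortedPart_succ_anti m (by omega)

lemma le_sortedPart_of_mem_drop {i a : ℕ} (ha : a ∈ (sortedParts m).drop i) :
    a ≤ sortedPart m (i + 1) := by
  obtain ⟨j, hj, rfl⟩ := List.mem_iff_getElem.mp ha
  simp only [List.length_drop, sortedParts_length] at hj
  rw [List.getElem_drop, ← sortedPart_succ_of_lt m (by omega)]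
  exact sortedPart_succ_anti m (by omega)

lemma tailSum_zero : tailSum m 0 = r := by simp [tailSum, sortedParts_sum]

lemma tailSum_length : tailSum m m.length = 0 := by
  rw [tailSum, List.drop_eq_nil_of_le (sortedParts_length m).le]; rfl

lemma tailSum_succ {i : ℕ} (hi : i < m.length) :
    tailSum m i = sortedPart m (i + 1) + tailSum m (i + 1) := by
  rw [tailSum, tailSum, List.drop_eq_getElem_cons (by rwa [sortedParts_length]), List.sum_cons,
    sortedPart_succ_of_lt m hi]

lemma tailSum_le (i : ℕ) : tailSum m i ≤ r := by
  have := congrArg List.sum (List.take_append_drop i (sortedParts m))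
  rw [List.sum_append, sortedParts_sum] at this
  simp only [tailSum]; omega

lemma tailSum_pos {i : ℕ} (hi : i < m.length) : 0 < tailSum m i := by
  rw [tailSum_succ m hi]
  have := one_le_sortedPart_succ m hi
  omega

/-- The partial sum `μ_1 + ⋯ + μ_g` of the conjugate partition. -/
def dualSum (g : ℕ) : ℕ := ∑ t ∈ Finset.Icc 1 g, dualPart m t

lemma dualSum_zero : dualSum m 0 = 0 := by simp [dualSum]

lemma dualSum_succ (g : ℕ) : dualSum m (g + 1) = dualSum m g + dualPart m (g + 1) := by
  rw [dualSum, Finset.sum_Icc_succ_top (by omega)]; rfl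

lemma dualSum_mono : Monotone (dualSum m) :=
  monotone_nat_of_le_succ fun g => by rw [dualSum_succ]; omega

/-- Count the cells in the first `g` columns of the Young diagram by rows: a row of length `a` meets
`min g a` of these columns. -/
lemma sum_countP_le (L : List ℕ) (g : ℕ) :
    ∑ t ∈ Finset.Icc 1 g, L.countP (t ≤ ·) = (L.map (min g)).sum := by
  induction L with
  | nil => simp
  | cons a L ih =>
    simp only [List.countP_cons, Finset.sum_add_distrib, ih, List.map_cons, List.sum_cons]
    rw [add_comm]
    congr 1
    simp only [decide_eq_true_eq]
    rw [← Finset.card_filter]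
    have : Finset.filter (fun t => t ≤ a) (Finset.Icc 1 g) = Finset.Icc 1 (min g a) := by
      ext t; simp; omega
    rw [this]; simp

lemma dualSum_eq (g : ℕ) : dualSum m g = ((sortedParts m).map (min g)).sum := sum_countP_le _ _

lemma sum_map_min_le_length_mul (L : List ℕ) (g : ℕ) : (L.map (min g)).sum ≤ L.length * g := by
  induction L with
  | nil => simp
  | cons a L ih => simp only [List.map_cons, List.sum_cons, List.length_cons]; grind

lemma sum_map_min_eq_length_mul_iff (L : List ℕ) (g : ℕ) :
    (L.map (min g)).sum = L.length * g ↔ ∀ a ∈ L, g ≤ a := by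
  induction L with
  | nil => simp
  | cons a L ih =>
    have := sum_map_min_le_length_mul L g
    simp only [List.map_cons, List.sum_cons, List.length_cons, List.forall_mem_cons, ← ih, add_mul]
    omega

lemma sum_map_min_le_sum (L : List ℕ) (g : ℕ) : (L.map (min g)).sum ≤ L.sum := by
  induction L with
  | nil => simp
  | cons a L ih => simp only [List.map_cons, List.sum_cons]; omega

lemma sum_map_min_eq_sum_iff (L : List ℕ) (g : ℕ) :
    (L.map (min g)).sum = L.sum ↔ ∀ a ∈ L, a ≤ g := by
  induction L with
  | nil => simp
  | cons a L ih =>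
    have := sum_map_min_le_sum L g
    simp only [List.map_cons, List.sum_cons, List.forall_mem_cons, ← ih]
    omega

lemma dualSum_split (g i : ℕ) : dualSum m g =
    (((sortedParts m).take i).map (min g)).sum + (((sortedParts m).drop i).map (min g)).sum := by
  rw [dualSum_eq, ← List.sum_append, ← List.map_append, List.take_append_drop]

/-- In `∑ min(g, n_ℓ)`, bound the first `i` summands by `g` and the remaining ones by `n_ℓ`. -/
lemma dualSum_le {i : ℕ} (hi : i ≤ m.length) (g : ℕ) : dualSum m g ≤ i * g + tailSum m i := by
  rw [dualSum_split m g i]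
  have h1 := sum_map_min_le_length_mul ((sortedParts m).take i) g
  have h2 := sum_map_min_le_sum ((sortedParts m).drop i) g
  rw [List.length_take, sortedParts_length, min_eq_left hi] at h1
  exact add_le_add h1 h2

/-- Equality requires both bounds in `dualSum_le` to be sharp for every part. This locates the
vertices and edges of the Newton polygon of the equation. -/
lemma dualSum_eq_iff {i : ℕ} (hi : i ≤ m.length) (g : ℕ) :
    dualSum m g = i * g + tailSum m i ↔
      (∀ a ∈ (sortedParts m).take i, g ≤ a) ∧ ∀ a ∈ (sortedParts m).drop i, a ≤ g := by
  rw [← sum_map_min_eq_length_mul_iff, ← sum_map_min_eq_sum_iff, dualSum_split m g i]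
  have h1 := sum_map_min_le_length_mul ((sortedParts m).take i) g
  have h2 := sum_map_min_le_sum ((sortedParts m).drop i) g
  rw [List.length_take, sortedParts_length, min_eq_left hi] at h1 ⊢
  simp only [tailSum]
  omega

lemma dualSum_le_rank (g : ℕ) : dualSum m g ≤ r := by
  simpa [tailSum_zero] using dualSum_le m (Nat.zero_le _) g

lemma dualSum_rank : dualSum m r = r := by
  have := (dualSum_eq_iff m (Nat.zero_le _) r).mpr ⟨by simp, fun a ha => by
    have := List.single_le_sum (l := sortedParts m) (by simp) a (by simpa using ha)
    rwa [sortedParts_sum] at this⟩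
  simpa [tailSum_zero] using this

/-- The symmetry of the Young diagram under transposition: both sides say that the cell in row `i +
1` and column `j` belongs to it. -/
lemma le_dualPart_iff {i j : ℕ} (hj : 1 ≤ j) :
    i + 1 ≤ dualPart m j ↔ j ≤ sortedPart m (i + 1) := by
  have key : ∀ L : List ℕ, L.Pairwise (· ≥ ·) → ∀ i,
      (i + 1 ≤ L.countP (j ≤ ·) ↔ j ≤ L.getD i 0) := by
    intro L
    induction L with
    | nil => intro _ i; simp; omega
    | cons a L ih =>
      intro h i
      rw [List.pairwise_cons] at h
      rw [List.countP_cons]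
      by_cases hja : j ≤ a
      · simp only [hja, decide_true, if_true]
        cases i with
        | zero => simp [hja]
        | succ i => rw [List.getD_cons_succ, ← ih h.2]; omega
      · have h0 : L.countP (j ≤ ·) = 0 := by
          rw [List.countP_eq_zero]
          intro b hb
          have := h.1 b hb
          simp; omega
        simp only [hja, decide_false, h0]
        constructor
        · intro h; simp at h
        · intro h'
          exfalso
          cases i with
          | zero => simp at h'; omega
          | succ i =>
            rw [List.getD_cons_succ, ← ih h.2] at h'
            omega
  exact key _ (sortedParts_pairwise m) i

lemma level_spec {l : ℕ} (hl : l ≤ r) : l ≤ dualSum m (level m l) :=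
  Nat.sInf_mem (s := {g | l ≤ dualSum m g}) ⟨r, by simpa [dualSum_rank] using hl⟩

lemma level_pos {l : ℕ} (hl : l ∈ Finset.Icc 1 r) : 1 ≤ level m l := by
  rw [Finset.mem_Icc] at hl
  by_contra h
  have := level_spec m hl.2
  rw [show level m l = 0 by omega, dualSum_zero] at this
  omega

/-- The exponent of `λ` in the `l`-th term of the `i`-th equation. -/
lemma le_mul_level_add {i l : ℕ} (hi : i ≤ m.length) (hl : l ≤ r) :
    l ≤ i * level m l + tailSum m i :=
  (level_spec m hl).trans (dualSum_le m hi _)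

lemma dualSum_strict {g g' : ℕ} (hg' : g' ≤ sortedPart m 1) (h : g < g') :
    dualSum m g < dualSum m g' := by
  obtain ⟨g', rfl⟩ : ∃ h, g' = h + 1 := ⟨g' - 1, by omega⟩
  have h1 := dualSum_mono m (show g ≤ g' by omega)
  have h2 := (le_dualPart_iff m (i := 0) (j := g' + 1) (by omega)).mpr (by simpa using hg')
  rw [dualSum_succ]; omega

/-- The partial sums of `μ` increase strictly up to `g = n_1`, because `μ_g ≥ 1` there; so the level
function inverts them in this range. -/
lemma level_dualSum {g : ℕ} (hg' : g ≤ sortedPart m 1) : level m (dualSum m g) = g := by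
  refine le_antisymm (Nat.sInf_le (le_refl (dualSum m g))) ?_
  by_contra h
  have h1 := dualSum_strict m hg' (not_le.mp h)
  have := level_spec m (dualSum_le_rank m g)
  omega

lemma dualSum_mem_Icc {g : ℕ} (hg : 1 ≤ g) (hg' : g ≤ sortedPart m 1) :
    dualSum m g ∈ Finset.Icc 1 r := by
  have := dualSum_strict m hg' (show 0 < g by omega)
  rw [Finset.mem_Icc]
  exact ⟨by omega, dualSum_le_rank m g⟩

/-- The terms of the `i`-th equation without `λ`. -/
lemma exponent_eq_zero {i l : ℕ} (hi : i ≤ m.length) (hl : l ≤ r)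
    (h : i * level m l + tailSum m i - l = 0) :
    l = dualSum m (level m l) ∧ sortedPart m (i + 1) ≤ level m l ∧
      (1 ≤ i → level m l ≤ sortedPart m i) := by
  have h1 := level_spec m hl
  have h2 := dualSum_le m hi (level m l)
  have h3 := (dualSum_eq_iff m hi (level m l)).mp (by omega)
  refine ⟨by omega, ?_, fun hi1 => ?_⟩
  · rcases hi.lt_or_eq with hi | hi
    · rw [sortedPart_succ_of_lt m hi]
      refine h3.2 _ ?_
      rw [List.drop_eq_getElem_cons (by rwa [sortedParts_length])]
      exact List.mem_cons_self
    · rw [sortedPart_succ_of_le m hi.ge]; omega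
  · obtain ⟨i, rfl⟩ : ∃ j, i = j + 1 := ⟨i - 1, by omega⟩
    rw [sortedPart_succ_of_lt m hi]
    refine h3.1 _ ?_
    rw [List.mem_take_iff_getElem]
    exact ⟨i, by rw [sortedParts_length]; omega, rfl⟩

lemma sortedPart_le_one (i : ℕ) : sortedPart m (i + 1) ≤ sortedPart m 1 :=
  sortedPart_succ_anti m (Nat.zero_le i)

/-- The term `u ^ n_{i+1}` in the `i`-th equation. -/
lemma exponent_dualSum {i : ℕ} (hi : i < m.length) :
    i * sortedPart m (i + 1) + tailSum m i = dualSum m (sortedPart m (i + 1)) :=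
  ((dualSum_eq_iff m hi.le _).mpr ⟨fun a ha => by
    obtain _ | i := i
    · simp at ha
    · exact (sortedPart_succ_anti m (by omega)).trans (le_sortedPart_of_mem_take m ha),
    fun a ha => le_sortedPart_of_mem_drop m ha⟩).symm

/-- The term `u ^ n_i` in the `i`-th equation. -/
lemma exponent_dualSum_self {i : ℕ} (hi : i < m.length) :
    (i + 1) * sortedPart m (i + 1) + tailSum m (i + 1) = dualSum m (sortedPart m (i + 1)) := by
  rw [← exponent_dualSum m hi, tailSum_succ m hi]; ring

/-- The bookkeeping behind the substitution `u = λ u'`: the exponent of `λ` gains `γ_l`, and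
`λ^{n_{i+1}}` is divided out. The additive form avoids a further truncated subtraction. -/
lemma exponent_succ {i l : ℕ} (hi : i < m.length) (hl : l ≤ r) :
    (i + 1) * level m l + tailSum m (i + 1) - l + sortedPart m (i + 1) =
      i * level m l + tailSum m i - l + level m l := by
  have h1 := le_mul_level_add m hi.le hl
  have h2 := le_mul_level_add m (show i + 1 ≤ m.length by omega) hl
  have h3 := tailSum_succ m hi
  rw [add_mul] at h2 ⊢
  omega

/-- By conjugacy, `μ_l = i + 1` means `n_{i+2} < l ≤ n_{i+1}`. The bound `l ≤ r` in `partMult` costs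
nothing since `n_{i+1} ≤ r`. -/
lemma partMult_succ (i : ℕ) :
    partMult m (i + 1) = sortedPart m (i + 1) - sortedPart m (i + 2) := by
  have : (Finset.Icc 1 r).filter (fun l => dualPart m l = i + 1) =
      Finset.Ioc (sortedPart m (i + 2)) (sortedPart m (i + 1)) := by
    ext l
    simp only [Finset.mem_filter, Finset.mem_Icc, Finset.mem_Ioc]
    have hle : sortedPart m (i + 1) ≤ r := by
      rcases lt_or_ge i m.length with hi | hi
      · have := tailSum_succ m hi
        have := tailSum_le m i
        omega
      · rw [sortedPart_succ_of_le m hi]; omega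
    constructor
    · rintro ⟨h1, h2⟩
      have a1 := le_dualPart_iff m (i := i) h1.1
      have a2 := le_dualPart_iff m (i := i + 1) h1.1
      rw [show i + 1 + 1 = i + 2 from rfl] at a2
      omega
    · rintro ⟨h1, h2⟩
      have a1 := le_dualPart_iff m (i := i) (j := l) (by omega)
      have a2 := le_dualPart_iff m (i := i + 1) (j := l) (by omega)
      rw [show i + 1 + 1 = i + 2 from rfl] at a2
      omega
  rw [partMult, this, Nat.card_Ioc]

lemma exists_dualPart_eq_iff {i : ℕ} (hi : 1 ≤ i) :
    (∃ l, 1 ≤ l ∧ dualPart m l = i) ↔ partMult m i ≠ 0 := by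
  rw [partMult, Finset.card_ne_zero]
  constructor
  · rintro ⟨l, hl, h⟩
    refine ⟨l, ?_⟩
    simp only [Finset.mem_filter, Finset.mem_Icc]
    refine ⟨⟨hl, ?_⟩, h⟩
    have h1 := (le_dualPart_iff m (i := 0) hl).mp (by omega)
    rcases Nat.eq_zero_or_pos m.length with h0 | h0
    · rw [sortedPart_succ_of_le m h0.le] at h1; omega
    · have := tailSum_succ m h0
      have := tailSum_le m 0
      omega
  · rintro ⟨l, hl⟩
    simp only [Finset.mem_filter, Finset.mem_Icc] at hl
    exact ⟨l, hl.1.1, hl.2⟩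

end Combinatorics

end ParabolicSpectral


namespace ParabolicSpectral

noncomputable section

/-! ### The equations of the charts and their reductions modulo `λ` -/

section Charts

open Polynomial

variable {r : ℕ} (m : Composition r)

section EvalEq

variable {B : Type*} [CommRing B]

/-- The value `x^{N_i} + ∑_{ℓ=1}^r c_ℓ y^{γ_ℓ} x^{i γ_ℓ + N_i - ℓ}` of the `i`-th equation. -/
def evalEq (c : ℕ → B) (i : ℕ) (x y : B) : B :=
  x ^ tailSum m i + ∑ l ∈ Finset.Icc 1 r, c l * y ^ level m l *
    x ^ (i * level m l + tailSum m i - l)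

lemma map_evalEq {B' : Type*} [CommRing B'] (f : B →+* B') (c : ℕ → B) (i : ℕ) (x y : B) :
    f (evalEq m c i x y) = evalEq m (fun l => f (c l)) i (f x) (f y) := by
  simp [evalEq]

lemma evalEq_zero_right (c : ℕ → B) (i : ℕ) (x : B) : evalEq m c i x 0 = x ^ tailSum m i := by
  rw [evalEq, Finset.sum_eq_zero, add_zero]
  intro l hl
  rw [zero_pow (by have := level_pos m hl; omega), mul_zero, zero_mul]

/-- The strict transform in the chart `u = λ u'`: each term becomes divisible by exactly the power
`λ^{n_{i+1}}` needed to pass from `F_i` to `F_{i+1}`. -/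
lemma evalEq_mul {i : ℕ} (hi : i < m.length) (c : ℕ → B) (x y : B) :
    evalEq m c i x (x * y) = x ^ sortedPart m (i + 1) * evalEq m c (i + 1) x y := by
  rw [evalEq, evalEq, mul_add, ← pow_add, ← tailSum_succ m hi, Finset.mul_sum]
  congr 1
  refine Finset.sum_congr rfl fun l hl => ?_
  have h := exponent_succ m hi (Finset.mem_Icc.mp hl).2
  calc c l * (x * y) ^ level m l * x ^ (i * level m l + tailSum m i - l)
      = c l * y ^ level m l * x ^ (i * level m l + tailSum m i - l + level m l) := by
        rw [mul_pow, pow_add]; ring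
    _ = _ := by rw [← h, pow_add]; ring

/-- The effect of all `i` substitutions at once; the power of `λ` removed is `n_1 + ⋯ + n_i = r -
N_i`. -/
lemma evalEq_pow_mul {i : ℕ} (hi : i ≤ m.length) (c : ℕ → B) (x y : B) :
    evalEq m c 0 x (x ^ i * y) = x ^ (r - tailSum m i) * evalEq m c i x y := by
  have hN := tailSum_le m i
  rw [evalEq, evalEq, mul_add, ← pow_add, tailSum_zero, Nat.sub_add_cancel hN, Finset.mul_sum]
  congr 1
  refine Finset.sum_congr rfl fun l hl => ?_
  have hl := (Finset.mem_Icc.mp hl).2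
  have h := le_mul_level_add m hi hl
  have e : i * level m l + (0 * level m l + r - l) =
      r - tailSum m i + (i * level m l + tailSum m i - l) := by omega
  calc c l * (x ^ i * y) ^ level m l * x ^ (0 * level m l + r - l)
      = c l * y ^ level m l * x ^ (i * level m l + (0 * level m l + r - l)) := by
        rw [mul_pow, pow_add, pow_mul]; ring
    _ = _ := by rw [e, pow_add]; ring

end EvalEq

section RedPoly

variable {κ : Type*} [Field κ]

/-- The polynomial in `u` obtained from the `i`-th equation by setting `λ = 0`. -/
def redPoly (c : ℕ → κ) (i : ℕ) : κ[X] := evalEq m (fun l => C (c l)) i 0 X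

lemma coeff_redPoly (c : ℕ → κ) (i g : ℕ) : (redPoly m c i).coeff g =
    (if tailSum m i = 0 ∧ g = 0 then 1 else 0) + ∑ l ∈ Finset.Icc 1 r,
      if i * level m l + tailSum m i - l = 0 ∧ level m l = g then c l else 0 := by
  rw [redPoly, evalEq, coeff_add, finsetSum_coeff]
  congr 1
  · rcases eq_or_ne (tailSum m i) 0 with h | h
    · simp [h, coeff_one]
    · simp [h]
  · refine Finset.sum_congr rfl fun l _ => ?_
    rcases eq_or_ne (i * level m l + tailSum m i - l) 0 with h | h
    · simp [h, coeff_X_pow, eq_comm]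
    · simp [h]

/-- A term of level `g` loses its `λ` only if `l` is the last index of that level, so a single `l`
can contribute. For `g ≥ 1` the leading term `λ^{N_i}` plays no part. -/
lemma coeff_redPoly_of_pos (c : ℕ → κ) {i g : ℕ} (hi : i ≤ m.length) (hg : 1 ≤ g)
    (hg' : g ≤ sortedPart m 1) : (redPoly m c i).coeff g =
      if i * g + tailSum m i = dualSum m g then c (dualSum m g) else 0 := by
  rw [coeff_redPoly, if_neg (by omega), zero_add, Finset.sum_eq_single (dualSum m g)]
  · rw [level_dualSum m hg']
    have := dualSum_le m hi g
    congr 1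
    simp only [and_true, eq_iff_iff]
    omega
  · intro l hl hne
    rw [if_neg]
    rintro ⟨h1, rfl⟩
    exact hne (exponent_eq_zero m hi (Finset.mem_Icc.mp hl).2 h1).1
  · exact fun h => absurd (dualSum_mem_Icc m hg hg') h

/-- For `i < σ` the coefficient is `c_l` with `l = μ_1 + ⋯ + μ_{n_{i+1}}`. For `i = σ` it is the
constant term, which comes from `λ^{N_σ} = 1`. Together with `X_pow_dvd_redPoly`, the order of
vanishing at `u = 0` is exactly `n_{i+1}`. -/
lemma coeff_redPoly_sortedPart {c : ℕ → κ} (hc : ∀ l ∈ Finset.Icc 1 r, c l ≠ 0) {i : ℕ}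
    (hi : i ≤ m.length) : (redPoly m c i).coeff (sortedPart m (i + 1)) ≠ 0 := by
  rcases hi.lt_or_eq with hi' | rfl
  · have h1 := one_le_sortedPart_succ m hi'
    have h2 := sortedPart_le_one m i
    rw [coeff_redPoly_of_pos m c hi h1 h2, if_pos (exponent_dualSum m hi')]
    exact hc _ (dualSum_mem_Icc m h1 h2)
  · rw [sortedPart_succ_of_le m le_rfl, coeff_redPoly, if_pos ⟨tailSum_length m, rfl⟩,
      Finset.sum_eq_zero, add_zero]
    · exact one_ne_zero
    · intro l hl
      have := level_pos m hl
      rw [if_neg (by omega)]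

lemma redPoly_ne_zero {c : ℕ → κ} (hc : ∀ l ∈ Finset.Icc 1 r, c l ≠ 0) {i : ℕ}
    (hi : i ≤ m.length) : redPoly m c i ≠ 0 := fun h =>
  coeff_redPoly_sortedPart m hc hi (by rw [h, coeff_zero])

lemma X_pow_dvd_redPoly (c : ℕ → κ) {i : ℕ} (hi : i ≤ m.length) :
    X ^ sortedPart m (i + 1) ∣ redPoly m c i := by
  rw [X_pow_dvd_iff]
  intro g hg
  rw [coeff_redPoly, if_neg, zero_add, Finset.sum_eq_zero]
  · intro l hl
    rw [if_neg]
    rintro ⟨h1, rfl⟩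
    have := (exponent_eq_zero m hi (Finset.mem_Icc.mp hl).2 h1).2.1
    omega
  · rintro ⟨h1, -⟩
    rcases hi.lt_or_eq with hi | rfl
    · exact absurd h1 (tailSum_pos m hi).ne'
    · rw [sortedPart_succ_of_le m le_rfl] at hg; omega

/-- A term of the `(i+1)`-st equation without `λ` has level at most `n_{i+1}`, and the extreme one
has a nonzero coefficient. After division by the exact power of `u`, the degree left is a difference
of consecutive parts. -/
lemma natDegree_redPoly {c : ℕ → κ} (hc : ∀ l ∈ Finset.Icc 1 r, c l ≠ 0) {i : ℕ}
    (hi : i < m.length) : (redPoly m c (i + 1)).natDegree = sortedPart m (i + 1) := by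
  refine natDegree_eq_of_le_of_coeff_ne_zero ?_ ?_
  · rw [natDegree_le_iff_coeff_eq_zero]
    intro g hg
    rw [coeff_redPoly, if_neg (by omega), zero_add, Finset.sum_eq_zero]
    intro l hl
    rw [if_neg]
    rintro ⟨h1, rfl⟩
    have := (exponent_eq_zero m (show i + 1 ≤ m.length by omega)
      (Finset.mem_Icc.mp hl).2 h1).2.2 (by omega)
    omega
  · have h1 := one_le_sortedPart_succ m hi
    have h2 := sortedPart_le_one m i
    rw [coeff_redPoly_of_pos m c (show i + 1 ≤ m.length by omega) h1 h2,
      if_pos (exponent_dualSum_self m hi)]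
    exact hc _ (dualSum_mem_Icc m h1 h2)

lemma redPoly_map {κ' : Type*} [Field κ'] (f : κ →+* κ') (c : ℕ → κ) (i : ℕ) :
    (redPoly m c i).map f = redPoly m (fun l => f (c l)) i := by
  have := map_evalEq m (mapRingHom f) (fun l => C (c l)) i 0 X
  simpa [redPoly] using this

end RedPoly

variable {O : Type u} [CommRing O] (s : O) (c : ℕ → O)

/-- The `i`-th equation, with coefficients in an arbitrary ring `O`. -/
def chartEq (i : ℕ) : MvPolynomial (Fin 2) O :=
  evalEq m (fun l => MvPolynomial.C (c l)) i (MvPolynomial.X 0) (MvPolynomial.X 1)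

/-- The ring `O[λ, u] / (s - λ^i u, chartEq i)`. -/
abbrev ChartRing (i : ℕ) : Type u :=
  MvPolynomial (Fin 2) O ⧸ (Ideal.span
    {MvPolynomial.C s - MvPolynomial.X 0 ^ i * MvPolynomial.X 1, chartEq m c i})

/-- The class of `λ` in `ChartRing`. -/
def chartLam (i : ℕ) : ChartRing m s c i := Ideal.Quotient.mk _ (MvPolynomial.X 0)

/-- The class of `u` in `ChartRing`. -/
def chartU (i : ℕ) : ChartRing m s c i := Ideal.Quotient.mk _ (MvPolynomial.X 1)

lemma chartRing_algebraMap (i : ℕ) (x : O) : algebraMap O (ChartRing m s c i) x =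
    Ideal.Quotient.mk _ (MvPolynomial.C x) := rfl

lemma chartRing_rel (i : ℕ) :
    algebraMap O (ChartRing m s c i) s = chartLam m s c i ^ i * chartU m s c i := by
  rw [← sub_eq_zero]
  exact Ideal.Quotient.eq_zero_iff_mem.mpr (Ideal.subset_span (Set.mem_insert _ _))

lemma chartRing_eq (i : ℕ) :
    evalEq m (fun l => algebraMap O (ChartRing m s c i) (c l)) i (chartLam m s c i)
      (chartU m s c i) = 0 := by
  have h : Ideal.Quotient.mk _ (chartEq m c i) = (0 : ChartRing m s c i) :=
    Ideal.Quotient.eq_zero_iff_mem.mpr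
      (Ideal.subset_span (Set.mem_insert_of_mem _ (Set.mem_singleton _)))
  exact (map_evalEq m (Ideal.Quotient.mk _) _ i _ _).symm.trans h

lemma chartRing_map_eq {i : ℕ} {B : Type*} [CommRing B] (f : ChartRing m s c i →+* B) :
    evalEq m (fun l => f (algebraMap O _ (c l))) i (f (chartLam m s c i)) (f (chartU m s c i)) =
      0 := by
  rw [← map_evalEq, chartRing_eq, map_zero]

lemma chartRing_rel_zero : algebraMap O (ChartRing m s c 0) s = chartU m s c 0 := by
  simpa using chartRing_rel m s c 0

/-- Every element of `ChartRing` is the value of a polynomial. -/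
lemma chartRing_induction {i : ℕ} {P : ChartRing m s c i → Prop} (a : ChartRing m s c i)
    (hC : ∀ x, P (algebraMap O _ x)) (hadd : ∀ a b, P a → P b → P (a + b))
    (hlam : ∀ a, P a → P (a * chartLam m s c i)) (hu : ∀ a, P a → P (a * chartU m s c i)) :
    P a := by
  obtain ⟨p, rfl⟩ := Ideal.Quotient.mk_surjective a
  induction p using MvPolynomial.induction_on with
  | C x => exact hC x
  | add p q hp hq => rw [map_add]; exact hadd _ _ hp hq
  | mul_X p j hp =>
    rw [map_mul]
    fin_cases j
    · exact hlam _ hp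
    · exact hu _ hp

section Lift

variable {s c} {B : Type*} [CommRing B] {i : ℕ}

/-- The ring homomorphism out of `ChartRing` defined by the images of `O`, `λ` and `u`. -/
def chartLift (f : O →+* B) (x y : B) (h1 : f s = x ^ i * y)
    (h2 : evalEq m (fun l => f (c l)) i x y = 0) : ChartRing m s c i →+* B :=
  Ideal.Quotient.lift _ (MvPolynomial.eval₂Hom f ![x, y]) (by
    intro a ha
    rw [← RingHom.mem_ker]
    refine (Ideal.span_le.mpr ?_) ha
    rintro _ (rfl | rfl)
    · simp [RingHom.mem_ker, h1]
    · rw [SetLike.mem_coe, RingHom.mem_ker, chartEq, map_evalEq]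
      simpa using h2)

variable {m} (f : O →+* B) (x y : B) (h1 : f s = x ^ i * y)
    (h2 : evalEq m (fun l => f (c l)) i x y = 0)

@[simp] lemma chartLift_algebraMap (a : O) :
    chartLift m f x y h1 h2 (algebraMap O _ a) = f a := by
  rw [chartRing_algebraMap, chartLift, Ideal.Quotient.lift_mk]; simp

@[simp] lemma chartLift_lam : chartLift m f x y h1 h2 (chartLam m s c i) = x := by
  rw [chartLam, chartLift, Ideal.Quotient.lift_mk]; simp

@[simp] lemma chartLift_u : chartLift m f x y h1 h2 (chartU m s c i) = y := by
  rw [chartU, chartLift, Ideal.Quotient.lift_mk]; simp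

lemma chartRing_hom_ext {f g : ChartRing m s c i →+* B}
    (h : ∀ a, f (algebraMap O _ a) = g (algebraMap O _ a))
    (h1 : f (chartLam m s c i) = g (chartLam m s c i))
    (h2 : f (chartU m s c i) = g (chartU m s c i)) : f = g := by
  refine RingHom.ext fun a => ?_
  refine chartRing_induction m s c (P := fun a => f a = g a) a h ?_ ?_ ?_
  · intro a b ha hb; rw [map_add, map_add, ha, hb]
  · intro a ha; rw [map_mul, map_mul, ha, h1]
  · intro a ha; rw [map_mul, map_mul, ha, h2]

end Lift

end Charts

end

end ParabolicSpectral


namespace ParabolicSpectral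

noncomputable section

/-! ### The second blow-up chart, chart data, and `λ` as a nonzerodivisor -/

section ChartProperties

open Polynomial

variable {r : ℕ} {m : Composition r}

section OtherChart

variable {B : Type*} [CommRing B]

/-- The strict transform in the other chart `λ = v u`; the exceptional power is again the
`n_{i+1}`-st, now of `u`. -/
lemma evalEq_mul_self {i : ℕ} (hi : i < m.length) (c : ℕ → B) (u v : B) :
    evalEq m c i (v * u) u = u ^ sortedPart m (i + 1) * (v ^ tailSum m i * u ^ tailSum m (i + 1) +
      ∑ l ∈ Finset.Icc 1 r, c l * v ^ (i * level m l + tailSum m i - l) *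
        u ^ ((i + 1) * level m l + tailSum m (i + 1) - l)) := by
  rw [evalEq, mul_add, Finset.mul_sum]
  congr 1
  · rw [mul_pow, tailSum_succ m hi, pow_add u]; ring
  · refine Finset.sum_congr rfl fun l hl => ?_
    have h := exponent_succ m hi (Finset.mem_Icc.mp hl).2
    calc c l * u ^ level m l * (v * u) ^ (i * level m l + tailSum m i - l)
        = c l * v ^ (i * level m l + tailSum m i - l) *
          u ^ (i * level m l + tailSum m i - l + level m l) := by rw [mul_pow, pow_add]; ring
      _ = _ := by rw [← h, pow_add]; ring

/-- On the other chart of the blow-up, the functions `u` and `v = λ/u` have no common zero. -/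
lemma coeff_mem_of_mem {i : ℕ} (hi : i < m.length) (c : ℕ → B) {u v : B} {I : Ideal B}
    (hu : u ∈ I) (hv : v ∈ I) (h : v ^ tailSum m i * u ^ tailSum m (i + 1) +
      ∑ l ∈ Finset.Icc 1 r, c l * v ^ (i * level m l + tailSum m i - l) *
        u ^ ((i + 1) * level m l + tailSum m (i + 1) - l) = 0) :
    c (dualSum m (sortedPart m (i + 1))) ∈ I := by
  have h1 := one_le_sortedPart_succ m hi
  have h2 := sortedPart_le_one m i
  have hmem := dualSum_mem_Icc m h1 h2
  -- The term at `l = μ_1 + ⋯ + μ_{n_{i+1}}` contains neither `u` nor `v`; all others lie in `I`.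
  rw [← Finset.add_sum_erase _ _ hmem, level_dualSum m h2, exponent_dualSum m hi,
    exponent_dualSum_self m hi, Nat.sub_self, pow_zero, pow_zero, mul_one, mul_one] at h
  rw [eq_neg_of_add_eq_zero_left ((add_left_comm _ _ _).trans h), neg_mem_iff]
  refine Ideal.add_mem _ (Ideal.mul_mem_right _ _ (Ideal.pow_mem_of_mem _ hv _
    (tailSum_pos m hi))) (Ideal.sum_mem _ fun l hl => ?_)
  obtain ⟨hne, hl⟩ := Finset.mem_erase.mp hl
  -- If both exponents vanish, then `n_{i+1} ≤ γ_l ≤ n_{i+1}`, and `l` is the index already split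
  -- off.
  rcases Nat.eq_zero_or_pos (i * level m l + tailSum m i - l) with e1 | e1
  · rcases Nat.eq_zero_or_pos ((i + 1) * level m l + tailSum m (i + 1) - l) with e2 | e2
    · obtain ⟨a1, a2, -⟩ := exponent_eq_zero m hi.le (Finset.mem_Icc.mp hl).2 e1
      obtain ⟨-, -, a3⟩ := exponent_eq_zero m (show i + 1 ≤ m.length from hi)
        (Finset.mem_Icc.mp hl).2 e2
      have a4 : level m l = sortedPart m (i + 1) := le_antisymm (a3 (by omega)) a2
      exact absurd (a4 ▸ a1) hne
    · exact Ideal.mul_mem_left _ _ (Ideal.pow_mem_of_mem _ hu _ e2)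
  · exact Ideal.mul_mem_right _ _ (Ideal.mul_mem_left _ _ (Ideal.pow_mem_of_mem _ hv _ e1))

end OtherChart

variable {O : Type u} [CommRing O] {κ : Type*} [Field κ]

/-- A discrete valuation ring `O` with uniformizer `s` and residue map `ρ`, and coefficients
`c_1, …, c_r` which satisfy the genericity conditions. -/
structure IsChartDatum (m : Composition r) (s : O) (ρ : O →+* κ) (c : ℕ → O) : Prop where
  rank_pos : 0 < r
  surj : Function.Surjective ρ
  ker : RingHom.ker ρ = Ideal.span {s}
  ne_zero : s ≠ 0
  coeff : ∀ l ∈ Finset.Icc 1 r, ρ (c l) ≠ 0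
  sep : ∀ i ∈ Finset.Icc 1 m.length, ∃ h : κ[X],
    redPoly m (fun l => ρ (c l)) i = X ^ sortedPart m (i + 1) * h ∧ h.Separable

/-- Reduction modulo `λ`. -/
def evalLamZero (O : Type u) [CommRing O] : MvPolynomial (Fin 2) O →+* O[X] :=
  MvPolynomial.eval₂Hom C ![0, X]

@[simp] lemma evalLamZero_C (x : O) : evalLamZero O (MvPolynomial.C x) = C x := by
  simp [evalLamZero]

@[simp] lemma evalLamZero_X_zero : evalLamZero O (MvPolynomial.X 0) = 0 := by
  simp [evalLamZero]

@[simp] lemma evalLamZero_X_one : evalLamZero O (MvPolynomial.X 1) = X := by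
  simp [evalLamZero]

@[simp] lemma evalLamZero_aeval (p : O[X]) :
    evalLamZero O (aeval (MvPolynomial.X 1) p) = p := by
  induction p using Polynomial.induction_on' with
  | add p q hp hq => rw [map_add, map_add, hp, hq]
  | monomial n a =>
    rw [aeval_monomial, map_mul, MvPolynomial.algebraMap_eq, evalLamZero_C, map_pow,
      evalLamZero_X_one, C_mul_X_pow_eq_monomial]

lemma exists_eq_X_mul_add (p : MvPolynomial (Fin 2) O) :
    ∃ q, p = MvPolynomial.X 0 * q + aeval (MvPolynomial.X 1) (evalLamZero O p) := by
  induction p using MvPolynomial.induction_on with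
  | C x => exact ⟨0, by simp [MvPolynomial.algebraMap_eq]⟩
  | add p q hp hq =>
    obtain ⟨a, ha⟩ := hp
    obtain ⟨b, hb⟩ := hq
    exact ⟨a + b, by rw [map_add, map_add]; nth_rewrite 1 [ha, hb]; ring⟩
  | mul_X p j hp =>
    obtain ⟨a, ha⟩ := hp
    fin_cases j
    · exact ⟨p, by simp [mul_comm]⟩
    · refine ⟨a * MvPolynomial.X 1, ?_⟩
      simp only [Fin.mk_one, Fin.isValue, map_mul, evalLamZero_X_one, aeval_X]
      nth_rewrite 1 [ha]; ring

namespace IsChartDatum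

variable {s : O} {ρ : O →+* κ} {c : ℕ → O} (H : IsChartDatum m s ρ c)
include H

lemma map_s : ρ s = 0 := by
  rw [← RingHom.mem_ker, H.ker]; exact Ideal.mem_span_singleton_self s

lemma isMaximal : (Ideal.span {s}).IsMaximal := by
  rw [← H.ker]; exact RingHom.ker_isMaximal_of_surjective ρ H.surj

lemma prime_s : Prime s := by
  rw [← Ideal.span_singleton_prime H.ne_zero]
  exact H.isMaximal.isPrime

lemma maximalIdeal_eq [IsLocalRing O] : IsLocalRing.maximalIdeal O = Ideal.span {s} :=
  (IsLocalRing.eq_maximalIdeal H.isMaximal).symm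

lemma isUnit_of_map_ne_zero [IsLocalRing O] {x : O} (hx : ρ x ≠ 0) : IsUnit x := by
  by_contra h
  have h1 : x ∈ IsLocalRing.maximalIdeal O := h
  rw [H.maximalIdeal_eq, ← H.ker] at h1
  exact hx h1

lemma isUnit_coeff [IsLocalRing O] {l : ℕ} (hl : l ∈ Finset.Icc 1 r) : IsUnit (c l) :=
  H.isUnit_of_map_ne_zero (H.coeff l hl)

lemma isUnit_coeff_dualSum [IsLocalRing O] {i : ℕ} (hi : i < m.length) :
    IsUnit (c (dualSum m (sortedPart m (i + 1)))) :=
  H.isUnit_coeff (dualSum_mem_Icc m (one_le_sortedPart_succ m hi) (sortedPart_le_one m i))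

/-- For `i = 0` the exponents of `λ` are `r - l` and the leading one is `r > 0`, so only `l = r`
survives at `λ = 0`. -/
lemma evalEq_zero_zero {B : Type*} [CommRing B] (c' : ℕ → B) (x : B) :
    evalEq m c' 0 0 x = c' r * x ^ level m r := by
  have hr := H.rank_pos
  rw [evalEq, tailSum_zero, zero_pow hr.ne', zero_add, Finset.sum_eq_single r]
  · simp
  · intro l hl hne
    rw [Finset.mem_Icc] at hl
    rw [zero_pow (by omega), mul_zero]
  · intro h; exact absurd (Finset.mem_Icc.mpr ⟨hr, le_rfl⟩) h

omit H in
lemma map_evalLamZero_chartEq (i : ℕ) :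
    (evalLamZero O (chartEq m c i)).map ρ = redPoly m (fun l => ρ (c l)) i := by
  have := map_evalEq m ((mapRingHom ρ).comp (evalLamZero O)) (fun l => MvPolynomial.C (c l)) i
    (MvPolynomial.X 0) (MvPolynomial.X 1)
  simpa [redPoly, chartEq] using this

/-- The chart is cut out by `G = s - λ^i u` and `F`, and these remain a regular sequence modulo `λ`:
`G` becomes prime and does not divide `F`. Hence a relation `a G + b F ≡ 0` modulo `λ` is a multiple
of the Koszul relation; subtracting a lift of it makes `a` and `b` divisible by `λ`, and `λ` can be
cancelled. -/
lemma lam_mem_nonZeroDivisors [IsDomain O] {i : ℕ} (hi : i ≤ m.length) :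
    chartLam m s c i ∈ nonZeroDivisors (ChartRing m s c i) := by
  rw [mem_nonZeroDivisors_iff_right]
  intro a ha
  obtain ⟨p, rfl⟩ := Ideal.Quotient.mk_surjective a
  set G : MvPolynomial (Fin 2) O := MvPolynomial.C s - MvPolynomial.X 0 ^ i * MvPolynomial.X 1
    with hG
  set F := chartEq m c i with hF
  rw [chartLam, ← map_mul, Ideal.Quotient.eq_zero_iff_mem, Ideal.mem_span_pair] at ha
  obtain ⟨a, b, hab⟩ := ha
  have e0 := congrArg (evalLamZero O) hab
  simp only [map_add, map_mul, evalLamZero_X_zero, mul_zero] at e0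
  -- For `i = 0`, `G` reduces to `s - u`, and `F` at `u = s` is `c_r s^{γ_r} ≠ 0`. For `i > 0`, `G`
  -- reduces to the prime `s`, and `F` modulo `s` is the nonzero reduced polynomial.
  have key : Prime (evalLamZero O G) ∧ ¬ evalLamZero O G ∣ evalLamZero O F := by
    rcases Nat.eq_zero_or_pos i with rfl | hi0
    · have hG' : evalLamZero O G = -(X - C s) := by simp [hG]
      rw [hG', neg_dvd, dvd_iff_isRoot, IsRoot.def]
      refine ⟨(prime_X_sub_C s).neg, ?_⟩
      have := map_evalEq m ((evalRingHom s).comp (evalLamZero O))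
        (fun l => MvPolynomial.C (c l)) 0 (MvPolynomial.X 0) (MvPolynomial.X 1)
      have e : eval s (evalLamZero O F) = evalEq m c 0 0 s := by simpa [hF, chartEq] using this
      rw [e, H.evalEq_zero_zero]
      refine mul_ne_zero ?_ (pow_ne_zero _ H.ne_zero)
      rintro h
      exact H.coeff r (Finset.mem_Icc.mpr ⟨H.rank_pos, le_rfl⟩) (by rw [h, map_zero])
    · have hG' : evalLamZero O G = C s := by
        simp [hG, zero_pow hi0.ne']
      rw [hG']
      refine ⟨prime_C_iff.mpr H.prime_s, fun h => ?_⟩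
      have h' := Polynomial.map_dvd ρ h
      rw [map_C, H.map_s, C_0, zero_dvd_iff, map_evalLamZero_chartEq] at h'
      exact redPoly_ne_zero m H.coeff hi h'
  obtain ⟨hp, hnd⟩ := key
  have hdvd : evalLamZero O G ∣ evalLamZero O b := by
    refine (hp.dvd_or_dvd (a := evalLamZero O b) (b := evalLamZero O F) ?_).resolve_right hnd
    exact ⟨-evalLamZero O a, by linear_combination e0⟩
  obtain ⟨d, hd⟩ := hdvd
  have ha' : evalLamZero O a = -(evalLamZero O F * d) := by
    refine mul_right_cancel₀ hp.ne_zero ?_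
    linear_combination e0 - evalLamZero O F * hd
  -- `(a, b) ≡ d · (-F, G)` modulo `λ`; `D` lifts `d`, so that `a + F D` and `b - G D` are divisible
  -- by `λ`.
  set D : MvPolynomial (Fin 2) O := aeval (MvPolynomial.X 1) d with hD
  obtain ⟨b', hb'⟩ := exists_eq_X_mul_add (b - G * D)
  obtain ⟨a', ha''⟩ := exists_eq_X_mul_add (a + F * D)
  have z1 : evalLamZero O (b - G * D) = 0 := by
    rw [map_sub, map_mul, hD, evalLamZero_aeval, hd, sub_self]
  have z2 : evalLamZero O (a + F * D) = 0 := by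
    rw [map_add, map_mul, hD, evalLamZero_aeval, ha', neg_add_cancel]
  rw [z1, map_zero, add_zero] at hb'
  rw [z2, map_zero, add_zero] at ha''
  have hX : (MvPolynomial.X 0 : MvPolynomial (Fin 2) O) ≠ 0 := MvPolynomial.X_ne_zero 0
  have hp' : p = a' * G + b' * F := by
    refine mul_left_cancel₀ hX ?_
    linear_combination -hab + G * ha'' + F * hb'
  rw [Ideal.Quotient.eq_zero_iff_mem, Ideal.mem_span_pair]
  exact ⟨a', b', hp'.symm⟩

end IsChartDatum

/-! ### Comparison of the charts and the blow-up steps -/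

section Comparison

variable (m) (s : O) (c : ℕ → O)

/-- The map from the `0`-th to the `i`-th chart, `u ↦ λ^i u`. -/
def chartMap {i : ℕ} (hi : i ≤ m.length) : ChartRing m s c 0 →+* ChartRing m s c i :=
  chartLift m (algebraMap O _) (chartLam m s c i) (chartLam m s c i ^ i * chartU m s c i)
    (by rw [chartRing_rel]; ring) (by rw [evalEq_pow_mul m hi, chartRing_eq, mul_zero])

variable {m}

@[simp] lemma chartMap_algebraMap {i : ℕ} (hi : i ≤ m.length) (x : O) :
    chartMap m s c hi (algebraMap O _ x) = algebraMap O _ x := by simp [chartMap]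

@[simp] lemma chartMap_lam {i : ℕ} (hi : i ≤ m.length) :
    chartMap m s c hi (chartLam m s c 0) = chartLam m s c i := by simp [chartMap]

@[simp] lemma chartMap_u {i : ℕ} (hi : i ≤ m.length) :
    chartMap m s c hi (chartU m s c 0) = chartLam m s c i ^ i * chartU m s c i := by
  simp [chartMap]

/-- The chart maps become surjective once `λ` is inverted, since `λ^i u_i` is the image of `u_0`. -/
lemma exists_pow_mul_eq_chartMap {i : ℕ} (hi : i ≤ m.length) (a : ChartRing m s c i) :
    ∃ (n : ℕ) (b : ChartRing m s c 0), chartLam m s c i ^ n * a = chartMap m s c hi b := by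
  refine chartRing_induction m s c (P := fun a => ∃ (n : ℕ) (b : ChartRing m s c 0),
    chartLam m s c i ^ n * a = chartMap m s c hi b) a ?_ ?_ ?_ ?_
  · exact fun x => ⟨0, algebraMap O _ x, by simp⟩
  · rintro a b ⟨n, a', ha⟩ ⟨k, b', hb⟩
    refine ⟨n + k, chartLam m s c 0 ^ k * a' + chartLam m s c 0 ^ n * b', ?_⟩
    rw [map_add, map_mul, map_mul, ← ha, ← hb]
    simp only [map_pow, chartMap_lam]; ring
  · rintro a ⟨n, a', ha⟩
    exact ⟨n, a' * chartLam m s c 0, by rw [map_mul, ← ha, chartMap_lam]; ring⟩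
  · rintro a ⟨n, a', ha⟩
    exact ⟨i + n, a' * chartU m s c 0, by rw [map_mul, ← ha, chartMap_u]; ring⟩

/-- The map from the `i`-th chart to any ring in which `λ` is invertible. -/
lemma exists_lift_of_isUnit {i : ℕ} (hi : i ≤ m.length) {B : Type*} [CommRing B]
    (f : ChartRing m s c 0 →+* B) (hu : IsUnit (f (chartLam m s c 0))) :
    ∃ g : ChartRing m s c i →+* B, g.comp (chartMap m s c hi) = f := by
  obtain ⟨w, hw⟩ := hu.exists_right_inv
  set x := f (chartLam m s c 0)
  have e1 : f (algebraMap O _ s) = x ^ i * (w ^ i * f (chartU m s c 0)) := by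
    rw [← mul_assoc, ← mul_pow, hw, one_pow, one_mul, chartRing_rel]; simp
  have e2 : f (chartU m s c 0) = x ^ i * (w ^ i * f (chartU m s c 0)) := by
    rw [← e1, chartRing_rel]; simp
  have e3 : evalEq m (fun l => (f.comp (algebraMap O _)) (c l)) i x (w ^ i * f (chartU m s c 0)) =
      0 := by
    have h := congrArg f (chartRing_eq m s c 0)
    rw [map_evalEq, e2, map_zero, evalEq_pow_mul m hi] at h
    exact ((hu.pow _).mul_right_eq_zero).mp h
  refine ⟨chartLift m (f.comp (algebraMap O _)) x (w ^ i * f (chartU m s c 0)) e1 e3,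
    chartRing_hom_ext (fun a => by simp) (by simp [x]) (by simp [← e2])⟩

/-- The localization of the `0`-th chart at `λ`, an injective map because `λ` is a nonzerodivisor,
factors through the `i`-th chart. -/
lemma IsChartDatum.chartMap_injective [IsDomain O] {ρ : O →+* κ} (H : IsChartDatum m s ρ c) {i : ℕ}
    (hi : i ≤ m.length) : Function.Injective (chartMap m s c hi) := by
  obtain ⟨g, hg⟩ := exists_lift_of_isUnit s c hi
    (algebraMap (ChartRing m s c 0) (Localization.Away (chartLam m s c 0)))
    (IsLocalization.Away.algebraMap_isUnit _)
  have : Function.Injective (g.comp (chartMap m s c hi)) := by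
    rw [hg]
    refine IsLocalization.injective _ (M := Submonoid.powers (chartLam m s c 0)) ?_
    rw [Submonoid.powers_le]
    exact H.lam_mem_nonZeroDivisors (Nat.zero_le _)
  exact Function.Injective.of_comp this

/-- The map from the `i`-th to the `(i+1)`-st chart, `u_i ↦ λ u_{i+1}`. -/
def chartStep {i : ℕ} (hi : i < m.length) : ChartRing m s c i →+* ChartRing m s c (i + 1) :=
  chartLift m (algebraMap O _) (chartLam m s c (i + 1))
    (chartLam m s c (i + 1) * chartU m s c (i + 1))
    (by rw [chartRing_rel]; ring) (by rw [evalEq_mul m hi, chartRing_eq, mul_zero])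

@[simp] lemma chartStep_algebraMap {i : ℕ} (hi : i < m.length) (x : O) :
    chartStep s c hi (algebraMap O _ x) = algebraMap O _ x := by simp [chartStep]

@[simp] lemma chartStep_lam {i : ℕ} (hi : i < m.length) :
    chartStep s c hi (chartLam m s c i) = chartLam m s c (i + 1) := by simp [chartStep]

@[simp] lemma chartStep_u {i : ℕ} (hi : i < m.length) : chartStep s c hi (chartU m s c i) =
    chartLam m s c (i + 1) * chartU m s c (i + 1) := by simp [chartStep]

lemma exists_pow_mul_eq_chartStep {i : ℕ} (hi : i < m.length) (a : ChartRing m s c (i + 1)) :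
    ∃ (n : ℕ) (b : ChartRing m s c i), chartLam m s c (i + 1) ^ n * a = chartStep s c hi b := by
  refine chartRing_induction m s c (P := fun a => ∃ (n : ℕ) (b : ChartRing m s c i),
    chartLam m s c (i + 1) ^ n * a = chartStep s c hi b) a ?_ ?_ ?_ ?_
  · exact fun x => ⟨0, algebraMap O _ x, by simp⟩
  · rintro a b ⟨n, a', ha⟩ ⟨k, b', hb⟩
    refine ⟨n + k, chartLam m s c i ^ k * a' + chartLam m s c i ^ n * b', ?_⟩
    rw [map_add, map_mul, map_mul, ← ha, ← hb]
    simp only [map_pow, chartStep_lam]; ring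
  · rintro a ⟨n, a', ha⟩
    exact ⟨n, a' * chartLam m s c i, by rw [map_mul, ← ha, chartStep_lam]; ring⟩
  · rintro a ⟨n, a', ha⟩
    exact ⟨n + 1, a' * chartU m s c i, by rw [map_mul, ← ha, chartStep_u]; ring⟩

section AffineBlowup

variable {B R S : Type u} [CommRing B] [CommRing R] [CommRing S] [Algebra B R] [Algebra B S]

/-- A criterion for `S` to be `R[(x, y)/x]`. The map `φ` to `R[1/x]` is injective because `S` has no
`x'`-torsion and agrees with `R` up to powers of `x'`; its image is generated by `R` and `y/x`,
since fractions of elements of `(x, y)` by `x` are combinations of `1` and `y/x`. -/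
lemma exists_equiv_affineBlowup {x y : R} {x' y' : S} (step : R →+* S) (hx : step x = x')
    (hpow : ∀ a : S, ∃ (n : ℕ) (b : R), x' ^ n * a = step b) (hx' : x' ∈ nonZeroDivisors S)
    (hgen : Subring.closure (Set.range step ∪ {y'}) = ⊤)
    (φ : S →+* Localization.Away x) (hφ : ∀ b, φ (algebraMap B S b) = algebraMap B _ b)
    (hstep : ∀ a, φ (step a) = algebraMap R _ a)
    (hy : φ y' * algebraMap R _ x = algebraMap R _ y) :
    ∃ e : S ≃ₐ[B] affineBlowup (Ideal.span {x, y}) x,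
      (e x' : Localization.Away x) = algebraMap R _ x ∧
      (e y' : Localization.Away x) * algebraMap R _ x = algebraMap R _ y := by
  have hu : IsUnit (algebraMap R (Localization.Away x) x) :=
    IsLocalization.Away.algebraMap_isUnit x
  have hinj : Function.Injective φ := by
    rw [injective_iff_map_eq_zero]
    intro a ha
    obtain ⟨n, b, hb⟩ := hpow a
    have h := congrArg φ hb
    rw [map_mul, ha, mul_zero, hstep, eq_comm,
      IsLocalization.map_eq_zero_iff (Submonoid.powers x)] at h
    obtain ⟨⟨_, k, rfl⟩, hk⟩ := h
    have h := congrArg step hk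
    simp only [map_mul, map_pow, hx, ← hb, map_zero, ← mul_assoc, ← pow_add] at h
    exact (mem_nonZeroDivisors_iff.mp (pow_mem hx' _)).1 _ h
  let T := affineBlowup (Ideal.span {x, y}) x
  have hmem (a : S) : φ a ∈ T := by
    have ha : a ∈ Subring.closure (Set.range step ∪ {y'}) := hgen ▸ trivial
    have hle : Subring.closure (Set.range step ∪ {y'}) ≤ T.toSubring.comap φ := by
      rw [Subring.closure_le]
      rintro _ (⟨b, rfl⟩ | rfl)
      · change φ _ ∈ T
        rw [hstep]; exact T.algebraMap_mem b
      · exact Algebra.subset_adjoin ⟨y, Ideal.subset_span (Set.mem_insert_of_mem _ rfl), hy⟩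
    exact hle ha
  let T' : Subalgebra R (Localization.Away x) :=
    { φ.range with algebraMap_mem' := fun a => ⟨_, hstep a⟩ }
  have hT : T ≤ T' := by
    refine Algebra.adjoin_le ?_
    rintro z ⟨a, ha, hz⟩
    obtain ⟨p, q, rfl⟩ := Ideal.mem_span_pair.mp ha
    refine ⟨step p + step q * y', hu.mul_right_cancel ?_⟩
    change φ _ * _ = _
    rw [hz, map_add, map_mul, hstep, hstep, map_add, map_mul, map_mul, ← hy]
    ring
  let e : S →ₐ[B] T :=
    { toFun a := ⟨φ a, hmem a⟩
      map_one' := Subtype.ext (map_one φ)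
      map_mul' a b := Subtype.ext (map_mul φ a b)
      map_zero' := Subtype.ext (map_zero φ)
      map_add' a b := Subtype.ext (map_add φ a b)
      commutes' a := Subtype.ext (hφ a) }
  have he : Function.Bijective e := by
    refine ⟨fun a b h => hinj (congrArg Subtype.val h), fun ⟨z, hz⟩ => ?_⟩
    obtain ⟨a, ha⟩ := hT hz
    exact ⟨a, Subtype.ext ha⟩
  exact ⟨AlgEquiv.ofBijective e he, by rw [← hx]; exact hstep x, hy⟩

/-- In `R[(x, y)/y]`, a subring of `R[1/y]`, the element `y` is a nonzerodivisor and `v = x/y`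
exists. The claim thus only needs these two properties, in an arbitrary `R`-algebra. -/
lemma exists_affineBlowup_span_eq_top {x y : R}
    (h : ∀ (T : Type u) [CommRing T] (f : R →+* T) (v : T), f y ∈ nonZeroDivisors T →
      v * f y = f x → Ideal.span {f y, v} = ⊤) :
    ∃ v : affineBlowup (Ideal.span {x, y}) y,
      v * algebraMap R _ y = algebraMap R _ x ∧ Ideal.span {algebraMap R _ y, v} = ⊤ := by
  have hu : IsUnit (algebraMap R (Localization.Away y) y) :=
    IsLocalization.Away.algebraMap_isUnit y
  obtain ⟨w, hw⟩ := hu.exists_left_inv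
  let T := affineBlowup (Ideal.span {x, y}) y
  have hw' : algebraMap R (Localization.Away y) x * w * algebraMap R _ y = algebraMap R _ x := by
    rw [mul_assoc, hw, mul_one]
  let v : T := ⟨algebraMap R _ x * w,
    Algebra.subset_adjoin ⟨x, Ideal.subset_span (Set.mem_insert _ _), hw'⟩⟩
  have hv : v * algebraMap R T y = algebraMap R T x := Subtype.ext hw'
  refine ⟨v, hv, h T (algebraMap R T) v ?_ hv⟩
  rw [mem_nonZeroDivisors_iff_right]
  intro a ha
  exact Subtype.ext ((hu.mul_left_eq_zero).mp (congrArg Subtype.val ha))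

end AffineBlowup

/-- In the chart where `λ` generates, the equation divided by `λ^{n_{i+1}}` is the next equation. In
the other chart, dividing by the nonzerodivisor `u^{n_{i+1}}` puts a unit coefficient into the ideal
`(u, v)`. -/
lemma IsChartDatum.isBlowupStep [IsDomain O] [IsLocalRing O] {ρ : O →+* κ}
    (H : IsChartDatum m s ρ c) {i : ℕ} (hi : i < m.length) :
    IsBlowupStep O (chartLam m s c i) (chartU m s c i) (chartLam m s c (i + 1))
      (chartU m s c (i + 1)) := by
  constructor
  · let ι := algebraMap (ChartRing m s c i) (Localization.Away (chartLam m s c i))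
    have hx : IsUnit (ι (chartLam m s c i)) := IsLocalization.Away.algebraMap_isUnit _
    obtain ⟨w, hw⟩ := hx.exists_right_inv
    have hy : ι (chartLam m s c i) * (w * ι (chartU m s c i)) = ι (chartU m s c i) := by
      rw [← mul_assoc, hw, one_mul]
    let φ : ChartRing m s c (i + 1) →+* Localization.Away (chartLam m s c i) :=
      chartLift m (ι.comp (algebraMap O (ChartRing m s c i))) (ι (chartLam m s c i))
        (w * ι (chartU m s c i))
        (by
          rw [RingHom.comp_apply, chartRing_rel, pow_succ, mul_assoc, hy, map_mul, map_pow])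
        (by
          have h := congrArg ι (chartRing_eq m s c i)
          rw [map_evalEq, map_zero, ← hy, evalEq_mul m hi] at h
          exact ((hx.pow _).mul_right_eq_zero).mp h)
    have hφa (a : O) : φ (algebraMap O _ a) = ι (algebraMap O _ a) := chartLift_algebraMap ..
    have hφx : φ (chartLam m s c (i + 1)) = ι (chartLam m s c i) := chartLift_lam ..
    have hφy : φ (chartU m s c (i + 1)) = w * ι (chartU m s c i) := chartLift_u ..
    refine exists_equiv_affineBlowup (chartStep s c hi) (chartStep_lam s c hi)
      (exists_pow_mul_eq_chartStep s c hi) (H.lam_mem_nonZeroDivisors hi) ?_ φ hφa ?_ ?_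
    · rw [eq_top_iff]
      intro a _
      refine chartRing_induction m s c (P := fun a => a ∈ Subring.closure _) a ?_ ?_ ?_ ?_
      · exact fun x => Subring.subset_closure (Or.inl ⟨algebraMap O _ x, by simp⟩)
      · exact fun a b ha hb => add_mem ha hb
      · exact fun a ha => mul_mem ha (Subring.subset_closure (Or.inl ⟨chartLam m s c i, by simp⟩))
      · exact fun a ha => mul_mem ha (Subring.subset_closure (Or.inr rfl))
    · intro a
      refine congr($(chartRing_hom_ext (f := φ.comp (chartStep s c hi)) (g := ι) ?_ ?_ ?_) a)
      · intro a; rw [RingHom.comp_apply, chartStep_algebraMap, hφa]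
      · rw [RingHom.comp_apply, chartStep_lam, hφx]
      · rw [RingHom.comp_apply, chartStep_u, map_mul, hφx, hφy, hy]
    · rw [hφy]; exact (mul_comm _ _).trans hy
  · refine exists_affineBlowup_span_eq_top fun T _ f v hy hv => ?_
    have h := congrArg f (chartRing_eq m s c i)
    rw [map_evalEq, map_zero, ← hv, evalEq_mul_self hi] at h
    have h0 := (mem_nonZeroDivisors_iff.mp (pow_mem hy _)).1 _ h
    have h1 := coeff_mem_of_mem hi _ (I := Ideal.span {f (chartU m s c i), v})
      (Ideal.subset_span (Set.mem_insert _ _)) (Ideal.subset_span (Set.mem_insert_of_mem _ rfl)) h0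
    exact Ideal.eq_top_of_isUnit_mem _ h1
      (((H.isUnit_coeff_dualSum hi).map (algebraMap O _)).map f)

end Comparison

end ChartProperties

end

end ParabolicSpectral


namespace ParabolicSpectral

noncomputable section

/-! ### Local rings of the charts along `λ = 0`, and the valuative blow-up argument -/

section LocalStructure

open Polynomial

section PrincipalMaximalIdeal

variable {R : Type*} [CommRing R] [IsLocalRing R] [IsNoetherianRing R] {π : R}

/-- By Krull's intersection theorem a nonzero element lies in a last power of the maximal ideal, and
its cofactor is then a unit. No domain hypothesis is needed, so this can be used to prove that rings
are domains. -/
lemma exists_eq_mul_pow_of_maximalIdeal_eq_span (h : IsLocalRing.maximalIdeal R = Ideal.span {π})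
    {a : R} (ha : a ≠ 0) : ∃ (n : ℕ) (w : R), IsUnit w ∧ a = w * π ^ n := by
  have hex : ∃ n, a ∉ IsLocalRing.maximalIdeal R ^ n := by
    by_contra! hall
    have : a ∈ ⨅ n, IsLocalRing.maximalIdeal R ^ n := by simpa [Ideal.mem_iInf] using hall
    rw [Ideal.iInf_pow_eq_bot_of_isLocalRing _ (Ideal.IsPrime.ne_top inferInstance)] at this
    exact ha this
  classical
  obtain ⟨n, hn⟩ : ∃ n, Nat.find hex = n + 1 := by
    refine Nat.exists_eq_add_one.mpr (Nat.pos_of_ne_zero fun h0 => ?_)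
    have := Nat.find_spec hex
    rw [h0] at this
    simp at this
  have h1 : a ∈ IsLocalRing.maximalIdeal R ^ n := not_not.mp (Nat.find_min hex (by omega))
  have h2 : a ∉ IsLocalRing.maximalIdeal R ^ (n + 1) := hn ▸ Nat.find_spec hex
  rw [h, Ideal.span_singleton_pow, Ideal.mem_span_singleton'] at h1 h2
  obtain ⟨w, rfl⟩ := h1
  refine ⟨n, w, ?_, rfl⟩
  by_contra hw
  have : w ∈ Ideal.span {π} := h ▸ hw
  obtain ⟨v, rfl⟩ := Ideal.mem_span_singleton'.mp this
  exact h2 ⟨v, by ring⟩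

lemma isDomain_of_maximalIdeal_eq_span (h : IsLocalRing.maximalIdeal R = Ideal.span {π})
    (hπ : π ∈ nonZeroDivisors R) : IsDomain R := by
  have : NoZeroDivisors R := by
    refine ⟨fun {a b} hab => ?_⟩
    by_contra! hne
    obtain ⟨n, w, hw, rfl⟩ := exists_eq_mul_pow_of_maximalIdeal_eq_span h hne.1
    obtain ⟨k, v, hv, rfl⟩ := exists_eq_mul_pow_of_maximalIdeal_eq_span h hne.2
    have h1 : w * v * π ^ (n + k) = 0 := by rw [← hab]; ring
    rw [(hw.mul hv).mul_right_eq_zero] at h1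
    have := (mem_nonZeroDivisors_iff.mp (pow_mem hπ (n + k))).1 1 (by rw [h1, zero_mul])
    exact one_ne_zero this
  exact NoZeroDivisors.to_isDomain R

lemma isDiscreteValuationRing_of_maximalIdeal_eq_span [IsDomain R]
    (h : IsLocalRing.maximalIdeal R = Ideal.span {π}) (hπ : π ≠ 0) :
    IsDiscreteValuationRing R := by
  have hf : ¬ IsField R := by
    rw [IsLocalRing.isField_iff_maximalIdeal_eq, h, Ideal.span_singleton_eq_bot]
    exact hπ
  exact ((IsDiscreteValuationRing.TFAE R hf).out 0 4).mpr (⟨⟨π, h⟩⟩ : Submodule.IsPrincipal _)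

end PrincipalMaximalIdeal

variable {r : ℕ} {m : Composition r} {O : Type u} [CommRing O] {κ : Type*} [Field κ]
  {s : O} {ρ : O →+* κ} {c : ℕ → O}

lemma chartRing_exists_sub_mem {i : ℕ} (x : ChartRing m s c i) :
    ∃ p : O[X], x - aeval (chartU m s c i) p ∈ Ideal.span {chartLam m s c i} := by
  obtain ⟨p, rfl⟩ := Ideal.Quotient.mk_surjective x
  obtain ⟨q, hq⟩ := exists_eq_X_mul_add p
  let φ : MvPolynomial (Fin 2) O →ₐ[O] ChartRing m s c i := Ideal.Quotient.mkₐ O _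
  have e : aeval (chartU m s c i) (evalLamZero O p) =
      φ (aeval (MvPolynomial.X 1 : MvPolynomial (Fin 2) O) (evalLamZero O p)) := by
    rw [← aeval_algHom_apply]; rfl
  have h := congrArg φ hq
  rw [map_add, map_mul, ← e] at h
  refine ⟨evalLamZero O p, Ideal.mem_span_singleton'.mpr ⟨φ q, ?_⟩⟩
  change φ q * φ (MvPolynomial.X 0) = φ p - _
  linear_combination -h

/-- The monic polynomial `T^r + ∑ c_l s^{γ_l} T^{r-l}` which defines the `0`-th chart. -/
def spectralPoly (m : Composition r) (s : O) (c : ℕ → O) : O[X] :=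
  X ^ r + ∑ l ∈ Finset.Icc 1 r, C (c l * s ^ level m l) * X ^ (r - l)

lemma eval₂_spectralPoly {B : Type*} [CommRing B] (f : O →+* B) (x : B) :
    (spectralPoly m s c).eval₂ f x = evalEq m (fun l => f (c l)) 0 x (f s) := by
  simp only [spectralPoly, evalEq, tailSum_zero, eval₂_add, eval₂_finsetSum, eval₂_mul, eval₂_C,
    eval₂_pow, eval₂_X, map_mul, map_pow, zero_mul, zero_add]

lemma degree_spectralPoly_sum_lt (m : Composition r) (s : O) (c : ℕ → O) :
    (∑ l ∈ Finset.Icc 1 r, C (c l * s ^ level m l) * X ^ (r - l)).degree < (r : WithBot ℕ) := by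
  refine (degree_sum_le _ _).trans_lt ((Finset.sup_lt_iff (WithBot.bot_lt_coe r)).mpr ?_)
  intro l hl
  rw [Finset.mem_Icc] at hl
  refine (degree_C_mul_X_pow_le _ _).trans_lt ?_
  exact Nat.cast_lt.mpr (by omega)

lemma monic_spectralPoly : (spectralPoly m s c).Monic :=
  monic_X_pow_add (degree_spectralPoly_sum_lt m s c)

lemma natDegree_spectralPoly [Nontrivial O] : (spectralPoly m s c).natDegree = r := by
  refine natDegree_eq_of_degree_eq_some ?_
  rw [spectralPoly, degree_add_eq_left_of_degree_lt, degree_X_pow]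
  rw [degree_X_pow]
  exact degree_spectralPoly_sum_lt m s c

/-- The valuative form of the blow-up sequence. -/
lemma IsChartDatum.exists_isUnit_of_valuationRing [IsLocalRing O] (H : IsChartDatum m s ρ c)
    {W : Type*} [CommRing W] [IsDomain W] [ValuationRing W] (f : O →+* W) [IsLocalHom f]
    (hs : f s ≠ 0) {x : W} (hx : evalEq m (fun l => f (c l)) 0 x (f s) = 0) :
    x ≠ 0 ∧ x ∈ IsLocalRing.maximalIdeal W ∧ ∃ i ∈ Finset.Icc 1 m.length, ∃ u : W,
      IsUnit u ∧ f s = x ^ i * u ∧ evalEq m (fun l => f (c l)) i x u = 0 := by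
  have hsm : f s ∈ IsLocalRing.maximalIdeal W := by
    rw [IsLocalRing.mem_maximalIdeal, mem_nonunits_iff, isUnit_map_iff]
    have : s ∈ IsLocalRing.maximalIdeal O := by
      rw [H.maximalIdeal_eq]; exact Ideal.mem_span_singleton_self s
    exact this
  have hx0 : x ≠ 0 := by
    rintro rfl
    rw [H.evalEq_zero_zero] at hx
    refine mul_ne_zero ?_ (pow_ne_zero _ hs) hx
    exact ((H.isUnit_coeff (Finset.mem_Icc.mpr ⟨H.rank_pos, le_rfl⟩)).map f).ne_zero
  have hxm : x ∈ IsLocalRing.maximalIdeal W := by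
    have h1 : x ^ r ∈ IsLocalRing.maximalIdeal W := by
      rw [evalEq, tailSum_zero] at hx
      rw [eq_neg_of_add_eq_zero_left hx, neg_mem_iff]
      refine Ideal.sum_mem _ fun l hl => Ideal.mul_mem_right _ _ (Ideal.mul_mem_left _ _ ?_)
      exact Ideal.pow_mem_of_mem _ hsm _ (level_pos m hl)
    exact Ideal.IsPrime.mem_of_pow_mem inferInstance _ h1
  refine ⟨hx0, hxm, ?_⟩
  -- If `u` is never a unit, the valuation ring is centred at the origin of every chart, up to the
  -- last one, where there is no such point.
  by_contra! hno
  have key : ∀ i ≤ m.length, ∃ u ∈ IsLocalRing.maximalIdeal W,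
      f s = x ^ i * u ∧ evalEq m (fun l => f (c l)) i x u = 0 := by
    intro i
    induction i with
    | zero => exact fun _ => ⟨f s, hsm, by simp, hx⟩
    | succ i ih =>
      intro hi
      obtain ⟨u, hu, h1, h2⟩ := ih (by omega)
      have hu0 : u ≠ 0 := by rintro rfl; rw [mul_zero] at h1; exact hs h1
      have hdvd : x ∣ u := by
        -- If `x` does not divide `u`, then `x = u v` with `v` not a unit. This is a centre with `u
        -- = v = 0` in the other chart, which the unit coefficient of the strict transform excludes.
        rcases ValuationRing.dvd_total x u with h | ⟨v, hv⟩
        · exact h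
        · by_cases hvu : IsUnit v
          · rw [hv, hvu.mul_right_dvd]
          · exfalso
            rw [hv, mul_comm, evalEq_mul_self (show i < m.length by omega)] at h2
            have h3 := (mul_eq_zero.mp h2).resolve_left (pow_ne_zero _ hu0)
            have h4 := coeff_mem_of_mem (show i < m.length by omega) _ hu
              (I := IsLocalRing.maximalIdeal W) hvu h3
            exact h4 ((H.isUnit_coeff_dualSum (show i < m.length by omega)).map f)
      obtain ⟨u', rfl⟩ := hdvd
      have h3 : f s = x ^ (i + 1) * u' := by rw [h1]; ring
      have h4 : evalEq m (fun l => f (c l)) (i + 1) x u' = 0 := by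
        rw [evalEq_mul m (show i < m.length by omega)] at h2
        exact (mul_eq_zero.mp h2).resolve_left (pow_ne_zero _ hx0)
      refine ⟨u', fun hu' => ?_, h3, h4⟩
      exact hno (i + 1) (Finset.mem_Icc.mpr ⟨by omega, hi⟩) u' hu' h3 h4
  obtain ⟨u, hu, -, h2⟩ := key m.length le_rfl
  -- As `N_σ = 0`, the last equation reads `1 + ∑ ⋯ = 0` with every further term divisible by `u`.
  rw [evalEq, tailSum_length, pow_zero] at h2
  have h1 : (1 : W) ∈ IsLocalRing.maximalIdeal W := by
    rw [eq_neg_of_add_eq_zero_left h2, neg_mem_iff]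
    refine Ideal.sum_mem _ fun l hl => Ideal.mul_mem_right _ _ (Ideal.mul_mem_left _ _ ?_)
    exact Ideal.pow_mem_of_mem _ hu _ (level_pos m hl)
  exact h1 isUnit_one

/-- The homomorphism from `κ[u]` defined by a homomorphism from `O` which kills `s`. -/
lemma IsChartDatum.exists_residueHom (H : IsChartDatum m s ρ c) {B : Type*} [CommRing B]
    (f : O →+* B) (hf : f s = 0) (y : B) :
    ∃ Φ : κ[X] →+* B, Φ X = y ∧ (∀ x, Φ (C (ρ x)) = f x) ∧
      (∀ p : O[X], Φ (p.map ρ) = p.eval₂ f y) ∧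
      ∀ i, Φ (redPoly m (fun l => ρ (c l)) i) = evalEq m (fun l => f (c l)) i 0 y := by
  have hker : RingHom.ker ρ ≤ RingHom.ker f := by
    rw [H.ker, Ideal.span_le, Set.singleton_subset_iff]; exact hf
  let g : κ →+* B := RingHom.liftOfSurjective ρ H.surj ⟨f, hker⟩
  have hg (x : O) : g (ρ x) = f x := RingHom.liftOfRightInverse_comp_apply _ _ _ ⟨f, hker⟩ x
  have hC (x : O) : eval₂RingHom g y (C (ρ x)) = f x := by simp [hg]
  refine ⟨eval₂RingHom g y, by simp, hC, fun p => ?_, fun i => ?_⟩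
  · have : g.comp ρ = f := RingHom.ext hg
    rw [coe_eval₂RingHom, eval₂_map, this]
  · rw [redPoly, map_evalEq]
    simp only [hC, map_zero]
    simp

lemma IsChartDatum.map_u_pow_eq_zero [IsLocalRing O] (H : IsChartDatum m s ρ c) {B : Type*}
    [CommRing B] (f : ChartRing m s c 0 →+* B) (hf : f (chartLam m s c 0) = 0) :
    f (chartU m s c 0 ^ level m r) = 0 := by
  have h := chartRing_map_eq m s c f
  rw [hf, H.evalEq_zero_zero, (((H.isUnit_coeff (Finset.mem_Icc.mpr ⟨H.rank_pos, le_rfl⟩)).map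
    (algebraMap O _)).map f).mul_right_eq_zero, ← map_pow] at h
  exact h

lemma map_aeval_evalLamZero_chartEq {i : ℕ} {B : Type*} [CommRing B] (f : ChartRing m s c i →+* B)
    (hf : f (chartLam m s c i) = 0) :
    f (aeval (chartU m s c i) (evalLamZero O (chartEq m c i))) = 0 := by
  have h := chartRing_map_eq m s c f
  rw [hf] at h
  rw [← h]
  have h' := map_evalEq m ((f.comp (aeval (R := O) (chartU m s c i)).toRingHom).comp
    (evalLamZero O)) (fun l => MvPolynomial.C (c l)) i (MvPolynomial.X 0) (MvPolynomial.X 1)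
  simpa [chartEq] using h'

section AtPrime

variable {i : ℕ} (q : Ideal (ChartRing m s c i)) [q.IsPrime]

lemma IsChartDatum.algebraMap_s_mem [IsLocalRing O] (H : IsChartDatum m s ρ c)
    (hq : chartLam m s c i ∈ q) : algebraMap O _ s ∈ q := by
  rcases Nat.eq_zero_or_pos i with rfl | hi
  · rw [chartRing_rel_zero]
    have h := H.map_u_pow_eq_zero (B := ChartRing m s c 0 ⧸ q) (Ideal.Quotient.mk q)
      (Ideal.Quotient.eq_zero_iff_mem.mpr hq)
    rw [Ideal.Quotient.eq_zero_iff_mem] at h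
    exact Ideal.IsPrime.mem_of_pow_mem inferInstance _ h
  · rw [chartRing_rel]
    exact Ideal.mul_mem_right _ _ (Ideal.pow_mem_of_mem _ hq _ hi)

/-- Modulo `(λ, u)` every element comes from `O`, and `s` is a multiple of `u`; so the quotient is a
quotient of the field `O/(s)`, and the origin is the only prime containing `λ` and `u`. -/
lemma IsChartDatum.eq_span_of_mem [IsLocalRing O] (H : IsChartDatum m s ρ c)
    (hq : chartLam m s c i ∈ q) (hu : chartU m s c i ∈ q) :
    q = Ideal.span {chartLam m s c i, chartU m s c i} := by
  set I := Ideal.span {chartLam m s c i, chartU m s c i} with hI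
  have hlI : chartLam m s c i ∈ I := Ideal.subset_span (Set.mem_insert _ _)
  have huI : chartU m s c i ∈ I := Ideal.subset_span (Set.mem_insert_of_mem _ rfl)
  have hIq : I ≤ q := by
    rw [hI, Ideal.span_le]
    rintro _ (rfl | rfl)
    exacts [hq, hu]
  refine le_antisymm (fun x hx => ?_) hIq
  have hex : ∃ o : O, x - algebraMap O _ o ∈ I := by
    refine chartRing_induction m s c (P := fun x => ∃ o : O, x - algebraMap O _ o ∈ I) x ?_ ?_ ?_ ?_
    · exact fun o => ⟨o, by simp⟩
    · rintro a b ⟨o, ho⟩ ⟨o', ho'⟩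
      refine ⟨o + o', ?_⟩
      rw [map_add, add_sub_add_comm]
      exact add_mem ho ho'
    · exact fun a _ => ⟨0, by simpa using Ideal.mul_mem_left _ a hlI⟩
    · exact fun a _ => ⟨0, by simpa using Ideal.mul_mem_left _ a huI⟩
  obtain ⟨o, ho⟩ := hex
  have hoq : algebraMap O _ o ∈ q := by
    have := sub_mem hx (hIq ho)
    rwa [sub_sub_cancel] at this
  have hos : o ∈ Ideal.span {s} := by
    by_contra hns
    rw [← H.ker] at hns
    exact Ideal.IsPrime.ne_top inferInstance
      (Ideal.eq_top_of_isUnit_mem q hoq ((H.isUnit_of_map_ne_zero hns).map _))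
  obtain ⟨w, rfl⟩ := Ideal.mem_span_singleton'.mp hos
  have : algebraMap O _ (w * s) ∈ I := by
    rw [map_mul, chartRing_rel]
    exact Ideal.mul_mem_left _ _ (Ideal.mul_mem_left _ _ huI)
  simpa using add_mem ho this

/-- At a prime `q` which contains `λ`, the quotient is generated over `κ` by `u`, subject to a
factor of the reduced polynomial. -/
lemma IsChartDatum.exists_residueHom_quotient [IsLocalRing O] (H : IsChartDatum m s ρ c)
    (hi : i ≤ m.length) (hq : chartLam m s c i ∈ q) :
    ∃ (Φ : κ[X] →+* ChartRing m s c i ⧸ q) (g : κ[X]), Function.Surjective Φ ∧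
      RingHom.ker Φ = Ideal.span {g} ∧ Irreducible g ∧
      g ∣ redPoly m (fun l => ρ (c l)) i ∧ Φ X = Ideal.Quotient.mk q (chartU m s c i) ∧
      ∀ p : O[X], Φ (p.map ρ) = Ideal.Quotient.mk q (aeval (chartU m s c i) p) := by
  have hs := H.algebraMap_s_mem q hq
  obtain ⟨Φ, h1, h2, h3, h4⟩ := H.exists_residueHom
    ((Ideal.Quotient.mk q).comp (algebraMap O _))
    (Ideal.Quotient.eq_zero_iff_mem.mpr hs) (Ideal.Quotient.mk q (chartU m s c i))
  have h5 (p : O[X]) : Φ (p.map ρ) = Ideal.Quotient.mk q (aeval (chartU m s c i) p) := by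
    rw [h3, ← hom_eval₂]; rfl
  have hsurj : Function.Surjective Φ := by
    intro x
    obtain ⟨x, rfl⟩ := Ideal.Quotient.mk_surjective x
    obtain ⟨p, hp⟩ := chartRing_exists_sub_mem x
    refine ⟨p.map ρ, ?_⟩
    rw [h5, eq_comm, Ideal.Quotient.mk_eq_mk_iff_sub_mem]
    exact (Ideal.span_singleton_le_iff_mem _).mpr hq hp
  obtain ⟨g, hg⟩ := IsPrincipalIdealRing.principal (RingHom.ker Φ)
  have hg' : RingHom.ker Φ = Ideal.span {g} := hg
  have hmem : redPoly m (fun l => ρ (c l)) i ∈ RingHom.ker Φ := by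
    rw [RingHom.mem_ker, h4]
    have h := chartRing_map_eq m s c (B := ChartRing m s c _ ⧸ q) (Ideal.Quotient.mk q)
    rwa [Ideal.Quotient.eq_zero_iff_mem.mpr hq] at h
  rw [hg', Ideal.mem_span_singleton] at hmem
  have hp : (RingHom.ker Φ).IsPrime := RingHom.ker_isPrime Φ
  have hg0 : g ≠ 0 := by
    rintro rfl
    exact redPoly_ne_zero m H.coeff hi (zero_dvd_iff.mp hmem)
  rw [hg', Ideal.span_singleton_prime hg0] at hp
  exact ⟨Φ, g, hsurj, hg', hp.irreducible, hmem, h1, h5⟩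

lemma aeval_mem_span_of_map_eq_zero (H : IsChartDatum m s ρ c) {A : Type*} [CommRing A]
    [Algebra O A] (y : A) {p : O[X]} (hp : p.map ρ = 0) :
    aeval y p ∈ Ideal.span {algebraMap O A s} := by
  have : C s ∣ p := by
    rw [C_dvd_iff_dvd_coeff]
    intro n
    rw [← Ideal.mem_span_singleton, ← H.ker, RingHom.mem_ker, ← coeff_map, hp, coeff_zero]
  obtain ⟨p, rfl⟩ := this
  rw [map_mul, aeval_C]
  exact Ideal.mul_mem_right _ _ (Ideal.mem_span_singleton_self _)

/-- For `i ≥ 1` the quotient of the chart by `λ` satisfies the equation `u^{n_{i+1}} h_i = 0` over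
`κ`. The point `q` corresponds to a simple factor `g` of this polynomial, and the cofactor of `g`,
invertible at `q`, carries `q` into `(λ)`. -/
lemma IsChartDatum.exists_mul_mem_span_lam [IsLocalRing O] (H : IsChartDatum m s ρ c)
    (hi : i ≤ m.length) (hq : chartLam m s c i ∈ q)
    (hgood : chartU m s c i ∉ q ∨ sortedPart m (i + 1) ≤ 1) {x : ChartRing m s c i} (hx : x ∈ q) :
    ∃ t ∉ q, t * x ∈ Ideal.span {chartLam m s c i} := by
  set L := Ideal.span {chartLam m s c i} with hL
  have hlL : chartLam m s c i ∈ L := Ideal.mem_span_singleton_self _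
  have hLq : L ≤ q := (Ideal.span_singleton_le_iff_mem _).mpr hq
  obtain ⟨p, hp⟩ := chartRing_exists_sub_mem x
  -- In the `0`-th chart `s = u` is not visibly a multiple of `λ`. But `λ ∈ q` forces `u ∈ q`, hence
  -- `n_1 = 1` and `γ_r = 1`, and the equation modulo `λ` is `c_r u = 0`.
  rcases Nat.eq_zero_or_pos i with rfl | hi0
  · have hs := H.algebraMap_s_mem q hq
    have hu : chartU m s c 0 ∈ q := by simpa [chartRing_rel] using hs
    have hlen : 0 < m.length := by
      rw [Composition.length_pos_iff]; exact H.rank_pos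
    have h1 : sortedPart m 1 = 1 := by
      have := hgood.resolve_left (not_not.mpr hu)
      have := one_le_sortedPart_succ m hlen
      simp only [zero_add] at *
      omega
    have hlev : level m r = 1 := by
      have h2 := exponent_dualSum m hlen
      rw [zero_mul, zero_add, tailSum_zero, zero_add, h1] at h2
      have h3 := level_dualSum m h1.ge
      rwa [← h2] at h3
    have hF := H.map_u_pow_eq_zero (B := ChartRing m s c 0 ⧸ L) (Ideal.Quotient.mk L)
      (Ideal.Quotient.eq_zero_iff_mem.mpr hlL)
    rw [hlev, pow_one, Ideal.Quotient.eq_zero_iff_mem] at hF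
    have hqL : q ≤ L := by
      rw [H.eq_span_of_mem q hq hu, Ideal.span_le]
      rintro _ (rfl | rfl)
      exacts [hlL, hF]
    exact ⟨1, fun h => Ideal.IsPrime.ne_top inferInstance ((Ideal.eq_top_iff_one q).mpr h), by
      simpa using hqL hx⟩
  have hsL : algebraMap O _ s ∈ L := by
    rw [chartRing_rel]
    exact Ideal.mul_mem_right _ _ (Ideal.pow_mem_of_mem _ hlL _ hi0)
  have hzero {p : O[X]} (h : p.map ρ = 0) : aeval (chartU m s c i) p ∈ L :=
    (Ideal.span_singleton_le_iff_mem _).mpr hsL (aeval_mem_span_of_map_eq_zero H _ h)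
  obtain ⟨Φ, g, -, hker, hirr, hdvd, hX, hΦ⟩ := H.exists_residueHom_quotient q hi hq
  have hgX : g ∣ X ↔ chartU m s c i ∈ q := by
    rw [← Ideal.mem_span_singleton, ← hker, RingHom.mem_ker, hX, Ideal.Quotient.eq_zero_iff_mem]
  have hcoeff := coeff_redPoly_sortedPart m H.coeff hi
  obtain ⟨h, hh, hsep⟩ := H.sep i (Finset.mem_Icc.mpr ⟨hi0, hi⟩)
  -- the factor `g` is simple
  obtain ⟨k, hk, hgk⟩ : ∃ k, redPoly m (fun l => ρ (c l)) i = g * k ∧ ¬ g ∣ k := by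
    have h0 : ¬ X ∣ h := by
      rw [X_dvd_iff]
      rwa [hh, coeff_X_pow_mul', if_pos le_rfl, Nat.sub_self] at hcoeff
    by_cases hgX' : g ∣ X
    · have hn := hgood.resolve_left (not_not.mpr (hgX.mp hgX'))
      have hass : Associated g X := hirr.associated_of_dvd irreducible_X hgX'
      interval_cases hn' : sortedPart m (i + 1)
      · rw [pow_zero, one_mul] at hh
        exact absurd (hh ▸ (hass.dvd_iff_dvd_left.mp hdvd)) h0
      · obtain ⟨w, hw⟩ := hass
        refine ⟨w * h, by rw [hh, ← hw]; ring, fun hd => h0 ?_⟩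
        rw [w.isUnit.dvd_mul_left] at hd
        exact (Associated.dvd_iff_dvd_left ⟨w, hw⟩).mp hd
    · have hgh : g ∣ h := by
        rw [hh] at hdvd
        exact (hirr.prime.dvd_or_dvd hdvd).resolve_left fun h' => hgX' (hirr.prime.dvd_of_dvd_pow h')
      obtain ⟨k, rfl⟩ := hgh
      refine ⟨X ^ sortedPart m (i + 1) * k, by rw [hh]; ring, fun hd => ?_⟩
      have hgk := (hirr.prime.dvd_or_dvd hd).resolve_left
        fun h' => hgX' (hirr.prime.dvd_of_dvd_pow h')
      exact hirr.not_isUnit (hsep.squarefree g (mul_dvd_mul_left g hgk))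
  obtain ⟨G, rfl⟩ := Polynomial.map_surjective ρ H.surj g
  obtain ⟨K, rfl⟩ := Polynomial.map_surjective ρ H.surj k
  -- The factorization over `κ` lifts to `O[u]` up to multiples of `s`, which lie in `(λ)` because
  -- `i ≥ 1`.
  have hprod : aeval (chartU m s c i) (G * K) ∈ L := by
    have e1 : aeval (chartU m s c i) (evalLamZero O (chartEq m c i)) ∈ L := by
      rw [← Ideal.Quotient.eq_zero_iff_mem]
      exact map_aeval_evalLamZero_chartEq (B := ChartRing m s c i ⧸ L) (Ideal.Quotient.mk L)
        (Ideal.Quotient.eq_zero_iff_mem.mpr hlL)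
    have e2 : aeval (chartU m s c i) (G * K - evalLamZero O (chartEq m c i)) ∈ L := by
      refine hzero ?_
      rw [Polynomial.map_sub, IsChartDatum.map_evalLamZero_chartEq, hk, Polynomial.map_mul,
        sub_self]
    rw [map_sub] at e2
    simpa using add_mem e2 e1
  refine ⟨aeval (chartU m s c i) K, fun hKq => hgk ?_, ?_⟩
  · rw [← Ideal.mem_span_singleton, ← hker, RingHom.mem_ker, hΦ]
    exact Ideal.Quotient.eq_zero_iff_mem.mpr hKq
  · have hpq : aeval (chartU m s c i) p ∈ q := by
      have := sub_mem hx (hLq hp)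
      rwa [sub_sub_cancel] at this
    have hpk : p.map ρ ∈ RingHom.ker Φ := by
      rw [RingHom.mem_ker, hΦ]; exact Ideal.Quotient.eq_zero_iff_mem.mpr hpq
    rw [hker, Ideal.mem_span_singleton] at hpk
    obtain ⟨g2, hg2⟩ := hpk
    obtain ⟨G2, rfl⟩ := Polynomial.map_surjective ρ H.surj g2
    have e3 : aeval (chartU m s c i) (p - G * G2) ∈ L := by
      refine hzero ?_
      rw [Polynomial.map_sub, hg2, Polynomial.map_mul, sub_self]
    have e4 : x - aeval (chartU m s c i) (G * G2) ∈ L := by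
      rw [map_sub] at e3
      simpa using add_mem hp e3
    have e5 := Ideal.mul_mem_left L (aeval (chartU m s c i) K) e4
    have e6 := Ideal.mul_mem_left L (aeval (chartU m s c i) G2) hprod
    convert add_mem e5 e6 using 1
    simp only [map_mul]; ring

variable (Aq : Type*) [CommRing Aq] [Algebra (ChartRing m s c i) Aq]
  [IsLocalization.AtPrime Aq q] [IsLocalRing Aq]

lemma IsChartDatum.maximalIdeal_atPrime [IsLocalRing O] (H : IsChartDatum m s ρ c)
    (hi : i ≤ m.length) (hq : chartLam m s c i ∈ q)
    (hgood : chartU m s c i ∉ q ∨ sortedPart m (i + 1) ≤ 1) :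
    IsLocalRing.maximalIdeal Aq = Ideal.span {algebraMap _ Aq (chartLam m s c i)} := by
  rw [← IsLocalization.AtPrime.map_eq_maximalIdeal q Aq]
  refine le_antisymm ?_ ?_
  · rw [Ideal.map_le_iff_le_comap]
    intro x hx
    obtain ⟨t, ht, htx⟩ := H.exists_mul_mem_span_lam q hi hq hgood hx
    obtain ⟨w, hw⟩ := Ideal.mem_span_singleton'.mp htx
    have hu : IsUnit (algebraMap _ Aq t) :=
      IsLocalization.map_units Aq (⟨t, ht⟩ : q.primeCompl)
    rw [Ideal.mem_comap, ← Ideal.unit_mul_mem_iff_mem _ hu, ← map_mul, ← hw, map_mul]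
    exact Ideal.mul_mem_left _ _ (Ideal.mem_span_singleton_self _)
  · rw [Ideal.span_singleton_le_iff_mem]
    exact Ideal.mem_map_of_mem _ hq

lemma IsChartDatum.isDomain_atPrime [IsDomain O] [IsLocalRing O] [IsNoetherianRing O]
    (H : IsChartDatum m s ρ c)
    (hi : i ≤ m.length) (hq : chartLam m s c i ∈ q)
    (hgood : chartU m s c i ∉ q ∨ sortedPart m (i + 1) ≤ 1) : IsDomain Aq := by
  have : IsNoetherianRing Aq := IsLocalization.isNoetherianRing q.primeCompl _ inferInstance
  refine isDomain_of_maximalIdeal_eq_span (H.maximalIdeal_atPrime q Aq hi hq hgood) ?_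
  exact IsLocalization.map_nonZeroDivisors_le q.primeCompl Aq
    ⟨_, H.lam_mem_nonZeroDivisors hi, rfl⟩

lemma IsChartDatum.isDiscreteValuationRing_atPrime [IsDomain O] [IsLocalRing O] [IsNoetherianRing O]
    (H : IsChartDatum m s ρ c) [IsDomain Aq]
    (hi : i ≤ m.length) (hq : chartLam m s c i ∈ q)
    (hgood : chartU m s c i ∉ q ∨ sortedPart m (i + 1) ≤ 1) : IsDiscreteValuationRing Aq := by
  have : IsNoetherianRing Aq := IsLocalization.isNoetherianRing q.primeCompl _ inferInstance
  refine isDiscreteValuationRing_of_maximalIdeal_eq_span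
    (H.maximalIdeal_atPrime q Aq hi hq hgood) ?_
  exact nonZeroDivisors.ne_zero (IsLocalization.map_nonZeroDivisors_le q.primeCompl Aq
    ⟨_, H.lam_mem_nonZeroDivisors hi, rfl⟩)

end AtPrime

end LocalStructure

end

end ParabolicSpectral


namespace ParabolicSpectral

noncomputable section

/-! ### Regularity of the charts -/

section Regularity

open Polynomial

variable {r : ℕ} {m : Composition r} {O : Type u} [CommRing O] {κ : Type*} [Field κ]
  {s : O} {ρ : O →+* κ} {c : ℕ → O}

lemma isIntegral_of_evalEq_eq_zero {W E : Type*} [CommRing W] [CommRing E] [Algebra W E]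
    (f : O →+* W) {x : E}
    (hx : evalEq m (fun l => algebraMap W E (f (c l))) 0 x (algebraMap W E (f s)) = 0) :
    IsIntegral W x := by
  refine ⟨(spectralPoly m s c).map f, monic_spectralPoly.map f, ?_⟩
  rw [eval₂_map, eval₂_spectralPoly]
  exact hx

/-- An element of a chart which vanishes on some valuation ring over the chart, centred at a good
point, is killed by an element outside the centre. -/
lemma IsChartDatum.exists_mul_eq_zero_of_map_eq_zero [IsDomain O] [IsLocalRing O]
    [IsNoetherianRing O] (H : IsChartDatum m s ρ c) {i : ℕ} (hi : i ≤ m.length)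
    {W : Type*} [CommRing W] [IsDomain W] [IsLocalRing W] (g : ChartRing m s c i →+* W)
    (hlam : g (chartLam m s c i) ∈ IsLocalRing.maximalIdeal W) (hlam0 : g (chartLam m s c i) ≠ 0)
    (hu : IsUnit (g (chartU m s c i))) {b : ChartRing m s c i} (hb : g b = 0) :
    ∃ t, IsUnit (g t) ∧ t * b = 0 := by
  let q := (IsLocalRing.maximalIdeal W).comap g
  have hq : chartLam m s c i ∈ q := hlam
  have hgood : chartU m s c i ∉ q ∨ sortedPart m (i + 1) ≤ 1 := Or.inl fun h => h hu
  let Aq := Localization.AtPrime q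
  have : IsDomain Aq := H.isDomain_atPrime q Aq hi hq hgood
  have : IsNoetherianRing Aq := IsLocalization.isNoetherianRing q.primeCompl _ inferInstance
  have hun (y : q.primeCompl) : IsUnit (g y) := not_not.mp fun h => y.2 h
  by_cases hb0 : algebraMap _ Aq b = 0
  · rw [IsLocalization.map_eq_zero_iff q.primeCompl] at hb0
    obtain ⟨t, ht⟩ := hb0
    exact ⟨t, hun t, ht⟩
  · exfalso
    obtain ⟨n, w, hw, h⟩ := exists_eq_mul_pow_of_maximalIdeal_eq_span
      (H.maximalIdeal_atPrime q Aq hi hq hgood) hb0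
    have h' := congrArg (IsLocalization.lift hun) h
    rw [IsLocalization.lift_eq, hb, map_mul, map_pow, IsLocalization.lift_eq] at h'
    exact mul_ne_zero (hw.map (IsLocalization.lift hun)).ne_zero (pow_ne_zero _ hlam0) h'.symm

/-- A valuation ring `A` of the residue field of `p` dominating `O` has its centre, on some chart
`j`, at a point with `λ = 0` and `u` a unit. The local ring of the chart there is a domain with
uniformizer `λ`, and `λ` does not vanish in the residue field, so everything vanishing there is
killed by an element outside the centre. The annihilator is carried back to chart `i` through the
`0`-th chart. -/
lemma IsChartDatum.exists_mul_eq_zero_of_lam_notMem [IsDomain O] [IsDiscreteValuationRing O]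
    (H : IsChartDatum m s ρ c) {i : ℕ} (hi : i ≤ m.length) (p : Ideal (ChartRing m s c i))
    [p.IsPrime] (hp : chartLam m s c i ∉ p) {a : ChartRing m s c i} (ha : a ∈ p) :
    ∃ t ∉ p, t * a = 0 := by
  let E := p.ResidueField
  let π : ChartRing m s c i →+* E := algebraMap _ _
  have hπ (x) : π x = 0 ↔ x ∈ p := Ideal.algebraMap_residueField_eq_zero
  let f : O →+* E := π.comp (algebraMap O _)
  -- If `s` vanished then so would `u`, and the equation would reduce to `λ^{N_i} = 0`.
  have hs : f s ≠ 0 := by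
    intro h
    have hs : algebraMap O _ s ∈ p := (hπ _).mp h
    rw [chartRing_rel] at hs
    have hu : chartU m s c i ∈ p := (Ideal.IsPrime.mem_or_mem inferInstance hs).resolve_left
      fun h => hp (Ideal.IsPrime.mem_of_pow_mem inferInstance _ h)
    have h := chartRing_map_eq m s c π
    rw [(hπ _).mpr hu, evalEq_zero_right] at h
    exact pow_ne_zero _ (mt (hπ _).mp hp) h
  obtain ⟨A, hA, hloc⟩ := IsLocalRing.exists_factor_valuationRing f
  let fW : O →+* A := f.codRestrict A.toSubring hA
  have : IsLocalHom fW := hloc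
  have hfW (x : O) : (fW x : E) = f x := rfl
  have hx0 : evalEq m (fun l => f (c l)) 0 (π (chartLam m s c i)) (f s) = 0 := by
    have h := chartRing_map_eq m s c (π.comp (chartMap m s c hi))
    rw [RingHom.comp_apply, chartMap_lam, RingHom.comp_apply, ← chartRing_rel_zero] at h
    simp only [RingHom.comp_apply, chartMap_algebraMap] at h
    exact h
  have hint : IsIntegral A (π (chartLam m s c i)) := isIntegral_of_evalEq_eq_zero fW hx0
  obtain ⟨x, hx⟩ := IsIntegrallyClosed.isIntegral_iff.mp hint
  have hx' : (x : E) = π (chartLam m s c i) := hx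
  have hinjA : Function.Injective A.subtype := Subtype.val_injective
  have hxW : evalEq m (fun l => fW (c l)) 0 x (fW s) = 0 := by
    refine hinjA ?_
    rw [map_evalEq, map_zero, ← hx0, ← hx']
    rfl
  have hsW : fW s ≠ 0 := fun h => hs (by rw [← hfW, h]; rfl)
  obtain ⟨hx0, hxm, j, hj, u, hu, e1, e2⟩ := H.exists_isUnit_of_valuationRing fW hsW hxW
  have hj := (Finset.mem_Icc.mp hj).2
  let g : ChartRing m s c j →+* A := chartLift m fW x u e1 e2
  have hgl : g (chartLam m s c j) = x := chartLift_lam ..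
  have hgu : g (chartU m s c j) = u := chartLift_u ..
  -- Charts `i` and `j` have no direct map between them; both are compared with the `0`-th chart,
  -- from which they differ only by powers of `λ`.
  have hcomp : (A.subtype.comp g).comp (chartMap m s c hj) = π.comp (chartMap m s c hi) := by
    refine chartRing_hom_ext (fun a => ?_) ?_ ?_
    · rw [RingHom.comp_apply, RingHom.comp_apply, chartMap_algebraMap, RingHom.comp_apply,
        chartMap_algebraMap]
      exact congrArg _ (chartLift_algebraMap ..)
    · rw [RingHom.comp_apply, RingHom.comp_apply, chartMap_lam, RingHom.comp_apply, chartMap_lam,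
        hgl]
      exact hx'
    · rw [← chartRing_rel_zero, RingHom.comp_apply, RingHom.comp_apply, chartMap_algebraMap,
        RingHom.comp_apply, chartMap_algebraMap]
      exact congrArg _ (chartLift_algebraMap ..)
  obtain ⟨n, a0, ha0⟩ := exists_pow_mul_eq_chartMap s c hi a
  have hb : g (chartMap m s c hj a0) = 0 := by
    refine hinjA ?_
    have h := congr($hcomp a0)
    rw [RingHom.comp_apply, RingHom.comp_apply, RingHom.comp_apply, ← ha0, map_mul,
      (hπ a).mpr ha, mul_zero] at h
    rw [map_zero]; exact h
  obtain ⟨t, ht, htb⟩ := H.exists_mul_eq_zero_of_map_eq_zero hj g (by rwa [hgl]) (by rwa [hgl])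
    (by rwa [hgu]) hb
  obtain ⟨k, t0, ht0⟩ := exists_pow_mul_eq_chartMap s c hj t
  have h0 : t0 * a0 = 0 := by
    refine H.chartMap_injective s c hj ?_
    rw [map_mul, map_zero, ← ht0, mul_assoc, htb, mul_zero]
  -- `t0 a0 = 0` already holds in the `0`-th chart, because the map to chart `j` is injective; the
  -- power of `λ` turns `a` into the image of `a0`.
  refine ⟨chartMap m s c hi t0 * chartLam m s c i ^ n, fun hmem => ?_, ?_⟩
  · rcases Ideal.IsPrime.mem_or_mem inferInstance hmem with h | h
    · have h' := congr($hcomp t0)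
      rw [RingHom.comp_apply, RingHom.comp_apply, RingHom.comp_apply, (hπ _).mpr h, ← ht0,
        map_mul, map_pow, hgl, map_mul, map_pow] at h'
      refine mul_ne_zero (pow_ne_zero _ ?_) ?_ h'
      · exact (map_ne_zero_iff _ hinjA).mpr hx0
      · exact (map_ne_zero_iff _ hinjA).mpr ht.ne_zero
    · exact hp (Ideal.IsPrime.mem_of_pow_mem inferInstance _ h)
  · rw [mul_assoc, ha0, ← map_mul, h0, map_zero]

lemma isRegularLocalRing_of_isField {R : Type*} [CommRing R] (h : IsField R) :
    IsRegularLocalRing R := by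
  let := h.toField
  have : IsPrincipalIdealRing R := h.isPrincipalIdealRing
  have : IsDomain R := h.isDomain
  have : IsLocalRing R := @Field.instIsLocalRing R h.toField
  infer_instance

/-- According to whether `λ` lies in `p`, the local ring is a discrete valuation ring or a field. -/
lemma IsChartDatum.isRegularLocalRing_atPrime [IsDomain O] [IsDiscreteValuationRing O]
    (H : IsChartDatum m s ρ c) {i : ℕ} (hi : i ≤ m.length) (p : Ideal (ChartRing m s c i))
    [p.IsPrime] (hp : p = Ideal.span {chartLam m s c i, chartU m s c i} →
      sortedPart m (i + 1) ≤ 1) : IsRegularLocalRing (Localization.AtPrime p) := by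
  by_cases hlam : chartLam m s c i ∈ p
  · have hgood : chartU m s c i ∉ p ∨ sortedPart m (i + 1) ≤ 1 := by
      by_cases hu : chartU m s c i ∈ p
      · exact Or.inr (hp (H.eq_span_of_mem p hlam hu))
      · exact Or.inl hu
    have : IsDomain (Localization.AtPrime p) := H.isDomain_atPrime p (Localization.AtPrime p) hi hlam hgood
    have : IsDiscreteValuationRing (Localization.AtPrime p) :=
      H.isDiscreteValuationRing_atPrime p (Localization.AtPrime p) hi hlam hgood
    infer_instance
  · refine isRegularLocalRing_of_isField ?_
    rw [IsLocalRing.isField_iff_maximalIdeal_eq, ← Localization.AtPrime.map_eq_maximalIdeal,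
      eq_bot_iff, Ideal.map_le_iff_le_comap]
    intro a ha
    obtain ⟨t, ht, hta⟩ := H.exists_mul_eq_zero_of_lam_notMem hi p hlam ha
    rw [Ideal.mem_comap, Ideal.mem_bot, IsLocalization.map_eq_zero_iff p.primeCompl]
    exact ⟨⟨t, ht⟩, hta⟩

end Regularity

end

end ParabolicSpectral


namespace ParabolicSpectral

noncomputable section

/-! ### Extension of the ground field, and smoothness -/

section BaseChange

open Polynomial

variable {r : ℕ} {m : Composition r} {k : Type u} [Field k]

/-- A common root of `h` and `h'` would be a multiple root of `P`, and it is nonzero because `h(0) ≠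
0`. -/
lemma separable_of_simple_roots {h P : k[X]} {n : ℕ} (hP : P = X ^ n * h) (h0 : h.coeff 0 ≠ 0)
    (hsimple : ∀ z : AlgebraicClosure k, z ≠ 0 → aeval z P = 0 → aeval z (derivative P) ≠ 0) :
    h.Separable := by
  rw [Separable, isCoprime_iff_aeval_ne_zero_of_isAlgClosed k (AlgebraicClosure k)]
  intro z
  by_contra! hz
  have hz0 : z ≠ 0 := by
    rintro rfl
    have := hz.1
    rw [← coeff_zero_eq_aeval_zero'] at this
    exact h0 ((map_eq_zero _).mp this)
  refine hsimple z hz0 ?_ ?_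
  · rw [hP, map_mul, hz.1, mul_zero]
  · rw [hP, derivative_mul, map_add, map_mul, map_mul, hz.1, hz.2, mul_zero, mul_zero, add_zero]

lemma fibrePoly_eq_redPoly (c : ℕ → k⟦X⟧) (i : ℕ) :
    fibrePoly m c i = redPoly m (fun l => PowerSeries.constantCoeff (c l)) i := by
  have := map_evalEq m (MvPolynomial.eval₂Hom (Polynomial.C.comp
    (PowerSeries.constantCoeff (R := k))) ![0, Polynomial.X]) (fun l => MvPolynomial.C (c l)) i
    (MvPolynomial.X 0) (MvPolynomial.X 1)
  refine this.trans ?_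
  simp [redPoly]

lemma IsGeneric.isChartDatum {c : ℕ → k⟦X⟧} (hgen : IsGeneric m c) (hr : 0 < r) :
    IsChartDatum m (PowerSeries.X : k⟦X⟧) (PowerSeries.constantCoeff (R := k)) c where
  rank_pos := hr
  surj x := ⟨PowerSeries.C x, by simp⟩
  ker := by
    ext x
    rw [RingHom.mem_ker, Ideal.mem_span_singleton, PowerSeries.X_dvd_iff]
  ne_zero := PowerSeries.X_ne_zero
  coeff := hgen.1
  sep i hi := by
    have hi' := (Finset.mem_Icc.mp hi).2
    obtain ⟨h, hh⟩ := X_pow_dvd_redPoly m (fun l => PowerSeries.constantCoeff (c l)) hi'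
    refine ⟨h, hh, separable_of_simple_roots hh ?_ ?_⟩
    · have := coeff_redPoly_sortedPart m hgen.1 hi'
      rw [hh, coeff_X_pow_mul'] at this
      simpa using this
    · have := hgen.2 i hi
      rwa [fibrePoly_eq_redPoly] at this

variable {O : Type u} [CommRing O] [Algebra k O] {s : O} {ρ : O →ₐ[k] k} {c : ℕ → O}
  (k' : Type u) [Field k'] [Algebra k k']

/-- The reduction map of a chart datum after a field extension. -/
def baseChangeRes (ρ : O →ₐ[k] k) : k' ⊗[k] O →ₐ[k'] k' :=
  Algebra.TensorProduct.lift (Algebra.ofId k' k') ((Algebra.ofId k k').comp ρ)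
    fun _ _ => Commute.all _ _

lemma baseChangeRes_tmul (a : k') (x : O) :
    baseChangeRes k' ρ (a ⊗ₜ x) = a * algebraMap k k' (ρ x) := by
  simp [baseChangeRes, Algebra.ofId_apply]

lemma one_tmul_mul_injective [IsDomain O] (hs : s ≠ 0) :
    ((1 : k') ⊗ₜ[k] s) ∈ nonZeroDivisors (k' ⊗[k] O) := by
  rw [mem_nonZeroDivisors_iff_left]
  have hinj : Function.Injective (LinearMap.lTensor k' (LinearMap.mulLeft k s)) :=
    Module.Flat.lTensor_preserves_injective_linearMap _ (mul_right_injective₀ hs)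
  have hmul : ∀ z : k' ⊗[k] O, (1 : k') ⊗ₜ[k] s * z =
      LinearMap.lTensor k' (LinearMap.mulLeft k s) z := by
    intro z
    induction z with
    | zero => simp
    | tmul a x => simp
    | add x y hx hy => rw [mul_add, hx, hy, map_add]
  intro z hz
  rw [hmul] at hz
  exact hinj (hz.trans (map_zero _).symm)

lemma isNoetherianRing_tensor [FiniteDimensional k k'] (A : Type u) [CommRing A] [Algebra k A]
    [IsNoetherianRing A] : IsNoetherianRing (k' ⊗[k] A) := by
  have : IsNoetherianRing (A ⊗[k] k') := IsNoetherianRing.of_finite A _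
  exact isNoetherianRing_of_ringEquiv _ (Algebra.TensorProduct.comm k A k').toRingEquiv

lemma isIntegral_includeRight [FiniteDimensional k k'] (A : Type u) [CommRing A] [Algebra k A] :
    (Algebra.TensorProduct.includeRight : A →ₐ[k] k' ⊗[k] A).toRingHom.IsIntegral := by
  have h1 : (algebraMap A (A ⊗[k] k')).IsIntegral :=
    algebraMap_isIntegral_iff.mpr inferInstance
  have h2 : ((Algebra.TensorProduct.comm k A k').toRingEquiv : A ⊗[k] k' →+* k' ⊗[k] A).IsIntegral :=
    RingHom.isIntegral_of_surjective _ (Algebra.TensorProduct.comm k A k').surjective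
  exact fun a => RingHom.IsIntegral.trans _ _ h1 h2 a

section

/-- The residue field of `O` is `k` itself, so `k' ⊗ O` modulo `s` is `k'`. Nonvanishing of the
coefficients and separability of `h_i` persist under field extension. -/
lemma IsChartDatum.baseChange [IsDomain O] (H : IsChartDatum m s (ρ : O →+* k) c) :
    IsChartDatum m ((1 : k') ⊗ₜ[k] s) (baseChangeRes k' ρ : k' ⊗[k] O →+* k')
      (fun l => (1 : k') ⊗ₜ[k] c l) where
  rank_pos := H.rank_pos
  surj x := ⟨x ⊗ₜ 1, by simp [baseChangeRes_tmul]⟩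
  ker := by
    refine le_antisymm ?_ ?_
    · have key (z : k' ⊗[k] O) : z - (baseChangeRes k' ρ z) ⊗ₜ[k] (1 : O) ∈
          Ideal.span {(1 : k') ⊗ₜ[k] s} := by
        induction z with
        | zero => simp
        | tmul a x =>
          have hx : x - algebraMap k O (ρ x) ∈ Ideal.span {s} := by
            rw [← H.ker, RingHom.mem_ker]; simp
          obtain ⟨y, hy⟩ := Ideal.mem_span_singleton'.mp hx
          refine Ideal.mem_span_singleton'.mpr ⟨a ⊗ₜ y, ?_⟩
          rw [Algebra.TensorProduct.tmul_mul_tmul, hy, mul_one, baseChangeRes_tmul,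
            TensorProduct.tmul_sub, Algebra.algebraMap_eq_smul_one, TensorProduct.tmul_smul,
            mul_comm a, ← Algebra.smul_def, TensorProduct.smul_tmul']
        | add x y hx hy =>
          rw [map_add, TensorProduct.add_tmul, add_sub_add_comm]
          exact add_mem hx hy
      intro z hz
      have hz' : baseChangeRes k' ρ z = 0 := hz
      simpa [hz'] using key z
    · rw [Ideal.span_singleton_le_iff_mem, RingHom.mem_ker]
      have : ρ s = 0 := H.map_s
      simp [baseChangeRes_tmul, this]
  ne_zero := nonZeroDivisors.ne_zero (one_tmul_mul_injective k' H.ne_zero)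
  coeff l hl := by
    have := H.coeff l hl
    simpa [baseChangeRes_tmul] using this
  sep i hi := by
    obtain ⟨h, h1, h2⟩ := H.sep i hi
    refine ⟨h.map (algebraMap k k'), ?_, h2.map⟩
    have := congrArg (Polynomial.map (algebraMap k k')) h1
    rw [redPoly_map, Polynomial.map_mul, Polynomial.map_pow, map_X] at this
    rw [← this]
    simp [baseChangeRes_tmul]

variable [IsDomain O] [IsLocalRing O] [FiniteDimensional k k']

/-- `k' ⊗ O` is integral over `O`, so each of its maximal ideals lies over that of `O` and contains
`s`, which already generates a maximal ideal. -/
lemma IsChartDatum.isLocalRing_baseChange (H : IsChartDatum m s (ρ : O →+* k) c) :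
    IsLocalRing (k' ⊗[k] O) := by
  have H' := H.baseChange k'
  refine IsLocalRing.of_unique_max_ideal ⟨_, H'.isMaximal, fun I hI => ?_⟩
  have h := Ideal.isMaximal_comap_of_isIntegral_of_isMaximal' _ (isIntegral_includeRight k' O) I
  have h1 : s ∈ I.comap (Algebra.TensorProduct.includeRight : O →ₐ[k] k' ⊗[k] O).toRingHom := by
    rw [IsLocalRing.eq_maximalIdeal h, H.maximalIdeal_eq]
    exact Ideal.mem_span_singleton_self s
  exact (H'.isMaximal.eq_of_le hI.ne_top ((Ideal.span_singleton_le_iff_mem _).mpr h1)).symm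

variable [IsNoetherianRing O]

lemma IsChartDatum.isDomain_baseChange (H : IsChartDatum m s (ρ : O →+* k) c) :
    IsDomain (k' ⊗[k] O) := by
  have := H.isLocalRing_baseChange k'
  have := isNoetherianRing_tensor k' O (k := k)
  exact isDomain_of_maximalIdeal_eq_span (H.baseChange k').maximalIdeal_eq
    (one_tmul_mul_injective k' H.ne_zero)

lemma IsChartDatum.isDiscreteValuationRing_baseChange (H : IsChartDatum m s (ρ : O →+* k) c)
    [IsDomain (k' ⊗[k] O)] : IsDiscreteValuationRing (k' ⊗[k] O) := by
  have := H.isLocalRing_baseChange k'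
  have := isNoetherianRing_tensor k' O (k := k)
  exact isDiscreteValuationRing_of_maximalIdeal_eq_span (H.baseChange k').maximalIdeal_eq
    (H.baseChange k').ne_zero

end

variable (k) in
/-- The ring homomorphism `a ↦ 1 ⊗ a`. -/
def tensorIncl (A : Type u) [CommRing A] [Algebra k A] : A →+* k' ⊗[k] A :=
  (Algebra.TensorProduct.includeRight : A →ₐ[k] k' ⊗[k] A)

variable (m s c)

/-- Charts commute with base change. -/
lemma exists_chartRing_baseChange_equiv (i : ℕ) {s' : k' ⊗[k] O} {c' : ℕ → k' ⊗[k] O}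
    (hs' : s' = 1 ⊗ₜ s) (hc' : ∀ l, c' l = 1 ⊗ₜ c l) :
    ∃ e : k' ⊗[k] ChartRing m s c i ≃+* ChartRing m s' c' i,
      e (1 ⊗ₜ chartLam m s c i) = chartLam m s' c' i ∧
      e (1 ⊗ₜ chartU m s c i) = chartU m s' c' i := by
  let A := ChartRing m s c i
  let A' := ChartRing m s' c' i
  let ιO : O →ₐ[k] k' ⊗[k] O := Algebra.TensorProduct.includeRight
  let f0 : A →+* A' := chartLift m ((algebraMap (k' ⊗[k] O) A').comp ιO.toRingHom)
    (chartLam m s' c' i) (chartU m s' c' i)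
    (by
      refine Eq.trans ?_ (chartRing_rel m s' c' i)
      exact congrArg (algebraMap (k' ⊗[k] O) A') hs'.symm)
    (by
      have h := chartRing_eq m s' c' i
      simp only [hc'] at h
      exact h)
  have hf0 (x : O) : f0 (algebraMap O A x) = algebraMap (k' ⊗[k] O) A' (1 ⊗ₜ x) :=
    chartLift_algebraMap ..
  let f1 : A →ₐ[k] A' := { f0 with
    commutes' := fun x => by
      change f0 (algebraMap k A x) = _
      rw [IsScalarTower.algebraMap_apply k O A, hf0,
        IsScalarTower.algebraMap_apply k (k' ⊗[k] O) A']
      congr 1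
      exact ιO.commutes x }
  let F : k' ⊗[k] A →ₐ[k'] A' := Algebra.TensorProduct.lift (Algebra.ofId k' A') f1
    fun _ _ => Commute.all _ _
  have hF (a : k') (x : A) : F (a ⊗ₜ x) = algebraMap k' A' a * f0 x := by
    simp [F, Algebra.ofId_apply, f1]
  let g0 : k' ⊗[k] O →ₐ[k'] k' ⊗[k] A :=
    Algebra.TensorProduct.map (AlgHom.id k' k') (IsScalarTower.toAlgHom k O A)
  have hg0 (a : k') (x : O) : g0 (a ⊗ₜ x) = a ⊗ₜ algebraMap O A x := by simp [g0]
  let ιA : A →+* k' ⊗[k] A := tensorIncl k k' A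
  have hιA (x : A) : ιA x = 1 ⊗ₜ x := rfl
  let G : A' →+* k' ⊗[k] A := chartLift m g0.toRingHom (ιA (chartLam m s c i))
    (ιA (chartU m s c i))
    (by
      have h := congrArg ιA (chartRing_rel m s c i)
      rw [RingHom.map_mul, RingHom.map_pow] at h
      rw [← h, hs']; exact hg0 1 s)
    (by
      have h := chartRing_map_eq m s c (i := i) (B := k' ⊗[k] A) ιA
      refine Eq.trans ?_ h
      congr 1
      funext l
      rw [hc']
      exact hg0 1 (c l))
  have hGF : ∀ z, G (F z) = z := by
    intro z
    induction z with
    | zero => simp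
    | add x y hx hy => rw [map_add, map_add, hx, hy]
    | tmul a x =>
      have h1 : G (algebraMap k' A' a) = a ⊗ₜ 1 := by
        rw [IsScalarTower.algebraMap_apply k' (k' ⊗[k] O) A']
        refine (chartLift_algebraMap ..).trans ?_
        exact (hg0 a 1).trans (by rw [map_one])
      have h2 : G.comp f0 = ιA := by
        refine chartRing_hom_ext (B := k' ⊗[k] A) (fun x => ?_) ?_ ?_
        · rw [RingHom.comp_apply, hf0]
          exact (chartLift_algebraMap ..).trans (hg0 1 x)
        · rw [RingHom.comp_apply, show f0 (chartLam m s c i) = chartLam m s' c' i from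
            chartLift_lam ..]
          exact chartLift_lam ..
        · rw [RingHom.comp_apply, show f0 (chartU m s c i) = chartU m s' c' i from
            chartLift_u ..]
          exact chartLift_u ..
      have h3 : G (f0 x) = 1 ⊗ₜ x := congr($h2 x)
      rw [hF, map_mul, h1, h3, Algebra.TensorProduct.tmul_mul_tmul, mul_one, one_mul]
  have hFG : F.toRingHom.comp G = RingHom.id _ := by
    refine chartRing_hom_ext (fun x => ?_) ?_ ?_
    · have h1 : G (algebraMap _ A' x) = g0 x := chartLift_algebraMap ..
      rw [RingHom.comp_apply, h1]
      change F (g0 x) = algebraMap _ A' x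
      induction x with
      | zero => simp
      | add x y hx hy =>
        rw [map_add, map_add, map_add, hx (chartLift_algebraMap ..), hy (chartLift_algebraMap ..)]
      | tmul a x =>
        rw [hg0, hF, hf0, IsScalarTower.algebraMap_apply k' (k' ⊗[k] O) A', ← map_mul]
        congr 1
        simp
    · have h1 : G (chartLam m s' c' i) = 1 ⊗ₜ chartLam m s c i := chartLift_lam ..
      rw [RingHom.comp_apply, h1]
      refine (hF _ _).trans ?_
      rw [map_one, one_mul]; exact chartLift_lam ..
    · have h1 : G (chartU m s' c' i) = 1 ⊗ₜ chartU m s c i := chartLift_u ..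
      rw [RingHom.comp_apply, h1]
      refine (hF _ _).trans ?_
      rw [map_one, one_mul]; exact chartLift_u ..
  refine ⟨RingEquiv.ofRingHom F.toRingHom G hFG (RingHom.ext hGF), ?_, ?_⟩
  · refine (hF _ _).trans ?_
    rw [map_one, one_mul]; exact chartLift_lam ..
  · refine (hF _ _).trans ?_
    rw [map_one, one_mul]; exact chartLift_u ..

variable {m s c}

/-- The base change of a local ring `A_p` is regular if the local rings of `k' ⊗ A` at primes lying
under `p` are. -/
lemma isRegularRing_tensor_atPrime {A : Type u} [CommRing A] [Algebra k A] [IsNoetherianRing A]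
    [FiniteDimensional k k'] (p : Ideal A) [p.IsPrime]
    (h : ∀ (P : Ideal (k' ⊗[k] A)) [P.IsPrime], (∀ a, (1 : k') ⊗ₜ[k] a ∈ P → a ∈ p) →
      IsRegularLocalRing (Localization.AtPrime P)) :
    IsRegularRing (k' ⊗[k] Localization.AtPrime p) := by
  let Ap := Localization.AtPrime p
  have : IsNoetherianRing Ap := IsLocalization.isNoetherianRing p.primeCompl _ inferInstance
  have := isNoetherianRing_tensor k' Ap (k := k)
  rw [isRegularRing_iff]
  intro P _
  let : Algebra (k' ⊗[k] A) (k' ⊗[k] Ap) :=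
    (Algebra.TensorProduct.map (AlgHom.id k k') (IsScalarTower.toAlgHom k A Ap)).toAlgebra
  have hmap (a : k') (x : A) :
      algebraMap (k' ⊗[k] A) (k' ⊗[k] Ap) (a ⊗ₜ x) = a ⊗ₜ algebraMap A Ap x := by
    simp [RingHom.algebraMap_toAlgebra]
  have : IsScalarTower k' (k' ⊗[k] A) (k' ⊗[k] Ap) :=
    .of_algebraMap_eq <| by intro; simp [RingHom.algebraMap_toAlgebra]
  have hloc := IsLocalization.tensorProduct_tensorProduct_right k k' p.primeCompl Ap
    (by ext; simp [RingHom.algebraMap_toAlgebra])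
  let Q := P.comap (algebraMap (k' ⊗[k] A) (k' ⊗[k] Ap))
  have hloc2 : IsLocalization.AtPrime (Localization.AtPrime P) Q :=
    IsLocalization.isLocalization_isLocalization_atPrime_isLocalization
      (p.primeCompl.map (Algebra.TensorProduct.includeRight (R := k) (A := k'))) _ P
  have hreg : IsRegularLocalRing (Localization.AtPrime Q) := by
    refine h Q fun a ha => ?_
    by_contra hap
    have hu : IsUnit (algebraMap A Ap a) := IsLocalization.map_units Ap (⟨a, hap⟩ : p.primeCompl)
    have hu' := hu.map (Algebra.TensorProduct.includeRight : Ap →ₐ[k] k' ⊗[k] Ap)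
    have ha' : (1 : k') ⊗ₜ[k] algebraMap A Ap a ∈ P := by rw [← hmap]; exact ha
    exact (Ideal.IsPrime.ne_top inferInstance : P ≠ ⊤) (Ideal.eq_top_of_isUnit_mem _ ha' hu')
  exact IsRegularLocalRing.of_ringEquiv
    (IsLocalization.algEquiv Q.primeCompl (Localization.AtPrime Q)
      (Localization.AtPrime P)).toRingEquiv

lemma isRegularLocalRing_atPrime_of_ringEquiv {A B : Type*} [CommRing A] [CommRing B] (e : A ≃+* B)
    (P : Ideal A) [P.IsPrime]
    (h : IsRegularLocalRing (Localization.AtPrime (P.comap (e.symm : B →+* A)))) :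
    IsRegularLocalRing (Localization.AtPrime P) := by
  refine IsRegularLocalRing.of_ringEquiv (R := Localization.AtPrime (P.comap (e.symm : B →+* A)))
    (IsLocalization.ringEquivOfRingEquiv (M := (P.comap (e.symm : B →+* A)).primeCompl)
      (T := P.primeCompl) _ _ e.symm ?_)
  ext x
  constructor
  · rintro ⟨y, hy, rfl⟩; exact hy
  · intro hx
    exact ⟨e x, by simpa [Ideal.primeCompl] using hx, by simp⟩

/-- Geometric regularity is regularity of the same kind of chart over `k' ⊗ O`, which again carries
a chart datum. A prime of the base change at the origin lies under `p` only if `p` is the origin. -/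
lemma IsChartDatum.isSmoothAt [IsDomain O] [IsLocalRing O] [IsNoetherianRing O]
    (H : IsChartDatum m s (ρ : O →+* k) c) {i : ℕ} (hi : i ≤ m.length)
    (p : Ideal (ChartRing m s c i)) [p.IsPrime]
    (hp : p = Ideal.span {chartLam m s c i, chartU m s c i} → sortedPart m (i + 1) ≤ 1) :
    IsSmoothAt k (ChartRing m s c i) p := by
  intro k' _ _ _
  refine isRegularRing_tensor_atPrime k' p fun P _ hP => ?_
  obtain ⟨e, e1, e2⟩ := exists_chartRing_baseChange_equiv m s c k' i
    (s' := (1 : k') ⊗ₜ[k] s) (c' := fun l => (1 : k') ⊗ₜ[k] c l) rfl fun _ => rfl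
  refine isRegularLocalRing_atPrime_of_ringEquiv e P ?_
  have := H.isDomain_baseChange k' (k := k)
  have := H.isDiscreteValuationRing_baseChange k'
  refine (H.baseChange k').isRegularLocalRing_atPrime hi _ fun h => hp ?_
  refine H.eq_span_of_mem p (hP _ ?_) (hP _ ?_)
  · have := h.ge (Ideal.subset_span (Set.mem_insert _ _))
    rw [← e1, Ideal.mem_comap] at this
    simpa using this
  · have := h.ge (Ideal.subset_span (Set.mem_insert_of_mem _ rfl))
    rw [← e2, Ideal.mem_comap] at this
    simpa using this

end BaseChange

end

end ParabolicSpectral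


namespace ParabolicSpectral

noncomputable section

/-! ### Non-smoothness at the origin when `n_{i+1} ≥ 2` -/

section NonSmooth

open Polynomial TrivSqZeroExt

/-- `G` and `G'` are two tangent vectors at the closed point, dual to `x` and `y`. They are linearly
independent, which a one-dimensional cotangent space does not allow. -/
lemma not_isPrincipal_maximalIdeal_of_dualNumber {R K : Type*} [CommRing R] [IsLocalRing R] [Field K]
    (G G' : R →+* DualNumber K) (hfst : ∀ z, fst (G z) = fst (G' z))
    (hsurj : Function.Surjective fun z => fst (G z)) {x y : R} (hx : G x = DualNumber.eps)
    (hx' : G' x = 0) (hy : G y = 0) (hy' : G' y = DualNumber.eps) :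
    ¬ (IsLocalRing.maximalIdeal R).IsPrincipal := by
  rintro ⟨π, hπ⟩
  let F : R →+* K := (fstHom K K K).toRingHom.comp G
  have hF (z : R) : F z = fst (G z) := rfl
  have hmax : ∀ z, z ∈ IsLocalRing.maximalIdeal R ↔ F z = 0 := by
    intro z
    have : (RingHom.ker F).IsMaximal := RingHom.ker_isMaximal_of_surjective F hsurj
    rw [← IsLocalRing.eq_maximalIdeal this, RingHom.mem_ker]
  have hspan (z : R) (hz : F z = 0) : ∃ w, z = w * π := by
    rw [← hmax, hπ, Submodule.mem_span_singleton] at hz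
    obtain ⟨w, hw⟩ := hz
    exact ⟨w, hw.symm⟩
  have hπ0 : F π = 0 := by
    rw [← hmax, hπ]; exact Submodule.mem_span_singleton_self π
  obtain ⟨α, hα⟩ := hspan x (by rw [hF, hx]; simp)
  obtain ⟨β, hβ⟩ := hspan y (by rw [hF, hy]; simp)
  rw [hF] at hπ0
  have hπ0' : fst (G' π) = 0 := by rw [← hfst]; exact hπ0
  have h1 := congrArg snd hx
  have h2 := congrArg snd hy
  have h4 := congrArg snd hx'
  have h3 := congrArg snd hy'
  rw [hα, map_mul, snd_mul] at h1 h4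
  rw [hβ, map_mul, snd_mul] at h2 h3
  simp [hπ0, hπ0', ← hfst] at h1 h2 h3 h4
  -- With `x = α π` and `y = β π`, the `ε`-part of `G' x = 0` kills the residue of `α` or the
  -- `ε`-part of `G' π`. The first contradicts `G x = ε`, the second `G' y = ε`.
  rcases h4 with h4 | h4
  · rw [h4] at h1; simp at h1
  · rw [h4] at h3; simp at h3

variable {r : ℕ} {m : Composition r}

section

variable {O : Type u} [CommRing O] {κ : Type*} [Field κ] {s : O} {ρ : O →+* κ} {c : ℕ → O}

lemma IsChartDatum.isMaximal_of_lam_mem [IsLocalRing O] (H : IsChartDatum m s ρ c) {i : ℕ}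
    (hi : i ≤ m.length) (q : Ideal (ChartRing m s c i)) [q.IsPrime] (hq : chartLam m s c i ∈ q) :
    q.IsMaximal := by
  obtain ⟨Φ, g, h1, h2, h3, -⟩ := H.exists_residueHom_quotient q hi hq
  have hmax : (RingHom.ker Φ).IsMaximal := by
    rw [h2]; exact PrincipalIdealRing.isMaximal_of_irreducible h3
  let e := RingHom.quotientKerEquivOfSurjective h1
  have hf : IsField (κ[X] ⧸ RingHom.ker Φ) := (Ideal.Quotient.maximal_ideal_iff_isField_quotient _).mp hmax
  exact (Ideal.Quotient.maximal_ideal_iff_isField_quotient _).mpr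
    (e.symm.toMulEquiv.isField hf)

/-- Primes containing `λ` are maximal, so `p` is minimal over the principal ideal `(λ)` and Krull's
theorem applies. -/
lemma IsChartDatum.height_le_one [IsLocalRing O] [IsNoetherianRing O] (H : IsChartDatum m s ρ c)
    {i : ℕ} (hi : i ≤ m.length) (p : Ideal (ChartRing m s c i)) [p.IsPrime]
    (hp : chartLam m s c i ∈ p) : p.height ≤ 1 := by
  refine Ideal.height_le_one_of_isPrincipal_of_mem_minimalPrimes
    (Ideal.span {chartLam m s c i}) p ⟨⟨inferInstance, ?_⟩, ?_⟩
  · rwa [Ideal.span_singleton_le_iff_mem]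
  · rintro q ⟨hq, hq'⟩ hqp
    rw [Ideal.span_singleton_le_iff_mem] at hq'
    have := H.isMaximal_of_lam_mem hi q hq'
    exact (this.eq_of_le (Ideal.IsPrime.ne_top inferInstance) hqp).ge

end

lemma isPrincipal_maximalIdeal_of_ringKrullDim_le_one {R : Type*} [CommRing R]
    [IsRegularLocalRing R] (h : ringKrullDim R ≤ 1) : (IsLocalRing.maximalIdeal R).IsPrincipal := by
  rw [← IsRegularLocalRing.spanFinrank_maximalIdeal] at h
  have h' : (IsLocalRing.maximalIdeal R).spanFinrank ≤ 1 := by exact_mod_cast h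
  rcases Nat.le_one_iff_eq_zero_or_eq_one.mp h' with h' | h'
  · rw [(Submodule.spanFinrank_eq_zero_iff_eq_bot (IsNoetherian.noetherian _)).mp h']
    infer_instance
  · exact ((Submodule.spanFinrank_eq_one_iff _).mp h').1

variable {k : Type u} [Field k]

/-- The first order expansion `f(0) + d f'(0) ε` of a power series. -/
def firstOrder (d : k) : k⟦X⟧ →+* DualNumber k where
  toFun f := inl (PowerSeries.coeff 0 f) + inr (d * PowerSeries.coeff 1 f)
  map_one' := by
    ext <;> simp [PowerSeries.coeff_one]
  map_zero' := by simp
  map_add' f g := by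
    ext <;> simp [mul_add]
  map_mul' f g := by
    ext
    · simp
    · simp [PowerSeries.coeff_mul, Finset.Nat.antidiagonal_succ]
      ring

/-- By `exponent_succ`, the order in `(λ, u)` of the `l`-th term is at least `n_{i+1} ≥ 2`, and `N_i
≥ n_{i+1}`. So the equation imposes no condition on tangent vectors at the origin. -/
lemma evalEq_dualNumber_eq_zero {i : ℕ} (hn : 2 ≤ sortedPart m (i + 1))
    (c : ℕ → DualNumber k) (a b : k) :
    evalEq m c i (a • DualNumber.eps) (b • DualNumber.eps) = 0 := by
  have hi : i < m.length := by
    by_contra h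
    rw [sortedPart_succ_of_le m (not_lt.mp h)] at hn
    omega
  have h2 (n : ℕ) (hn : 2 ≤ n) (e : k) : (e • DualNumber.eps : DualNumber k) ^ n = 0 := by
    obtain ⟨j, rfl⟩ := Nat.exists_eq_add_of_le hn
    rw [pow_add, pow_two, smul_mul_smul_comm, DualNumber.eps_mul_eps, smul_zero, zero_mul]
  rw [evalEq, h2, zero_add]
  · refine Finset.sum_eq_zero fun l hl => ?_
    have h := exponent_succ m hi (Finset.mem_Icc.mp hl).2
    have hpos := level_pos m hl
    have h3 : 2 ≤ i * level m l + tailSum m i - l + level m l := by omega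
    rw [mul_assoc]
    generalize i * level m l + tailSum m i - l = e at h3
    rcases Nat.lt_or_ge 1 (level m l) with h4 | h4
    · rw [h2 _ h4, zero_mul, mul_zero]
    · rcases Nat.lt_or_ge 1 e with h5 | h5
      · rw [h2 _ h5, mul_zero, mul_zero]
      · rw [show level m l = 1 by omega, show e = 1 by omega, pow_one, pow_one,
          smul_mul_smul_comm, DualNumber.eps_mul_eps, smul_zero, mul_zero]
  · have := tailSum_succ m hi
    omega

/-- The image of `t` is forced by `t = λ^i u`: it is `b ε` for `i = 0`, and `0` for `i ≥ 1` as a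
multiple of `ε²`. -/
lemma exists_tangentHom (c : ℕ → k⟦X⟧) {i : ℕ} (hn : 2 ≤ sortedPart m (i + 1)) (a b : k) :
    ∃ g : ChartRing m PowerSeries.X c i →+* DualNumber k,
      g (chartLam m _ c i) = a • DualNumber.eps ∧ g (chartU m _ c i) = b • DualNumber.eps ∧
      ∀ f, fst (g (algebraMap k⟦X⟧ _ f)) = PowerSeries.constantCoeff f := by
  have h1 : firstOrder (if i = 0 then b else 0) PowerSeries.X =
      (a • DualNumber.eps : DualNumber k) ^ i * (b • DualNumber.eps) := by
    rcases i with _ | i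
    · ext <;> simp [firstOrder]
    · rw [pow_succ, mul_assoc, smul_mul_smul_comm, DualNumber.eps_mul_eps, smul_zero, mul_zero]
      ext <;> simp [firstOrder]
  refine ⟨chartLift m (firstOrder (if i = 0 then b else 0)) (a • DualNumber.eps)
    (b • DualNumber.eps) h1 (evalEq_dualNumber_eq_zero hn _ a b), chartLift_lam .., chartLift_u ..,
    fun f => ?_⟩
  rw [chartLift_algebraMap]
  generalize (if i = 0 then b else 0) = d
  change fst ((inl (PowerSeries.coeff 0 f) : DualNumber k) + inr (d * PowerSeries.coeff 1 f)) = _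
  simp

/-- Already the trivial extension `k' = k` fails: a regular local ring of dimension at most one has
principal maximal ideal, while the directions `λ` and `u` are independent tangent vectors. -/
lemma IsChartDatum.not_isSmoothAt {c : ℕ → k⟦X⟧}
    (H : IsChartDatum m (PowerSeries.X : k⟦X⟧) (PowerSeries.constantCoeff (R := k)) c) {i : ℕ}
    (hn : 2 ≤ sortedPart m (i + 1)) (p : Ideal (ChartRing m PowerSeries.X c i)) [p.IsPrime]
    (hp : p = Ideal.span {chartLam m _ c i, chartU m _ c i}) :
    ¬ IsSmoothAt k (ChartRing m PowerSeries.X c i) p := by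
  intro hsm
  have hi : i ≤ m.length := by
    by_contra h
    rw [sortedPart_succ_of_le m (not_le.mp h).le] at hn
    omega
  let R := Localization.AtPrime p
  have h1 : IsRegularRing (k ⊗[k] R) := hsm k
  have h2 : IsRegularRing R := IsRegularRing.of_ringEquiv (Algebra.TensorProduct.lid k R).toRingEquiv
  have h3 : IsRegularLocalRing R := IsRegularLocalRing.of_isRegularRing_of_isLocalRing R
  have hlam : chartLam m _ c i ∈ p := hp ▸ Ideal.subset_span (Set.mem_insert _ _)
  have hdim : ringKrullDim R ≤ 1 := by
    rw [IsLocalization.AtPrime.ringKrullDim_eq_height p R]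
    exact_mod_cast H.height_le_one hi p hlam
  obtain ⟨g, hg1, hg2, hg3⟩ := exists_tangentHom c hn 1 0
  obtain ⟨g', hg1', hg2', hg3'⟩ := exists_tangentHom c hn 0 1
  let F : DualNumber k →+* k := (fstHom k k k).toRingHom
  have hF (z) : F z = fst z := rfl
  have hker : ∀ g'' : ChartRing m PowerSeries.X c i →+* DualNumber k, fst (g'' (chartLam m _ c i)) = 0 →
      fst (g'' (chartU m _ c i)) = 0 → ∀ y : p.primeCompl, IsUnit (g'' y) := by
    intro g'' hl hu y
    rw [TrivSqZeroExt.isUnit_iff_isUnit_fst, isUnit_iff_ne_zero]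
    have hprime : (RingHom.ker (F.comp g'')).IsPrime := RingHom.ker_isPrime _
    have h := H.eq_span_of_mem (RingHom.ker (F.comp g'')) hl hu
    rw [← hp] at h
    intro h0
    exact y.2 (h ▸ h0)
  have hun := hker g (by rw [hg1]; simp) (by rw [hg2]; simp)
  have hun' := hker g' (by rw [hg1']; simp) (by rw [hg2']; simp)
  let G : R →+* DualNumber k := IsLocalization.lift hun
  let G' : R →+* DualNumber k := IsLocalization.lift hun'
  have hG (z) : G (algebraMap _ R z) = g z := IsLocalization.lift_eq ..
  have hG' (z) : G' (algebraMap _ R z) = g' z := IsLocalization.lift_eq ..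
  have heq : F.comp G = F.comp G' := by
    refine IsLocalization.ringHom_ext p.primeCompl ?_
    refine chartRing_hom_ext (fun f => ?_) ?_ ?_
    · simp only [RingHom.comp_apply, hG, hG', hF, hg3, hg3']
    · simp only [RingHom.comp_apply, hG, hG', hF, hg1, hg1']; simp
    · simp only [RingHom.comp_apply, hG, hG', hF, hg2, hg2']; simp
  have hfst (z : R) : fst (G z) = fst (G' z) := by
    rw [← hF, ← hF]; exact RingHom.congr_fun heq z
  refine not_isPrincipal_maximalIdeal_of_dualNumber G G' hfst (fun z => ?_)
    (x := algebraMap _ R (chartLam m PowerSeries.X c i))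
    (y := algebraMap _ R (chartU m PowerSeries.X c i)) ?_ ?_ ?_ ?_
    (isPrincipal_maximalIdeal_of_ringKrullDim_le_one hdim)
  · refine ⟨algebraMap _ R (algebraMap k⟦X⟧ (ChartRing m PowerSeries.X c i) (PowerSeries.C z)), ?_⟩
    simp only [hG, hg3]; simp
  · rw [hG, hg1, one_smul]
  · rw [hG', hg1', zero_smul]
  · rw [hG, hg2, zero_smul]
  · rw [hG', hg2', one_smul]

lemma IsChartDatum.not_isSmoothAt_iff {c : ℕ → k⟦X⟧}
    (H : IsChartDatum m (PowerSeries.X : k⟦X⟧) (PowerSeries.constantCoeff (R := k)) c) {i : ℕ}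
    (hi : i ≤ m.length) (p : Ideal (ChartRing m PowerSeries.X c i)) [p.IsPrime] :
    ¬ IsSmoothAt k (ChartRing m PowerSeries.X c i) p ↔
      p = Ideal.span {chartLam m _ c i, chartU m _ c i} ∧ 2 ≤ sortedPart m (i + 1) := by
  constructor
  · contrapose!
    intro h
    let ρ : k⟦X⟧ →ₐ[k] k := { PowerSeries.constantCoeff (R := k) with
      commutes' := fun x => by simp }
    have H' : IsChartDatum m (PowerSeries.X : k⟦X⟧) (ρ : k⟦X⟧ →+* k) c := H
    exact H'.isSmoothAt hi p fun hp => Nat.lt_succ_iff.mp (h hp)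
  · rintro ⟨hp, hn⟩
    exact H.not_isSmoothAt hn p hp

/-- By unfolding, `BlowupRing m c i` is the chart ring over `k⟦X⟧` with `s = X`, so results on
charts transfer without an isomorphism. -/
lemma IsGeneric.not_isSmoothAt_iff {c : ℕ → k⟦X⟧} (hgen : IsGeneric m c) (hr : 0 < r) {i : ℕ}
    (hi : i ≤ m.length) (p : Ideal (BlowupRing m c i)) [hp : p.IsPrime] :
    ¬ IsSmoothAt k (BlowupRing m c i) p ↔
      p = Ideal.span {lam m c i, uvar m c i} ∧ 2 ≤ sortedPart m (i + 1) :=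
  @IsChartDatum.not_isSmoothAt_iff _ _ _ _ _ (hgen.isChartDatum hr) _ hi p hp

lemma IsGeneric.isBlowupStep {c : ℕ → k⟦X⟧} (hgen : IsGeneric m c) (hr : 0 < r) {i : ℕ}
    (hi : i < m.length) : IsBlowupStep k⟦X⟧ (lam m c i) (uvar m c i) (lam m c (i + 1))
      (uvar m c (i + 1)) :=
  (hgen.isChartDatum hr).isBlowupStep _ _ hi

end NonSmooth

end

end ParabolicSpectral


namespace ParabolicSpectral

noncomputable section

/-! ### The `0`-th chart as a finite free algebra, and its completion -/

section Completion

open Polynomial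

/-- In the `0`-th chart `u = s`, and modulo `u` the equation is `λ^r = 0`. -/
lemma chartLam_pow_mem {r : ℕ} (m : Composition r) {O : Type u} [CommRing O] (s : O) (c : ℕ → O) :
    chartLam m s c 0 ^ r ∈ Ideal.span {algebraMap O (ChartRing m s c 0) s} := by
  have h := chartRing_map_eq m s c
    (B := ChartRing m s c 0 ⧸ Ideal.span {chartU m s c 0}) (Ideal.Quotient.mk _)
  rw [Ideal.Quotient.eq_zero_iff_mem.mpr (Ideal.mem_span_singleton_self _), evalEq_zero_right,
    ← map_pow, Ideal.Quotient.eq_zero_iff_mem, tailSum_zero] at h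
  rwa [chartRing_rel_zero]

/-- A finite algebra over a complete ring is complete. -/
lemma isPrecomplete_of_finite {O A : Type*} [CommRing O] [CommRing A] [Algebra O A]
    [Module.Finite O A] (s : O) [IsPrecomplete (Ideal.span {s}) O] (I : Ideal A)
    (hs : algebraMap O A s ∈ I) {N : ℕ} (hN : 1 ≤ N) (hI : I ^ N ≤ Ideal.span {algebraMap O A s}) :
    IsPrecomplete I A := by
  refine ⟨fun f hf => ?_⟩
  replace hf {a b : ℕ} (hab : a ≤ b) : f a - f b ∈ I ^ a := by
    have := hf hab
    rwa [SModEq.sub_mem, smul_eq_mul, Ideal.mul_top] at this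
  obtain ⟨d, π, hπ⟩ := Module.Finite.exists_fin' O A
  -- Along multiples of `N` the differences are divisible by `s^n`. Lifted along `O^d → A`, they
  -- form a series that converges coordinatewise.
  have hstep (n : ℕ) : ∃ q : Fin d → O, f (N * (n + 1)) - f (N * n) =
      algebraMap O A s ^ n * π q := by
    have h1 := hf (Nat.mul_le_mul_left N (Nat.le_succ n))
    rw [pow_mul] at h1
    have h2 := Ideal.pow_right_mono hI n h1
    rw [Ideal.span_singleton_pow, Ideal.mem_span_singleton] at h2
    obtain ⟨y, hy⟩ := h2
    obtain ⟨q, hq⟩ := hπ (-y)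
    exact ⟨q, by rw [hq, mul_neg, ← hy]; ring⟩
  choose q hq using hstep
  let S (n : ℕ) : Fin d → O := ∑ i ∈ Finset.range n, s ^ i • q i
  have hS (n : ℕ) : f (N * n) = f 0 + π (S n) := by
    induction n with
    | zero => simp [S]
    | succ n ih =>
      have : S (n + 1) = S n + s ^ n • q n := Finset.sum_range_succ _ _
      rw [this, map_add, ← add_assoc, ← ih, map_smul, Algebra.smul_def, map_pow, ← hq]
      ring
  have hlim (j : Fin d) : ∃ L : O, ∀ n, S n j - L ∈ Ideal.span {s ^ n} := by
    obtain ⟨L, hL⟩ := IsPrecomplete.prec (I := Ideal.span {s}) (M := O) inferInstance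
      (f := fun n => S n j) (by
        intro a b hab
        rw [SModEq.sub_mem, smul_eq_mul, Ideal.mul_top, Ideal.span_singleton_pow,
          ← neg_mem_iff, neg_sub]
        have : S b j - S a j = ∑ i ∈ Finset.Ico a b, s ^ i * q i j := by
          rw [Finset.sum_Ico_eq_sub _ hab]; simp [S]
        rw [this]
        refine sum_mem fun i hi => Ideal.mul_mem_right _ _ (Ideal.mem_span_singleton.mpr ?_)
        exact pow_dvd_pow _ (Finset.mem_Ico.mp hi).1)
    refine ⟨L, fun n => ?_⟩
    have := hL n
    rwa [SModEq.sub_mem, smul_eq_mul, Ideal.mul_top, Ideal.span_singleton_pow] at this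
  choose L hL using hlim
  refine ⟨f 0 + π L, fun n => ?_⟩
  rw [SModEq.sub_mem, smul_eq_mul, Ideal.mul_top]
  have h1 : f n - f (N * n) ∈ I ^ n := hf (Nat.le_mul_of_pos_left n hN)
  have h2 : f (N * n) - (f 0 + π L) ∈ I ^ n := by
    rw [hS, add_sub_add_left_eq_sub, ← map_sub]
    have : ∃ z : Fin d → O, S n - L = s ^ n • z := by
      choose z hz using fun j => Ideal.mem_span_singleton.mp (hL j n)
      exact ⟨z, funext hz⟩
    obtain ⟨z, hz⟩ := this
    rw [hz, map_smul, Algebra.smul_def, map_pow]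
    exact Ideal.mul_mem_right _ _ (Ideal.pow_mem_pow hs n)
  have := add_mem h1 h2
  rwa [sub_add_sub_cancel] at this

lemma span_pair_unit_mul {A : Type*} [CommRing A] {v w : A} (hv : IsUnit v) (hw : IsUnit w)
    (x y : A) : Ideal.span {v * x, w * y} = Ideal.span {x, y} := by
  rw [Ideal.span_insert, Ideal.span_insert, Ideal.span_singleton_mul_left_unit hv,
    Ideal.span_singleton_mul_left_unit hw]

lemma span_pair_pow_succ_le {A : Type*} [CommRing A] {x y : A} {n : ℕ}
    (h : x ^ n ∈ Ideal.span {y}) : Ideal.span {x, y} ^ (n + 1) ≤ Ideal.span {y} := by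
  rw [Ideal.span_insert]
  refine Ideal.sup_pow_add_le_pow_sup_pow.trans (sup_le ?_ ?_)
  · rwa [Ideal.span_singleton_pow, Ideal.span_singleton_le_iff_mem]
  · rw [pow_one]

variable {r : ℕ} {m : Composition r} {O : Type u} [CommRing O] {κ : Type*} [Field κ] {s : O}
  {ρ : O →+* κ} {c : ℕ → O}

lemma aeval_spectralPoly_lam : aeval (chartLam m s c 0) (spectralPoly m s c) = 0 := by
  rw [aeval_def, eval₂_spectralPoly]
  have h := chartRing_eq m s c 0
  rw [← chartRing_rel_zero] at h
  exact h

/-- Since `u = s`, the `0`-th chart is generated by `λ`, a root of the monic `spectralPoly`;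
division with remainder bounds the degree. -/
lemma exists_aeval_lam_eq [Nontrivial O] (a : ChartRing m s c 0) :
    ∃ p : O[X], p.degree < r ∧ aeval (chartLam m s c 0) p = a := by
  have h : ∃ p : O[X], aeval (chartLam m s c 0) p = a := by
    refine chartRing_induction m s c (P := fun a => ∃ p : O[X], aeval (chartLam m s c 0) p = a) a
      (fun x => ⟨C x, by simp⟩) ?_ ?_ ?_
    · rintro _ _ ⟨p, rfl⟩ ⟨q, rfl⟩; exact ⟨p + q, by simp⟩
    · rintro _ ⟨p, rfl⟩; exact ⟨p * X, by simp⟩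
    · rintro _ ⟨p, rfl⟩
      exact ⟨p * C s, by rw [map_mul, aeval_C, chartRing_rel_zero]⟩
  obtain ⟨p, rfl⟩ := h
  refine ⟨p %ₘ spectralPoly m s c, ?_, ?_⟩
  · refine (degree_modByMonic_lt _ monic_spectralPoly).trans_eq ?_
    rw [degree_eq_natDegree monic_spectralPoly.ne_zero, natDegree_spectralPoly]
  · have h := congrArg (aeval (chartLam m s c 0)) (modByMonic_add_div p (spectralPoly m s c))
    rwa [map_add, map_mul, aeval_spectralPoly_lam, zero_mul, add_zero] at h

/-- The chart maps to `AdjoinRoot (spectralPoly m s c)`, where powers of the root below `r` are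
independent. -/
lemma eq_zero_of_aeval_lam_eq_zero [Nontrivial O] {p : O[X]} (hp : p.degree < r)
    (h : aeval (chartLam m s c 0) p = 0) : p = 0 := by
  let P := spectralPoly m s c
  have h1 : AdjoinRoot.of P s = AdjoinRoot.root P ^ 0 * AdjoinRoot.of P s := by
    rw [pow_zero, one_mul]
  have h2 : evalEq m (fun l => AdjoinRoot.of P (c l)) 0 (AdjoinRoot.root P) (AdjoinRoot.of P s) =
      0 := by
    rw [← eval₂_spectralPoly]; exact AdjoinRoot.eval₂_root P
  let g : ChartRing m s c 0 →+* AdjoinRoot P :=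
    chartLift m (AdjoinRoot.of P) (AdjoinRoot.root P) (AdjoinRoot.of P s) h1 h2
  have h3 := congrArg g h
  rw [map_zero, aeval_def, hom_eval₂] at h3
  have e1 : g.comp (algebraMap O _) = AdjoinRoot.of P := RingHom.ext fun x => chartLift_algebraMap _ _ _ h1 h2 x
  have e2 : g (chartLam m s c 0) = AdjoinRoot.root P := chartLift_lam ..
  have h4 : p.eval₂ (AdjoinRoot.of P) (AdjoinRoot.root P) = 0 := by rw [← h3, e1, e2]
  have h5 : p.eval₂ (AdjoinRoot.of P) (AdjoinRoot.root P) = AdjoinRoot.mk P p :=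
    AdjoinRoot.aeval_eq p
  rw [h5, AdjoinRoot.mk_eq_zero] at h4
  by_contra hne
  refine monic_spectralPoly.not_dvd_of_degree_lt hne ?_ h4
  rwa [degree_eq_natDegree monic_spectralPoly.ne_zero, natDegree_spectralPoly]

instance chartRing_zero_finite : Module.Finite O (ChartRing m s c 0) := by
  nontriviality O
  refine Module.Finite.of_surjective (M := AdjoinRoot (spectralPoly m s c))
    (hM := (AdjoinRoot.powerBasis' monic_spectralPoly).finite)
    (AdjoinRoot.liftAlgHom (spectralPoly m s c) (Algebra.ofId O _) (chartLam m s c 0)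
      aeval_spectralPoly_lam).toLinearMap fun a => ?_
  obtain ⟨p, -, rfl⟩ := exists_aeval_lam_eq a
  refine ⟨AdjoinRoot.mk _ p, ?_⟩
  rfl

lemma IsChartDatum.nontrivial_chartRing_zero [Nontrivial O] (H : IsChartDatum m s ρ c) :
    Nontrivial (ChartRing m s c 0) := by
  by_contra h
  rw [not_nontrivial_iff_subsingleton] at h
  have h0 : aeval (chartLam m s c 0) (1 : O[X]) = 0 := Subsingleton.elim _ _
  refine one_ne_zero (eq_zero_of_aeval_lam_eq_zero (m := m) ?_ h0)
  rw [degree_one]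
  exact_mod_cast H.rank_pos

section

variable [IsLocalRing O]

/-- By finiteness over `O`, a maximal ideal contains `s = u`, and then `λ` because `λ^r ∈ (u)`. -/
lemma IsChartDatum.eq_span_of_isMaximal (H : IsChartDatum m s ρ c)
    (I : Ideal (ChartRing m s c 0)) [I.IsMaximal] :
    I = Ideal.span {chartLam m s c 0, chartU m s c 0} := by
  have : Algebra.IsIntegral O (ChartRing m s c 0) := Algebra.IsIntegral.of_finite O _
  have h := Ideal.isMaximal_comap_of_isIntegral_of_isMaximal (R := O) I
  have h1 : s ∈ I.comap (algebraMap O _) := by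
    rw [IsLocalRing.eq_maximalIdeal h, H.maximalIdeal_eq]
    exact Ideal.mem_span_singleton_self s
  rw [Ideal.mem_comap, chartRing_rel_zero] at h1
  refine H.eq_span_of_mem I ?_ h1
  have h2 := chartRing_map_eq m s c (B := ChartRing m s c 0 ⧸ I) (Ideal.Quotient.mk I)
  rw [Ideal.Quotient.eq_zero_iff_mem.mpr h1, evalEq_zero_right, ← map_pow,
    Ideal.Quotient.eq_zero_iff_mem] at h2
  exact Ideal.IsPrime.mem_of_pow_mem inferInstance _ h2

lemma IsChartDatum.isLocalRing_chartRing_zero (H : IsChartDatum m s ρ c) :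
    IsLocalRing (ChartRing m s c 0) := by
  have := H.nontrivial_chartRing_zero
  obtain ⟨I, hI⟩ := Ideal.exists_maximal (ChartRing m s c 0)
  refine IsLocalRing.of_unique_max_ideal ⟨I, hI, fun J hJ => ?_⟩
  rw [H.eq_span_of_isMaximal I, H.eq_span_of_isMaximal J]

lemma IsChartDatum.maximalIdeal_chartRing_zero (H : IsChartDatum m s ρ c)
    [IsLocalRing (ChartRing m s c 0)] : IsLocalRing.maximalIdeal (ChartRing m s c 0) =
      Ideal.span {chartLam m s c 0, chartU m s c 0} :=
  H.eq_span_of_isMaximal _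

lemma IsChartDatum.isAdicComplete_chartRing_zero [IsNoetherianRing O] (H : IsChartDatum m s ρ c)
    [IsPrecomplete (Ideal.span {s}) O] :
    IsAdicComplete (Ideal.span {chartLam m s c 0, chartU m s c 0}) (ChartRing m s c 0) := by
  have := H.isLocalRing_chartRing_zero
  rw [← H.maximalIdeal_chartRing_zero]
  have hu : chartU m s c 0 ∈ IsLocalRing.maximalIdeal (ChartRing m s c 0) := by
    rw [H.maximalIdeal_chartRing_zero]; exact Ideal.subset_span (Set.mem_insert_of_mem _ rfl)
  have : IsPrecomplete (IsLocalRing.maximalIdeal (ChartRing m s c 0)) (ChartRing m s c 0) := by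
    refine isPrecomplete_of_finite (O := O) s _ (by rwa [chartRing_rel_zero]) (N := r + 1)
      (by omega) ?_
    have hl := chartLam_pow_mem m s c
    rw [H.maximalIdeal_chartRing_zero]
    rw [chartRing_rel_zero] at hl ⊢
    exact span_pair_pow_succ_le hl
  exact { }

end

/-- Comparison of `O[λ]/(λ^r + ⋯)` with its completion. -/
lemma IsChartDatum.exists_isCompletionMap [IsLocalRing O] (H : IsChartDatum m s ρ c)
    [IsLocalRing (ChartRing m s c 0)]
    {O' : Type u} [CommRing O'] [IsLocalRing O'] [IsNoetherianRing O'] {κ' : Type*} [Field κ']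
    {s' : O'} {ρ' : O' →+* κ'} {c' : ℕ → O'} [IsPrecomplete (Ideal.span {s'}) O']
    (H' : IsChartDatum m s' ρ' c') (f : O →+* O') {v w : O'} (hv : IsUnit v) (hw : IsUnit w)
    (hs : f s = s' * v)
    (hc : ∀ l ∈ Finset.Icc 1 r, f (c l) * v ^ level m l * w ^ l = c' l)
    (hdense : ∀ (N : ℕ) (y : O'), ∃ x, y - f x ∈ Ideal.span {s' ^ N})
    (hinj : ∀ (N : ℕ) (x : O), f x ∈ Ideal.span {s' ^ N} → x ∈ Ideal.span {s ^ N}) :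
    ∃ ψ : ChartRing m s c 0 →+* ChartRing m s' c' 0,
      (∀ x, ψ (algebraMap O _ x) = algebraMap O' _ (f x)) ∧ IsCompletionMap ψ := by
  set A := ChartRing m s c 0
  set A' := ChartRing m s' c' 0
  let ι : O' →+* A' := algebraMap O' A'
  have hι : ∀ x, ι x = algebraMap O' A' x := fun _ => rfl
  obtain ⟨w', hw'⟩ := hw.exists_right_inv
  have hs'u : ι s' = chartU m s' c' 0 := chartRing_rel_zero m s' c'
  -- With `s = s' v` and `c'_l = c_l v^{γ_l} w^l`, the root over `O` is the root over `O'` divided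
  -- by the unit `w`.
  have h2 : evalEq m (fun l => (ι.comp f) (c l)) 0 (ι w' * chartLam m s' c' 0) (ι (f s)) = 0 := by
    have h3 := chartRing_eq m s' c' 0
    rw [← hs'u] at h3
    have h4 : evalEq m (fun l => (ι.comp f) (c l)) 0 (ι w' * chartLam m s' c' 0) (ι (f s)) =
        ι w' ^ r * evalEq m (fun l => ι (c' l)) 0 (chartLam m s' c' 0) (ι s') := by
      rw [evalEq, evalEq, tailSum_zero, mul_add, mul_pow, Finset.mul_sum]
      congr 1
      refine Finset.sum_congr rfl fun l hl => ?_
      have hlr := (Finset.mem_Icc.mp hl).2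
      rw [zero_mul, zero_add, ← hc l hl, hs, map_mul, map_mul, map_mul, map_pow, map_pow,
        RingHom.comp_apply, mul_pow, mul_pow]
      have e : ι w' ^ r * ι w ^ l = ι w' ^ (r - l) := by
        have e1 : ι w * ι w' = 1 := by rw [← map_mul, hw', map_one]
        calc ι w' ^ r * ι w ^ l = ι w' ^ (r - l + l) * ι w ^ l := by rw [Nat.sub_add_cancel hlr]
          _ = ι w' ^ (r - l) * (ι w * ι w') ^ l := by rw [pow_add, mul_pow]; ring
          _ = _ := by rw [e1, one_pow, mul_one]
      rw [← e]
      ring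
    rw [h4, h3, mul_zero]
  let ψ : A →+* A' := chartLift m (ι.comp f) (ι w' * chartLam m s' c' 0) (ι (f s))
    (by simp) h2
  have hψC (x : O) : ψ (algebraMap O A x) = ι (f x) := chartLift_algebraMap _ _ _ _ h2 x
  have hψl : ψ (chartLam m s c 0) = ι w' * chartLam m s' c' 0 := chartLift_lam ..
  have hψu : ψ (chartU m s c 0) = ι (f s) := chartLift_u ..
  refine ⟨ψ, hψC, ?_⟩
  set M := IsLocalRing.maximalIdeal A
  have hM : M = Ideal.span {chartLam m s c 0, chartU m s c 0} := H.maximalIdeal_chartRing_zero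
  have hw'u : IsUnit w' := IsUnit.of_mul_eq_one w (by rw [mul_comm]; exact hw')
  have hmap : M.map ψ = Ideal.span {chartLam m s' c' 0, chartU m s' c' 0} := by
    rw [hM, Ideal.map_span, Set.image_pair, hψl, hψu, hs, map_mul, hs'u, mul_comm (chartU m s' c' 0)]
    exact span_pair_unit_mul (hw'u.map ι) (hv.map ι) _ _
  have hs'M : ι s' ∈ M.map ψ := by
    rw [hmap, hs'u]; exact Ideal.subset_span (Set.mem_insert_of_mem _ rfl)
  -- Density of the image modulo powers of `s'`, checked on generators; `λ'` is approximated by `x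
  -- λ` with `x ∈ O` close to `w`.
  have happrox (N : ℕ) (y : A') : ∃ x : A, y - ψ x ∈ Ideal.span {ι s' ^ N} := by
    have hO (z : O') : ∃ x : O, ι z - ψ (algebraMap O A x) ∈ Ideal.span {ι s' ^ N} := by
      obtain ⟨x, hx⟩ := hdense N z
      refine ⟨x, ?_⟩
      rw [hψC, ← map_sub]
      have := Ideal.mem_map_of_mem ι hx
      rwa [Ideal.map_span, Set.image_singleton, map_pow] at this
    obtain ⟨xw, hxw⟩ := hO w
    have hlam : chartLam m s' c' 0 - ψ (algebraMap O A xw * chartLam m s c 0) ∈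
        Ideal.span {ι s' ^ N} := by
      have e : chartLam m s' c' 0 - ψ (algebraMap O A xw * chartLam m s c 0) =
          (ι w - ψ (algebraMap O A xw)) * (ι w' * chartLam m s' c' 0) := by
        have e1 : ι w * ι w' = 1 := by rw [← map_mul, hw', map_one]
        rw [map_mul, hψl, sub_mul, ← mul_assoc (ι w), e1, one_mul]
      rw [e]
      exact Ideal.mul_mem_right _ _ hxw
    have hmul {y z : A'} {a b : A} (hy : y - ψ a ∈ Ideal.span {ι s' ^ N})
        (hz : z - ψ b ∈ Ideal.span {ι s' ^ N}) : y * z - ψ (a * b) ∈ Ideal.span {ι s' ^ N} := by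
      have e : y * z - ψ (a * b) = (y - ψ a) * z + ψ a * (z - ψ b) := by rw [map_mul]; ring
      rw [e]
      exact add_mem (Ideal.mul_mem_right _ _ hy) (Ideal.mul_mem_left _ _ hz)
    refine chartRing_induction m s' c'
      (P := fun y => ∃ x : A, y - ψ x ∈ Ideal.span {ι s' ^ N}) y ?_ ?_ ?_ ?_
    · intro z
      obtain ⟨x, hx⟩ := hO z
      exact ⟨_, hx⟩
    · rintro y z ⟨a, ha⟩ ⟨b, hb⟩
      refine ⟨a + b, ?_⟩
      rw [map_add, add_sub_add_comm]
      exact add_mem ha hb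
    · rintro y ⟨a, ha⟩
      exact ⟨_, hmul ha hlam⟩
    · rintro y ⟨a, ha⟩
      obtain ⟨x, hx⟩ := hO s'
      refine ⟨a * algebraMap O A x, ?_⟩
      have := hmul ha hx
      nth_rewrite 2 [hs'u] at this
      exact this
  have hpow (N : ℕ) : Ideal.span {ι s' ^ N} ≤ M.map ψ ^ N := by
    rw [Ideal.span_singleton_le_iff_mem]; exact Ideal.pow_mem_pow hs'M N
  -- Compare coefficients in the power bases of `λ` and `λ'`: each coefficient of `x` becomes
  -- divisible by `s'^N`, hence is divisible by `s^N`.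
  have hpull (N : ℕ) (x : A) (hx : ψ x ∈ Ideal.span {ι s' ^ N}) : x ∈ M ^ N := by
    obtain ⟨p, hp, rfl⟩ := exists_aeval_lam_eq x
    obtain ⟨y, hy⟩ := Ideal.mem_span_singleton.mp hx
    obtain ⟨q, hq, rfl⟩ := exists_aeval_lam_eq y
    let P : O'[X] := (p.map f).comp (C w' * X)
    have hP : P.degree < r := by
      refine lt_of_le_of_lt ?_ hp
      rw [degree_le_iff_coeff_zero]
      intro n hn
      rw [comp_C_mul_X_coeff, coeff_map, coeff_eq_zero_of_degree_lt hn, map_zero, zero_mul]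
    have hψP : ψ (aeval (chartLam m s c 0) p) = aeval (chartLam m s' c' 0) P := by
      have e : ψ.comp (algebraMap O A) = ι.comp f := RingHom.ext hψC
      rw [aeval_def, hom_eval₂, e, hψl, aeval_def, eval₂_comp, eval₂_map, eval₂_mul, eval₂_C,
        eval₂_X]
    have hdeg : (C (s' ^ N) * q).degree < r := by
      refine lt_of_le_of_lt ?_ hq
      rw [degree_le_iff_coeff_zero]
      intro n hn
      rw [coeff_C_mul, coeff_eq_zero_of_degree_lt hn, mul_zero]
    have h0 : P - C (s' ^ N) * q = 0 := by
      refine eq_zero_of_aeval_lam_eq_zero (m := m) (s := s') (c := c')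
        ((degree_sub_le _ _).trans_lt (max_lt hP hdeg)) ?_
      rw [map_sub, ← hψP, hy, map_mul, aeval_C, map_pow, hι, sub_self]
    have hcoeff (n : ℕ) : p.coeff n ∈ Ideal.span {s ^ N} := by
      refine hinj N _ ?_
      have h1 := congrArg (fun t : O'[X] => t.coeff n) (sub_eq_zero.mp h0)
      simp only [P, comp_C_mul_X_coeff, coeff_map, coeff_C_mul] at h1
      rw [← Ideal.mul_unit_mem_iff_mem _ (hw'u.pow n), h1]
      exact Ideal.mul_mem_right _ _ (Ideal.mem_span_singleton_self _)
    have hsM : algebraMap O A s ^ N ∈ M ^ N := by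
      refine Ideal.pow_mem_pow ?_ N
      rw [chartRing_rel_zero, hM]; exact Ideal.subset_span (Set.mem_insert_of_mem _ rfl)
    rw [aeval_eq_sum_range]
    refine sum_mem fun n _ => ?_
    obtain ⟨z, hz⟩ := Ideal.mem_span_singleton.mp (hcoeff n)
    rw [hz, Algebra.smul_def, map_mul, map_pow]
    exact Ideal.mul_mem_right _ _ (Ideal.mul_mem_right _ _ hsM)
  refine ⟨?_, ?_, ?_⟩
  · rw [hmap]; exact H'.isAdicComplete_chartRing_zero
  · intro n y
    obtain ⟨x, hx⟩ := happrox n y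
    exact ⟨x, hpow n hx⟩
  · intro n x hx
    rw [← Ideal.map_pow] at hx
    -- By density, the ideal generated by `ψ(M^n)` agrees with `ψ(M^n)` up to multiples of `s'^n`.
    have : ∃ y ∈ M ^ n, ψ x - ψ y ∈ Ideal.span {ι s' ^ n} := by
      refine Submodule.span_induction (p := fun t _ => ∃ y ∈ M ^ n, t - ψ y ∈ Ideal.span {ι s' ^ n})
        ?_ ?_ ?_ ?_ hx
      · rintro _ ⟨y, hy, rfl⟩; exact ⟨y, hy, by rw [sub_self]; exact zero_mem _⟩
      · exact ⟨0, zero_mem _, by rw [map_zero, sub_zero]; exact zero_mem _⟩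
      · rintro a b - - ⟨y, hy, h1⟩ ⟨z, hz, h2⟩
        refine ⟨y + z, add_mem hy hz, ?_⟩
        rw [map_add, add_sub_add_comm]
        exact add_mem h1 h2
      · rintro a t - ⟨y, hy, h1⟩
        obtain ⟨b, hb⟩ := happrox n a
        refine ⟨b * y, Ideal.mul_mem_left _ _ hy, ?_⟩
        have e : a • t - ψ (b * y) = a * (t - ψ y) + (a - ψ b) * ψ y := by
          rw [map_mul, smul_eq_mul]; ring
        rw [e]
        exact add_mem (Ideal.mul_mem_left _ _ h1) (Ideal.mul_mem_right _ _ hb)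
    obtain ⟨y, hy, h⟩ := this
    rw [← map_sub] at h
    have := add_mem (hpull n _ h) hy
    rwa [sub_add_cancel] at this

lemma IsCompletionMap.comp_ringEquiv {R R' S : Type u} [CommRing R] [IsLocalRing R] [CommRing R']
    [IsLocalRing R'] [CommRing S] {ψ : R →+* S} (h : IsCompletionMap ψ) (e : R' ≃+* R) :
    IsCompletionMap (ψ.comp (e : R' →+* R)) := by
  have hmax : (IsLocalRing.maximalIdeal R').map (e : R' →+* R) = IsLocalRing.maximalIdeal R :=
    IsLocalRing.eq_maximalIdeal (Ideal.map_isMaximal_of_equiv e)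
  have hmap : (IsLocalRing.maximalIdeal R').map (ψ.comp (e : R' →+* R)) =
      (IsLocalRing.maximalIdeal R).map ψ := by
    rw [← Ideal.map_map, hmax]
  obtain ⟨h1, h2, h3⟩ := h
  refine ⟨by rwa [hmap], fun n y => ?_, fun n x hx => ?_⟩
  · obtain ⟨x, hx⟩ := h2 n y
    exact ⟨e.symm x, by rw [hmap]; simpa using hx⟩
  · rw [hmap] at hx
    have h4 := h3 n (e x) hx
    rw [← hmax, ← Ideal.map_pow] at h4
    obtain ⟨y, hy, hyx⟩ := (Ideal.mem_map_iff_of_surjective _ e.surjective).mp h4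
    rwa [← e.injective hyx]

end Completion

end

end ParabolicSpectral


namespace ParabolicSpectral

noncomputable section

/-! ### Places of the plane curve over the closed point of `O` -/

section Places

open Polynomial

variable {r : ℕ} {m : Composition r} {O : Type u} [CommRing O] {κ : Type*} [Field κ] {s : O}
  {ρ : O →+* κ} {c : ℕ → O}

/-- The local ring `B` over `O`, with the elements `θ` and `u = s/θ^i`, is centred on the `i`-th
chart at the point of the exceptional divisor `λ = 0` where `u` is a root of `g`. -/
structure IsPlace (m : Composition r) (s : O) (ρ : O →+* κ) (c : ℕ → O) {B : Type*} [CommRing B]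
    [IsLocalRing B] (f : O →+* B) (θ u : B) (i : ℕ) (g : κ[X]) : Prop where
  mem_Icc : i ∈ Finset.Icc 1 m.length
  isUnit : IsUnit u
  mem : θ ∈ IsLocalRing.maximalIdeal B
  rel : f s = θ ^ i * u
  eq : evalEq m (fun l => f (c l)) i θ u = 0
  monic : g.Monic
  irreducible : Irreducible g
  res : ∀ p : O[X], p.eval₂ f u ∈ IsLocalRing.maximalIdeal B ↔ g ∣ p.map ρ

namespace IsPlace

variable {B : Type*} [CommRing B] [IsLocalRing B] {f : O →+* B} {θ u : B} {i : ℕ} {g : κ[X]}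
  (P : IsPlace m s ρ c f θ u i g)

include P

lemma not_dvd_X : ¬ g ∣ X := by
  intro h
  rw [← map_X ρ, ← P.res, eval₂_X] at h
  exact h P.isUnit

lemma dvd_redPoly : g ∣ redPoly m (fun l => ρ (c l)) i := by
  rw [← IsChartDatum.map_evalLamZero_chartEq, ← P.res]
  let π : B →+* B ⧸ IsLocalRing.maximalIdeal B := Ideal.Quotient.mk _
  have h0 : π θ = 0 := Ideal.Quotient.eq_zero_iff_mem.mpr P.mem
  have h1 := congrArg π P.eq
  rw [map_evalEq, h0, map_zero] at h1
  have h2 := map_evalEq m ((π.comp (eval₂RingHom f u)).comp (evalLamZero O))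
    (fun l => MvPolynomial.C (c l)) i (MvPolynomial.X 0) (MvPolynomial.X 1)
  rw [← Ideal.Quotient.eq_zero_iff_mem]
  refine Eq.trans h2 (Eq.trans ?_ h1)
  simp

/-- The homomorphism from the chart. -/
def chartHom : ChartRing m s c i →+* B := chartLift m f θ u P.rel P.eq

@[simp] lemma chartHom_algebraMap (x : O) : P.chartHom (algebraMap O _ x) = f x :=
  chartLift_algebraMap ..

@[simp] lemma chartHom_lam : P.chartHom (chartLam m s c i) = θ := chartLift_lam ..

@[simp] lemma chartHom_u : P.chartHom (chartU m s c i) = u := chartLift_u ..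

lemma chartHom_aeval (p : O[X]) : P.chartHom (aeval (chartU m s c i) p) = p.eval₂ f u := by
  have e : P.chartHom.comp (algebraMap O _) = f := RingHom.ext P.chartHom_algebraMap
  rw [aeval_def, hom_eval₂, e, chartHom_u]

lemma chartHom_mem_iff {a : ChartRing m s c i} {p : O[X]}
    (hp : a - aeval (chartU m s c i) p ∈ Ideal.span {chartLam m s c i}) :
    P.chartHom a ∈ IsLocalRing.maximalIdeal B ↔ g ∣ p.map ρ := by
  rw [← P.res, ← P.chartHom_aeval]
  have h : P.chartHom a - P.chartHom (aeval (chartU m s c i) p) ∈ IsLocalRing.maximalIdeal B := by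
    obtain ⟨y, hy⟩ := Ideal.mem_span_singleton'.mp hp
    rw [← map_sub, ← hy, map_mul, chartHom_lam]
    exact Ideal.mul_mem_left _ _ P.mem
  constructor
  · intro h1
    have := sub_mem h1 h
    rwa [sub_sub_cancel] at this
  · intro h1
    have := add_mem h h1
    rwa [sub_add_cancel] at this

omit P in
/-- Compatible places have the same data. -/
lemma eq_of_isLocalHom [IsDomain B] {B' : Type*} [CommRing B'] [IsDomain B'] [IsLocalRing B']
    {f' : O →+* B'} {θ' u' : B'} {i' : ℕ} {g' : κ[X]} (H : IsChartDatum m s ρ c)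
    (P : IsPlace m s ρ c f θ u i g) (P' : IsPlace m s ρ c f' θ' u' i' g') (η : B →+* B')
    [IsLocalHom η] (hf : ∀ x, η (f x) = f' x) (hθ : η θ = θ') (hθ0 : θ' ≠ 0) : i = i' ∧ g = g' := by
  have h1 : θ' ^ i * η u = θ' ^ i' * u' := by
    rw [← P'.rel, ← hf, P.rel, map_mul, map_pow, hθ]
  have hu : IsUnit (η u) := P.isUnit.map η
  -- The index `i` is the order of `s` with respect to the nonunit `θ'`; two different orders would
  -- make `θ'` a unit.
  have key {a b : ℕ} {v w : B'} (hv : IsUnit v) (hab : a < b) : θ' ^ a * v ≠ θ' ^ b * w := by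
    intro h
    obtain ⟨d, rfl⟩ := Nat.exists_eq_add_of_lt hab
    have h2 : v = θ' * (θ' ^ d * w) := by
      refine mul_left_cancel₀ (pow_ne_zero a hθ0) (h.trans ?_)
      ring
    exact P'.mem (isUnit_of_mul_isUnit_left (h2 ▸ hv))
  have hi : i = i' := by
    rcases lt_trichotomy i i' with h | h | h
    · exact absurd h1 (key hu h)
    · exact h
    · exact absurd h1.symm (key P'.isUnit h)
  subst hi
  refine ⟨rfl, ?_⟩
  have hu' : η u = u' := mul_left_cancel₀ (pow_ne_zero i hθ0) h1
  have hdvd (p : κ[X]) : g ∣ p ↔ g' ∣ p := by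
    obtain ⟨p, rfl⟩ := map_surjective ρ H.surj p
    rw [← P.res, ← P'.res]
    have e : η.comp f = f' := RingHom.ext hf
    have h3 : η (p.eval₂ f u) = p.eval₂ f' u' := by rw [hom_eval₂, e, hu']
    rw [← h3]
    simp only [IsLocalRing.mem_maximalIdeal, mem_nonunits_iff, isUnit_map_iff]
  exact eq_of_monic_of_associated P.monic P'.monic
    (associated_of_dvd_dvd ((hdvd _).mpr dvd_rfl) ((hdvd _).mp dvd_rfl))

section FractionField

variable {E : Type*} [Field E] {j : ChartRing m s c 0 →+* E} {ι : B →+* E}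
  (hι : Function.Injective ι) (hιf : ∀ x, ι (f x) = j (algebraMap O _ x))
  (hιθ : ι θ = j (chartLam m s c 0))

include hιf hιθ

lemma comp_chartHom_chartMap (hi : i ≤ m.length) :
    (ι.comp P.chartHom).comp (chartMap m s c hi) = j := by
  refine chartRing_hom_ext (fun x => ?_) ?_ ?_
  · simp [hιf]
  · simp [hιθ]
  · rw [← chartRing_rel_zero]; simp [hιf]

omit P in
lemma comp_chartHom_eq (P : IsPlace m s ρ c f θ u i g) (hθ : θ ≠ 0) (hι : Function.Injective ι)
    {B' : Type*} [CommRing B'] [IsLocalRing B']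
    {f' : O →+* B'} {θ' u' : B'} (P' : IsPlace m s ρ c f' θ' u' i g) {ι' : B' →+* E}
    (hιf' : ∀ x, ι' (f' x) = j (algebraMap O _ x))
    (hιθ' : ι' θ' = j (chartLam m s c 0)) (a : ChartRing m s c i) :
    ι (P.chartHom a) = ι' (P'.chartHom a) := by
  have hi := (Finset.mem_Icc.mp P.mem_Icc).2
  obtain ⟨n, b, hb⟩ := exists_pow_mul_eq_chartMap s c hi a
  have h1 := congr($(P.comp_chartHom_chartMap hιf hιθ hi) b)
  have h2 := congr($(P'.comp_chartHom_chartMap hιf' hιθ' hi) b)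
  rw [← h2] at h1
  simp only [RingHom.comp_apply, ← hb, map_mul, map_pow, chartHom_lam, hιθ, hιθ'] at h1
  refine mul_left_cancel₀ (pow_ne_zero n ?_) h1
  rw [← hιθ]
  exact (map_ne_zero_iff ι hι).mpr hθ

variable [IsDomain B] [IsDomain O] [IsLocalRing O] [IsNoetherianRing O]
  (H : IsChartDatum m s ρ c) (hE : ∀ e : E, ∃ a b, j b ≠ 0 ∧ e * j b = j a)

include hι hE H

/-- `B` is the image of the local ring `W` of the chart at its centre. A nonzero element of `B` is a
quotient in `E` of elements of the `0`-th chart, each of which is a unit of `W` times a power of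
`θ`; the resulting exponent cannot be negative because `θ` is not a unit of `B`. -/
lemma exists_mul_chartHom_eq (hθ0 : θ ≠ 0) :
    (∀ b : B, ∃ a t, IsUnit (P.chartHom t) ∧ b * P.chartHom t = P.chartHom a) ∧
      IsLocalRing.maximalIdeal B = Ideal.span {θ} ∧ IsNoetherianRing B := by
  have hi := (Finset.mem_Icc.mp P.mem_Icc).2
  let q := (IsLocalRing.maximalIdeal B).comap P.chartHom
  have hq : chartLam m s c i ∈ q := by
    change P.chartHom (chartLam m s c i) ∈ IsLocalRing.maximalIdeal B
    rw [chartHom_lam]; exact P.mem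
  have hu : chartU m s c i ∉ q := by
    intro h
    change P.chartHom (chartU m s c i) ∈ IsLocalRing.maximalIdeal B at h
    rw [chartHom_u] at h
    exact h P.isUnit
  have hgood : chartU m s c i ∉ q ∨ sortedPart m (i + 1) ≤ 1 := Or.inl hu
  let W := Localization.AtPrime q
  have : IsDomain W := H.isDomain_atPrime q W hi hq hgood
  have hmax := H.maximalIdeal_atPrime q W hi hq hgood
  have : IsNoetherianRing W := IsLocalization.isNoetherianRing q.primeCompl _ inferInstance
  have hun (y : q.primeCompl) : IsUnit (P.chartHom y) := not_not.mp fun h => y.2 h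
  let L : W →+* B := IsLocalization.lift hun
  have hL (a) : L (algebraMap _ W a) = P.chartHom a := IsLocalization.lift_eq ..
  have hLlam : L (algebraMap _ W (chartLam m s c i)) = θ := by rw [hL, chartHom_lam]
  have hfac {x : ChartRing m s c 0} (hx : j x ≠ 0) : ∃ (n : ℕ) (w : W), IsUnit w ∧
      P.chartHom (chartMap m s c hi x) = L w * θ ^ n := by
    have hne : algebraMap _ W (chartMap m s c hi x) ≠ 0 := by
      intro h
      have h1 := congr($(P.comp_chartHom_chartMap hιf hιθ hi) x)
      rw [RingHom.comp_apply, RingHom.comp_apply, ← hL, h, map_zero, map_zero] at h1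
      exact hx h1.symm
    obtain ⟨n, w, hw, h⟩ := exists_eq_mul_pow_of_maximalIdeal_eq_span hmax hne
    exact ⟨n, w, hw, by rw [← hL, h, map_mul, map_pow, hLlam]⟩
  have hsurj : Function.Surjective L := by
    intro b
    rcases eq_or_ne b 0 with rfl | hb
    · exact ⟨0, map_zero _⟩
    obtain ⟨x, y, hy, hxy⟩ := hE (ι b)
    have hx : j x ≠ 0 := by
      rw [← hxy]; exact mul_ne_zero ((map_ne_zero_iff ι hι).mpr hb) hy
    obtain ⟨n, v, hv, ev⟩ := hfac hx
    obtain ⟨k, w, hw, ew⟩ := hfac hy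
    have h1 : b * (L w * θ ^ k) = L v * θ ^ n := by
      apply hι
      rw [map_mul, ← ev, ← ew]
      have h3 (z) : ι (P.chartHom (chartMap m s c hi z)) = j z :=
        congr($(P.comp_chartHom_chartMap hιf hιθ hi) z)
      rw [h3, h3, hxy]
    obtain ⟨w', hw'⟩ := hw.exists_right_inv
    have hw'' : L w * L w' = 1 := by rw [← map_mul, hw', map_one]
    rcases le_or_gt k n with h | h
    · obtain ⟨d, rfl⟩ := Nat.exists_eq_add_of_le h
      refine ⟨v * w' * algebraMap _ W (chartLam m s c i) ^ d, ?_⟩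
      rw [map_mul, map_mul, map_pow, hLlam]
      refine mul_right_cancel₀ (pow_ne_zero k hθ0) ?_
      calc L v * L w' * θ ^ d * θ ^ k = L w' * (L v * θ ^ (k + d)) := by ring
        _ = (L w * L w') * (b * θ ^ k) := by rw [← h1]; ring
        _ = _ := by rw [hw'', one_mul]
    · obtain ⟨d, rfl⟩ := Nat.exists_eq_add_of_lt h
      have h2 : L v = θ * (θ ^ d * b * L w) := by
        refine mul_right_cancel₀ (pow_ne_zero n hθ0) ?_
        rw [← h1]; ring
      exact absurd (isUnit_of_mul_isUnit_left (h2 ▸ hv.map L)) P.mem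
  refine ⟨fun b => ?_, ?_, isNoetherianRing_of_surjective W B L hsurj⟩
  · obtain ⟨w, rfl⟩ := hsurj b
    obtain ⟨a, t, rfl⟩ := IsLocalization.exists_mk'_eq q.primeCompl w
    exact ⟨a, t, hun t, by rw [← hL, ← map_mul, IsLocalization.mk'_spec, hL]⟩
  · refine le_antisymm (fun b hb => ?_) ((Ideal.span_singleton_le_iff_mem _).mpr P.mem)
    obtain ⟨w, rfl⟩ := hsurj b
    have hw : w ∈ IsLocalRing.maximalIdeal W := fun h => hb (h.map L)
    rw [hmax] at hw
    obtain ⟨y, rfl⟩ := Ideal.mem_span_singleton'.mp hw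
    rw [map_mul, hLlam]
    exact Ideal.mul_mem_left _ _ (Ideal.mem_span_singleton_self _)

omit P in
-- Whether a chart element becomes a unit depends only on `g`, so a fraction of chart elements that
-- lies in `B` also lies in `B'`. A place is therefore determined by `(i, g)`.
lemma range_eq (P : IsPlace m s ρ c f θ u i g) (hθ : θ ≠ 0)
    {B' : Type*} [CommRing B'] [IsDomain B'] [IsLocalRing B']
    {f' : O →+* B'} {θ' u' : B'} (P' : IsPlace m s ρ c f' θ' u' i g) {ι' : B' →+* E}
    (hιf' : ∀ x, ι' (f' x) = j (algebraMap O _ x))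
    (hιθ' : ι' θ' = j (chartLam m s c 0)) : ι.range ≤ ι'.range := by
  rintro _ ⟨b, rfl⟩
  obtain ⟨a, t, ht, hb⟩ := (P.exists_mul_chartHom_eq hι hιf hιθ H hE hθ).1 b
  have ht' : IsUnit (P'.chartHom t) := by
    obtain ⟨p, hp⟩ := chartRing_exists_sub_mem t
    have h1 := P.chartHom_mem_iff hp
    have h2 := P'.chartHom_mem_iff hp
    rw [← h1] at h2
    exact not_not.mp fun h => h2.mp h ht
  obtain ⟨w, hw⟩ := ht'.exists_right_inv
  refine ⟨P'.chartHom a * w, ?_⟩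
  have e := P.comp_chartHom_eq hιf hιθ hθ hι P' hιf' hιθ'
  rw [map_mul, ← e, ← hb, map_mul, e, mul_assoc, ← map_mul, hw, map_one, mul_one]

end FractionField

end IsPlace

variable [IsDomain O] [IsDiscreteValuationRing O]

/-- The chart is the one found by the valuative blow-up argument, and `g` is the monic generator of
the kernel of `κ[u] → A^{(i)}/q` at the centre `q`. -/
lemma IsChartDatum.exists_isPlace_of_valuationRing (H : IsChartDatum m s ρ c)
    {B : Type*} [CommRing B] [IsDomain B] [ValuationRing B] (f : O →+* B) [IsLocalHom f]
    (hs : f s ≠ 0) {θ : B} (hθ : evalEq m (fun l => f (c l)) 0 θ (f s) = 0) :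
    θ ≠ 0 ∧ ∃ u i g, IsPlace m s ρ c f θ u i g := by
  obtain ⟨h0, hmem, i, hi, u, hu, e1, e2⟩ := H.exists_isUnit_of_valuationRing f hs hθ
  refine ⟨h0, u, i, ?_⟩
  have hi' := (Finset.mem_Icc.mp hi).2
  let G : ChartRing m s c i →+* B := chartLift m f θ u e1 e2
  have hG (p : O[X]) : G (aeval (chartU m s c i) p) = p.eval₂ f u := by
    have e : G.comp (algebraMap O _) = f := RingHom.ext fun x => chartLift_algebraMap _ _ _ e1 e2 x
    rw [aeval_def, hom_eval₂, e, show G (chartU m s c i) = u from chartLift_u ..]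
  let q := (IsLocalRing.maximalIdeal B).comap G
  have hq : chartLam m s c i ∈ q := by
    change G (chartLam m s c i) ∈ IsLocalRing.maximalIdeal B
    rw [show G (chartLam m s c i) = θ from chartLift_lam ..]; exact hmem
  obtain ⟨Φ, g, -, hker, hirr, -, -, hΦ⟩ := H.exists_residueHom_quotient q hi' hq
  have hlc : g.leadingCoeff ≠ 0 := leadingCoeff_ne_zero.mpr hirr.ne_zero
  have hassoc : Associated (g * C g.leadingCoeff⁻¹) g :=
    associated_mul_unit_left _ _ (isUnit_C.mpr (isUnit_iff_ne_zero.mpr (inv_ne_zero hlc)))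
  refine ⟨g * C g.leadingCoeff⁻¹, hi, hu, hmem, e1, e2, monic_mul_leadingCoeff_inv hirr.ne_zero,
    hassoc.irreducible_iff.mpr hirr, fun p => ?_⟩
  rw [hassoc.dvd_iff_dvd_left, ← Ideal.mem_span_singleton, ← hker, RingHom.mem_ker, hΦ,
    Ideal.Quotient.eq_zero_iff_mem, ← hG]
  rfl

/-- Every point of the exceptional divisor of a chart, off the origin, is a place. -/
lemma IsChartDatum.exists_isPlace (H : IsChartDatum m s ρ c) {E : Type*} [Field E]
    {j : ChartRing m s c 0 →+* E} (hj : Function.Injective j)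
    (hE : ∀ e : E, ∃ a b, j b ≠ 0 ∧ e * j b = j a) {i : ℕ} (hi : i ∈ Finset.Icc 1 m.length)
    {g : κ[X]} (hmonic : g.Monic) (hirr : Irreducible g)
    (hdvd : g ∣ redPoly m (fun l => ρ (c l)) i) (hX : ¬ g ∣ X) :
    ∃ (W : Type u) (_ : CommRing W) (_ : IsDomain W) (_ : IsDiscreteValuationRing W)
      (f : O →+* W) (θ u : W) (ι : W →+* E), IsLocalHom f ∧ IsPlace m s ρ c f θ u i g ∧
      Function.Injective ι ∧ (∀ x, ι (f x) = j (algebraMap O _ x)) ∧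
      ι θ = j (chartLam m s c 0) ∧ θ ≠ 0 ∧ ∀ e : E, ∃ a b, ι b ≠ 0 ∧ e * ι b = ι a := by
  have hi1 := (Finset.mem_Icc.mp hi).1
  have hi' := (Finset.mem_Icc.mp hi).2
  have : Fact (Irreducible g) := ⟨hirr⟩
  -- The point is the kernel of the map from the chart to `κ[u]/(g)` with `λ ↦ 0`, which exists
  -- since `g` divides the reduced equation. Its local ring is the required discrete valuation ring.
  let F : O →+* AdjoinRoot g := (AdjoinRoot.of g).comp ρ
  have hFp (p : O[X]) : p.eval₂ F (AdjoinRoot.root g) = AdjoinRoot.mk g (p.map ρ) := by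
    have h5 : (p.map ρ).eval₂ (AdjoinRoot.of g) (AdjoinRoot.root g) = AdjoinRoot.mk g (p.map ρ) :=
      AdjoinRoot.aeval_eq _
    rw [← h5, eval₂_map]
  have e1 : F s = (0 : AdjoinRoot g) ^ i * AdjoinRoot.root g := by
    rw [zero_pow (by omega), zero_mul, RingHom.comp_apply, H.map_s, map_zero]
  have e2 : evalEq m (fun l => F (c l)) i 0 (AdjoinRoot.root g) = 0 := by
    have h1 := map_evalEq m (AdjoinRoot.mk g) (fun l => C (ρ (c l))) i 0 X
    rw [map_zero, AdjoinRoot.mk_X] at h1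
    exact h1.symm.trans (AdjoinRoot.mk_eq_zero.mpr hdvd)
  let G : ChartRing m s c i →+* AdjoinRoot g := chartLift m F 0 (AdjoinRoot.root g) e1 e2
  have hGl : G (chartLam m s c i) = 0 := chartLift_lam ..
  have hGu : G (chartU m s c i) = AdjoinRoot.root g := chartLift_u ..
  have hGp (p : O[X]) : G (aeval (chartU m s c i) p) = AdjoinRoot.mk g (p.map ρ) := by
    have e : G.comp (algebraMap O _) = F := RingHom.ext fun x => chartLift_algebraMap _ _ _ e1 e2 x
    rw [aeval_def, hom_eval₂, e, hGu, hFp]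
  let q := RingHom.ker G
  have hqp : q.IsPrime := RingHom.ker_isPrime G
  have hq : chartLam m s c i ∈ q := hGl
  have hu : chartU m s c i ∉ q := by
    intro h
    have h1 : AdjoinRoot.root g = 0 := hGu.symm.trans h
    rw [← AdjoinRoot.mk_X, AdjoinRoot.mk_eq_zero] at h1
    exact hX h1
  have hgood : chartU m s c i ∉ q ∨ sortedPart m (i + 1) ≤ 1 := Or.inl hu
  let W := Localization.AtPrime q
  have hdom : IsDomain W := H.isDomain_atPrime q W hi' hq hgood
  have hdvr : IsDiscreteValuationRing W := H.isDiscreteValuationRing_atPrime q W hi' hq hgood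
  have hmemW (a) : algebraMap _ W a ∈ IsLocalRing.maximalIdeal W ↔ a ∈ q :=
    IsLocalization.AtPrime.to_map_mem_maximal_iff W q a
  have hl0 : chartLam m s c 0 ≠ 0 := by
    have := H.nontrivial_chartRing_zero
    exact nonZeroDivisors.ne_zero (H.lam_mem_nonZeroDivisors (Nat.zero_le _))
  have hjl : j (chartLam m s c 0) ≠ 0 := (map_ne_zero_iff j hj).mpr hl0
  -- In the field `E` the nonzero element `λ` is invertible, so the embedding extends from the
  -- `0`-th to the `i`-th chart.
  obtain ⟨ji, hji⟩ := exists_lift_of_isUnit s c hi' j (isUnit_iff_ne_zero.mpr hjl)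
  have hji' (a) : ji (chartMap m s c hi' a) = j a := congr($hji a)
  have hjil : ji (chartLam m s c i) = j (chartLam m s c 0) := by rw [← hji', chartMap_lam]
  have hinj : Function.Injective ji := by
    rw [injective_iff_map_eq_zero]
    intro a ha
    obtain ⟨n, b, hb⟩ := exists_pow_mul_eq_chartMap s c hi' a
    have h1 := congrArg ji hb
    rw [map_mul, ha, mul_zero, hji', eq_comm, map_eq_zero_iff j hj] at h1
    rw [h1, map_zero] at hb
    exact (mem_nonZeroDivisors_iff_left.mp
      (pow_mem (H.lam_mem_nonZeroDivisors hi') n)) a hb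
  have hun (y : q.primeCompl) : IsUnit (ji y) := by
    rw [isUnit_iff_ne_zero]
    refine (map_ne_zero_iff ji hinj).mpr fun h => y.2 ?_
    rw [h]; exact zero_mem q
  let ι : W →+* E := IsLocalization.lift hun
  have hι (a) : ι (algebraMap _ W a) = ji a := IsLocalization.lift_eq ..
  have hιinj : Function.Injective ι := by
    rw [injective_iff_map_eq_zero]
    intro w hw
    obtain ⟨a, t, rfl⟩ := IsLocalization.exists_mk'_eq q.primeCompl w
    have h1 := congrArg ι (IsLocalization.mk'_spec W a t)
    rw [map_mul, hw, zero_mul, hι, eq_comm, map_eq_zero_iff ji hinj] at h1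
    rw [h1, IsLocalization.mk'_zero]
  let f : O →+* W := (algebraMap _ W).comp (algebraMap O (ChartRing m s c i))
  have hfs : f s ∈ IsLocalRing.maximalIdeal W := (hmemW _).mpr (H.algebraMap_s_mem q hq)
  have hloc : IsLocalHom f := by
    refine ⟨fun x hx => ?_⟩
    by_contra hx'
    have h1 : x ∈ IsLocalRing.maximalIdeal O := hx'
    rw [H.maximalIdeal_eq] at h1
    obtain ⟨y, rfl⟩ := Ideal.mem_span_singleton'.mp h1
    rw [map_mul] at hx
    exact hfs (isUnit_of_mul_isUnit_right hx)
  have hfu (p : O[X]) : p.eval₂ f (algebraMap _ W (chartU m s c i)) =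
      algebraMap _ W (aeval (chartU m s c i) p) := by
    rw [aeval_def, hom_eval₂]
  refine ⟨W, inferInstance, hdom, hdvr, f, algebraMap _ W (chartLam m s c i),
    algebraMap _ W (chartU m s c i), ι, hloc, ⟨hi, ?_, (hmemW _).mpr hq, ?_, ?_, hmonic, hirr, ?_⟩,
    hιinj, ?_, ?_, ?_, ?_⟩
  · exact not_not.mp fun h => hu ((hmemW _).mp h)
  · rw [← map_pow, ← map_mul, ← chartRing_rel]; rfl
  · exact chartRing_map_eq m s c (B := W) (algebraMap (ChartRing m s c i) W)
  · intro p
    rw [hfu, hmemW, RingHom.mem_ker, hGp, AdjoinRoot.mk_eq_zero]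
  · intro x
    rw [← hji', chartMap_algebraMap]
    exact hι _
  · rw [hι, hjil]
  · intro h
    have := hι (chartLam m s c i)
    rw [h, map_zero, hjil] at this
    exact hjl this.symm
  · intro e
    obtain ⟨a, b, hb, hab⟩ := hE e
    refine ⟨algebraMap _ W (chartMap m s c hi' a), algebraMap _ W (chartMap m s c hi' b), ?_, ?_⟩
    · rw [hι, hji']; exact hb
    · rw [hι, hji', hι, hji', hab]

omit [IsDomain O] [IsDiscreteValuationRing O] in
/-- The number of places, counted with degrees. -/
lemma IsChartDatum.finsum_natDegree (H : IsChartDatum m s ρ c) {i : ℕ}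
    (hi : i ∈ Finset.Icc 1 m.length) :
    {g : κ[X] | g.Monic ∧ Irreducible g ∧ g ∣ redPoly m (fun l => ρ (c l)) i ∧ ¬ g ∣ X}.Finite ∧
    (∀ g ∈ {g : κ[X] | g.Monic ∧ Irreducible g ∧ g ∣ redPoly m (fun l => ρ (c l)) i ∧ ¬ g ∣ X},
      g.Separable) ∧
    ∑ᶠ g ∈ {g : κ[X] | g.Monic ∧ Irreducible g ∧ g ∣ redPoly m (fun l => ρ (c l)) i ∧ ¬ g ∣ X},
      g.natDegree = partMult m i := by
  classical
  obtain ⟨h, hh, hsep⟩ := H.sep i hi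
  obtain ⟨i, rfl⟩ : ∃ i', i = i' + 1 := ⟨i - 1, by have := Finset.mem_Icc.mp hi; omega⟩
  have hi' := (Finset.mem_Icc.mp hi).2
  have hred := redPoly_ne_zero m H.coeff hi'
  have h0 : h ≠ 0 := by
    rintro rfl; rw [mul_zero] at hh; exact hred hh
  have hcoeff : h.coeff 0 ≠ 0 := by
    have := coeff_redPoly_sortedPart m H.coeff hi'
    rw [hh, coeff_X_pow_mul'] at this
    simpa using this
  -- Removing the factor `X` leaves exactly the monic prime factors of `h`. These are distinct by
  -- separability, so their degrees add up to `deg h`.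
  have hset : {g : κ[X] | g.Monic ∧ Irreducible g ∧
      g ∣ redPoly m (fun l => ρ (c l)) (i + 1) ∧ ¬ g ∣ X} =
      ((UniqueFactorizationMonoid.normalizedFactors h).toFinset : Set κ[X]) := by
    ext g
    rw [Finset.mem_coe, Multiset.mem_toFinset,
      UniqueFactorizationMonoid.mem_normalizedFactors_iff' h0]
    constructor
    · rintro ⟨h1, h2, h3, h4⟩
      refine ⟨h2, h1.normalize_eq_self, ?_⟩
      rw [hh] at h3
      rcases h2.prime.dvd_or_dvd h3 with h5 | h5
      · exact absurd (h2.prime.dvd_of_dvd_pow h5) h4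
      · exact h5
    · rintro ⟨h2, h1, h3⟩
      refine ⟨?_, h2, hh ▸ h3.mul_left _, fun h4 => ?_⟩
      · rw [← h1]; exact monic_normalize h2.ne_zero
      · have h5 := (h2.associated_of_dvd irreducible_X h4).symm.dvd.trans h3
        exact hcoeff (X_dvd_iff.mp h5)
  rw [hset]
  refine ⟨Finset.finite_toSet _, fun g hg => ?_, ?_⟩
  · rw [Finset.mem_coe, Multiset.mem_toFinset] at hg
    exact hsep.of_dvd (UniqueFactorizationMonoid.dvd_of_mem_normalizedFactors hg)
  rw [finsum_mem_coe_finset]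
  have hdeg : h.natDegree = partMult m (i + 1) := by
    rw [partMult_succ]
    have h1 := natDegree_redPoly m H.coeff (show i < m.length by omega)
    rw [hh, natDegree_X_pow_mul _ h0] at h1
    exact Nat.eq_sub_of_add_eq h1
  rw [← hdeg]
  have hnodup : (UniqueFactorizationMonoid.normalizedFactors h).Nodup :=
    (UniqueFactorizationMonoid.squarefree_iff_nodup_normalizedFactors h0).mp hsep.squarefree
  have hne : (0 : κ[X]) ∉ UniqueFactorizationMonoid.normalizedFactors h :=
    UniqueFactorizationMonoid.zero_notMem_normalizedFactors h
  have hprod := UniqueFactorizationMonoid.prod_normalizedFactors h0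
  rw [← natDegree_eq_of_degree_eq (degree_eq_degree_of_associated hprod),
    natDegree_multiset_prod _ hne, Finset.sum, Multiset.toFinset_val, hnodup.dedup]

end Places

end

end ParabolicSpectral



namespace ParabolicSpectral

noncomputable section

/-! ### Normal local rings of the function field over `O` -/

section PlaneCurvePlaces

open Polynomial

/-- `B` contains the integral closure of `O` in `E`, which is Dedekind because `E/K` is finite
separable. Hence it contains the localization at its centre, a valuation ring of `E`. -/
lemma valuationRing_of_isIntegrallyClosed {O K E B : Type*} [CommRing O] [IsDedekindDomain O]
    [Field K] [Algebra O K] [IsFractionRing O K] [Field E] [Algebra O E] [Algebra K E]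
    [IsScalarTower O K E] [FiniteDimensional K E] [Algebra.IsSeparable K E] [CommRing B]
    [IsDomain B] [IsLocalRing B] [IsIntegrallyClosed B] [Algebra B E] [IsFractionRing B E]
    (f : O →+* B) (hf : ∀ x, algebraMap B E (f x) = algebraMap O E x) : ValuationRing B := by
  have hinj := IsFractionRing.injective B E
  have hint (x : integralClosure O E) : ∃ y, algebraMap B E y = x := by
    refine IsIntegrallyClosed.isIntegral_iff.mp ?_
    obtain ⟨p, hp, h⟩ := x.2
    refine ⟨p.map f, hp.map f, ?_⟩
    rwa [eval₂_map, show (algebraMap B E).comp f = algebraMap O E from RingHom.ext hf]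
  choose η hη using hint
  let η' : integralClosure O E →+* B :=
    { toFun := η
      map_one' := hinj (by simp [hη])
      map_mul' := fun x y => hinj (by simp [hη])
      map_zero' := hinj (by simp [hη])
      map_add' := fun x y => hinj (by simp [hη]) }
  have hη' (x) : algebraMap B E (η' x) = x := hη x
  have : IsDedekindDomain (integralClosure O E) := integralClosure.isDedekindDomain O K E
  have : IsFractionRing (integralClosure O E) E :=
    integralClosure.isFractionRing_of_finite_extension K E
  let P := (IsLocalRing.maximalIdeal B).comap η'
  have hP : P.IsPrime := inferInstance
  have : ValuationRing (Localization.AtPrime P) := by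
    -- A zero centre is allowed at this stage: the localization is then a field.
    by_cases h0 : P = ⊥
    · have : IsField (Localization.AtPrime P) := by
        have hle : P.primeCompl = nonZeroDivisors (integralClosure O E) := by
          ext x
          simp [h0, Ideal.primeCompl]
        have : IsFractionRing (integralClosure O E) (Localization.AtPrime P) := by
          rw [IsFractionRing, ← hle]; infer_instance
        exact (IsFractionRing.toField (integralClosure O E) (K := Localization.AtPrime P)).toIsField
      let := this.toField
      infer_instance
    · have := IsLocalization.AtPrime.isDiscreteValuationRing_of_dedekind_domain
        (integralClosure O E) h0 (Localization.AtPrime P)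
      infer_instance
  have key (a b : integralClosure O E) : ∃ t w, t ∉ P ∧ (a * w = b * t ∨ b * w = a * t) := by
    have hl := IsLocalization.injective (Localization.AtPrime P) P.primeCompl_le_nonZeroDivisors
    obtain ⟨w, hw⟩ := ValuationRing.cond (algebraMap _ (Localization.AtPrime P) a)
      (algebraMap _ (Localization.AtPrime P) b)
    obtain ⟨⟨w', t⟩, e⟩ := IsLocalization.surj P.primeCompl w
    refine ⟨t, w', t.2, hw.imp ?_ ?_⟩ <;> intro h <;> apply hl <;>
      rw [map_mul, map_mul, ← e, ← h, mul_assoc]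
  refine (ValuationRing.iff_isInteger_or_isInteger B E).mpr fun e => ?_
  obtain ⟨a, b, hb, rfl⟩ := IsFractionRing.div_surjective (A := integralClosure O E) e
  obtain ⟨t, w, ht, h⟩ := key a b
  have hb0 : (b : E) ≠ 0 := by
    simpa using nonZeroDivisors.ne_zero hb
  have ht' : IsUnit (η' t) := by
    by_contra h
    exact ht ((IsLocalRing.mem_maximalIdeal _).mpr h)
  obtain ⟨t', htt⟩ := ht'.exists_right_inv
  have htt : (t : E) * algebraMap B E t' = 1 := by
    rw [← hη', ← map_mul, htt, map_one]
  have ht0 : (t : E) ≠ 0 := left_ne_zero_of_mul_eq_one htt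
  rcases h with h | h <;> have h := congr(algebraMap _ E $h) <;> rw [map_mul, map_mul] at h
  · refine .inr ⟨η' w * t', ?_⟩
    have ha0 : (a : E) ≠ 0 := by
      intro h0
      exact mul_ne_zero hb0 ht0 (h.symm.trans (by simp [h0]))
    change _ = ((a : E) / b)⁻¹
    rw [map_mul, hη', inv_div, eq_div_iff ha0]
    replace h : (a : E) * w = b * t := h
    linear_combination algebraMap B E t' * h + b * htt
  · refine .inl ⟨η' w * t', ?_⟩
    change _ = (a : E) / b
    rw [map_mul, hη', eq_div_iff hb0]
    replace h : (b : E) * w = a * t := h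
    linear_combination algebraMap B E t' * h + a * htt

variable {r : ℕ} {m : Composition r} {O : Type u} [CommRing O] {κ : Type*} [Field κ] {s : O}
  {ρ : O →+* κ} {c : ℕ → O}

/-- For `r > 1` only `l = r - 1` contributes, with `c_{r-1} s^{γ_{r-1}}`. This linear term makes the
derivative nonzero in every characteristic. -/
lemma IsChartDatum.coeff_one_spectralPoly_ne_zero [IsDomain O] (H : IsChartDatum m s ρ c) :
    (spectralPoly m s c).coeff 1 ≠ 0 := by
  have hr := H.rank_pos
  rw [spectralPoly, coeff_add, finsetSum_coeff]
  simp only [coeff_X_pow, coeff_C_mul]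
  by_cases h1 : r = 1
  · subst h1
    rw [if_pos rfl, Finset.sum_eq_zero, add_zero]
    · exact one_ne_zero
    · intro l hl
      rw [Finset.mem_Icc] at hl
      rw [if_neg (by lia), mul_zero]
  · rw [if_neg (by lia), zero_add, Finset.sum_eq_single (r - 1)]
    · rw [if_pos (by lia), mul_one]
      refine mul_ne_zero (fun h => H.coeff (r - 1) (Finset.mem_Icc.mpr (by lia)) ?_)
        (pow_ne_zero _ H.ne_zero)
      rw [h, map_zero]
    · intro l hl hne
      rw [Finset.mem_Icc] at hl
      rw [if_neg (by lia), mul_zero]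
    · intro h
      exact absurd (Finset.mem_Icc.mpr (by lia)) h

lemma algebraMap_chartRing_zero_injective [Nontrivial O] (hr : 0 < r) :
    Function.Injective (algebraMap O (ChartRing m s c 0)) := by
  rw [injective_iff_map_eq_zero]
  intro x hx
  refine C_eq_zero.mp (eq_zero_of_aeval_lam_eq_zero (m := m) (s := s) (c := c) (p := C x) ?_ ?_)
  · exact degree_C_le.trans_lt (by exact_mod_cast hr)
  · rw [aeval_C, hx]

/-- Independence of the powers of `λ` below `r` makes `spectralPoly` the minimal polynomial of `λ`
over `O`, and over `K` since `O` is integrally closed. It is irreducible with nonzero derivative,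
and `λ` generates `E`. -/
lemma IsChartDatum.finite_and_isSeparable [IsDomain O] [IsIntegrallyClosed O]
    (H : IsChartDatum m s ρ c) {K E : Type*} [Field K] [Algebra O K] [IsFractionRing O K] [Field E]
    [Algebra O E] [Algebra K E] [IsScalarTower O K E] {j : ChartRing m s c 0 →+* E}
    (hj : Function.Injective j) (hE : ∀ e, ∃ a b, j b ≠ 0 ∧ e * j b = j a)
    (hjO : ∀ x, algebraMap O E x = j (algebraMap O _ x)) :
    FiniteDimensional K E ∧ Algebra.IsSeparable K E := by
  have haev (p : O[X]) : j (aeval (chartLam m s c 0) p) = aeval (j (chartLam m s c 0)) p := by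
    rw [aeval_def, aeval_def, hom_eval₂]
    congr 1
    exact RingHom.ext fun x => (hjO x).symm
  set θ := j (chartLam m s c 0) with hθ
  have hP0 : aeval θ (spectralPoly m s c) = 0 := by
    rw [← haev, aeval_spectralPoly_lam, map_zero]
  have hmin : spectralPoly m s c = minpoly O θ := by
    refine minpoly.unique' _ _ monic_spectralPoly hP0 fun q hq => ?_
    by_contra! h
    rw [degree_eq_natDegree monic_spectralPoly.ne_zero, natDegree_spectralPoly] at hq
    refine h.1 (eq_zero_of_aeval_lam_eq_zero hq (hj ?_))
    rw [haev, h.2, map_zero]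
  have hintO : IsIntegral O θ := ⟨_, monic_spectralPoly, hP0⟩
  have hint : IsIntegral K θ := hintO.tower_top
  have hinj : Function.Injective (algebraMap O E) := by
    rw [IsScalarTower.algebraMap_eq O K E]
    exact (algebraMap K E).injective.comp (IsFractionRing.injective O K)
  have : Module.IsTorsionFree O E := Module.isTorsionFree_iff_algebraMap_injective.mpr hinj
  have hminK : minpoly K θ = (spectralPoly m s c).map (algebraMap O K) := by
    rw [hmin]
    exact minpoly.isIntegrallyClosed_eq_field_fractions' K hintO
  have hsep : IsSeparable K θ := by
    refine (separable_iff_derivative_ne_zero (minpoly.irreducible hint)).mpr fun h => ?_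
    have h1 := congr(Polynomial.coeff $h 0)
    rw [hminK, derivative_map, coeff_map, coeff_derivative, coeff_zero] at h1
    simp only [zero_add, Nat.cast_zero, mul_one] at h1
    exact H.coeff_one_spectralPoly_ne_zero (IsFractionRing.injective O K (by rw [h1, map_zero]))
  have htop : IntermediateField.adjoin K {θ} = ⊤ := by
    rw [eq_top_iff]
    intro e _
    have hmem (a : ChartRing m s c 0) : j a ∈ IntermediateField.adjoin K {θ} := by
      obtain ⟨p, -, rfl⟩ := exists_aeval_lam_eq a
      rw [haev, ← aeval_map_algebraMap K]
      exact IntermediateField.algebra_adjoin_le_adjoin K _ (aeval_mem_adjoin_singleton K θ)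
    obtain ⟨a, b, hb, h⟩ := hE e
    rw [eq_div_of_mul_eq hb h]
    exact div_mem (hmem a) (hmem b)
  constructor
  · have := IntermediateField.adjoin.finiteDimensional hint
    rw [htop] at this
    exact LinearEquiv.finiteDimensional (IntermediateField.topEquiv (F := K) (E := E)).toLinearEquiv
  · have := (IntermediateField.isSeparable_adjoin_simple_iff_isSeparable K E).mpr hsep
    rw [htop] at this
    exact Algebra.IsSeparable.of_algHom K (⊤ : IntermediateField K E)
      (IntermediateField.topEquiv (F := K) (E := E)).symm.toAlgHom

lemma IsChartDatum.exists_isPlace_of_isIntegrallyClosed [IsDomain O] [IsDiscreteValuationRing O]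
    (H : IsChartDatum m s ρ c) {E : Type*} [Field E] {j : ChartRing m s c 0 →+* E}
    (hj : Function.Injective j) (hE : ∀ e, ∃ a b, j b ≠ 0 ∧ e * j b = j a)
    {B : Type*} [CommRing B] [IsDomain B] [IsLocalRing B] [IsIntegrallyClosed B] [Algebra B E]
    [IsFractionRing B E] (f : O →+* B) [IsLocalHom f]
    (hf : ∀ x, algebraMap B E (f x) = j (algebraMap O _ x)) :
    ∃ θ u i g, algebraMap B E θ = j (chartLam m s c 0) ∧ θ ≠ 0 ∧ IsPlace m s ρ c f θ u i g := by
  have hinjB := IsFractionRing.injective B E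
  let := (j.comp (algebraMap O (ChartRing m s c 0))).toAlgebra
  have hinj : Function.Injective (algebraMap O E) :=
    hj.comp (algebraMap_chartRing_zero_injective H.rank_pos)
  let := (IsFractionRing.lift (K := FractionRing O) hinj).toAlgebra
  have : IsScalarTower O (FractionRing O) E := .of_algebraMap_eq fun x =>
    (IsFractionRing.lift_algebraMap hinj x).symm
  obtain ⟨_, _⟩ := H.finite_and_isSeparable (K := FractionRing O) hj hE fun _ => rfl
  have := valuationRing_of_isIntegrallyClosed (K := FractionRing O) (E := E) f hf
  have heq : evalEq m (fun l => algebraMap B E (f (c l))) 0 (j (chartLam m s c 0))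
      (algebraMap B E (f s)) = 0 := by
    have h := congr(j $(aeval_spectralPoly_lam (m := m) (s := s) (c := c)))
    rw [aeval_def, hom_eval₂, map_zero, eval₂_spectralPoly] at h
    simp only [hf]
    exact h
  obtain ⟨θ, hθ⟩ : ∃ θ, algebraMap B E θ = j (chartLam m s c 0) := by
    refine IsIntegrallyClosed.isIntegral_iff.mp ⟨(spectralPoly m s c).map f,
      monic_spectralPoly.map f, ?_⟩
    rw [eval₂_map, eval₂_spectralPoly]
    exact heq
  have hs : f s ≠ 0 := fun h => H.ne_zero (hinj (by
    rw [map_zero, ← map_zero (algebraMap B E), ← h, hf]; rfl))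
  obtain ⟨h0, u, i, g, P⟩ := H.exists_isPlace_of_valuationRing f hs (θ := θ) (hinjB (by
    rw [map_zero, map_evalEq, hθ]; exact heq))
  exact ⟨θ, u, i, g, hθ, h0, P⟩

lemma finrank_of_surjective_of_ker_eq_span {κ F R : Type*} [Field κ] [Field F] [Field R]
    [Algebra F R] {e : κ →+* F} (he : Function.Surjective e) {Ψ : κ[X] →+* R}
    (hΨ : Function.Surjective Ψ) {g : κ[X]} (hg : g.Monic) (hirr : Irreducible g)
    (hker : RingHom.ker Ψ = Ideal.span {g}) (hC : ∀ a, Ψ (C a) = algebraMap F R (e a)) :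
    Module.finrank F R = g.natDegree ∧ (g.Separable → Algebra.IsSeparable F R) := by
  have haev (p : κ[X]) : aeval (Ψ X) (p.map e) = Ψ p := by
    have : eval₂RingHom ((algebraMap F R).comp e) (Ψ X) = Ψ := by
      ext a <;> simp [hC]
    rw [aeval_def, eval₂_map, ← this, coe_eval₂RingHom]
    simp
  have hirr' : Irreducible (g.map e) :=
    (MulEquiv.irreducible_iff (mapEquiv (RingEquiv.ofBijective e ⟨e.injective, he⟩))).mpr hirr
  have hroot : aeval (Ψ X) (g.map e) = 0 := by
    rw [haev, ← RingHom.mem_ker, hker]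
    exact Ideal.mem_span_singleton_self _
  have hmin : g.map e = minpoly F (Ψ X) :=
    minpoly.eq_of_irreducible_of_monic hirr' hroot (hg.map e)
  have hint : IsIntegral F (Ψ X) := ⟨_, hg.map e, hroot⟩
  have htop : IntermediateField.adjoin F {Ψ X} = ⊤ := by
    rw [eq_top_iff]
    intro b _
    obtain ⟨p, rfl⟩ := hΨ b
    rw [← haev p]
    exact IntermediateField.algebra_adjoin_le_adjoin F _ (aeval_mem_adjoin_singleton F (Ψ X))
  constructor
  · rw [← natDegree_map e, hmin, ← IntermediateField.adjoin.finrank hint, htop,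
      IntermediateField.finrank_top']
  · intro hsep
    have hs : _root_.IsSeparable F (Ψ X) := by
      rw [_root_.IsSeparable, ← hmin]
      exact hsep.map
    have := (IntermediateField.isSeparable_adjoin_simple_iff_isSeparable F R).mpr hs
    rw [htop] at this
    exact Algebra.IsSeparable.of_algHom F (⊤ : IntermediateField F R)
      (IntermediateField.topEquiv (F := F) (E := R)).symm.toAlgHom

namespace IsPlace

variable {B : Type*} [CommRing B] [IsDomain B] [IsLocalRing B] {f : O →+* B} {θ u : B} {i : ℕ}
  {g : κ[X]} {E : Type*} [Field E] {j : ChartRing m s c 0 →+* E} {ι : B →+* E}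

lemma isDiscreteValuationRing [IsDomain O] [IsLocalRing O] [IsNoetherianRing O]
    (P : IsPlace m s ρ c f θ u i g) (hι : Function.Injective ι)
    (hιf : ∀ x, ι (f x) = j (algebraMap O _ x)) (hιθ : ι θ = j (chartLam m s c 0))
    (H : IsChartDatum m s ρ c) (hE : ∀ e : E, ∃ a b, j b ≠ 0 ∧ e * j b = j a) (hθ0 : θ ≠ 0) :
    IsDiscreteValuationRing B := by
  obtain ⟨-, hmax, _⟩ := P.exists_mul_chartHom_eq hι hιf hιθ H hE hθ0
  exact isDiscreteValuationRing_of_maximalIdeal_eq_span hmax hθ0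

/-- Modulo `θ`, elements of `B` are fractions of polynomials in the residue of `u`, and the
polynomials that vanish are the multiples of `g`; so the residue field is `κ[u]/(g)`. -/
lemma exists_residueField_hom [IsDomain O] [IsLocalRing O] [IsNoetherianRing O]
    (P : IsPlace m s ρ c f θ u i g) (hι : Function.Injective ι)
    (hιf : ∀ x, ι (f x) = j (algebraMap O _ x)) (hιθ : ι θ = j (chartLam m s c 0))
    (H : IsChartDatum m s ρ c) (hE : ∀ e : E, ∃ a b, j b ≠ 0 ∧ e * j b = j a) (hθ0 : θ ≠ 0) :
    ∃ Ψ : κ[X] →+* IsLocalRing.ResidueField B, Function.Surjective Ψ ∧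
      RingHom.ker Ψ = Ideal.span {g} ∧ ∀ x, Ψ (C (ρ x)) = IsLocalRing.residue B (f x) := by
  have hi := (Finset.mem_Icc.mp P.mem_Icc).1
  obtain ⟨hfrac, hmax, -⟩ := P.exists_mul_chartHom_eq hι hιf hιθ H hE hθ0
  have hs : ((IsLocalRing.residue B).comp f) s = 0 := by
    rw [RingHom.comp_apply, IsLocalRing.residue_eq_zero_iff, P.rel]
    exact Ideal.mul_mem_right _ _ (Ideal.pow_mem_of_mem _ P.mem _ (by lia))
  obtain ⟨Ψ, -, hC, hΨ, -⟩ := H.exists_residueHom _ hs (IsLocalRing.residue B u)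
  have hmap : Function.Surjective (mapRingHom ρ) := map_surjective ρ H.surj
  have hΨ' (p : O[X]) : Ψ (p.map ρ) = IsLocalRing.residue B (p.eval₂ f u) := by
    rw [hΨ, hom_eval₂]
  have hker : RingHom.ker Ψ = Ideal.span {g} := by
    ext q
    obtain ⟨p, rfl⟩ := hmap q
    rw [RingHom.mem_ker, coe_mapRingHom, hΨ', IsLocalRing.residue_eq_zero_iff, P.res,
      Ideal.mem_span_singleton]
  -- Bézout for the irreducible `g` and a polynomial prime to it; this absorbs the denominators.
  have hfield : ∀ y ∈ Ψ.range, y ≠ 0 → y⁻¹ ∈ Ψ.range := by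
    rintro _ ⟨q, rfl⟩ hq
    have hndvd : ¬ g ∣ q := by
      rwa [← Ideal.mem_span_singleton, ← hker, RingHom.mem_ker]
    obtain ⟨a, b, hab⟩ := (P.irreducible.coprime_iff_not_dvd.mpr hndvd)
    refine ⟨b, eq_inv_of_mul_eq_one_left ?_⟩
    have hg0 : Ψ g = 0 := by
      rw [← RingHom.mem_ker, hker]; exact Ideal.mem_span_singleton_self _
    have := congr(Ψ $hab)
    rwa [map_add, map_mul, map_mul, hg0, mul_zero, zero_add, map_one] at this
  have hchart (a : ChartRing m s c i) : IsLocalRing.residue B (P.chartHom a) ∈ Ψ.range := by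
    obtain ⟨p, hp⟩ := chartRing_exists_sub_mem a
    refine ⟨p.map ρ, ?_⟩
    rw [hΨ', ← P.chartHom_aeval, eq_comm, ← sub_eq_zero, ← map_sub,
      IsLocalRing.residue_eq_zero_iff, ← map_sub]
    obtain ⟨y, hy⟩ := Ideal.mem_span_singleton'.mp hp
    rw [← hy, map_mul, chartHom_lam]
    exact Ideal.mul_mem_left _ _ P.mem
  refine ⟨Ψ, fun b => ?_, hker, hC⟩
  obtain ⟨b, rfl⟩ := IsLocalRing.residue_surjective b
  obtain ⟨a, t, ht, h⟩ := hfrac b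
  have ht0 : IsLocalRing.residue B (P.chartHom t) ≠ 0 := (ht.map _).ne_zero
  have h1 := congr(IsLocalRing.residue B $h)
  rw [map_mul] at h1
  rw [eq_div_of_mul_eq ht0 h1, div_eq_mul_inv]
  change _ ∈ Ψ.range
  exact mul_mem (hchart a) (hfield _ (hchart t) ht0)

/-- `s = θ^i u` with `u` a unit and `θ` a uniformizer, and the powers of the maximal ideal are
strictly decreasing. -/
lemma sSup_ramification [IsLocalRing O] [IsDiscreteValuationRing B]
    (P : IsPlace m s ρ c f θ u i g) (hO : IsLocalRing.maximalIdeal O = Ideal.span {s})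
    (hmax : IsLocalRing.maximalIdeal B = Ideal.span {θ}) :
    sSup {n | (IsLocalRing.maximalIdeal O).map f ≤ IsLocalRing.maximalIdeal B ^ n} = i := by
  have hpow : (IsLocalRing.maximalIdeal O).map f = IsLocalRing.maximalIdeal B ^ i := by
    rw [hO, Ideal.map_span, Set.image_singleton, P.rel, hmax, Ideal.span_singleton_pow,
      Ideal.span_singleton_mul_right_unit P.isUnit]
  have hanti := Ideal.pow_right_strictAnti (IsLocalRing.maximalIdeal B)
    (IsDiscreteValuationRing.not_a_field B) Ideal.IsPrime.ne_top'
  simp only [hpow, hanti.le_iff_ge]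
  exact csSup_Iic

end IsPlace

/-- The points of a normal model of the field of fractions over the closed point of `O`. -/
lemma IsChartDatum.exists_bijOn [IsDomain O] [IsDiscreteValuationRing O]
    (H : IsChartDatum m s ρ c) {E : Type*} [Field E] {j : ChartRing m s c 0 →+* E}
    (hj : Function.Injective j) (hE : ∀ e, ∃ a b, j b ≠ 0 ∧ e * j b = j a)
    {S : Type*} (B : S → Type*) [∀ y, CommRing (B y)] [∀ y, IsDomain (B y)]
    [∀ y, IsLocalRing (B y)] [∀ y, IsIntegrallyClosed (B y)] [∀ y, Algebra (B y) E]
    [∀ y, IsFractionRing (B y) E] (f : ∀ y, O →+* B y) [∀ y, IsLocalHom (f y)]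
    (hf : ∀ y x, algebraMap (B y) E (f y x) = j (algebraMap O _ x))
    (hinj : ∀ y y', (algebraMap (B y) E).range = (algebraMap (B y') E).range → y = y')
    (hsurj : ∀ (W : Type u) [CommRing W] [IsDomain W] [IsDiscreteValuationRing W] (F : O →+* W)
      [IsLocalHom F] (ι : W →+* E) (_ : Function.Injective ι)
      (_ : ∀ x, ι (F x) = j (algebraMap O _ x)) (_ : j.range ≤ ι.range), ∃ (y : S) (η : B y →+* W), IsLocalHom η ∧
        ∀ b, ι (η b) = algebraMap (B y) E b) :
    ∃ (θ u : ∀ y, B y) (e : S → ℕ) (g : S → κ[X]),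
      (∀ y, algebraMap (B y) E (θ y) = j (chartLam m s c 0) ∧ θ y ≠ 0 ∧
        IsPlace m s ρ c (f y) (θ y) (u y) (e y) (g y)) ∧
      ∀ i ∈ Finset.Icc 1 m.length, Set.BijOn g {y | e y = i}
        {g | g.Monic ∧ Irreducible g ∧ g ∣ redPoly m (fun l => ρ (c l)) i ∧ ¬ g ∣ X} := by
  choose θ u e g hθ hθ0 P using fun y => H.exists_isPlace_of_isIntegrallyClosed hj hE (f y) (hf y)
  refine ⟨θ, u, e, g, fun y => ⟨hθ y, hθ0 y, P y⟩, fun i hi => ⟨?_, ?_, ?_⟩⟩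
  · rintro y rfl
    exact ⟨(P y).monic, (P y).irreducible, (P y).dvd_redPoly, (P y).not_dvd_X⟩
  · rintro y rfl y' (hy' : e y' = e y) hg
    have P' := P y'
    rw [hy', ← hg] at P'
    exact hinj _ _ (le_antisymm
      ((P y).range_eq (IsFractionRing.injective _ _) (hf y) (hθ y) H hE (hθ0 y) P' (hf y') (hθ y'))
      (P'.range_eq (IsFractionRing.injective _ _) (hf y') (hθ y') H hE (hθ0 y') (P y) (hf y)
        (hθ y)))
  · rintro G ⟨h1, h2, h3, h4⟩
    -- The model contains a point `y` dominated by the discrete valuation ring attached to `(i, G)`;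
    -- domination preserves the pair.
    obtain ⟨W, _, _, _, F, θ', u', ι, hF, P', hι, hιF, hιθ, hθ', -⟩ :=
      H.exists_isPlace hj hE hi h1 h2 h3 h4
    have hle : j.range ≤ ι.range := by
      rintro _ ⟨a, rfl⟩
      refine chartRing_induction m s c (P := fun a => j a ∈ ι.range) a (fun x => ⟨F x, hιF x⟩)
        (fun a b ha hb => ?_) (fun a ha => ?_) (fun a ha => ?_)
      · rw [map_add]; exact add_mem ha hb
      · rw [map_mul]; exact mul_mem ha ⟨θ', hιθ⟩
      · rw [map_mul]
        refine mul_mem ha ?_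
        rw [← chartRing_rel_zero]
        exact ⟨F s, hιF s⟩
    obtain ⟨y, η, hη, hιη⟩ := hsurj W F ι hι hιF hle
    have := (P y).eq_of_isLocalHom H P' η (fun x => hι (by rw [hιη, hf, hιF]))
      (hι (by rw [hιη, hθ, hιθ])) hθ'
    exact ⟨y, this.1, this.2⟩

end PlaneCurvePlaces

end

end ParabolicSpectral



namespace ParabolicSpectral

noncomputable section

/-! ### The normalization of an integral scheme -/

section NormalizationPoints

variable (Y : Scheme.{u}) [IsIntegral Y]

instance isIntegralHom_normalizationMap : IsIntegralHom (normalizationMap Y) :=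
  inferInstanceAs (IsIntegralHom (Y.fromSpecStalk (genericPoint Y)).fromNormalization)

/-- Over an affine open the normalization is the integral closure of the sections in the function
field; this form keeps only the embedding into that field. -/
lemma exists_normalization_hom {V : Y.Opens} (hV : IsAffineOpen V) (hη : genericPoint Y ∈ V) :
    ∃ e : Γ(normalization Y, normalizationMap Y ⁻¹ᵁ V) →+* Y.functionField,
      Function.Injective e ∧
      (∀ f, e ((normalizationMap Y).app V f) = Y.presheaf.germ V _ hη f) ∧
      ∀ z, (Y.presheaf.germ V _ hη).hom.IsIntegralElem z → z ∈ e.range := by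
  let g := Y.fromSpecStalk (genericPoint Y)
  have htop : g ⁻¹ᵁ V = ⊤ := by
    rw [eq_top_iff]
    intro p _
    have : g p ∈ Set.range g := ⟨p, rfl⟩
    rw [Scheme.range_fromSpecStalk] at this
    exact this.mem_open V.isOpen hη
  let i : Y.functionField ⟶ Γ(Spec Y.functionField, g ⁻¹ᵁ V) :=
    (Scheme.ΓSpecIso _).inv ≫ (Spec Y.functionField).presheaf.map (homOfLE le_top).op
  have hi : g.app V = Y.presheaf.germ V _ hη ≫ i := Scheme.fromSpecStalk_app hη
  have : IsIso i := by
    have : IsIso (homOfLE (le_top (a := g ⁻¹ᵁ V))) := by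
      rw [htop]
      exact inferInstanceAs (IsIso (𝟙 _))
    infer_instance
  let := (g.app V).hom.toAlgebra
  let v : integralClosure Γ(Y, V) Γ(Spec Y.functionField, g ⁻¹ᵁ V) →+* _ :=
    (Subalgebra.val _).toRingHom
  let j := (g.normalizationObjIso hV)
  let e := (inv i).hom.comp (v.comp j.hom.hom)
  have hinv (z) : i ((inv i) z) = z := by
    rw [← CommRingCat.comp_apply, IsIso.inv_hom_id]; rfl
  have hinv' (z) : (inv i) (i z) = z := by
    rw [← CommRingCat.comp_apply, IsIso.hom_inv_id]; rfl
  have hj (z) : j.inv (j.hom z) = z := by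
    rw [← CommRingCat.comp_apply, j.hom_inv_id]; rfl
  have hj' (z) : j.hom (j.inv z) = z := by
    rw [← CommRingCat.comp_apply, j.inv_hom_id]; rfl
  refine ⟨e, ?_, fun f => ?_, fun z hz => ?_⟩
  · intro a b h
    have h1 := congr(i $h)
    change i ((inv i) _) = i ((inv i) _) at h1
    rw [hinv, hinv] at h1
    have h2 : j.hom a = j.hom b := Subtype.ext h1
    exact (hj a).symm.trans (congr(j.inv $h2).trans (hj b))
  · have h1 : (normalizationMap Y).app V f = j.inv (algebraMap _ _ f) :=
      congr($(g.fromNormalization_app hV).hom f)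
    change (inv i) (v (j.hom _)) = _
    rw [h1, hj']
    change (inv i) (g.app V f) = _
    rw [hi]
    exact hinv' _
  · obtain ⟨p, hp, h⟩ := hz
    have hmem : i z ∈ integralClosure Γ(Y, V) Γ(Spec Y.functionField, g ⁻¹ᵁ V) := by
      refine ⟨p, hp, ?_⟩
      have h1 := congr(i.hom $h)
      rw [Polynomial.hom_eval₂, map_zero] at h1
      change p.eval₂ (g.app V).hom _ = 0
      rw [hi]
      exact h1
    refine ⟨j.inv ⟨i z, hmem⟩, ?_⟩
    change (inv i) (v (j.hom _)) = _
    rw [hj']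
    exact hinv' z

variable {Y}

lemma normalizationMap_app_injective {V : Y.Opens} (hV : IsAffineOpen V)
    (hη : genericPoint Y ∈ V) : Function.Injective ((normalizationMap Y).app V) := by
  obtain ⟨e, -, he, -⟩ := exists_normalization_hom Y hV hη
  intro a b h
  apply germ_injective_of_isIntegral Y _ hη
  rw [← he, ← he, h]

lemma exists_mul_normalizationMap_app_eq {V : Y.Opens} (hV : IsAffineOpen V)
    (hη : genericPoint Y ∈ V) (z : Γ(normalization Y, normalizationMap Y ⁻¹ᵁ V)) :
    ∃ a b, b ≠ 0 ∧ z * (normalizationMap Y).app V b = (normalizationMap Y).app V a := by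
  obtain ⟨e, hinj, he, -⟩ := exists_normalization_hom Y hV hη
  have : Nonempty V := ⟨⟨_, hη⟩⟩
  have := functionField_isFractionRing_of_isAffineOpen Y V hV
  obtain ⟨a, b, hb, h⟩ := IsFractionRing.div_surjective (A := Γ(Y, V)) (e z)
  refine ⟨a, b, nonZeroDivisors.ne_zero hb, hinj ?_⟩
  have hb0 : algebraMap Γ(Y, V) Y.functionField b ≠ 0 :=
    IsFractionRing.to_map_ne_zero_of_mem_nonZeroDivisors hb
  rw [map_mul, he, he, ← h]
  exact div_mul_cancel₀ _ hb0

/-- Transitivity of integrality: an element of the function field integral over the normalization is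
integral over `Γ(Y, V)`. -/
lemma isIntegrallyClosed_normalization {V : Y.Opens} (hV : IsAffineOpen V)
    (hη : genericPoint Y ∈ V) :
    IsIntegrallyClosed Γ(normalization Y, normalizationMap Y ⁻¹ᵁ V) := by
  obtain ⟨e, hinj, he, hint⟩ := exists_normalization_hom Y hV hη
  have : Nonempty V := ⟨⟨_, hη⟩⟩
  have := functionField_isFractionRing_of_isAffineOpen Y V hV
  let := e.toAlgebra
  let := ((normalizationMap Y).app V).hom.toAlgebra
  have : IsScalarTower Γ(Y, V) Γ(normalization Y, normalizationMap Y ⁻¹ᵁ V) Y.functionField :=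
    .of_algebraMap_eq fun f => (he f).symm
  have : FaithfulSMul Γ(normalization Y, normalizationMap Y ⁻¹ᵁ V) Y.functionField :=
    (faithfulSMul_iff_algebraMap_injective _ _).mpr hinj
  have : IsFractionRing Γ(normalization Y, normalizationMap Y ⁻¹ᵁ V) Y.functionField :=
    IsFractionRing.of_field _ _ fun z => by
      obtain ⟨a, b, hb, h⟩ := IsFractionRing.div_surjective (A := Γ(Y, V)) z
      refine ⟨(normalizationMap Y).app V a, (normalizationMap Y).app V b, ?_⟩
      rw [← h]
      change _ = e _ / e _
      rw [he, he]
      rfl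
  have hi : Algebra.IsIntegral Γ(Y, V) Γ(normalization Y, normalizationMap Y ⁻¹ᵁ V) :=
    ⟨IsIntegralHom.isIntegral_app (normalizationMap Y) V hV⟩
  refine (isIntegrallyClosed_iff Y.functionField).mpr fun {z} hz => ?_
  exact hint z (isIntegral_trans (R := Γ(Y, V)) z hz)

instance isIntegrallyClosed_normalization_stalk (y : normalization Y) :
    IsIntegrallyClosed ((normalization Y).presheaf.stalk y) := by
  obtain ⟨_, ⟨V, hV, rfl⟩, hyV, -⟩ := Y.isBasis_affineOpens.exists_subset_of_mem_open
    (Set.mem_univ (normalizationMap Y y)) isOpen_univ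
  have hη : genericPoint Y ∈ V :=
    ((genericPoint_spec Y).mem_open_set_iff V.isOpen).mpr ⟨_, trivial, hyV⟩
  have := isIntegrallyClosed_normalization hV hη
  let W := normalizationMap Y ⁻¹ᵁ V
  have hW : IsAffineOpen W := IsAffineOpen.preimage hV _
  have : Nonempty W := ⟨⟨y, hyV⟩⟩
  have := hW.isLocalization_stalk ⟨y, hyV⟩
  let := (normalization Y).presheaf.algebra_section_stalk (U := W) ⟨y, hyV⟩
  exact isIntegrallyClosed_of_isLocalization (R := Γ(normalization Y, W))
    ((normalization Y).presheaf.stalk y) _ (hW.primeIdealOf ⟨y, hyV⟩).asIdeal.primeCompl_le_nonZeroDivisors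

lemma exists_mul_germ_normalizationMap_eq {V : Y.Opens} (hV : IsAffineOpen V)
    (hη : genericPoint Y ∈ V) (hη' : genericPoint (normalization Y) ∈ normalizationMap Y ⁻¹ᵁ V)
    (z : (normalization Y).functionField) :
    ∃ a b, b ≠ 0 ∧
      z * (normalization Y).presheaf.germ _ _ hη' ((normalizationMap Y).app V b) =
        (normalization Y).presheaf.germ _ _ hη' ((normalizationMap Y).app V a) := by
  let W := normalizationMap Y ⁻¹ᵁ V
  have hW : IsAffineOpen W := IsAffineOpen.preimage hV _
  have : Nonempty W := ⟨⟨_, hη'⟩⟩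
  have := functionField_isFractionRing_of_isAffineOpen _ W hW
  obtain ⟨c, d, hd, rfl⟩ := IsFractionRing.div_surjective (A := Γ(normalization Y, W)) z
  obtain ⟨c1, c2, hc2, hc⟩ := exists_mul_normalizationMap_app_eq hV hη c
  obtain ⟨d1, d2, hd2, hd'⟩ := exists_mul_normalizationMap_app_eq hV hη d
  have hinj := germ_injective_of_isIntegral (normalization Y) _ hη'
  have hν := normalizationMap_app_injective hV hη
  have : Nonempty V := ⟨⟨_, hη⟩⟩
  have hd0 := IsFractionRing.to_map_ne_zero_of_mem_nonZeroDivisors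
    (K := (normalization Y).functionField) hd
  have hd1 : d1 ≠ 0 := by
    rintro rfl
    rw [map_zero] at hd'
    exact (mul_ne_zero (nonZeroDivisors.ne_zero hd) ((map_ne_zero_iff _ hν).mpr hd2)) hd'
  refine ⟨c1 * d2, c2 * d1, mul_ne_zero hc2 hd1, ?_⟩
  rw [map_mul, ← hd', map_mul, map_mul ((normalizationMap Y).app V).hom c1 d2, ← hc]
  simp only [map_mul]
  change algebraMap _ _ c / algebraMap _ _ d * (_ * (algebraMap _ _ d * _)) =
    algebraMap _ _ c * _ * _
  field_simp

end NormalizationPoints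

end

end ParabolicSpectral



namespace ParabolicSpectral

noncomputable section

/-! ### Points and coordinate rings over affine opens -/

section AffinePieces

lemma exists_iso_of_isOpenImmersion {X Z : Scheme.{u}} (π : Z ⟶ X) {U : X.Opens}
    (hU : IsAffineOpen U) {R : CommRingCat.{u}} (j : Spec R ⟶ Z) [IsOpenImmersion j]
    (α : Γ(X, U) ⟶ R) (hj : j ≫ π = Spec.map α ≫ hU.fromSpec)
    (hrange : π ⁻¹ᵁ U = j.opensRange) :
    IsAffineOpen (π ⁻¹ᵁ U) ∧ ∃ e : Γ(Z, π ⁻¹ᵁ U) ≅ R, π.app U ≫ e.hom = α := by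
  refine ⟨hrange ▸ isAffineOpen_opensRange j, ?_⟩
  have hle : ⊤ ≤ j ⁻¹ᵁ (π ⁻¹ᵁ U) := by rw [hrange]; simp
  have : IsIso (j.app (π ⁻¹ᵁ U)) := Scheme.Hom.isIso_app _ _ hrange.le
  have : IsIso (j.appLE (π ⁻¹ᵁ U) ⊤ hle) := by
    rw [Scheme.Hom.appLE]
    have : IsIso (homOfLE hle) := by
      have h : j ⁻¹ᵁ (π ⁻¹ᵁ U) = ⊤ := top_le_iff.mp hle
      rw [show homOfLE hle = eqToHom h.symm from Subsingleton.elim _ _]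
      infer_instance
    infer_instance
  refine ⟨asIso (j.appLE (π ⁻¹ᵁ U) ⊤ hle) ≪≫ Scheme.ΓSpecIso R, ?_⟩
  simp only [Iso.trans_hom, asIso_hom]
  rw [Scheme.Hom.app_eq_appLE, Scheme.Hom.appLE_comp_appLE_assoc]
  have h1 : (j ≫ π).appLE U ⊤ hle = (Spec.map α ≫ hU.fromSpec).appLE U ⊤ (hj ▸ hle) := by
    congr 1
  rw [h1, ← Scheme.Hom.appLE_comp_appLE (Spec.map α) hU.fromSpec U ⊤ ⊤ (by simp) (by simp)]
  rw [Scheme.Hom.appLE, IsAffineOpen.fromSpec_app_self]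
  simp only [Category.assoc, ← Functor.map_comp, Scheme.Hom.appLE]
  have h4 : (Scheme.ΓSpecIso Γ(X, U)).inv ≫ (Spec.map α).appTop ≫ (Scheme.ΓSpecIso R).hom = α := by
    simp
  refine Eq.trans ?_ h4
  congr 1

lemma exists_iso_relativeGluingData {X : Scheme.{u}} {F : X.AffineZariskiSiteᵒᵖ ⥤ CommRingCat.{u}}
    {α : (Scheme.AffineZariskiSite.toOpensFunctor X).op ⋙ X.presheaf ⟶ F}
    (H : α.Coequifibered) (U : X.AffineZariskiSite) :
    IsAffineOpen ((Scheme.AffineZariskiSite.relativeGluingData H).toBase ⁻¹ᵁ U.1) ∧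
    ∃ e : Γ((Scheme.AffineZariskiSite.relativeGluingData H).glued,
        (Scheme.AffineZariskiSite.relativeGluingData H).toBase ⁻¹ᵁ U.1) ≅ F.obj (.op U),
      (Scheme.AffineZariskiSite.relativeGluingData H).toBase.app U.1 ≫ e.hom = α.app (.op U) := by
  let j : Spec (F.obj (.op U)) ⟶ (Scheme.AffineZariskiSite.relativeGluingData H).glued :=
    (Scheme.AffineZariskiSite.relativeGluingData H).cover.f U
  have : IsOpenImmersion j := (Scheme.AffineZariskiSite.relativeGluingData H).cover.map_prop U
  refine exists_iso_of_isOpenImmersion _ U.2 j (α.app (.op U)) ?_ ?_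
  · exact (Scheme.AffineZariskiSite.relativeGluingData H).ι_toBase U
  · simpa using! (Scheme.AffineZariskiSite.relativeGluingData H).toBase_preimage_eq_opensRange_ι U

/-- The prime of a point of an affine open consists of the functions that are not invertible there.
This serves as the standard test for equality of points. -/
lemma eq_of_isUnit_germ_iff {Z : Scheme.{u}} {W : Z.Opens} (hW : IsAffineOpen W) {y y' : Z}
    (hy : y ∈ W) (hy' : y' ∈ W)
    (h : ∀ c, IsUnit (Z.presheaf.germ W y hy c) ↔ IsUnit (Z.presheaf.germ W y' hy' c)) :
    y = y' := by
  let := Z.presheaf.algebra_section_stalk ⟨y, hy⟩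
  let := Z.presheaf.algebra_section_stalk ⟨y', hy'⟩
  have h1 := hW.isLocalization_stalk ⟨y, hy⟩
  have h2 := hW.isLocalization_stalk ⟨y', hy'⟩
  refine (hW.fromSpec_primeIdealOf ⟨y, hy⟩).symm.trans
    (Eq.trans ?_ (hW.fromSpec_primeIdealOf ⟨y', hy'⟩))
  congr 1
  refine PrimeSpectrum.ext (Ideal.ext fun c => ?_)
  have e1 := IsLocalization.AtPrime.isUnit_to_map_iff (Z.presheaf.stalk y)
    (hW.primeIdealOf ⟨y, hy⟩).asIdeal c
  have e2 := IsLocalization.AtPrime.isUnit_to_map_iff (Z.presheaf.stalk y')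
    (hW.primeIdealOf ⟨y', hy'⟩).asIdeal c
  exact not_iff_not.mp (e1.symm.trans ((h c).trans e2))

/-- A function is invertible at a point exactly when it is nonzero and its inverse lies in the local
ring, viewed inside the function field. -/
lemma eq_of_range_eq {Z : Scheme.{u}} [IsIntegral Z] {W : Z.Opens} (hW : IsAffineOpen W) {y y' : Z}
    (hy : y ∈ W) (hy' : y' ∈ W)
    (h : (algebraMap (Z.presheaf.stalk y) Z.functionField).range =
      (algebraMap (Z.presheaf.stalk y') Z.functionField).range) : y = y' := by
  have : Nonempty W := ⟨⟨y, hy⟩⟩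
  have key {z : Z} (hz : z ∈ W) (c : Γ(Z, W)) : IsUnit (Z.presheaf.germ W z hz c) ↔
      Z.germToFunctionField W c ≠ 0 ∧ (Z.germToFunctionField W c)⁻¹ ∈
        (algebraMap (Z.presheaf.stalk z) Z.functionField).range := by
    rw [← Z.algebraMap_germ_eq_germToFunctionField hz]
    constructor
    · intro hu
      refine ⟨(hu.map _).ne_zero, ?_⟩
      obtain ⟨v, hv⟩ := hu.exists_left_inv
      exact ⟨v, eq_inv_of_mul_eq_one_left (by rw [← map_mul, hv, map_one])⟩
    · rintro ⟨h0, v, hv⟩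
      refine .of_mul_eq_one v (IsFractionRing.injective (Z.presheaf.stalk z) Z.functionField ?_)
      rw [map_mul, hv, map_one, mul_inv_cancel₀ h0]
  exact eq_of_isUnit_germ_iff hW hy hy' fun c => by rw [key hy, key hy', h]

/-- The centre of a local ring. -/
lemma exists_stalk_hom {Z : Scheme.{u}} {W : Z.Opens} (hW : IsAffineOpen W) {V : Type*}
    [CommRing V] [IsLocalRing V] (g : Γ(Z, W) →+* V) :
    ∃ (y : Z) (hy : y ∈ W) (η : Z.presheaf.stalk y →+* V), IsLocalHom η ∧
      ∀ c, η (Z.presheaf.germ W y hy c) = g c := by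
  let p : PrimeSpectrum Γ(Z, W) := ⟨(IsLocalRing.maximalIdeal V).comap g, inferInstance⟩
  have hy : hW.fromSpec p ∈ W := by
    have : hW.fromSpec p ∈ Set.range hW.fromSpec := ⟨p, rfl⟩
    rwa [hW.range_fromSpec] at this
  let := Z.presheaf.algebra_section_stalk ⟨_, hy⟩
  have hloc : IsLocalization.AtPrime (Z.presheaf.stalk (hW.fromSpec p)) p.asIdeal :=
    hW.isLocalization_stalk' p hy
  have hun (c : p.asIdeal.primeCompl) : IsUnit (g c) := not_not.mp fun h => c.2 h
  let η : Z.presheaf.stalk (hW.fromSpec p) →+* V := IsLocalization.lift hun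
  have hη (c) : η (Z.presheaf.germ W _ hy c) = g c := IsLocalization.lift_eq hun c
  refine ⟨_, hy, η, ⟨fun b hb => ?_⟩, hη⟩
  obtain ⟨⟨c, t⟩, h⟩ := IsLocalization.surj p.asIdeal.primeCompl b
  have h1 : b * Z.presheaf.germ W _ hy t = Z.presheaf.germ W _ hy c := h
  have h2 := congr(η $h1)
  rw [map_mul, hη, hη] at h2
  have hc : c ∈ p.asIdeal.primeCompl := fun hc => hc (h2 ▸ hb.mul (hun t))
  have hu : IsUnit (Z.presheaf.germ W _ hy c) :=
    IsLocalization.map_units (Z.presheaf.stalk (hW.fromSpec p)) (⟨c, hc⟩ : p.asIdeal.primeCompl)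
  rw [← h1] at hu
  exact isUnit_of_mul_isUnit_left hu

/-! ### Coordinate rings of the spectral curve -/

section SpectralCurve

variable {k : Type u} [Field k] {X : Scheme.{u}} [X.Over (Spec (.of k))] [IsIntegral X]
  (D : Finset X) (r : ℕ) (a : ∀ j, RatDiff k X j)
  (δ : Derivation k X.functionField X.functionField)

/-- The coordinate ring of the part of the spectral curve over `U`, in the ring of functions on
the generic fibre. -/
def spectralSubring (U : X.Opens) (hη : genericPoint X ∈ U) :
    Subring (AdjoinRoot (charPoly r a δ)) :=
  Subring.closure (Set.range (fun f => AdjoinRoot.of (charPoly r a δ) (X.presheaf.germ U _ hη f)) ∪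
    {z | ∃ h : X.functionField, LogField D U (h • δ) ∧
      z = AdjoinRoot.of (charPoly r a δ) h * AdjoinRoot.root (charPoly r a δ)})

/-- The generic fibre lies over the generic point, so the preimage of `U` is everything. -/
lemma restrictFun_bijective {U : X.Opens} (hη : genericPoint X ∈ U) :
    Function.Bijective (restrictFun r a δ (genericFibreMap r a δ ⁻¹ᵁ U)) := by
  have htop : genericFibreMap r a δ ⁻¹ᵁ U = ⊤ := by
    rw [eq_top_iff]
    intro p _
    have : X.fromSpecStalk (genericPoint X)
        (Spec.map (CommRingCat.ofHom (AdjoinRoot.of (charPoly r a δ))) p) ∈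
        Set.range (X.fromSpecStalk (genericPoint X)) := ⟨_, rfl⟩
    rw [Scheme.range_fromSpecStalk] at this
    exact this.mem_open U.isOpen hη
  have : IsIso (homOfLE (le_top (a := genericFibreMap r a δ ⁻¹ᵁ U))) := by
    rw [htop]
    exact inferInstanceAs (IsIso (𝟙 _))
  have : IsIso ((Scheme.ΓSpecIso (.of (AdjoinRoot (charPoly r a δ)))).inv ≫
    (GenericFibre r a δ).presheaf.map
      (homOfLE (le_top (a := genericFibreMap r a δ ⁻¹ᵁ U))).op) := inferInstance
  exact ConcreteCategory.bijective_of_isIso _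

lemma spectralRing_eq_map {U : X.Opens} (hη : genericPoint X ∈ U) :
    spectralRing D r a δ U = (spectralSubring D r a δ U hη).map (restrictFun r a δ _) := by
  rw [spectralSubring, RingHom.map_closure, spectralRing, Set.image_union]
  congr 2
  · rw [← Set.range_comp]
    congr 1
    ext f
    exact genericFibreMap_app r a δ hη f
  · ext z
    constructor
    · rintro ⟨h, hh, rfl⟩; exact ⟨_, ⟨h, hh, rfl⟩, rfl⟩
    · rintro ⟨_, ⟨h, hh, rfl⟩, rfl⟩; exact ⟨h, hh, rfl⟩

variable [LocallyOfFiniteType (X ↘ Spec (.of k))]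

lemma isAffineOpen_spectralCurveMap_preimage {U : X.Opens} (hU : IsAffineOpen U) :
    IsAffineOpen (spectralCurveMap D r a δ ⁻¹ᵁ U) :=
  (exists_iso_relativeGluingData (coequifibered_spectralDiagramMap D r a δ) ⟨U, hU⟩).1

lemma exists_spectralCurve_hom {U : X.Opens} (hU : IsAffineOpen U) (hη : genericPoint X ∈ U) :
    ∃ E : Γ(spectralCurve D r a δ, spectralCurveMap D r a δ ⁻¹ᵁ U) →+*
        AdjoinRoot (charPoly r a δ),
      Function.Injective E ∧ E.range = spectralSubring D r a δ U hη ∧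
      ∀ f, E ((spectralCurveMap D r a δ).app U f) =
        AdjoinRoot.of (charPoly r a δ) (X.presheaf.germ U _ hη f) := by
  obtain ⟨-, e, he⟩ :=
    exists_iso_relativeGluingData (coequifibered_spectralDiagramMap D r a δ) ⟨U, hU⟩
  let ρ := RingEquiv.ofBijective _ (restrictFun_bijective r a δ hη)
  let v : spectralRing D r a δ U →+* _ := (spectralRing D r a δ U).subtype
  have hbij : Function.Bijective e.hom := ConcreteCategory.bijective_of_isIso _
  let E := ρ.symm.toRingHom.comp (v.comp e.hom.hom)
  refine ⟨E, ?_, ?_, fun f => ?_⟩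
  · exact ρ.symm.injective.comp (Subtype.val_injective.comp hbij.1)
  · ext z
    have hz : ρ z ∈ spectralRing D r a δ U ↔ z ∈ spectralSubring D r a δ U hη := by
      rw [spectralRing_eq_map D r a δ hη]
      constructor
      · rintro ⟨w, hw, h⟩
        rwa [← ρ.injective h]
      · intro h
        exact ⟨z, h, rfl⟩
    rw [← hz]
    constructor
    · rintro ⟨w, rfl⟩
      change ρ (ρ.symm (v (e.hom w))) ∈ _
      rw [ρ.apply_symm_apply]
      exact (e.hom w).2
    · intro h
      obtain ⟨w, hw⟩ := hbij.2 ⟨ρ z, h⟩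
      refine ⟨w, ?_⟩
      change ρ.symm (v (e.hom w)) = z
      rw [hw]
      exact ρ.symm_apply_apply z
  · have h1 : e.hom ((spectralCurveMap D r a δ).app U f) = _ := congr($(he).hom f)
    change ρ.symm (v (e.hom _)) = _
    rw [h1, RingEquiv.symm_apply_eq]
    exact genericFibreMap_app r a δ hη f

end SpectralCurve

end AffinePieces

end

end ParabolicSpectral



namespace ParabolicSpectral

noncomputable section

/-! ### Passing between a uniformizer and a formal coordinate -/

section FormalCoordinate

open Polynomial

/-- Genericity does not depend on the coordinate: the reduced polynomials differ by the substitution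
`u ↦ v⁻¹ u`, which preserves separability and the order at `0`. -/
lemma IsChartDatum.of_comp {κ O O' : Type*} [Field κ] [CommRing O] [CommRing O'] {r : ℕ}
    {m : Composition r} {s' : O'} {ρ' : O' →+* κ} {c' : ℕ → O'} (H : IsChartDatum m s' ρ' c')
    {s : O} {ρ : O →+* κ} {c : ℕ → O} (hsurj : Function.Surjective ρ)
    (hker : RingHom.ker ρ = Ideal.span {s}) (hs : s ≠ 0) {v : κ} (hv : v ≠ 0)
    (hc : ∀ l ∈ Finset.Icc 1 r, ρ (c l) * v ^ level m l = ρ' (c' l)) : IsChartDatum m s ρ c where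
  rank_pos := H.rank_pos
  surj := hsurj
  ker := hker
  ne_zero := hs
  coeff l hl h := H.coeff l hl (by rw [← hc l hl, h, zero_mul])
  sep i hi := by
    obtain ⟨h, hh, hsep⟩ := H.sep i hi
    have e : redPoly m (fun l => ρ (c l)) i =
        (redPoly m (fun l => ρ' (c' l)) i).comp (C v⁻¹ * X) := by
      have := map_evalEq m (compRingHom (C v⁻¹ * X)) (fun l => C (ρ' (c' l))) i 0 X
      change (redPoly m (fun l => ρ' (c' l)) i).comp (C v⁻¹ * X) = _ at this
      rw [this, redPoly, evalEq, evalEq]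
      simp only [coe_compRingHom, zero_comp, X_comp, C_comp]
      congr 1
      refine Finset.sum_congr rfl fun l hl => ?_
      rw [← hc l hl, mul_pow, ← C_pow, ← mul_assoc, ← C_mul, mul_assoc (ρ (c l)),
        ← mul_pow, mul_inv_cancel₀ hv, one_pow, mul_one]
    refine ⟨C (v⁻¹ ^ sortedPart m (i + 1)) * h.comp (C v⁻¹ * X), ?_, ?_⟩
    · rw [e, hh, mul_comp, pow_comp, X_comp, mul_pow, ← C_pow]
      ring
    · refine Separable.unit_mul (isUnit_C.mpr (IsUnit.mk0 _ (pow_ne_zero _ (inv_ne_zero hv)))) ?_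
      have h1 := IsCoprime.map hsep (compRingHom (C v⁻¹ * X))
      rw [separable_def, derivative_comp]
      have hd : derivative (C v⁻¹ * X) = C v⁻¹ := by simp
      rw [hd]
      exact (isCoprime_mul_unit_left_right (isUnit_C.mpr (IsUnit.mk0 _ (inv_ne_zero hv))) _ _).mpr h1

variable {k : Type u} [Field k] {O : Type u} [CommRing O] [Algebra k O] {φ : O →ₐ[k] k⟦X⟧} {s : O}

lemma surjective_constantCoeff_comp :
    Function.Surjective ((PowerSeries.constantCoeff (R := k)).comp φ.toRingHom) := by
  intro y
  refine ⟨algebraMap k O y, ?_⟩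
  change PowerSeries.constantCoeff (φ _) = y
  rw [φ.commutes]
  simp

variable [IsLocalRing O]
  (hφ : (IsLocalRing.maximalIdeal O).map φ = Ideal.span {PowerSeries.X})
  (hs : IsLocalRing.maximalIdeal O = Ideal.span {s})

include hφ hs

lemma exists_eq_X_mul_of_map_maximalIdeal_eq :
    ∃ v : k⟦X⟧, IsUnit v ∧ φ s = PowerSeries.X * v := by
  rw [hs, Ideal.map_span, Set.image_singleton, Ideal.span_singleton_eq_span_singleton] at hφ
  obtain ⟨v, hv⟩ := hφ.symm
  exact ⟨v, v.isUnit, hv.symm⟩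

lemma ne_zero_of_map_maximalIdeal_eq : s ≠ 0 := by
  rintro rfl
  obtain ⟨v, hv, h⟩ := exists_eq_X_mul_of_map_maximalIdeal_eq hφ hs
  rw [map_zero] at h
  exact mul_ne_zero PowerSeries.X_ne_zero hv.ne_zero h.symm

omit hφ in
lemma ker_constantCoeff_comp :
    RingHom.ker ((PowerSeries.constantCoeff (R := k)).comp φ.toRingHom) = Ideal.span {s} := by
  rw [← hs]
  refine (IsLocalRing.eq_maximalIdeal ?_)
  exact RingHom.ker_isMaximal_of_surjective _ surjective_constantCoeff_comp

/-- Subtract the constant term, divide by `φ s`, which is `X` times a unit, and repeat: polynomials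
in `s` over `k` are dense. -/
lemma exists_sub_mem_span_X_pow (N : ℕ) (y : k⟦X⟧) :
    ∃ x, y - φ x ∈ Ideal.span {(PowerSeries.X : k⟦X⟧) ^ N} := by
  obtain ⟨v, hv, hφs⟩ := exists_eq_X_mul_of_map_maximalIdeal_eq hφ hs
  obtain ⟨v', hv'⟩ := hv.exists_right_inv
  induction N generalizing y with
  | zero => exact ⟨0, by simp⟩
  | succ N ih =>
    have h0 : PowerSeries.X ∣ y - PowerSeries.C (PowerSeries.constantCoeff y) := by
      rw [PowerSeries.X_dvd_iff]; simp
    obtain ⟨y', hy'⟩ := h0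
    obtain ⟨x, hx⟩ := ih (v' * y')
    refine ⟨algebraMap k O (PowerSeries.constantCoeff y) + s * x, ?_⟩
    obtain ⟨z, hz⟩ := Ideal.mem_span_singleton'.mp hx
    refine Ideal.mem_span_singleton'.mpr ⟨v * z, ?_⟩
    have h1 : φ (algebraMap k O (PowerSeries.constantCoeff y)) =
        PowerSeries.C (PowerSeries.constantCoeff y) := φ.commutes _
    rw [map_add, map_mul, h1, hφs]
    linear_combination PowerSeries.X * v * hz - hy' + PowerSeries.X * y' * hv'

variable [IsNoetherianRing O]

lemma mem_span_pow_of_mem_span_X_pow (N : ℕ) (x : O)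
    (hx : φ x ∈ Ideal.span {(PowerSeries.X : k⟦X⟧) ^ N}) : x ∈ Ideal.span {s ^ N} := by
  obtain ⟨v, hv, hφs⟩ := exists_eq_X_mul_of_map_maximalIdeal_eq hφ hs
  by_cases h0 : x = 0
  · rw [h0]; exact zero_mem _
  obtain ⟨n, w, hw, rfl⟩ := exists_eq_mul_pow_of_maximalIdeal_eq_span hs h0
  rw [map_mul, map_pow, hφs, mul_pow, Ideal.mem_span_singleton] at hx
  have h1 : (PowerSeries.X : k⟦X⟧) ^ N ∣ PowerSeries.X ^ n := by
    have hu : IsUnit (φ w * v ^ n) := (hw.map φ).mul (hv.pow n)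
    rw [show φ w * (PowerSeries.X ^ n * v ^ n) = PowerSeries.X ^ n * (φ w * v ^ n) by ring] at hx
    exact hu.dvd_mul_right.mp hx
  have h2 : N ≤ n := (pow_dvd_pow_iff PowerSeries.X_ne_zero PowerSeries.X_prime.not_isUnit).mp h1
  exact Ideal.mul_mem_left _ _ (Ideal.mem_span_singleton.mpr (pow_dvd_pow s h2))

/-- Divisibility of `φ (α l)` by `X^{γ_l}` descends to divisibility of `α l` by `s^{γ_l}`. The
coefficients for `s` and for `t` then differ by the units `v = s/t` and `w = (ds/s)/(dt/t)`. -/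
lemma exists_localCoeff {r : ℕ} {m : Composition r} {c : ℕ → k⟦X⟧} {α : ℕ → O}
    (hα : ∀ j ∈ Finset.Icc 1 r, φ (α j) * (PowerSeries.X * PowerSeries.derivative k (φ s)) ^ j =
      c j * PowerSeries.X ^ level m j * φ s ^ j) :
    ∃ (β : ℕ → O) (v w : k⟦X⟧), IsUnit v ∧ IsUnit w ∧ PowerSeries.constantCoeff w = 1 ∧
      φ s = PowerSeries.X * v ∧ ∀ l ∈ Finset.Icc 1 r, α l = β l * s ^ level m l ∧
        φ (β l) * v ^ level m l * w ^ l = c l := by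
  obtain ⟨v, hv, hφs⟩ := exists_eq_X_mul_of_map_maximalIdeal_eq hφ hs
  obtain ⟨v', hv'⟩ := hv.exists_right_inv
  -- From `s = t v` one gets `ds/s = (1 + t v'/v) dt/t`, where `v'` is the derivative; the constant
  -- term is `1`.
  let w := 1 + PowerSeries.X * (v' * PowerSeries.derivative k v)
  have hw0 : PowerSeries.constantCoeff w = 1 := by simp [w]
  have hw : IsUnit w := by
    rw [PowerSeries.isUnit_iff_constantCoeff, hw0]; exact isUnit_one
  have hX (n : ℕ) : (PowerSeries.X : k⟦X⟧) ^ n ≠ 0 := pow_ne_zero _ PowerSeries.X_ne_zero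
  have hw' : PowerSeries.X * PowerSeries.derivative k (φ s) = φ s * w := by
    rw [hφs, Derivation.leibniz, PowerSeries.derivative_X]
    simp only [smul_eq_mul, w]
    linear_combination -PowerSeries.X ^ 2 * PowerSeries.derivative k v * hv'
  have hφα (j) (hj : j ∈ Finset.Icc 1 r) : φ (α j) * w ^ j = c j * PowerSeries.X ^ level m j := by
    have h := hα j hj
    rw [hw', mul_pow, hφs] at h
    have h0 : (PowerSeries.X * v) ^ j ≠ 0 :=
      pow_ne_zero _ (mul_ne_zero PowerSeries.X_ne_zero hv.ne_zero)
    refine mul_right_cancel₀ h0 ?_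
    linear_combination h
  have hβ (j) : ∃ b, j ∈ Finset.Icc 1 r → α j = b * s ^ level m j := by
    by_cases hj : j ∈ Finset.Icc 1 r
    · have h1 : φ (α j) ∈ Ideal.span {(PowerSeries.X : k⟦X⟧) ^ level m j} := by
        rw [Ideal.mem_span_singleton]
        exact (hw.pow j).dvd_mul_right.mp ⟨c j, by rw [hφα j hj, mul_comm]⟩
      obtain ⟨b, hb⟩ := Ideal.mem_span_singleton'.mp (mem_span_pow_of_mem_span_X_pow hφ hs _ _ h1)
      exact ⟨b, fun _ => hb.symm⟩
    · exact ⟨0, fun h => absurd h hj⟩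
  choose β hβ using hβ
  refine ⟨β, v, w, hv, hw, hw0, hφs, fun l hl => ⟨hβ l hl, ?_⟩⟩
  have h1 := hφα l hl
  rw [hβ l hl, map_mul, map_pow, hφs] at h1
  refine mul_right_cancel₀ (hX (level m l)) ?_
  linear_combination h1

omit hφ hs in
instance isPrecomplete_span_X : IsPrecomplete (Ideal.span {(PowerSeries.X : k⟦X⟧)}) k⟦X⟧ := by
  refine ⟨fun f hf => ⟨PowerSeries.mk fun n => PowerSeries.coeff n (f (n + 1)), fun n => ?_⟩⟩
  have key {x y : k⟦X⟧} {n : ℕ} :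
      x ≡ y [SMOD (Ideal.span {(PowerSeries.X : k⟦X⟧)} ^ n • (⊤ : Submodule k⟦X⟧ k⟦X⟧))] ↔
        ∀ i < n, PowerSeries.coeff i x = PowerSeries.coeff i y := by
    rw [SModEq.sub_mem, smul_eq_mul, Ideal.mul_top, Ideal.span_singleton_pow,
      Ideal.mem_span_singleton, PowerSeries.X_pow_dvd_iff]
    simp only [map_sub, sub_eq_zero]
  refine key.mpr fun i hi => ?_
  rw [PowerSeries.coeff_mk]
  exact ((key.mp (hf (show i + 1 ≤ n from hi))) i (Nat.lt_succ_self i)).symm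

end FormalCoordinate

end

end ParabolicSpectral



namespace ParabolicSpectral

noncomputable section

/-! ### Derivations with bounded poles on a discrete valuation ring -/

section LocalDerivations

variable {k O K : Type*} [Field k] [CommRing O] [IsDomain O] [Algebra k O] [Field K] [Algebra O K]
  [Algebra k K] [IsScalarTower k O K] [IsFractionRing O K]

lemma exists_common_denominator {s : O} (hs : ∀ x : O, x ≠ 0 → ∃ (n : ℕ) (w : O), IsUnit w ∧
    x = w * s ^ n) (G : Finset K) :
    ∃ N : ℕ, ∀ z ∈ G, ∃ g : O, algebraMap O K s ^ N * z = algebraMap O K g := by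
  classical
  induction G using Finset.induction_on with
  | empty => exact ⟨0, by simp⟩
  | insert z G _ ih =>
    obtain ⟨N, hN⟩ := ih
    obtain ⟨a, b, hb, rfl⟩ := IsFractionRing.div_surjective (A := O) z
    obtain ⟨n, w, hw, rfl⟩ := hs b (nonZeroDivisors.ne_zero hb)
    obtain ⟨w', hw'⟩ := hw.exists_right_inv
    have hb0 := IsFractionRing.to_map_ne_zero_of_mem_nonZeroDivisors (K := K) hb
    refine ⟨N + n, fun y hy => ?_⟩
    rcases Finset.mem_insert.mp hy with rfl | hy
    · refine ⟨s ^ N * w' * a, ?_⟩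
      rw [mul_div_assoc', div_eq_iff hb0]
      simp only [← map_pow, ← map_mul]
      congr 1
      linear_combination -s ^ (N + n) * a * hw'
    · obtain ⟨g, hg⟩ := hN y hy
      refine ⟨s ^ n * g, ?_⟩
      rw [pow_add, mul_right_comm, hg, map_mul, map_pow, mul_comm]

/-- A rational vector field has a pole of bounded order on a local ring of finite type. -/
lemma exists_pow_mul_derivation_eq {s : O} (hs : ∀ x : O, x ≠ 0 → ∃ (n : ℕ) (w : O), IsUnit w ∧
    x = w * s ^ n) (G : Finset O) (hG : ∀ x : O, ∃ b ∈ Algebra.adjoin k (G : Set O),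
      ∃ t ∈ Algebra.adjoin k (G : Set O), IsUnit t ∧ x * t = b) (d : Derivation k K K) :
    ∃ N : ℕ, ∀ f : O, ∃ g : O, algebraMap O K s ^ N * d (algebraMap O K f) = algebraMap O K g := by
  classical
  obtain ⟨N, hN⟩ := exists_common_denominator (K := K) hs
    (G.image fun g => d (algebraMap O K g))
  have hadj (f : O) (hf : f ∈ Algebra.adjoin k (G : Set O)) :
      ∃ g : O, algebraMap O K s ^ N * d (algebraMap O K f) = algebraMap O K g := by
    induction hf using Algebra.adjoin_induction with
    | mem x hx => exact hN _ (Finset.mem_image_of_mem _ hx)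
    | algebraMap a =>
      refine ⟨0, ?_⟩
      rw [← IsScalarTower.algebraMap_apply, d.map_algebraMap, mul_zero, map_zero]
    | add x y _ _ hx hy =>
      obtain ⟨x', hx⟩ := hx
      obtain ⟨y', hy⟩ := hy
      exact ⟨x' + y', by rw [map_add, map_add, mul_add, hx, hy, map_add]⟩
    | mul x y _ _ hx hy =>
      obtain ⟨x', hx⟩ := hx
      obtain ⟨y', hy⟩ := hy
      refine ⟨x * y' + y * x', ?_⟩
      rw [map_mul, Derivation.leibniz, map_add, map_mul, map_mul, ← hx, ← hy]
      simp only [smul_eq_mul]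
      ring
  refine ⟨N, fun f => ?_⟩
  obtain ⟨b, hb, t, ht, htu, h⟩ := hG f
  obtain ⟨b', hb'⟩ := hadj b hb
  obtain ⟨c', hc'⟩ := hadj t ht
  obtain ⟨w, hw⟩ := htu.exists_right_inv
  refine ⟨w * (b' - f * c'), ?_⟩
  have h1 := congr(d (algebraMap O K $h))
  rw [map_mul, Derivation.leibniz] at h1
  have h2 := congr(algebraMap O K $hw)
  rw [map_mul, map_one] at h2
  simp only [smul_eq_mul] at h1
  rw [map_mul, map_sub, map_mul, ← hb', ← hc', ← h1]
  linear_combination -(algebraMap O K s ^ N * d (algebraMap O K f)) * h2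

variable [IsLocalRing O] [IsNoetherianRing O] {s : O}
  (hs : IsLocalRing.maximalIdeal O = Ideal.span {s}) (hs0 : s ≠ 0)
  (hk : ∀ f : O, ∃ (a : k) (g : O), f = algebraMap k O a + s * g) {d : Derivation k K K} {N : ℕ}
  (hN : ∀ f : O, ∃ g : O, algebraMap O K s ^ N * d (algebraMap O K f) = algebraMap O K g)

include hk hN in
omit [IsDomain O] [IsFractionRing O K] [IsLocalRing O] [IsNoetherianRing O] in
-- Writing `f = a + s g` gives `d f = s g + s d g`. Iterating puts an arbitrarily high power of `s`
-- in front of the remaining derivative, which absorbs its bounded pole.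
lemma exists_derivation_eq_mul (hd : d (algebraMap O K s) = algebraMap O K s) (f : O) :
    ∃ g : O, d (algebraMap O K f) = algebraMap O K (s * g) := by
  have key (n : ℕ) : ∃ p g : O, d (algebraMap O K f) =
      algebraMap O K (s * p) + algebraMap O K s ^ n * d (algebraMap O K g) := by
    induction n with
    | zero => exact ⟨0, f, by simp⟩
    | succ n ih =>
      obtain ⟨p, g, h⟩ := ih
      obtain ⟨a, g', rfl⟩ := hk g
      refine ⟨p + s ^ n * g', g', ?_⟩
      rw [h, map_add, map_add, ← IsScalarTower.algebraMap_apply, d.map_algebraMap,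
        map_mul _ s g', Derivation.leibniz, hd]
      simp only [map_mul, map_add, map_pow, smul_eq_mul]
      ring
  obtain ⟨p, g, h⟩ := key (N + 1)
  obtain ⟨g', hg'⟩ := hN g
  refine ⟨p + g', ?_⟩
  rw [h, pow_succ, mul_right_comm, hg', mul_add, map_add, map_mul, map_mul]
  ring

include hs hs0 hk hN in
omit [IsDomain O] in
-- The same expansion gives `d f = s^n d g` for every `n`. As the poles are bounded, `s^N d f` lies
-- in all powers of the maximal ideal.
lemma derivation_eq_zero_of_map_eq_zero (hd : d (algebraMap O K s) = 0) : d = 0 := by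
  have hs0' : algebraMap O K s ≠ 0 := (map_ne_zero_iff _ (IsFractionRing.injective O K)).mpr hs0
  have hO (f : O) : d (algebraMap O K f) = 0 := by
    have key (n : ℕ) : ∃ g : O, d (algebraMap O K f) =
        algebraMap O K s ^ n * d (algebraMap O K g) := by
      induction n with
      | zero => exact ⟨f, by simp⟩
      | succ n ih =>
        obtain ⟨g, h⟩ := ih
        obtain ⟨a, g', rfl⟩ := hk g
        refine ⟨g', ?_⟩
        rw [h, map_add, map_add, ← IsScalarTower.algebraMap_apply, d.map_algebraMap, map_mul,
          Derivation.leibniz, hd]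
        simp only [smul_eq_mul]
        ring
    obtain ⟨F, hF⟩ := hN f
    have hmem : F ∈ ⨅ n : ℕ, IsLocalRing.maximalIdeal O ^ n := by
      rw [Ideal.mem_iInf]
      intro n
      obtain ⟨g, hg⟩ := key n
      obtain ⟨g', hg'⟩ := hN g
      rw [hs, Ideal.span_singleton_pow, Ideal.mem_span_singleton]
      refine ⟨g', IsFractionRing.injective O K ?_⟩
      rw [← hF, hg, map_mul, ← hg', map_pow]
      ring
    rw [Ideal.iInf_pow_eq_bot_of_isLocalRing _ Ideal.IsPrime.ne_top', Ideal.mem_bot] at hmem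
    rw [hmem, map_zero] at hF
    exact (mul_eq_zero_iff_left (pow_ne_zero _ hs0')).mp hF
  ext z
  obtain ⟨a, b, hb, rfl⟩ := IsFractionRing.div_surjective (A := O) z
  have hb0 := IsFractionRing.to_map_ne_zero_of_mem_nonZeroDivisors (K := K) hb
  have h1 : d (algebraMap O K a / algebraMap O K b * algebraMap O K b) = 0 := by
    rw [div_mul_cancel₀ _ hb0, hO]
  rw [Derivation.leibniz, hO, smul_zero, zero_add, smul_eq_mul] at h1
  exact (mul_eq_zero_iff_left hb0).mp h1

end LocalDerivations

end

end ParabolicSpectral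



namespace ParabolicSpectral

noncomputable section

/-! ### Scalars and residue fields of a `k`-scheme -/

section ResidueFields

lemma exists_mul_germ_eq {Z : Scheme.{u}} {W : Z.Opens} (hW : IsAffineOpen W) {y : Z} (hy : y ∈ W)
    (o : Z.presheaf.stalk y) : ∃ b t, IsUnit (Z.presheaf.germ W y hy t) ∧
      o * Z.presheaf.germ W y hy t = Z.presheaf.germ W y hy b := by
  let := Z.presheaf.algebra_section_stalk ⟨y, hy⟩
  have h1 : IsLocalization.AtPrime (Z.presheaf.stalk y) (hW.primeIdealOf ⟨y, hy⟩).asIdeal :=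
    hW.isLocalization_stalk ⟨y, hy⟩
  obtain ⟨⟨b, t⟩, h⟩ := IsLocalization.surj (hW.primeIdealOf ⟨y, hy⟩).asIdeal.primeCompl o
  exact ⟨b, t, IsLocalization.map_units (Z.presheaf.stalk y) t, h⟩

variable {k : Type u} [Field k] {Z : Scheme.{u}} (f : Z ⟶ Spec (.of k))

/-- The structure map of a `k`-scheme on sections. -/
def sectionHom (W : Z.Opens) : k →+* Γ(Z, W) :=
  ((Scheme.ΓSpecIso (.of k)).inv ≫ f.appLE ⊤ W le_top).hom

/-- The structure map of a `k`-scheme on stalks. -/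
def stalkHom (z : Z) : k →+* Z.presheaf.stalk z :=
  ((Scheme.ΓSpecIso (.of k)).inv ≫ f.appTop ≫ Z.presheaf.germ ⊤ z trivial).hom

@[simp] lemma germ_sectionHom {W : Z.Opens} {z : Z} (hz : z ∈ W) (a : k) :
    Z.presheaf.germ W z hz (sectionHom f W a) = stalkHom f z a := by
  have e : ((Scheme.ΓSpecIso (.of k)).inv ≫ f.appLE ⊤ W le_top) ≫ Z.presheaf.germ W z hz =
      (Scheme.ΓSpecIso (.of k)).inv ≫ f.appTop ≫ Z.presheaf.germ ⊤ z trivial := by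
    simp only [Scheme.Hom.appLE, Category.assoc]
    rw [Z.presheaf.germ_res]
    rfl
  exact congr($(e).hom a)

lemma finiteType_sectionHom [LocallyOfFiniteType f] {W : Z.Opens} (hW : IsAffineOpen W) :
    (sectionHom f W).FiniteType := by
  have h1 := f.finiteType_appLE (isAffineOpen_top _) hW le_top
  refine RingHom.FiniteType.comp h1 (RingHom.FiniteType.of_surjective _ ?_)
  exact (ConcreteCategory.bijective_of_isIso (Scheme.ΓSpecIso (.of k)).inv).2

/-- The residue field at the point of `Spec k` is a copy of `k`; `e` is the comparison, under which
the residue field map becomes the structure map. -/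
lemma exists_residueFieldMap_eq (z : Z) :
    ∃ e : k →+* (Spec (.of k)).residueField (f z), Function.Surjective e ∧
      ∀ a, f.residueFieldMap z (e a) = Z.residue z (stalkHom f z a) := by
  let i := (Scheme.ΓSpecIso (.of k)).inv
  have hi : Function.Bijective i := ConcreteCategory.bijective_of_isIso _
  refine ⟨(i ≫ (Spec (.of k)).presheaf.germ ⊤ (f z) trivial ≫
    (Spec (.of k)).residue (f z)).hom, ?_, fun a => ?_⟩
  · intro b
    obtain ⟨b, rfl⟩ := (Spec (.of k)).residue_surjective (f z) b
    obtain ⟨c, t, ht, h⟩ := exists_mul_germ_eq (isAffineOpen_top (Spec (.of k)))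
      (y := f z) trivial b
    obtain ⟨c, rfl⟩ := hi.2 c
    obtain ⟨t, rfl⟩ := hi.2 t
    have ht0 : t ≠ 0 := by
      rintro rfl
      rw [map_zero, map_zero] at ht
      exact not_isUnit_zero ht
    refine ⟨c * t⁻¹, ?_⟩
    change (Spec (.of k)).residue (f z) _ = _
    congr 1
    refine ht.mul_right_cancel ?_
    rw [h]
    change (Spec (.of k)).presheaf.germ ⊤ (f z) trivial (i (c * t⁻¹)) * _ = _
    rw [← map_mul, ← map_mul, inv_mul_cancel_right₀ ht0]
  · have e : (i ≫ (Spec (.of k)).presheaf.germ ⊤ (f z) trivial ≫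
        (Spec (.of k)).residue (f z)) ≫ f.residueFieldMap z =
        ((Scheme.ΓSpecIso (.of k)).inv ≫ f.appTop ≫ Z.presheaf.germ ⊤ z trivial) ≫
          Z.residue z := by
      simp only [Category.assoc]
      rw [Scheme.residue_residueFieldMap]
      exact congr(i ≫ $(Scheme.Hom.germ_stalkMap_assoc f ⊤ z trivial (Z.residue z)))
    exact congr($(e).hom a)

lemma exists_sub_stalkHom_mem {z : Z} (h : f.residueDegree z = 1) (b : Z.presheaf.stalk z) :
    ∃ a, b - stalkHom f z a ∈ IsLocalRing.maximalIdeal (Z.presheaf.stalk z) := by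
  obtain ⟨e, he, hf⟩ := exists_residueFieldMap_eq f z
  let := (f.residueFieldMap z).hom.toAlgebra
  have h1 : Module.finrank ((Spec (.of k)).residueField (f z)) (Z.residueField z) = 1 := h
  have h2 := Algebra.finrank_eq_one_iff_bijective_algebraMap.mp h1
  obtain ⟨y, hy⟩ := h2.2 (Z.residue z b)
  obtain ⟨a, rfl⟩ := he y
  refine ⟨a, ?_⟩
  have h3 : Z.residue z (b - stalkHom f z a) = 0 := by
    rw [map_sub, ← hf, sub_eq_zero]
    exact hy.symm
  exact Ideal.Quotient.eq_zero_iff_mem.mp h3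

end ResidueFields

end

end ParabolicSpectral



namespace ParabolicSpectral

noncomputable section

/-! ### Vector fields vanishing along `D` -/

section LogFields

variable {k : Type u} [Field k] {X : Scheme.{u}} [X.Over (Spec (.of k))]

lemma algebraMap_stalk_eq (x : X) (a : k) :
    algebraMap k (X.presheaf.stalk x) a = stalkHom (X ↘ Spec (.of k)) x a := rfl

variable [IsIntegral X]

instance isScalarTower_stalk_functionField (x : X) :
    IsScalarTower k (X.presheaf.stalk x) X.functionField := by
  refine .of_algebraMap_eq fun a => ?_
  rw [algebraMap_stalk_eq, algebraMap_stalk_eq, ← germ_sectionHom _ (Opens.mem_top _),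
    ← germ_sectionHom _ (Opens.mem_top _)]
  have : Nonempty (⊤ : X.Opens) := ⟨⟨x, trivial⟩⟩
  exact (X.algebraMap_germ_eq_germToFunctionField (Opens.mem_top x) _).symm

lemma genericPoint_mem_of_mem {U : X.Opens} {x : X} (hx : x ∈ U) : genericPoint X ∈ U :=
  ((genericPoint_spec X).mem_open_set_iff U.isOpen).mpr ⟨x, trivial, hx⟩

lemma algebraMap_germ {U : X.Opens} {x : X} (hx : x ∈ U) (f : Γ(X, U)) :
    algebraMap (X.presheaf.stalk x) X.functionField (X.presheaf.germ U x hx f) =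
      X.presheaf.germ U _ (genericPoint_mem_of_mem hx) f := by
  have : Nonempty U := ⟨⟨x, hx⟩⟩
  exact X.algebraMap_germ_eq_germToFunctionField hx f

variable [LocallyOfFiniteType (X ↘ Spec (.of k))]

omit [IsIntegral X] in
-- Finite generation over `k`, phrased as an induction principle on sections.
lemma exists_finset_adjoin {U : X.Opens} (hU : IsAffineOpen U) :
    ∃ G : Finset Γ(X, U), ∀ P : Γ(X, U) → Prop, (∀ g ∈ G, P g) →
      (∀ a, P (sectionHom (X ↘ Spec (.of k)) U a)) → (∀ f g, P f → P g → P (f + g)) →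
      (∀ f g, P f → P g → P (f * g)) → ∀ f, P f := by
  let := (sectionHom (X ↘ Spec (.of k)) U).toAlgebra
  obtain ⟨⟨G, hG⟩⟩ : Algebra.FiniteType k Γ(X, U) := finiteType_sectionHom (X ↘ Spec (.of k)) hU
  refine ⟨G, fun P h1 h2 h3 h4 f => ?_⟩
  have hf : f ∈ Algebra.adjoin k (G : Set Γ(X, U)) := hG ▸ Algebra.mem_top
  induction hf using Algebra.adjoin_induction with
  | mem x hx => exact h1 x hx
  | algebraMap a => exact h2 a
  | add x y _ _ hx hy => exact h3 x y hx hy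
  | mul x y _ _ hx hy => exact h4 x y hx hy

omit [IsIntegral X] in
lemma exists_finset_stalk (x : X) : ∃ G : Finset (X.presheaf.stalk x), ∀ o : X.presheaf.stalk x,
    ∃ b ∈ Algebra.adjoin k (G : Set (X.presheaf.stalk x)),
      ∃ t ∈ Algebra.adjoin k (G : Set (X.presheaf.stalk x)), IsUnit t ∧ o * t = b := by
  classical
  obtain ⟨_, ⟨U, hU, rfl⟩, hx, -⟩ := X.isBasis_affineOpens.exists_subset_of_mem_open
    (Set.mem_univ x) isOpen_univ
  obtain ⟨G, hG⟩ := exists_finset_adjoin (k := k) hU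
  refine ⟨G.image (X.presheaf.germ U x hx), fun o => ?_⟩
  have hmem : ∀ f, X.presheaf.germ U x hx f ∈ Algebra.adjoin k
      ((G.image (X.presheaf.germ U x hx) : Finset (X.presheaf.stalk x)) : Set _) := by
    refine hG _ (fun g hg => ?_) (fun a => ?_) (fun f g hf hg => ?_) fun f g hf hg => ?_
    · exact Algebra.subset_adjoin (Finset.mem_image_of_mem _ hg)
    · rw [germ_sectionHom]; exact Subalgebra.algebraMap_mem _ a
    · rw [map_add]; exact add_mem hf hg
    · rw [map_mul]; exact mul_mem hf hg
  obtain ⟨b, t, ht, h⟩ := exists_mul_germ_eq hU hx o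
  exact ⟨_, hmem b, _, hmem t, ht, h⟩

/-- A uniformizer `s` at `x`, with its vector field `s ∂/∂s`. -/
structure IsLogUniformizer (x : X) (s : X.presheaf.stalk x)
    (ε : Derivation k X.functionField X.functionField) : Prop where
  maximalIdeal_eq : IsLocalRing.maximalIdeal (X.presheaf.stalk x) = Ideal.span {s}
  ne_zero : s ≠ 0
  derivation : ε (algebraMap _ _ s) = algebraMap _ _ s
  residue (f : X.presheaf.stalk x) : ∃ a : k,
    f - algebraMap k _ a ∈ IsLocalRing.maximalIdeal (X.presheaf.stalk x)

namespace IsLogUniformizer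

variable {x : X} {s : X.presheaf.stalk x} {ε : Derivation k X.functionField X.functionField}
  (h : IsLogUniformizer x s ε)

include h

omit [LocallyOfFiniteType (X ↘ Spec (.of k))] in
lemma exists_eq_add_mul (f : X.presheaf.stalk x) :
    ∃ (a : k) (g : X.presheaf.stalk x), f = algebraMap k _ a + s * g := by
  obtain ⟨a, ha⟩ := h.residue f
  rw [h.maximalIdeal_eq] at ha
  obtain ⟨g, hg⟩ := Ideal.mem_span_singleton'.mp ha
  exact ⟨a, g, by linear_combination -hg⟩

variable [IsNoetherianRing (X.presheaf.stalk x)]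

lemma exists_pow_mul_eq (d : Derivation k X.functionField X.functionField) :
    ∃ N : ℕ, ∀ f : X.presheaf.stalk x, ∃ g : X.presheaf.stalk x,
      algebraMap _ X.functionField s ^ N * d (algebraMap _ X.functionField f) =
        algebraMap _ X.functionField g := by
  obtain ⟨G, hG⟩ := exists_finset_stalk (k := k) x
  exact exists_pow_mul_derivation_eq
    (fun y hy => exists_eq_mul_pow_of_maximalIdeal_eq_span h.maximalIdeal_eq hy) G hG d

lemma exists_eq_mul (f : X.presheaf.stalk x) : ∃ g : X.presheaf.stalk x,
    ε (algebraMap _ X.functionField f) = algebraMap _ X.functionField (s * g) := by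
  obtain ⟨N, hN⟩ := h.exists_pow_mul_eq ε
  exact exists_derivation_eq_mul h.exists_eq_add_mul hN h.derivation f

/-- `δ` and `(δ(s)/s) ε` agree on `s`, and a derivation with bounded pole is determined by its value
on a uniformizer. -/
lemma exists_eq_smul {δ : Derivation k X.functionField X.functionField} (hδ : δ ≠ 0) :
    ∃ h1 : X.functionField, h1 ≠ 0 ∧ δ = h1 • ε := by
  have hs0 : algebraMap _ X.functionField s ≠ 0 :=
    (map_ne_zero_iff _ (IsFractionRing.injective _ _)).mpr h.ne_zero
  let h1 := δ (algebraMap _ X.functionField s) / algebraMap _ X.functionField s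
  have h2 : δ = h1 • ε := by
    obtain ⟨N, hN⟩ := h.exists_pow_mul_eq (δ - h1 • ε)
    refine sub_eq_zero.mp (derivation_eq_zero_of_map_eq_zero h.maximalIdeal_eq h.ne_zero
      h.exists_eq_add_mul hN ?_)
    rw [Derivation.sub_apply, Derivation.smul_apply, h.derivation, smul_eq_mul,
      div_mul_cancel₀ _ hs0, sub_self]
  refine ⟨h1, fun h0 => hδ ?_, h2⟩
  rw [h2, h0, zero_smul]

/-- Sections of `T_X(-D)` are regular multiples of `ε` at a point of `D`. -/
lemma exists_of_logField {D : Finset X} (hxD : x ∈ D) {U : X.Opens} (hU : IsAffineOpen U)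
    (hx : x ∈ U) {b : X.functionField} (hb : LogField D U (b • ε)) :
    ∃ o : X.presheaf.stalk x, algebraMap _ X.functionField o = b := by
  have hinj := IsFractionRing.injective (X.presheaf.stalk x) X.functionField
  have hs0 : algebraMap _ X.functionField s ≠ 0 := (map_ne_zero_iff _ hinj).mpr h.ne_zero
  obtain ⟨f, t, ht, hf⟩ := exists_mul_germ_eq hU hx s
  obtain ⟨t', ht'⟩ := h.exists_eq_mul (X.presheaf.germ U x hx t)
  obtain ⟨g, hg, hgD⟩ := hb (genericPoint_mem_of_mem hx) f
  have hg' := hgD x hxD hx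
  rw [h.maximalIdeal_eq] at hg'
  obtain ⟨o, ho⟩ := Ideal.mem_span_singleton'.mp hg'
  rw [← algebraMap_germ hx, ← algebraMap_germ hx, ← ho, ← hf, map_mul, map_mul,
    Derivation.smul_apply, Derivation.leibniz, h.derivation, ht', map_mul] at hg
  -- For `f = s t` one has `ε(f) = s (t + s t')`, that is, `s` times a unit; since `b ε(f)` vanishes
  -- at `x`, the factor `b` is regular there.
  have hu : IsUnit (X.presheaf.germ U x hx t + s * t') := by
    by_contra hu
    have h1 : s * t' ∈ IsLocalRing.maximalIdeal (X.presheaf.stalk x) := by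
      rw [h.maximalIdeal_eq]; exact Ideal.mul_mem_right _ _ (Ideal.mem_span_singleton_self s)
    have h2 := sub_mem ((IsLocalRing.mem_maximalIdeal _).mpr hu) h1
    rw [add_sub_cancel_right] at h2
    exact h2 ht
  obtain ⟨w, hw⟩ := hu.exists_right_inv
  refine ⟨o * w, mul_left_cancel₀ hs0 ?_⟩
  have hw' := congr(algebraMap _ X.functionField $hw)
  simp only [map_mul, map_add, map_one, smul_eq_mul] at hw' hg ⊢
  linear_combination algebraMap _ X.functionField w * hg +
    b * algebraMap _ X.functionField s * hw'

omit h [IsNoetherianRing (X.presheaf.stalk x)] [LocallyOfFiniteType (X ↘ Spec (.of k))]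
  [IsIntegral X] in
-- Suppose every function vanishing at the rational point `x'` vanishes at `x`. Subtracting from a
-- function its value at `x'` shows that the same functions are invertible at both points.
lemma exists_germ_mem_of_ne {U : X.Opens} (hU : IsAffineOpen U) (hx : x ∈ U) {x' : X}
    (hx' : x' ∈ U) (hne : x' ≠ x) (hdeg : (X ↘ Spec (.of k)).residueDegree x' = 1) :
    ∃ f, IsUnit (X.presheaf.germ U x hx f) ∧
      X.presheaf.germ U x' hx' f ∈ IsLocalRing.maximalIdeal (X.presheaf.stalk x') := by
  by_contra! hcon
  refine hne (eq_of_isUnit_germ_iff hU hx' hx fun c => ⟨fun hc => ?_, fun hc => ?_⟩)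
  · obtain ⟨a, ha⟩ := exists_sub_stalkHom_mem (X ↘ Spec (.of k)) hdeg (X.presheaf.germ U x' hx' c)
    have ha0 : a ≠ 0 := by
      rintro rfl
      rw [map_zero, sub_zero] at ha
      exact ha hc
    rw [← germ_sectionHom _ hx', ← map_sub] at ha
    have h1 : X.presheaf.germ U x hx (c - sectionHom (X ↘ Spec (.of k)) U a) ∈
        IsLocalRing.maximalIdeal (X.presheaf.stalk x) := by
      by_contra h1
      exact hcon _ (not_not.mp h1) ha
    by_contra h2
    have h3 := sub_mem (show X.presheaf.germ U x hx c ∈ _ from h2) h1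
    rw [map_sub, sub_sub_cancel] at h3
    exact h3 (((IsUnit.mk0 a ha0).map (sectionHom (X ↘ Spec (.of k)) U)).map
      (X.presheaf.germ U x hx).hom)
  · exact not_not.mp fun h1 => hcon c hc h1

/-- A multiple of `ε` by a function which does not vanish at `x` is a section of `T_X(-D)`. -/
lemma exists_logField {D : Finset X} (hD : ∀ x ∈ D, (X ↘ Spec (.of k)).residueDegree x = 1)
    {U : X.Opens} (hU : IsAffineOpen U) (hx : x ∈ U) :
    ∃ f, IsUnit (X.presheaf.germ U x hx f) ∧
      LogField D U (X.presheaf.germ U _ (genericPoint_mem_of_mem hx) f • ε) := by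
  classical
  have hη := genericPoint_mem_of_mem hx
  have hinj := IsFractionRing.injective (X.presheaf.stalk x) X.functionField
  obtain ⟨G, hG⟩ := exists_finset_adjoin (k := k) hU
  have hclear (g : Γ(X, U)) : ∃ t b, IsUnit (X.presheaf.germ U x hx t) ∧
      X.presheaf.germ U _ hη t * ε (X.presheaf.germ U _ hη g) = X.presheaf.germ U _ hη b := by
    obtain ⟨g', hg'⟩ := h.exists_eq_mul (X.presheaf.germ U x hx g)
    obtain ⟨b, t, ht, hb⟩ := exists_mul_germ_eq hU hx (s * g')
    refine ⟨t, b, ht, ?_⟩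
    rw [← algebraMap_germ hx, ← algebraMap_germ hx, ← algebraMap_germ hx, hg', ← hb]
    simp only [map_mul]
    ring
  choose t b ht hb using hclear
  have hsep (y : X) : ∃ f, IsUnit (X.presheaf.germ U x hx f) ∧ ∀ (_ : y ∈ D) (hy : y ∈ U),
      y ≠ x → X.presheaf.germ U y hy f ∈ IsLocalRing.maximalIdeal (X.presheaf.stalk y) := by
    by_cases hy : y ∈ D ∧ y ∈ U ∧ y ≠ x
    · obtain ⟨f, hf, hf'⟩ := exists_germ_mem_of_ne hU hx hy.2.1 hy.2.2 (hD y hy.1)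
      exact ⟨f, hf, fun _ _ _ => hf'⟩
    · exact ⟨1, by simp, fun h1 h2 h3 => absurd ⟨h1, h2, h3⟩ hy⟩
  choose e he he' using hsep
  -- `d0` clears the denominators of `ε` on generators of the coordinate ring, and `d1` vanishes at
  -- the other marked points in `U`; both are invertible at `x`.
  let d0 := ∏ g ∈ G, t g
  let d1 := ∏ y ∈ D, e y
  have hd0 : ∀ f, ∃ g, X.presheaf.germ U _ hη g =
      X.presheaf.germ U _ hη d0 * ε (X.presheaf.germ U _ hη f) := by
    refine hG _ (fun g hg => ?_) (fun a => ⟨0, ?_⟩) ?_ ?_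
    · refine ⟨(∏ g' ∈ G.erase g, t g') * b g, ?_⟩
      rw [map_mul, ← hb, ← mul_assoc, ← map_mul, Finset.prod_erase_mul _ _ hg]
    · rw [germ_sectionHom, ← algebraMap_stalk_eq, ε.map_algebraMap, mul_zero, map_zero]
    · rintro f g ⟨f', hf⟩ ⟨g', hg⟩
      exact ⟨f' + g', by rw [map_add, map_add, map_add, hf, hg, mul_add]⟩
    · rintro f g ⟨f', hf⟩ ⟨g', hg⟩
      refine ⟨f * g' + g * f', ?_⟩
      rw [map_add, map_mul, map_mul, map_mul, hf, hg, Derivation.leibniz, smul_eq_mul,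
        smul_eq_mul]
      ring
  refine ⟨d0 * d1, ?_, fun _ f => ?_⟩
  · rw [map_mul, map_prod, map_prod]
    exact (IsUnit.prod_iff.mpr fun g _ => ht g).mul (IsUnit.prod_iff.mpr fun y _ => he y)
  · obtain ⟨g, hg⟩ := hd0 f
    refine ⟨d1 * g, ?_, fun y hyD hy => ?_⟩
    · rw [map_mul, map_mul, hg, Derivation.smul_apply, smul_eq_mul]
      ring
    · by_cases hyx : y = x
      · subst hyx
        obtain ⟨f', hf'⟩ := h.exists_eq_mul (X.presheaf.germ U y hx f)
        have h1 : X.presheaf.germ U y hx g = X.presheaf.germ U y hx d0 * (s * f') := by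
          apply hinj
          rw [algebraMap_germ hx, hg, map_mul, ← hf', algebraMap_germ hx, algebraMap_germ hx]
        rw [map_mul, h1, h.maximalIdeal_eq]
        exact Ideal.mul_mem_left _ _ (Ideal.mul_mem_left _ _
          (Ideal.mul_mem_right _ _ (Ideal.mem_span_singleton_self s)))
      · rw [map_mul]
        refine Ideal.mul_mem_right _ _ ?_
        rw [map_prod, ← Finset.prod_erase_mul _ _ hyD]
        exact Ideal.mul_mem_left _ _ (he' y hyD hy hyx)

end IsLogUniformizer

end LogFields

end

end ParabolicSpectral



namespace ParabolicSpectral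

noncomputable section

/-! ### The spectral curve over a marked point as a chart -/

section LocalModel

open Polynomial

variable {k : Type u} [Field k] {X : Scheme.{u}} [X.Over (Spec (.of k))] [IsIntegral X]

lemma contract_smul (j : ℕ) (h : X.functionField)
    (ε : Derivation k X.functionField X.functionField) (w : RatDiff k X j) :
    contract j (h • ε) w = h ^ j * contract j ε w := by
  have hlift (z) : (h • ε).liftKaehlerDifferential z = h * ε.liftKaehlerDifferential z := by
    have : (h • ε).liftKaehlerDifferential = h • ε.liftKaehlerDifferential := by
      apply Derivation.liftKaehlerDifferential_unique
      ext x
      simp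
    rw [this]; rfl
  have : contract j (h • ε) = h ^ j • contract j ε := by
    refine PiTensorProduct.ext (MultilinearMap.ext fun z => ?_)
    simp only [contract, LinearMap.compMultilinearMap_apply, PiTensorProduct.lift.tprod,
      LinearMap.smul_apply, MultilinearMap.compLinearMap_apply, MultilinearMap.mkPiAlgebra_apply,
      hlift, Finset.prod_mul_distrib, Finset.prod_const, Finset.card_univ, Fintype.card_fin,
      smul_eq_mul]
  rw [this]; rfl

variable {r : ℕ} {m : Composition r} {a : ∀ j, RatDiff k X j} {x : X} {s : X.presheaf.stalk x}
  {ε : Derivation k X.functionField X.functionField} {β : ℕ → X.presheaf.stalk x}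
  (hβ : ∀ l ∈ Finset.Icc 1 r, algebraMap _ X.functionField (β l * s ^ level m l) =
    contract l ε (a l))
  {h1 : X.functionField} (hh1 : h1 ≠ 0)

include hβ hh1

omit hh1 in
-- The coordinates attached to `δ = h1 ε` and to `ε` satisfy `T = h1 λ`, and `a_l` evaluated on `δ`
-- is `h1^l` times its value on `ε`.
lemma charPoly_smul_comp :
    (charPoly r a (h1 • ε)).comp (C h1 * Polynomial.X) =
      C (h1 ^ r) * (spectralPoly m s β).map (algebraMap _ X.functionField) := by
  rw [charPoly, spectralPoly, add_comp, Polynomial.map_add, mul_add]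
  congr 1
  · simp [mul_pow]
  · rw [Polynomial.sum_comp, Polynomial.map_sum, Finset.mul_sum]
    refine Finset.sum_congr rfl fun l hl => ?_
    have hl' := (Finset.mem_Icc.mp hl).2
    rw [contract_smul, ← hβ l hl, mul_comp, C_comp, pow_comp, X_comp, Polynomial.map_mul, map_C,
      Polynomial.map_pow, map_X, mul_pow, C_mul]
    have hp : h1 ^ r = h1 ^ l * h1 ^ (r - l) := by rw [← pow_add, Nat.add_sub_cancel' hl']
    rw [hp]
    simp only [C_mul, C_pow]
    ring

omit hβ in
lemma of_mul_of_inv : AdjoinRoot.of (charPoly r a (h1 • ε)) h1 *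
    AdjoinRoot.of (charPoly r a (h1 • ε)) h1⁻¹ = 1 := by
  rw [← map_mul, mul_inv_cancel₀ hh1, map_one]

lemma eval₂_spectralPoly_root :
    (spectralPoly m s β).eval₂ ((AdjoinRoot.of (charPoly r a (h1 • ε))).comp
      (algebraMap _ X.functionField))
      (AdjoinRoot.of (charPoly r a (h1 • ε)) h1⁻¹ * AdjoinRoot.root _) = 0 := by
  have h := congr(eval₂ (AdjoinRoot.of (charPoly r a (h1 • ε)))
    (AdjoinRoot.of (charPoly r a (h1 • ε)) h1⁻¹ * AdjoinRoot.root _)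
      $(charPoly_smul_comp (m := m) (h1 := h1) hβ))
  rw [eval₂_comp, eval₂_mul, eval₂_mul, eval₂_C, eval₂_X, eval₂_C, eval₂_map, ← mul_assoc,
    of_mul_of_inv hh1, one_mul, AdjoinRoot.eval₂_root] at h
  have hu : IsUnit (AdjoinRoot.of (charPoly r a (h1 • ε)) (h1 ^ r)) :=
    (IsUnit.mk0 _ (pow_ne_zero r hh1)).map _
  exact (hu.mul_right_eq_zero).mp h.symm

/-- The local ring of the spectral curve, in the ring of functions on the generic fibre. -/
def chartToGenericFibre : ChartRing m s β 0 →+* AdjoinRoot (charPoly r a (h1 • ε)) :=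
  chartLift m ((AdjoinRoot.of (charPoly r a (h1 • ε))).comp (algebraMap _ X.functionField))
    (AdjoinRoot.of (charPoly r a (h1 • ε)) h1⁻¹ * AdjoinRoot.root _)
    (AdjoinRoot.of (charPoly r a (h1 • ε)) (algebraMap _ X.functionField s))
    (by rw [pow_zero, one_mul]; rfl)
    (by rw [← eval₂_spectralPoly_root (m := m) hβ hh1, eval₂_spectralPoly]; rfl)

lemma chartToGenericFibre_algebraMap (y : X.presheaf.stalk x) :
    chartToGenericFibre (m := m) hβ hh1 (algebraMap _ _ y) =
      AdjoinRoot.of (charPoly r a (h1 • ε)) (algebraMap _ X.functionField y) :=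
  chartLift_algebraMap ..

lemma chartToGenericFibre_lam :
    chartToGenericFibre (m := m) hβ hh1 (chartLam m s β 0) =
      AdjoinRoot.of (charPoly r a (h1 • ε)) h1⁻¹ * AdjoinRoot.root _ :=
  chartLift_lam ..

lemma chartToGenericFibre_aeval (p : (X.presheaf.stalk x)[X]) :
    chartToGenericFibre (m := m) hβ hh1 (aeval (chartLam m s β 0) p) =
      AdjoinRoot.mk (charPoly r a (h1 • ε))
        ((p.map (algebraMap _ X.functionField)).comp (C h1⁻¹ * Polynomial.X)) := by
  induction p using Polynomial.induction_on' with
  | add p q hp hq => rw [map_add, map_add, hp, hq, Polynomial.map_add, add_comp, map_add]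
  | monomial n y =>
    rw [aeval_monomial, map_mul, map_pow, chartToGenericFibre_algebraMap,
      chartToGenericFibre_lam, map_monomial, ← C_mul_X_pow_eq_monomial, mul_comp, C_comp, pow_comp,
      X_comp, map_mul, map_pow, map_mul, AdjoinRoot.mk_C, AdjoinRoot.mk_C, AdjoinRoot.mk_X]

/-- A polynomial of degree less than `r` in `λ` remains, after rescaling, below the degree of
`charPoly`, so it cannot be a nonzero multiple of it. -/
lemma chartToGenericFibre_injective (hr : 0 < r) :
    Function.Injective (chartToGenericFibre (m := m) hβ hh1) := by
  rw [injective_iff_map_eq_zero]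
  intro z hz
  obtain ⟨p, hp, rfl⟩ := exists_aeval_lam_eq z
  have hP : (charPoly r a (h1 • ε)).degree = r := by
    rw [charPoly, degree_add_eq_left_of_degree_lt, degree_X_pow]
    rw [degree_X_pow]
    refine (degree_sum_le _ _).trans_lt ((Finset.sup_lt_iff (WithBot.bot_lt_coe r)).mpr ?_)
    intro l hl
    rw [Finset.mem_Icc] at hl
    exact (degree_C_mul_X_pow_le _ _).trans_lt (Nat.cast_lt.mpr (by lia))
  have h2 : AdjoinRoot.mk (charPoly r a (h1 • ε))
      ((p.map (algebraMap _ X.functionField)).comp (C h1⁻¹ * Polynomial.X)) = 0 := by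
    rw [← hz, chartToGenericFibre_aeval]
  rw [AdjoinRoot.mk_eq_zero] at h2
  have h3 : ((p.map (algebraMap _ X.functionField)).comp (C h1⁻¹ * Polynomial.X)) = 0 := by
    refine eq_zero_of_dvd_of_degree_lt h2 ?_
    rw [hP]
    refine (degree_le_natDegree).trans_lt ?_
    rw [natDegree_comp]
    rw [natDegree_C_mul_X _ (inv_ne_zero hh1), mul_one]
    refine lt_of_le_of_lt (Nat.cast_le.mpr natDegree_map_le) ?_
    by_cases hp0 : p = 0
    · rw [hp0]; exact_mod_cast hr
    · rwa [← degree_eq_natDegree hp0]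
  have h4 : p.map (algebraMap _ X.functionField) = 0 := by
    have h5 := congr(($h3).comp (C h1 * Polynomial.X))
    rw [comp_assoc, mul_comp, C_comp, X_comp, ← mul_assoc, ← C_mul, inv_mul_cancel₀ hh1, C_1,
      one_mul, comp_X, zero_comp] at h5
    exact h5
  rw [(Polynomial.map_eq_zero_iff (IsFractionRing.injective _ _)).mp h4, map_zero]

variable [LocallyOfFiniteType (X ↘ Spec (.of k))] [IsNoetherianRing (X.presheaf.stalk x)]

/-- The local ring of the spectral curve over `x` is a localization of the coordinate ring of the
part of the spectral curve over an affine neighbourhood of `x`. -/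
lemma IsLogUniformizer.exists_chartRing_hom (h : IsLogUniformizer x s ε) (hr : 0 < r)
    {D : Finset X} (hD : ∀ x ∈ D, (X ↘ Spec (.of k)).residueDegree x = 1) (hxD : x ∈ D)
    {U : X.Opens} (hU : IsAffineOpen U) (hx : x ∈ U) :
    ∃ i : Γ(spectralCurve D r a (h1 • ε), spectralCurveMap D r a (h1 • ε) ⁻¹ᵁ U) →+*
        ChartRing m s β 0, Function.Injective i ∧
      (∀ f, i ((spectralCurveMap D r a (h1 • ε)).app U f) =
        algebraMap _ _ (X.presheaf.germ U x hx f)) ∧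
      ∀ z, ∃ d f, IsUnit (X.presheaf.germ U x hx d) ∧
        algebraMap _ _ (X.presheaf.germ U x hx d) * z = i f := by
  have hη := genericPoint_mem_of_mem hx
  obtain ⟨E, hE, hrange, hEf⟩ := exists_spectralCurve_hom D r a (h1 • ε) hU hη
  let j := chartToGenericFibre (m := m) hβ hh1
  have hj : Function.Injective j := chartToGenericFibre_injective hβ hh1 hr
  have hjO (f : Γ(X, U)) : j (algebraMap _ _ (X.presheaf.germ U x hx f)) =
      AdjoinRoot.of (charPoly r a (h1 • ε)) (X.presheaf.germ U _ hη f) := by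
    rw [← algebraMap_germ hx]
    exact chartToGenericFibre_algebraMap hβ hh1 _
  -- A section `b h1 ε` of `T_X(-D)` has `b h1` regular at `x`, so the generator `b T = (b h1) λ`
  -- lies in the chart.
  have hle : spectralSubring D r a (h1 • ε) U hη ≤ j.range := by
    refine Subring.closure_le.mpr ?_
    rintro _ (⟨f, rfl⟩ | ⟨b, hb, rfl⟩)
    · exact ⟨_, hjO f⟩
    · rw [smul_smul] at hb
      obtain ⟨o, ho⟩ := h.exists_of_logField hxD hU hx hb
      refine ⟨algebraMap _ _ o * chartLam m s β 0, ?_⟩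
      rw [map_mul]
      refine (congr($(chartToGenericFibre_algebraMap hβ hh1 o) *
        $(chartToGenericFibre_lam hβ hh1))).trans ?_
      rw [← mul_assoc, ← map_mul, ho, mul_inv_cancel_right₀ hh1]
  let J : ChartRing m s β 0 ≃+* j.range := RingEquiv.ofBijective j.rangeRestrict
    ⟨fun a b hab => hj (congr($(hab).1)), j.rangeRestrict_surjective⟩
  have hJ (z : j.range) : j (J.symm z) = z := congr($(J.apply_symm_apply z).1)
  let E' : Γ(spectralCurve D r a (h1 • ε), spectralCurveMap D r a (h1 • ε) ⁻¹ᵁ U) →+* j.range :=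
    E.codRestrict j.range fun f => hle (hrange ▸ ⟨f, rfl⟩)
  let i := J.symm.toRingHom.comp E'
  have hi (f) : j (i f) = E f := hJ _
  have hmem {z} (hz : j z ∈ spectralSubring D r a (h1 • ε) U hη) : ∃ f, z = i f := by
    rw [← hrange] at hz
    obtain ⟨f, hf⟩ := hz
    exact ⟨f, hj (by rw [hi, hf])⟩
  refine ⟨i, fun f g hfg => hE (by rw [← hi, ← hi, hfg]), fun f => hj ?_, fun z => ?_⟩
  · rw [hi, hEf, hjO]
  · let P (z : ChartRing m s β 0) : Prop := ∃ d f, IsUnit (X.presheaf.germ U x hx d) ∧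
      algebraMap _ _ (X.presheaf.germ U x hx d) * z = i f
    have hif (f) : i ((spectralCurveMap D r a (h1 • ε)).app U f) =
        algebraMap _ _ (X.presheaf.germ U x hx f) := hj (by rw [hi, hEf, hjO])
    have hmul (z z') (hz : P z) (hz' : P z') : P (z * z') := by
      obtain ⟨d, f, hd, h⟩ := hz
      obtain ⟨d', f', hd', h'⟩ := hz'
      refine ⟨d * d', f * f', by rw [map_mul]; exact hd.mul hd', ?_⟩
      rw [map_mul, map_mul, map_mul, ← h, ← h', mul_mul_mul_comm]
    have hC (y : X.presheaf.stalk x) : P (algebraMap _ _ y) := by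
      obtain ⟨b, t, ht, hb⟩ := exists_mul_germ_eq hU hx y
      refine ⟨t, (spectralCurveMap D r a (h1 • ε)).app U b, ht, ?_⟩
      rw [hif, ← hb, map_mul]
      exact mul_comm _ _
    change P z
    refine chartRing_induction m s β (P := P) z hC (fun z z' hz hz' => ?_) (fun z hz => ?_)
      (fun z hz => ?_)
    · obtain ⟨d, f, hd, h⟩ := hz
      obtain ⟨d', f', hd', h'⟩ := hz'
      refine ⟨d * d', (spectralCurveMap D r a (h1 • ε)).app U d' * f +
        (spectralCurveMap D r a (h1 • ε)).app U d * f', by rw [map_mul]; exact hd.mul hd', ?_⟩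
      rw [map_add, map_mul, map_mul i, map_mul, map_mul, hif, hif, ← h, ← h']
      ring
    · refine hmul _ _ hz ?_
      -- A section `d ε` of `T_X(-D)` with `d` invertible at `x` makes `d λ` a function on the
      -- spectral curve over `U`.
      obtain ⟨d, hd, hlog⟩ := h.exists_logField hD hU hx
      have hlam : j (algebraMap _ _ (X.presheaf.germ U x hx d) * chartLam m s β 0) ∈
          spectralSubring D r a (h1 • ε) U hη := by
        rw [map_mul, hjO]
        refine Subring.subset_closure (.inr ⟨X.presheaf.germ U _ hη d * h1⁻¹, ?_, ?_⟩)
        · rwa [smul_smul, inv_mul_cancel_right₀ hh1]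
        · rw [map_mul, mul_assoc]
          congr 1
          exact chartToGenericFibre_lam hβ hh1
      obtain ⟨f, hf⟩ := hmem hlam
      exact ⟨d, f, hd, hf⟩
    · refine hmul _ _ hz ?_
      rw [← chartRing_rel_zero]
      exact hC s

end LocalModel

end

end ParabolicSpectral



namespace ParabolicSpectral

noncomputable section

/-! ### Homomorphisms of local rings along a fibre -/

section FibreHom

variable {Z X : Scheme.{u}} (f : Z ⟶ X) {z : Z} {x : X} (h : f z = x)

/-- The homomorphism of local rings at a point of the fibre over `x`. -/
def fibreHom : X.presheaf.stalk x →+* Z.presheaf.stalk z :=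
  (X.presheaf.stalkSpecializes (specializes_of_eq h) ≫ f.stalkMap z).hom

lemma fibreHom_germ {U : X.Opens} (hx : x ∈ U) (hz : z ∈ f ⁻¹ᵁ U) (c : Γ(X, U)) :
    fibreHom f h (X.presheaf.germ U x hx c) = Z.presheaf.germ (f ⁻¹ᵁ U) z hz (f.app U c) := by
  have e : X.presheaf.germ U x hx ≫ X.presheaf.stalkSpecializes (specializes_of_eq h) ≫
      f.stalkMap z = f.app U ≫ Z.presheaf.germ (f ⁻¹ᵁ U) z hz := by
    rw [← Category.assoc, X.presheaf.germ_stalkSpecializes]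
    exact f.germ_stalkMap U z hz
  exact congr($(e).hom c)

lemma fibreHom_rfl : fibreHom f (rfl : f z = f z) = (f.stalkMap z).hom := by
  rw [fibreHom, X.presheaf.stalkSpecializes_refl, Category.id_comp]

instance isLocalHom_fibreHom : IsLocalHom (fibreHom f h) := by
  subst h
  rw [fibreHom_rfl]
  infer_instance

lemma ramificationIndex_eq : ramificationIndex f z =
    sSup {n | (IsLocalRing.maximalIdeal (X.presheaf.stalk x)).map (fibreHom f h) ≤
      IsLocalRing.maximalIdeal (Z.presheaf.stalk z) ^ n} := by
  subst h
  rw [fibreHom_rfl, ramificationIndex]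

/-- The point of `Z` over `x`, if over a neighbourhood `U` of `x` the local ring `A` is a
localization of the coordinate ring. -/
lemma exists_unique_point {A : Type*} [CommRing A] [IsLocalRing A] [Algebra (X.presheaf.stalk x) A]
    [IsLocalHom (algebraMap (X.presheaf.stalk x) A)]
    (hA : ∀ a ∈ IsLocalRing.maximalIdeal A, ∃ (n : ℕ) (y : X.presheaf.stalk x) (b : A),
      y ∈ IsLocalRing.maximalIdeal (X.presheaf.stalk x) ∧ a ^ n = algebraMap _ A y * b)
    {U : X.Opens} (hU : IsAffineOpen U) (hx : x ∈ U) (hV : IsAffineOpen (f ⁻¹ᵁ U))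
    (i : Γ(Z, f ⁻¹ᵁ U) →+* A) (hi : Function.Injective i)
    (hif : ∀ c, i (f.app U c) = algebraMap _ A (X.presheaf.germ U x hx c))
    (hfrac : ∀ a, ∃ d b, IsUnit (X.presheaf.germ U x hx d) ∧
      algebraMap _ A (X.presheaf.germ U x hx d) * a = i b) :
    ∃ (z : Z) (hz : f z = x), (∀ z', f z' = x ↔ z' = z) ∧ ∃ e : Z.presheaf.stalk z ≃+* A,
      (∀ y, e (fibreHom f hz y) = algebraMap _ A y) ∧
      ∀ (hzU : z ∈ f ⁻¹ᵁ U) c, e (Z.presheaf.germ (f ⁻¹ᵁ U) z hzU c) = i c := by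
  obtain ⟨z, hzU, η, hη, hηi⟩ := exists_stalk_hom hV i
  have hz : f z = x := by
    refine eq_of_isUnit_germ_iff hU hzU hx fun c => ?_
    have h1 : IsUnit (Z.presheaf.germ (f ⁻¹ᵁ U) z hzU (f.app U c)) ↔
        IsUnit (X.presheaf.germ U (f z) hzU c) := by
      rw [← fibreHom_germ f rfl hzU hzU, isUnit_map_iff]
    have h2 := isUnit_map_iff (algebraMap (X.presheaf.stalk x) A) (X.presheaf.germ U x hx c)
    have h3 := isUnit_map_iff η (Z.presheaf.germ (f ⁻¹ᵁ U) z hzU (f.app U c))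
    rw [← h1, ← h3, hηi, hif, h2]
  have hfib {z'} (hz' : f z' = x) (hz'U : z' ∈ f ⁻¹ᵁ U) (c : Γ(X, U)) :
      IsUnit (Z.presheaf.germ (f ⁻¹ᵁ U) z' hz'U (f.app U c)) ↔
        IsUnit (X.presheaf.germ U x hx c) := by
    rw [← fibreHom_germ f hz' hx hz'U, isUnit_map_iff]
  -- Invertibility at any point of the fibre is invertibility in `A`. A nonunit of `A` has a power
  -- divisible by an element of `𝔪_x`, which vanishes on the fibre; a unit of `A` divides a function
  -- from the base that is invertible at `x`.
  have hunit {z'} (hz' : f z' = x) (hz'U : z' ∈ f ⁻¹ᵁ U) (c : Γ(Z, f ⁻¹ᵁ U)) :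
      IsUnit (Z.presheaf.germ (f ⁻¹ᵁ U) z' hz'U c) ↔ IsUnit (i c) := by
    constructor
    · intro h1
      by_contra h2
      obtain ⟨n, y, b, hy, hn⟩ := hA _ ((IsLocalRing.mem_maximalIdeal _).mpr h2)
      obtain ⟨y', t, ht, hyt⟩ := exists_mul_germ_eq hU hx y
      obtain ⟨d, b', hd, hdb⟩ := hfrac b
      have h3 : f.app U (t * d) * c ^ n = f.app U y' * b' := by
        apply hi
        rw [map_mul i, map_mul i, hif, hif, map_pow, hn, ← hdb]
        simp only [map_mul, ← hyt]
        ring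
      have h4 : IsUnit (Z.presheaf.germ (f ⁻¹ᵁ U) z' hz'U (f.app U y')) := by
        have h5 : IsUnit (Z.presheaf.germ (f ⁻¹ᵁ U) z' hz'U (f.app U (t * d) * c ^ n)) := by
          rw [map_mul, map_pow]
          refine IsUnit.mul ?_ (h1.pow n)
          rw [hfib hz', map_mul]
          exact ht.mul hd
        rw [h3, map_mul] at h5
        exact isUnit_of_mul_isUnit_left h5
      rw [hfib hz', ← hyt] at h4
      exact hy (isUnit_of_mul_isUnit_left h4)
    · intro h1
      obtain ⟨a, ha⟩ := h1.exists_right_inv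
      obtain ⟨d, b, hd, hdb⟩ := hfrac a
      have h3 : c * b = f.app U d := by
        apply hi
        rw [map_mul, ← hdb, hif]
        linear_combination algebraMap _ A (X.presheaf.germ U x hx d) * ha
      rw [← hfib hz' hz'U, ← h3, map_mul] at hd
      exact isUnit_of_mul_isUnit_left hd
  have hbij : Function.Bijective η := by
    constructor
    · rw [injective_iff_map_eq_zero]
      intro b hb
      obtain ⟨c, t, ht, h1⟩ := exists_mul_germ_eq hV hzU b
      have h2 := congr(η $h1)
      rw [map_mul, hb, zero_mul, hηi, eq_comm, map_eq_zero_iff i hi] at h2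
      rw [h2, map_zero] at h1
      exact (ht.mul_left_eq_zero).mp h1
    · intro a
      obtain ⟨d, b, hd, hdb⟩ := hfrac a
      obtain ⟨w, hw⟩ := ((hfib hz hzU d).mpr hd).exists_right_inv
      refine ⟨w * Z.presheaf.germ (f ⁻¹ᵁ U) z hzU b, ?_⟩
      have h1 := congr(η $hw)
      rw [map_mul, hηi, hif, map_one] at h1
      rw [map_mul, hηi, ← hdb]
      linear_combination a * h1
  refine ⟨z, hz, fun z' => ⟨fun hz' => ?_, fun h => h ▸ hz⟩, RingEquiv.ofBijective η hbij,
    fun y => ?_, fun _ c => hηi c⟩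
  · have hz'U : z' ∈ f ⁻¹ᵁ U := by
      change f z' ∈ U
      rwa [hz']
    exact eq_of_isUnit_germ_iff hV hz'U hzU fun c => by rw [hunit hz', hunit hz]
  · obtain ⟨b, t, ht, h1⟩ := exists_mul_germ_eq hU hx y
    refine (ht.map (algebraMap _ A)).mul_right_cancel ?_
    rw [← map_mul, h1, ← hif, ← hif, ← hηi, ← hηi]
    change η _ * η _ = η _
    rw [← map_mul, ← fibreHom_germ f hz hx hzU, ← fibreHom_germ f hz hx hzU, ← map_mul, h1]

end FibreHom

end

end ParabolicSpectral



namespace ParabolicSpectral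

noncomputable section

/-! ### The completed local ring of the spectral curve at a marked point -/

section CompletedLocalRing

lemma add_mul_pow_mem {R : Type*} [CommRing R] {l t : R} {n : ℕ} (h : l ^ n ∈ Ideal.span {t})
    (x y : R) : (x * l + y * t) ^ n ∈ Ideal.span {t} := by
  have h1 : Ideal.Quotient.mk (Ideal.span {t}) t = 0 :=
    Ideal.Quotient.eq_zero_iff_mem.mpr (Ideal.mem_span_singleton_self _)
  rw [← Ideal.Quotient.eq_zero_iff_mem, map_pow] at h ⊢
  rw [map_add, map_mul, map_mul, h1, mul_zero, add_zero, mul_pow, h, mul_zero]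

/-- The maximal ideal is `(λ, s)` and `λ^r ∈ (s)`, so modulo `s` its elements have vanishing `r`-th
power. -/
lemma IsChartDatum.exists_pow_eq {r : ℕ} {m : Composition r} {O κ : Type u} [CommRing O]
    [IsLocalRing O] [Field κ] {s : O} {ρ : O →+* κ} {c : ℕ → O} (H : IsChartDatum m s ρ c) [IsLocalRing (ChartRing m s c 0)]
    {a : ChartRing m s c 0} (ha : a ∈ IsLocalRing.maximalIdeal (ChartRing m s c 0)) :
    ∃ b, a ^ r = algebraMap O _ s * b := by
  rw [H.maximalIdeal_chartRing_zero, ← chartRing_rel_zero] at ha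
  obtain ⟨x, y, rfl⟩ := Ideal.mem_span_pair.mp ha
  have h := add_mul_pow_mem (chartLam_pow_mem m s c) x y
  obtain ⟨b, hb⟩ := Ideal.mem_span_singleton'.mp h
  exact ⟨b, hb.symm.trans (mul_comm _ _)⟩

lemma IsChartDatum.isLocalHom_algebraMap {r : ℕ} {m : Composition r} {O κ : Type u} [CommRing O]
    [IsLocalRing O] [Field κ]
    {s : O} {ρ : O →+* κ} {c : ℕ → O} (H : IsChartDatum m s ρ c) [IsLocalRing (ChartRing m s c 0)] :
    IsLocalHom (algebraMap O (ChartRing m s c 0)) := by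
  refine ⟨fun x hx => ?_⟩
  by_contra h
  have h1 : x ∈ IsLocalRing.maximalIdeal O := h
  rw [H.maximalIdeal_eq] at h1
  obtain ⟨y, rfl⟩ := Ideal.mem_span_singleton'.mp h1
  have h2 : chartU m s c 0 ∈ IsLocalRing.maximalIdeal (ChartRing m s c 0) := by
    rw [H.maximalIdeal_chartRing_zero]; exact Ideal.subset_span (Set.mem_insert_of_mem _ rfl)
  rw [map_mul, chartRing_rel_zero] at hx
  exact h2 (isUnit_of_mul_isUnit_right hx)

variable {k : Type u} [Field k] {X : Scheme.{u}} [X.Over (Spec (.of k))] [IsIntegral X]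
  {r : ℕ} {m : Composition r} {a : ∀ j, RatDiff k X j} {x : X}
  {φ : X.presheaf.stalk x →ₐ[k] k⟦X⟧} {c : ℕ → k⟦X⟧}

/-- The equation of the spectral curve over the local ring of a marked point. -/
lemma IsLocalExpansion.exists_isChartDatum (hc : IsLocalExpansion m a x φ c) (hgen : IsGeneric m c)
    (hr : 0 < r) (hx : (X ↘ Spec (.of k)).residueDegree x = 1)
    [IsNoetherianRing (X.presheaf.stalk x)] :
    ∃ s ε β, IsLogUniformizer x s ε ∧ (∀ l ∈ Finset.Icc 1 r,
      algebraMap _ X.functionField (β l * s ^ level m l) = contract l ε (a l)) ∧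
      IsChartDatum m s ((PowerSeries.constantCoeff (R := k)).comp φ.toRingHom) β ∧
      ∃ (_ : IsLocalRing (ChartRing m s β 0)) (ψ : ChartRing m s β 0 →+* BlowupRing m c 0),
        (∀ y, ψ (algebraMap _ _ y) = algebraMap k⟦X⟧ _ (φ y)) ∧
          IsCompletionMap (R := ChartRing m s β 0) (S := BlowupRing m c 0) ψ := by
  obtain ⟨hφ, s, ε, hs, hε, hα⟩ := hc
  have hα' (j : ℕ) : ∃ α, j ∈ Finset.Icc 1 r → algebraMap _ X.functionField α = contract j ε (a j) ∧
      φ α * (PowerSeries.X * PowerSeries.derivative k (φ s)) ^ j =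
        c j * PowerSeries.X ^ level m j * φ s ^ j := by
    by_cases hj : j ∈ Finset.Icc 1 r
    · obtain ⟨α, h⟩ := hα j hj
      exact ⟨α, fun _ => h⟩
    · exact ⟨0, fun h => absurd h hj⟩
  choose α hα using hα'
  obtain ⟨β, v, w, hv, hw, hw0, hφs, hβ⟩ := exists_localCoeff hφ hs (fun j hj => (hα j hj).2)
  have hs0 := ne_zero_of_map_maximalIdeal_eq hφ hs
  have H' := hgen.isChartDatum hr
  have H : IsChartDatum m s ((PowerSeries.constantCoeff (R := k)).comp φ.toRingHom) β := by
    refine H'.of_comp surjective_constantCoeff_comp (ker_constantCoeff_comp hs) hs0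
      (v := PowerSeries.constantCoeff v) ((hv.map _).ne_zero) fun l hl => ?_
    rw [← (hβ l hl).2, map_mul, map_mul, map_pow, map_pow, hw0, one_pow, mul_one]
    rfl
  have := H.isLocalRing_chartRing_zero
  obtain ⟨ψ, hψ, hψc⟩ := H.exists_isCompletionMap H' φ.toRingHom hv hw hφs
    (fun l hl => (hβ l hl).2) (exists_sub_mem_span_X_pow hφ hs)
    (mem_span_pow_of_mem_span_X_pow hφ hs)
  refine ⟨s, ε, β, ⟨hs, hs0, hε, exists_sub_stalkHom_mem _ hx⟩, fun l hl => ?_, H, this, ψ, hψ, hψc⟩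
  rw [← (hβ l hl).1, (hα l hl).1]

variable [LocallyOfFiniteType (X ↘ Spec (.of k))]

/-- The local ring of the spectral curve at its point over a marked point. -/
lemma IsLocalExpansion.exists_point (hc : IsLocalExpansion m a x φ c) (hgen : IsGeneric m c)
    (hr : 0 < r) {D : Finset X} (hD : ∀ x ∈ D, (X ↘ Spec (.of k)).residueDegree x = 1) (hx : x ∈ D)
    {δ : Derivation k X.functionField X.functionField} (hδ : δ ≠ 0)
    [IsNoetherianRing (X.presheaf.stalk x)] :
    ∃ s β, IsChartDatum m s ((PowerSeries.constantCoeff (R := k)).comp φ.toRingHom) β ∧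
      ∃ (z : spectralCurve D r a δ) (hz : spectralCurveMap D r a δ z = x),
        (∀ z', spectralCurveMap D r a δ z' = x ↔ z' = z) ∧
        (∃ e : (spectralCurve D r a δ).presheaf.stalk z ≃+* ChartRing m s β 0,
          ∀ y, e (fibreHom _ hz y) = algebraMap _ _ y) ∧
        ∃ ψ : (spectralCurve D r a δ).presheaf.stalk z →+* BlowupRing m c 0,
          IsCompletionMap (S := BlowupRing m c 0) ψ ∧ ∀ y, ψ (fibreHom _ hz y) = algebraMap k⟦X⟧ _ (φ y) := by
  obtain ⟨s, ε, β, h, hβ, H, _, ψ, hψ, hψc⟩ := hc.exists_isChartDatum hgen hr (hD x hx)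
  obtain ⟨h1, hh1, rfl⟩ := h.exists_eq_smul hδ
  obtain ⟨U, hU, hxU, -⟩ := exists_isAffineOpen_mem_and_subset (X := X) (x := x) (U := ⊤) trivial
  obtain ⟨i, hi, hif, hfrac⟩ := h.exists_chartRing_hom hβ hh1 hr hD hx hU hxU
  have := H.isLocalHom_algebraMap
  obtain ⟨z, hz, huniq, e, he, -⟩ := exists_unique_point (spectralCurveMap D r a (h1 • ε))
    (A := ChartRing m s β 0) (fun a ha => by
      obtain ⟨b, hb⟩ := H.exists_pow_eq ha
      refine ⟨r, s, b, ?_, hb⟩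
      rw [H.maximalIdeal_eq]
      exact Ideal.mem_span_singleton_self s) hU hxU
    (isAffineOpen_spectralCurveMap_preimage D r a (h1 • ε) hU) i hi hif hfrac
  refine ⟨s, β, H, z, hz, huniq, ⟨e, he⟩, ψ.comp e.toRingHom, hψc.comp_ringEquiv e, fun y => ?_⟩
  rw [← hψ, ← he]
  rfl

end CompletedLocalRing

end

end ParabolicSpectral



namespace ParabolicSpectral

noncomputable section

/-! ### Local rings of the normalization inside its function field -/

section NormalizationFibre

variable {Y : Scheme.{u}} [IsIntegral Y]

/-- Sections inject into those of the normalization, so at either point the functions of `Y` that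
are invertible are the nonzero ones. -/
lemma normalizationMap_genericPoint :
    normalizationMap Y (genericPoint (normalization Y)) = genericPoint Y := by
  obtain ⟨V, hV, hηV, -⟩ := exists_isAffineOpen_mem_and_subset
    (x := normalizationMap Y (genericPoint (normalization Y))) (U := ⊤) trivial
  have hη := genericPoint_mem_of_mem hηV
  refine eq_of_isUnit_germ_iff hV hηV hη fun c => ?_
  have h1 : IsUnit ((normalization Y).presheaf.germ (normalizationMap Y ⁻¹ᵁ V) _ hηV
      ((normalizationMap Y).app V c)) ↔ IsUnit (Y.presheaf.germ V _ hηV c) := by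
    rw [← fibreHom_germ (normalizationMap Y) rfl hηV hηV, isUnit_map_iff]
  have h2 : IsUnit ((normalization Y).presheaf.germ (normalizationMap Y ⁻¹ᵁ V) _ hηV
      ((normalizationMap Y).app V c)) ↔ c ≠ 0 := by
    refine (isUnit_iff_ne_zero (G₀ := (normalization Y).functionField)).trans (not_congr ?_)
    rw [map_eq_zero_iff _ (germ_injective_of_isIntegral (normalization Y) _ hηV),
      map_eq_zero_iff _ (normalizationMap_app_injective hV hη)]
  have h3 : IsUnit (Y.presheaf.germ V _ hη c) ↔ c ≠ 0 := by
    refine (isUnit_iff_ne_zero (G₀ := Y.functionField)).trans (not_congr ?_)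
    rw [map_eq_zero_iff _ (germ_injective_of_isIntegral Y _ hη)]
  rw [← h1, h2, h3]

/-- The inclusion of a local ring of `Y` into the function field of the normalization. -/
def toNormFunctionField (z : Y) :
    Y.presheaf.stalk z →+* (normalization Y).functionField :=
  (fibreHom (normalizationMap Y) normalizationMap_genericPoint).comp
    (algebraMap (Y.presheaf.stalk z) Y.functionField)

lemma toNormFunctionField_injective (z : Y) : Function.Injective (toNormFunctionField z) :=
  (RingHom.injective (fibreHom (normalizationMap Y) normalizationMap_genericPoint :
    Y.functionField →+* (normalization Y).functionField)).comp
    (IsFractionRing.injective (Y.presheaf.stalk z) Y.functionField)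

lemma toNormFunctionField_germ {z : Y} {V : Y.Opens} (hz : z ∈ V)
    (hη : genericPoint (normalization Y) ∈ normalizationMap Y ⁻¹ᵁ V) (c : Γ(Y, V)) :
    toNormFunctionField z (Y.presheaf.germ V z hz c) =
      (normalization Y).presheaf.germ _ _ hη ((normalizationMap Y).app V c) := by
  rw [toNormFunctionField, RingHom.comp_apply, algebraMap_germ]
  exact fibreHom_germ _ _ _ _ _

lemma genericPoint_mem_preimage {z : Y} {V : Y.Opens} (hz : z ∈ V) :
    genericPoint (normalization Y) ∈ normalizationMap Y ⁻¹ᵁ V := by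
  change normalizationMap Y _ ∈ V
  rw [normalizationMap_genericPoint]
  exact genericPoint_mem_of_mem hz

lemma exists_mul_toNormFunctionField_eq (z : Y) (e : (normalization Y).functionField) :
    ∃ a b, toNormFunctionField z b ≠ 0 ∧ e * toNormFunctionField z b = toNormFunctionField z a := by
  obtain ⟨V, hV, hz, -⟩ := exists_isAffineOpen_mem_and_subset (x := z) (U := ⊤) trivial
  have hη := genericPoint_mem_preimage hz
  obtain ⟨a, b, hb, h⟩ := exists_mul_germ_normalizationMap_eq hV (genericPoint_mem_of_mem hz) hη e
  refine ⟨Y.presheaf.germ V z hz a, Y.presheaf.germ V z hz b, ?_, ?_⟩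
  · rw [Ne, map_eq_zero_iff _ (toNormFunctionField_injective z)]
    rwa [map_eq_zero_iff _ (germ_injective_of_isIntegral Y z hz)]
  · rw [toNormFunctionField_germ hz hη, toNormFunctionField_germ hz hη, h]

variable {X : Scheme.{u}} (π : Y ⟶ X) {x : X} {z : Y} (hz : π z = x)

lemma algebraMap_fibreHom_normalization {y : normalization Y}
    (hy : (normalizationMap Y ≫ π) y = x) (b : X.presheaf.stalk x) :
    algebraMap _ (normalization Y).functionField (fibreHom (normalizationMap Y ≫ π) hy b) =
      toNormFunctionField z (fibreHom π hz b) := by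
  obtain ⟨U, hx, c, rfl⟩ := X.presheaf.exists_germ_eq b
  have hzU : z ∈ π ⁻¹ᵁ U := by
    change π z ∈ U
    rwa [hz]
  have hyU : y ∈ (normalizationMap Y ≫ π) ⁻¹ᵁ U := by
    change (normalizationMap Y ≫ π) y ∈ U
    rwa [hy]
  refine (congrArg _ (fibreHom_germ _ hy hx hyU c)).trans ?_
  refine .trans ?_ (congrArg _ (fibreHom_germ π hz hx hzU c)).symm
  rw [toNormFunctionField_germ hzU (genericPoint_mem_preimage hzU), algebraMap_germ]
  rfl

/-- The centre on the normalization of an integrally closed local ring of its function field. -/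
lemma exists_normalization_stalk_hom {U : X.Opens} (hU : IsAffineOpen U) (hx : x ∈ U)
    (hV : IsAffineOpen (π ⁻¹ᵁ U)) {W : Type*} [CommRing W] [IsDomain W] [IsLocalRing W]
    [IsIntegrallyClosed W] (F : X.presheaf.stalk x →+* W) [IsLocalHom F]
    (ι : W →+* (normalization Y).functionField) (hι : Function.Injective ι)
    (hιF : ∀ b, ι (F b) = toNormFunctionField z (fibreHom π hz b))
    (hle : (toNormFunctionField z).range ≤ ι.range) :
    ∃ (y : normalization Y) (_ : (normalizationMap Y ≫ π) y = x)
      (η : (normalization Y).presheaf.stalk y →+* W), IsLocalHom η ∧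
        ∀ b, ι (η b) = algebraMap _ (normalization Y).functionField b := by
  have hzU : z ∈ π ⁻¹ᵁ U := by
    change π z ∈ U
    rwa [hz]
  have hη := genericPoint_mem_preimage hzU
  have hW : IsAffineOpen (normalizationMap Y ⁻¹ᵁ π ⁻¹ᵁ U) := IsAffineOpen.preimage hV _
  let := ι.toAlgebra
  have : FaithfulSMul W (normalization Y).functionField :=
    (faithfulSMul_iff_algebraMap_injective _ _).mpr hι
  have : IsFractionRing W (normalization Y).functionField := by
    refine IsFractionRing.of_field W _ fun e => ?_
    obtain ⟨a, b, hb, h⟩ := exists_mul_toNormFunctionField_eq z e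
    obtain ⟨a', ha'⟩ := hle ⟨a, rfl⟩
    obtain ⟨b', hb'⟩ := hle ⟨b, rfl⟩
    refine ⟨a', b', ?_⟩
    change e = ι a' / ι b'
    rw [ha', hb', eq_div_iff hb, h]
  -- Sections of the normalization are integral over those of `Y`, which lie in `W`; as `W` is
  -- integrally closed it contains them too.
  have hmem (c : Γ(normalization Y, normalizationMap Y ⁻¹ᵁ π ⁻¹ᵁ U)) :
      ∃ w, ι w = (normalization Y).presheaf.germ _ _ hη c := by
    refine IsIntegrallyClosed.isIntegral_iff.mp ?_
    have hint : ((normalizationMap Y).app (π ⁻¹ᵁ U)).hom.IsIntegral :=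
      IsIntegralHom.isIntegral_app _ _ hV
    obtain ⟨p, hp, hpc⟩ := hint c
    have hlift (b : Γ(Y, π ⁻¹ᵁ U)) : ∃ w, ι w =
        (normalization Y).presheaf.germ _ _ hη ((normalizationMap Y).app _ b) := by
      rw [← toNormFunctionField_germ hzU hη]
      exact hle ⟨_, rfl⟩
    choose τ hτ using hlift
    let τ' : Γ(Y, π ⁻¹ᵁ U) →+* W :=
      { toFun := τ
        map_one' := hι (by simp [hτ])
        map_mul' := fun x y => hι (by simp [hτ])
        map_zero' := hι (by simp [hτ])
        map_add' := fun x y => hι (by simp [hτ]) }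
    refine ⟨p.map τ', hp.map τ', ?_⟩
    have h := congr((normalization Y).presheaf.germ _ _ hη $hpc)
    rw [map_zero] at h
    rw [Polynomial.eval₂_map, ← h]
    refine .trans ?_ (Polynomial.hom_eval₂ p _ ((normalization Y).presheaf.germ _ _ hη).hom c).symm
    exact congr(Polynomial.eval₂ $(RingHom.ext hτ) _ p)
  choose τ hτ using hmem
  let τ' : Γ(normalization Y, normalizationMap Y ⁻¹ᵁ π ⁻¹ᵁ U) →+* W :=
    { toFun := τ
      map_one' := hι (by simp [hτ])
      map_mul' := fun x y => hι (by simp [hτ])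
      map_zero' := hι (by simp [hτ])
      map_add' := fun x y => hι (by simp [hτ]) }
  obtain ⟨y, hy, η, hηl, hητ⟩ := exists_stalk_hom hW τ'
  have hιη (c) : ι (η ((normalization Y).presheaf.germ _ y hy c)) =
      (normalization Y).presheaf.germ _ _ hη c := by rw [hητ]; exact hτ c
  refine ⟨y, ?_, η, hηl, fun b => ?_⟩
  · have hy' : y ∈ (normalizationMap Y ≫ π) ⁻¹ᵁ U := hy
    refine eq_of_isUnit_germ_iff hU hy' hx fun c => ?_
    have h1 : IsUnit ((normalization Y).presheaf.germ _ y hy'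
        ((normalizationMap Y ≫ π).app U c)) ↔ IsUnit (X.presheaf.germ U _ hy' c) := by
      rw [← fibreHom_germ (normalizationMap Y ≫ π) rfl hy' hy', isUnit_map_iff]
    have h2 := isUnit_map_iff η ((normalization Y).presheaf.germ _ y hy'
        ((normalizationMap Y ≫ π).app U c))
    have h3 : η ((normalization Y).presheaf.germ _ y hy' ((normalizationMap Y ≫ π).app U c)) =
        F (X.presheaf.germ U x hx c) := by
      apply hι
      rw [hιF, fibreHom_germ π hz hx hzU, toNormFunctionField_germ hzU hη]
      exact hιη _
    rw [← h1, ← h2, h3, isUnit_map_iff F]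
  · obtain ⟨c, t, ht, h⟩ := exists_mul_germ_eq hW hy b
    have h0 : algebraMap _ (normalization Y).functionField
        ((normalization Y).presheaf.germ _ y hy t) ≠ 0 := (ht.map _).ne_zero
    refine mul_right_cancel₀ h0 ?_
    rw [← map_mul, h, algebraMap_germ hy, algebraMap_germ hy, ← hιη, ← hιη, ← map_mul, ← map_mul,
      h]

end NormalizationFibre

end

end ParabolicSpectral



namespace ParabolicSpectral

noncomputable section

/-! ### The fibre of the normalized curve over a marked point -/

section FibrePlaces

lemma fibreHom_stalkHom {k : Type u} [Field k] {Z X : Scheme.{u}} (f : Z ⟶ X) {z : Z} {x : X}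
    (h : f z = x) (str : X ⟶ Spec (.of k)) (a : k) :
    fibreHom f h (stalkHom str x a) = stalkHom (f ≫ str) z a := by
  refine (fibreHom_germ f h (U := ⊤) trivial trivial _).trans ?_
  rfl

lemma residueDegree_eq_natDegree {k : Type u} [Field k] {Z : Scheme.{u}} (f : Z ⟶ Spec (.of k))
    {z : Z} {Ψ : Polynomial k →+* IsLocalRing.ResidueField (Z.presheaf.stalk z)}
    (hΨ : Function.Surjective Ψ) {g : Polynomial k} (hg : g.Monic) (hirr : Irreducible g)
    (hker : RingHom.ker Ψ = Ideal.span {g})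
    (hC : ∀ a, Ψ (Polynomial.C a) = IsLocalRing.residue _ (stalkHom f z a)) :
    f.residueDegree z = g.natDegree ∧ (g.Separable → IsResiduallySeparable f z) := by
  obtain ⟨e, he, hf⟩ := exists_residueFieldMap_eq f z
  let := (f.residueFieldMap z).hom.toAlgebra
  exact finrank_of_surjective_of_ker_eq_span (F := (Spec (.of k)).residueField (f z))
    (R := Z.residueField z) he hΨ hg hirr hker fun a => (hC a).trans (hf a).symm

variable {k : Type u} [Field k] {X Y : Scheme.{u}} [IsIntegral X] [IsIntegral Y]
  (str : X ⟶ Spec (.of k)) (π : Y ⟶ X) {x : X} {z : Y} (hz : π z = x)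
  [IsDiscreteValuationRing (X.presheaf.stalk x)]
  {r : ℕ} {m : Composition r} {s : X.presheaf.stalk x} {ρ : X.presheaf.stalk x →+* k}
  {β : ℕ → X.presheaf.stalk x}

/-- The points of the normalization of `Y` over `x`, if the local ring of `Y` over `x` is a chart
ring. -/
lemma IsChartDatum.normalization_fibre (H : IsChartDatum m s ρ β)
    (hρ : ∀ a, ρ (stalkHom str x a) = a)
    (e : Y.presheaf.stalk z ≃+* ChartRing m s β 0) (he : ∀ y, e (fibreHom π hz y) = algebraMap _ _ y)
    {U : X.Opens} (hU : IsAffineOpen U) (hx : x ∈ U) (hV : IsAffineOpen (π ⁻¹ᵁ U)) :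
    {y | (normalizationMap Y ≫ π) y = x}.Finite ∧
    (∀ (y : normalization Y) (hy : (normalizationMap Y ≫ π) y = x),
      IsDiscreteValuationRing ((normalization Y).presheaf.stalk y) ∧
      IsResiduallySeparable ((normalizationMap Y ≫ π) ≫ str) y ∧
      0 < ((normalizationMap Y ≫ π) ≫ str).residueDegree y ∧
      ramificationIndex (normalizationMap Y ≫ π) y ∈ Finset.Icc 1 m.length ∧
      Function.Injective (fibreHom (normalizationMap Y ≫ π) hy)) ∧
    ∀ i ∈ Finset.Icc 1 m.length, ∑ᶠ y ∈ {y | (normalizationMap Y ≫ π) y = x ∧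
        ramificationIndex (normalizationMap Y ≫ π) y = i},
      ((normalizationMap Y ≫ π) ≫ str).residueDegree y = partMult m i := by
  set f := normalizationMap Y ≫ π with hf
  let N := normalization Y
  -- The chart ring, identified with the local ring of `Y` at `z`, embeds into the function field of
  -- the normalization with that field as its field of fractions.
  let j : ChartRing m s β 0 →+* N.functionField := (toNormFunctionField z).comp e.symm.toRingHom
  have hj : Function.Injective j := (toNormFunctionField_injective z).comp e.symm.injective
  have hje (b) : j (e b) = toNormFunctionField z b := 
    congrArg (toNormFunctionField z) (e.symm_apply_apply b)
  have hE : ∀ e, ∃ a b, j b ≠ 0 ∧ e * j b = j a := by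
    intro w
    obtain ⟨a, b, hb, h⟩ := exists_mul_toNormFunctionField_eq z w
    exact ⟨e a, e b, by rwa [hje], by rwa [hje, hje]⟩
  have hjO (b) : j (algebraMap _ _ b) = toNormFunctionField z (fibreHom π hz b) := by
    rw [← he, hje]
  let S := {y : N // f y = x}
  have hloc (y : S) : IsLocalHom (fibreHom f y.2) := inferInstance
  have hfj (y : S) (b) : algebraMap _ N.functionField (fibreHom f y.2 b) =
      j (algebraMap _ _ b) := by
    rw [hjO]
    exact algebraMap_fibreHom_normalization π hz y.2 b
  have hW : IsAffineOpen (normalizationMap Y ⁻¹ᵁ π ⁻¹ᵁ U) := IsAffineOpen.preimage hV _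
  have hSU (y : S) : y.1 ∈ normalizationMap Y ⁻¹ᵁ π ⁻¹ᵁ U := by
    change f y.1 ∈ U
    rwa [y.2]
  -- Points of the fibre are separated by their local rings, and every discrete valuation ring
  -- containing the chart ring has a centre on the normalization.
  obtain ⟨θ, v, q, g, hP, hbij⟩ := H.exists_bijOn hj hE (S := S)
    (fun y => N.presheaf.stalk y.1) (fun y => fibreHom f y.2) hfj
    (fun y y' h => Subtype.ext (eq_of_range_eq hW (hSU y) (hSU y') h))
    (fun W _ _ _ F _ ι hι hιF hle => by
      obtain ⟨y, hy, η, hη, h⟩ := exists_normalization_stalk_hom π hz hU hx hV F ι hι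
        (fun b => by rw [hιF, hjO]) (by
          rintro _ ⟨b, rfl⟩
          exact hle ⟨e b, hje b⟩)
      exact ⟨⟨y, hy⟩, η, hη, h⟩)
  have hdvr (y : S) : IsDiscreteValuationRing (N.presheaf.stalk y.1) :=
    (hP y).2.2.isDiscreteValuationRing (IsFractionRing.injective _ N.functionField) (hfj y)
      (hP y).1 H hE (hP y).2.1
  have hram (y : S) : ramificationIndex f y.1 = q y := by
    rw [ramificationIndex_eq f y.2]
    have := hdvr y
    exact (hP y).2.2.sSup_ramification H.maximalIdeal_eq
      ((hP y).2.2.exists_mul_chartHom_eq (IsFractionRing.injective _ N.functionField) (hfj y)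
      (hP y).1 H hE (hP y).2.1).2.1
  have hdeg (y : S) : (f ≫ str).residueDegree y.1 = (g y).natDegree ∧
      ((g y).Separable → IsResiduallySeparable (f ≫ str) y.1) := by
    obtain ⟨Ψ, h1, h2, h3⟩ := (hP y).2.2.exists_residueField_hom
      (IsFractionRing.injective _ N.functionField) (hfj y) (hP y).1 H hE (hP y).2.1
    refine residueDegree_eq_natDegree (f ≫ str) h1 (hP y).2.2.monic (hP y).2.2.irreducible h2
      fun a => ?_
    rw [← fibreHom_stalkHom f y.2, ← h3, hρ]
  have hset (i : ℕ) : {y | f y = x ∧ ramificationIndex f y = i} = Subtype.val '' {y : S | q y = i} := by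
    ext y
    constructor
    · rintro ⟨h1, h2⟩
      exact ⟨⟨y, h1⟩, (hram _).symm.trans h2, rfl⟩
    · rintro ⟨y, h1, rfl⟩
      exact ⟨y.2, (hram _).trans h1⟩
  refine ⟨?_, fun y hy => ?_, fun i hi => ?_⟩
  · have h1 : {y | f y = x} ⊆ ⋃ i ∈ Finset.Icc 1 m.length, Subtype.val '' {y : S | q y = i} := by
      intro y hy
      simp only [Set.mem_iUnion]
      exact ⟨q ⟨y, hy⟩, (hP ⟨y, hy⟩).2.2.mem_Icc, ⟨y, hy⟩, rfl, rfl⟩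
    refine Set.Finite.subset (Set.Finite.biUnion (Finset.finite_toSet _) fun i hi => ?_) h1
    refine Set.Finite.image _ ?_
    exact (hbij i hi).finite_iff_finite.mpr (H.finsum_natDegree hi).1
  · obtain ⟨h1, h2⟩ := hdeg ⟨y, hy⟩
    have hmem := (hP ⟨y, hy⟩).2.2.mem_Icc
    refine ⟨hdvr ⟨y, hy⟩, h2 ?_, ?_, ?_, ?_⟩
    · exact (H.finsum_natDegree hmem).2.1 _ ((hbij _ hmem).mapsTo rfl)
    · rw [h1]
      exact (hP ⟨y, hy⟩).2.2.irreducible.natDegree_pos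
    · rw [hram ⟨y, hy⟩]
      exact hmem
    · intro b b' h
      have h3 := congr(algebraMap _ N.functionField $h)
      rw [hfj ⟨y, hy⟩, hfj ⟨y, hy⟩] at h3
      exact algebraMap_chartRing_zero_injective H.rank_pos (hj h3)
  · rw [hset, finsum_mem_image Subtype.val_injective.injOn, ← (H.finsum_natDegree hi).2.2]
    exact finsum_mem_eq_of_bijOn g (hbij i hi) fun y _ => (hdeg y).1

end FibrePlaces

end

end ParabolicSpectral



namespace ParabolicSpectral

noncomputable section

/-! ### Closed points and local equations -/

section ClosedPoints

lemma isUnit_germ_of_specializes {X : Scheme.{u}} {x x' : X} (h : x ⤳ x') {U : X.Opens}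
    (hx' : x' ∈ U) (hx : x ∈ U) {c : Γ(X, U)} (hc : IsUnit (X.presheaf.germ U x' hx' c)) :
    IsUnit (X.presheaf.germ U x hx c) := by
  have e := congr($(X.presheaf.germ_stalkSpecializes hx' h).hom c)
  have := hc.map (X.presheaf.stalkSpecializes h).hom
  exact e ▸ this

/-- If `x` specializes to `x'`, subtract from a function its value at `x`: the difference vanishes
at `x`, hence at `x'`, so functions invertible at `x` are invertible at `x'`. -/
lemma isClosed_of_residueDegree_eq_one {k : Type u} [Field k] {X : Scheme.{u}}
    (str : X ⟶ Spec (.of k)) {x : X} (h : str.residueDegree x = 1) : IsClosed {x} := by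
  refine closure_eq_iff_isClosed.mp (Set.Subset.antisymm (fun x' hx' => ?_) subset_closure)
  have hs : x ⤳ x' := specializes_iff_mem_closure.mpr hx'
  obtain ⟨U, hU, hx'U, -⟩ := exists_isAffineOpen_mem_and_subset (x := x') (U := ⊤) trivial
  have hxU : x ∈ U := hs.mem_open U.isOpen hx'U
  refine eq_of_isUnit_germ_iff hU hx'U hxU fun c => ⟨isUnit_germ_of_specializes hs _ _, fun hc => ?_⟩
  obtain ⟨a, ha⟩ := exists_sub_stalkHom_mem str h (X.presheaf.germ U x hxU c)
  have ha0 : a ≠ 0 := by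
    rintro rfl
    rw [map_zero, sub_zero] at ha
    exact ha hc
  by_contra hc'
  have h1 : X.presheaf.germ U x' hx'U (c - sectionHom str U a) ∈
      IsLocalRing.maximalIdeal (X.presheaf.stalk x') := by
    rw [IsLocalRing.mem_maximalIdeal]
    intro hu
    have hu' := isUnit_germ_of_specializes hs hx'U hxU hu
    rw [map_sub, germ_sectionHom] at hu'
    exact ha hu'
  rw [map_sub, germ_sectionHom] at h1
  have h2 := Ideal.sub_mem _ ((IsLocalRing.mem_maximalIdeal _).mpr hc') h1
  rw [sub_sub_cancel] at h2
  exact h2 ((IsUnit.mk0 a ha0).map (stalkHom str x'))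

/-- A function near a closed point whose local ring has principal maximal ideal, with no other
zeros. -/
lemma exists_section_eq_of_not_isUnit {X : Scheme.{u}} [IsIntegral X] [IsLocallyNoetherian X]
    {x : X} (hx : IsClosed {x}) {s : X.presheaf.stalk x}
    (hs : IsLocalRing.maximalIdeal (X.presheaf.stalk x) = Ideal.span {s}) (hs0 : s ≠ 0) :
    ∃ (U : X.Opens) (hxU : x ∈ U) (c : Γ(X, U)), X.presheaf.germ U x hxU c ≠ 0 ∧
      ¬ IsUnit (X.presheaf.germ U x hxU c) ∧
      ∀ (x' : X) (hx' : x' ∈ U), ¬ IsUnit (X.presheaf.germ U x' hx' c) → x' = x := by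
  obtain ⟨U, hU, hxU, -⟩ := exists_isAffineOpen_mem_and_subset (x := x) (U := ⊤) trivial
  have : IsNoetherianRing Γ(X, U) := IsLocallyNoetherian.component_noetherian ⟨U, hU⟩
  have hinj := germ_injective_of_isIntegral X (U := U) x hxU
  obtain ⟨b, t, ht, hbt⟩ := exists_mul_germ_eq hU hxU s
  let p : Ideal Γ(X, U) := (IsLocalRing.maximalIdeal (X.presheaf.stalk x)).comap
    (X.presheaf.germ U x hxU).hom
  obtain ⟨G, hG⟩ := IsNoetherian.noetherian p
  -- Each of the finitely many generators of the prime of `x` is a multiple of `b` after inverting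
  -- some `d`. On the locus where all these `d` are invertible, a zero of `b` is a zero of the whole
  -- prime, that is, a specialization of `x`.
  have hg (g : Γ(X, U)) : ∃ d e, g ∈ G → IsUnit (X.presheaf.germ U x hxU d) ∧ g * d = b * e := by
    by_cases hgG : g ∈ G
    · have h1 : g ∈ p := hG ▸ Ideal.subset_span hgG
      have h2 : X.presheaf.germ U x hxU g ∈ IsLocalRing.maximalIdeal (X.presheaf.stalk x) := h1
      rw [hs] at h2
      obtain ⟨w, hw⟩ := Ideal.mem_span_singleton'.mp h2
      obtain ⟨e, d, hd, hed⟩ := exists_mul_germ_eq hU hxU w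
      refine ⟨t * d, e, fun _ => ⟨by rw [map_mul]; exact ht.mul hd, hinj ?_⟩⟩
      rw [map_mul, map_mul, map_mul, ← hbt, ← hed, ← hw]
      ring
    · exact ⟨0, 0, fun h => absurd h hgG⟩
  choose d e hde using hg
  let T := ∏ g ∈ G, d g
  have hxT : x ∈ X.basicOpen T := by
    rw [X.mem_basicOpen _ _ hxU, map_prod]
    exact IsUnit.prod_iff.mpr fun g hg => (hde g hg).1
  refine ⟨X.basicOpen T, hxT, X.presheaf.map (homOfLE (X.basicOpen_le T)).op b, ?_, ?_, ?_⟩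
  · rw [germ_basicOpen, ← hbt]
    exact mul_ne_zero hs0 ht.ne_zero
  · rw [germ_basicOpen, ← hbt]
    intro h
    have h1 : s ∈ IsLocalRing.maximalIdeal (X.presheaf.stalk x) :=
      hs ▸ Ideal.mem_span_singleton_self s
    exact h1 (isUnit_of_mul_isUnit_left h)
  · intro x' hx' hb
    rw [germ_basicOpen] at hb
    have hx'U := X.basicOpen_le T hx'
    have hle : p ≤ (IsLocalRing.maximalIdeal (X.presheaf.stalk x')).comap
        (X.presheaf.germ U x' hx'U).hom := by
      rw [← hG]
      refine Submodule.span_le.mpr fun g hg h => hb ?_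
      have h1 := congr(X.presheaf.germ U x' hx'U $((hde g hg).2))
      rw [map_mul, map_mul] at h1
      rw [X.mem_basicOpen _ _ hx'U, map_prod] at hx'
      have h2 := (IsUnit.mul h (IsUnit.prod_iff.mp hx' g hg))
      exact isUnit_of_mul_isUnit_left (h1 ▸ h2)
    have hsp : x ⤳ x' := by
      refine specializes_iff_forall_open.mpr fun O hO hx'O => ?_
      obtain ⟨c, hc, hx'c⟩ := hU.exists_basicOpen_le (V := ⟨O, hO⟩) ⟨x', hx'O⟩ hx'U
      refine hc ?_
      rw [X.mem_basicOpen _ _ hxU]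
      rw [X.mem_basicOpen _ _ hx'U] at hx'c
      by_contra h
      exact hle h hx'c
    have := specializes_iff_mem_closure.mp hsp
    rwa [hx.closure_eq] at this

/-- Points with the same image, whose local rings are discrete valuation rings, do not specialize
to each other. -/
lemma eq_of_specializes_of_map_eq {Z X : Scheme.{u}} [IsIntegral Z] {f : Z ⟶ X} {y y' : Z}
    [IsDiscreteValuationRing (Z.presheaf.stalk y)] {U : X.Opens} {c : Γ(X, U)} (hy : y ∈ f ⁻¹ᵁ U)
    (hy' : y' ∈ f ⁻¹ᵁ U) (h0 : Z.presheaf.germ _ y hy (f.app U c) ≠ 0)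
    (hc : ¬ IsUnit (Z.presheaf.germ _ y' hy' (f.app U c))) (h : y' ⤳ y) : y' = y := by
  let P := (IsLocalRing.maximalIdeal (Z.presheaf.stalk y')).comap (Z.presheaf.stalkSpecializes h).hom
  have hgerm {W : Z.Opens} (hW : y ∈ W) (hW' : y' ∈ W) (b : Γ(Z, W)) :
      (Z.presheaf.stalkSpecializes h).hom (Z.presheaf.germ W y hW b) = Z.presheaf.germ W y' hW' b :=
    congr($(Z.presheaf.germ_stalkSpecializes hW h).hom b)
  have hP : P ≠ ⊥ := by
    intro hP
    have h1 : Z.presheaf.germ _ y hy (f.app U c) ∈ P := by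
      change _ ∈ IsLocalRing.maximalIdeal _
      rw [hgerm hy hy']
      exact hc
    rw [hP] at h1
    exact h0 h1
  have hPp : P.IsPrime := inferInstance
  -- `P` is the prime of `y'` in the discrete valuation ring at `y`. It contains the nonzero
  -- function `c`, so it is maximal.
  have hPm : P = IsLocalRing.maximalIdeal _ := IsLocalRing.eq_maximalIdeal (hPp.isMaximal hP)
  obtain ⟨W, hW, hyW, -⟩ := exists_isAffineOpen_mem_and_subset (x := y) (U := ⊤) trivial
  have hy'W : y' ∈ W := h.mem_open W.isOpen hyW
  refine eq_of_isUnit_germ_iff hW hy'W hyW fun b => ?_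
  have h1 : Z.presheaf.germ W y hyW b ∈ P ↔ ¬ IsUnit (Z.presheaf.germ W y' hy'W b) := by
    rw [← hgerm hyW hy'W]
    rfl
  rw [← not_iff_not, ← h1, hPm]
  rfl

/-- A uniformizer at `y` divides the pullback of `c`, which is invertible off the fibre over `x`. It
is therefore invertible near `y` away from the fibre, and the finitely many other points of the
fibre can be removed. -/
lemma exists_section_irreducible {Z X : Scheme.{u}} [IsIntegral Z] {f : Z ⟶ X} {x : X}
    (hfin : {y | f y = x}.Finite) {U : X.Opens} (hx : x ∈ U) {c : Γ(X, U)}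
    (hc : ¬ IsUnit (X.presheaf.germ U x hx c))
    (hcx : ∀ (x' : X) (hx' : x' ∈ U), ¬ IsUnit (X.presheaf.germ U x' hx' c) → x' = x) {y : Z}
    (hy : f y = x) [IsDiscreteValuationRing (Z.presheaf.stalk y)]
    (h0 : fibreHom f hy (X.presheaf.germ U x hx c) ≠ 0) :
    ∃ (V : Z.Opens) (hV : y ∈ V) (b : Γ(Z, V)), Irreducible (Z.presheaf.germ V y hV b) ∧
      ∀ (y' : Z) (hy' : y' ∈ V), y' ≠ y → IsUnit (Z.presheaf.germ V y' hy' b) ∧ f y' ≠ x := by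
  have hmem {y'} (hy' : f y' = x) : y' ∈ f ⁻¹ᵁ U := by
    change f y' ∈ U
    rwa [hy']
  have hunit {y'} (hy' : y' ∈ f ⁻¹ᵁ U) : IsUnit (Z.presheaf.germ _ y' hy' (f.app U c)) ↔
      IsUnit (X.presheaf.germ U (f y') hy' c) := by
    rw [← fibreHom_germ f rfl hy' hy', isUnit_map_iff]
  have hnu {y'} (hy' : f y' = x) (h : y' ∈ f ⁻¹ᵁ U) :
      ¬ IsUnit (Z.presheaf.germ _ y' h (f.app U c)) := by
    rw [← fibreHom_germ f hy' hx h, isUnit_map_iff]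
    exact hc
  rw [fibreHom_germ f hy hx (hmem hy)] at h0
  obtain ⟨ϖ, hϖ⟩ := IsDiscreteValuationRing.exists_irreducible (Z.presheaf.stalk y)
  have hdvd : Z.presheaf.germ _ y (hmem hy) (f.app U c) ∈
      IsLocalRing.maximalIdeal (Z.presheaf.stalk y) := hnu hy _
  rw [hϖ.maximalIdeal_eq] at hdvd
  obtain ⟨w, hw⟩ := Ideal.mem_span_singleton'.mp hdvd
  obtain ⟨V₁, hV₁, b₁, rfl⟩ := Z.presheaf.exists_germ_eq ϖ
  obtain ⟨V₂, hV₂, b₂, rfl⟩ := Z.presheaf.exists_germ_eq w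
  -- Closures are used since points of the fibre are not known to be closed; `y` avoids them because
  -- fibre points do not specialize to each other.
  let C : Set Z := ⋃ y' ∈ {y | f y = x} \ {y}, closure {y'}
  have hC : IsClosed C := (hfin.subset Set.sdiff_subset).isClosed_biUnion fun _ _ => isClosed_closure
  have hyC : y ∉ C := by
    simp only [C, Set.mem_iUnion, not_exists]
    rintro y' ⟨h1, h2⟩ h3
    exact h2 (eq_of_specializes_of_map_eq (hmem hy) (hmem h1) h0 (hnu h1 _)
      (specializes_iff_mem_closure.mpr h3))
  let V : Z.Opens := (V₁ ⊓ V₂) ⊓ (f ⁻¹ᵁ U ⊓ ⟨Cᶜ, hC.isOpen_compl⟩)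
  have hV : y ∈ V := ⟨⟨hV₁, hV₂⟩, hmem hy, hyC⟩
  have hl₁ : V ≤ V₁ := fun _ h => h.1.1
  have hl₂ : V ≤ V₂ := fun _ h => h.1.2
  have hl : V ≤ f ⁻¹ᵁ U := fun _ h => h.2.1
  have hgerm {W : Z.Opens} (hW : V ≤ W) {y'} (hy' : y' ∈ V) (b : Γ(Z, W)) :
      Z.presheaf.germ V y' hy' (Z.presheaf.map (homOfLE hW).op b) =
        Z.presheaf.germ W y' (hW hy') b := Z.presheaf.germ_res_apply _ _ _ _
  have heq : Z.presheaf.map (homOfLE hl₂).op b₂ * Z.presheaf.map (homOfLE hl₁).op b₁ =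
      Z.presheaf.map (homOfLE hl).op (f.app U c) := by
    apply germ_injective_of_isIntegral Z y hV
    rw [map_mul, hgerm, hgerm, hgerm]
    exact hw
  refine ⟨V, hV, Z.presheaf.map (homOfLE hl₁).op b₁, by rwa [hgerm], fun y' hy' hne => ?_⟩
  have hfx : f y' ≠ x := by
    intro h
    refine hy'.2.2 ?_
    simp only [C, Set.mem_iUnion]
    exact ⟨y', ⟨h, hne⟩, subset_closure rfl⟩
  refine ⟨?_, hfx⟩
  have h1 : IsUnit (Z.presheaf.germ _ y' (hl hy') (f.app U c)) := by
    rw [hunit]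
    by_contra h
    exact hfx (hcx _ _ h)
  rw [← hgerm hl hy', ← heq, map_mul] at h1
  exact isUnit_of_mul_isUnit_right h1

end ClosedPoints

end

end ParabolicSpectral



namespace ParabolicSpectral

noncomputable section

/-! ### Line bundles of effective divisors -/

section LineBundles

variable {Z : Scheme.{u}} [IsIntegral Z]

omit [IsIntegral Z] in
lemma germ_restrict {V W : Z.Opens} (h : V ≤ W) {y : Z} (hy : y ∈ V) (b : Γ(Z, W)) :
    Z.presheaf.germ V y hy (Z.presheaf.map (homOfLE h).op b) = Z.presheaf.germ W y (h hy) b :=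
  Z.presheaf.germ_res_apply _ _ _ _

/-- The line bundle of an effective divisor with local equations `σ i`. -/
lemma exists_lineBundle_hasDegree {k : Type u} [Field k] (str : Z ⟶ Spec (.of k)) {ι : Type u}
    (U : ι → Z.Opens) (hcover : ∀ y, ∃ i, y ∈ U i) (hη : ∀ i, genericPoint Z ∈ U i)
    (σ : ∀ i, Γ(Z, U i)) (hσ : ∀ i, σ i ≠ 0)
    (hunit : ∀ i j, i ≠ j → ∀ y (hi : y ∈ U i), y ∈ U j → IsUnit (Z.presheaf.germ (U i) y hi (σ i)))
    (v : Z → ℕ) (hv : ∀ i y (hi : y ∈ U i), Ring.ord _ (Z.presheaf.germ (U i) y hi (σ i)) = v y)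
    (hfin : v.support.Finite) {d : ℕ} (hd : ∑ᶠ y, v y * str.residueDegree y = d) :
    ∃ L : LineBundle Z, L.HasDegree str d := by
  have hinj {V : Z.Opens} (h : genericPoint Z ∈ V) := germ_injective_of_isIntegral Z (U := V) _ h
  have hηn (i j) : genericPoint Z ∈ U i ⊓ U j := ⟨hη i, hη j⟩
  -- On overlaps of distinct members of the cover both equations are units, so their quotient is a
  -- transition function. The cocycle condition follows by comparison in the function field.
  have hex (i j) : ∃ g : Γ(Z, U i ⊓ U j)ˣ, Z.presheaf.germ _ _ (hη i) (σ i) =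
      Z.presheaf.germ _ _ (hηn i j) g.1 * Z.presheaf.germ _ _ (hη j) (σ j) := by
    obtain rfl | hij := eq_or_ne i j
    · exact ⟨1, by rw [Units.val_one, map_one, one_mul]⟩
    · have h1 : IsUnit (Z.presheaf.map (homOfLE (inf_le_left : U i ⊓ U j ≤ U i)).op (σ i)) := by
        refine RingedSpace.isUnit_of_isUnit_germ (X := Z.toLocallyRingedSpace.toRingedSpace) _ _
          fun y hy => ?_
        have := hunit i j hij y hy.1 hy.2
        rw [← germ_restrict (inf_le_left : U i ⊓ U j ≤ U i) hy] at this
        exact this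
      have h2 : IsUnit (Z.presheaf.map (homOfLE (inf_le_right : U i ⊓ U j ≤ U j)).op (σ j)) := by
        refine RingedSpace.isUnit_of_isUnit_germ (X := Z.toLocallyRingedSpace.toRingedSpace) _ _
          fun y hy => ?_
        have := hunit j i hij.symm y hy.2 hy.1
        rw [← germ_restrict (inf_le_right : U i ⊓ U j ≤ U j) hy] at this
        exact this
      refine ⟨h1.unit * h2.unit⁻¹, ?_⟩
      rw [← germ_restrict (inf_le_left : U i ⊓ U j ≤ U i) (hηn i j),
        ← germ_restrict (inf_le_right : U i ⊓ U j ≤ U j) (hηn i j), ← map_mul]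
      congr 1
      rw [Units.val_mul, mul_assoc, IsUnit.val_inv_mul, mul_one, IsUnit.unit_spec]
  choose g hg using hex
  have hσ0 (i) : (Z.presheaf.germ _ _ (hη i) (σ i) : Z.functionField) ≠ 0 := by
    rw [Ne, map_eq_zero_iff _ (hinj (hη i))]
    exact hσ i
  let L : LineBundle Z :=
    { ι := ι
      U := U
      cover := hcover
      g := g
      cocycle := fun i j l => by
        have hη3 : genericPoint Z ∈ U i ⊓ U j ⊓ U l := ⟨⟨hη i, hη j⟩, hη l⟩
        apply hinj hη3
        rw [map_mul, germ_restrict, germ_restrict, germ_restrict]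
        refine mul_right_cancel₀ (hσ0 l) ?_
        exact (mul_assoc _ _ _).trans
          ((congr(_ * $((hg j l).symm))).trans ((hg i j).symm.trans (hg i l))) }
  refine ⟨L, fun i => Z.presheaf.germ _ _ (hη i) (σ i), fun y => v y, hσ0, fun i j h => hg i j,
    fun i y hy => ?_, ?_, ?_⟩
  · refine ⟨Z.presheaf.germ (U i) y hy (σ i), 1, v y, 0, ?_, one_ne_zero, ?_, hv i y hy, ?_, ?_⟩
    · rw [Ne, map_eq_zero_iff _ (germ_injective_of_isIntegral Z y hy)]
      exact hσ i
    · rw [map_one, mul_one, algebraMap_germ]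
    · rw [Ring.ord_one, Nat.cast_zero]
    · simp
  · refine hfin.subset fun y hy h => hy ?_
    simp [h]
  · have h1 : (Function.support fun y => v y * str.residueDegree y).Finite :=
      hfin.subset fun y hy h => hy (by simp only [h, zero_mul])
    rw [← hd]
    refine .trans ?_ ((Nat.castAddMonoidHom ℤ).map_finsum h1).symm
    simp

variable {X : Scheme.{u}} {f : Z ⟶ X} {x : X}

/-- The divisor consisting of some of the points over `x`. -/
lemma exists_lineBundle_of_fibre {k : Type u} [Field k] (str : Z ⟶ Spec (.of k))
    (hfin : {y | f y = x}.Finite) (hx : IsClosed {x}) {U : X.Opens} (hxU : x ∈ U) {c : Γ(X, U)}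
    (hc : ¬ IsUnit (X.presheaf.germ U x hxU c))
    (hcx : ∀ (x' : X) (hx' : x' ∈ U), ¬ IsUnit (X.presheaf.germ U x' hx' c) → x' = x)
    (hdvr : ∀ y, f y = x → IsDiscreteValuationRing (Z.presheaf.stalk y))
    (h0 : ∀ y (hy : f y = x), fibreHom f hy (X.presheaf.germ U x hxU c) ≠ 0)
    (T : Set Z) (hT : T ⊆ {y | f y = x}) :
    ∃ L : LineBundle Z, L.HasDegree str ((∑ᶠ y ∈ T, str.residueDegree y : ℕ) : ℤ) := by
  classical
  have hη : f (genericPoint Z) ≠ x := by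
    intro h
    have := hdvr _ h
    exact IsDiscreteValuationRing.not_isField (Z.presheaf.stalk (genericPoint Z))
      (Field.toIsField Z.functionField)
  have hex (y : {y : Z // f y = x}) : ∃ (V : Z.Opens) (hV : y.1 ∈ V) (b : Γ(Z, V)), b ≠ 0 ∧
      Ring.ord _ (Z.presheaf.germ V y.1 hV b) = T.indicator (1 : Z → ℕ) y.1 ∧
      ∀ (y' : Z) (hy' : y' ∈ V), y' ≠ y.1 →
        IsUnit (Z.presheaf.germ V y' hy' b) ∧ f y' ≠ x := by
    have := hdvr _ y.2
    obtain ⟨V, hV, b, hb, hbu⟩ := exists_section_irreducible hfin hxU hc hcx y.2 (h0 _ y.2)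
    by_cases hy : y.1 ∈ T
    · refine ⟨V, hV, b, ?_, ?_, hbu⟩
      · rintro rfl
        exact hb.ne_zero (map_zero _)
      · rw [Ring.ord_of_irreducible hb, Set.indicator_of_mem hy, Pi.one_apply, Nat.cast_one]
    · have : Nonempty V := ⟨⟨_, hV⟩⟩
      refine ⟨V, hV, 1, one_ne_zero, ?_, fun y' hy' h => ⟨?_, (hbu y' hy' h).2⟩⟩
      · rw [map_one, Ring.ord_one, Set.indicator_of_notMem hy, Nat.cast_zero]
      · rw [map_one]
        exact isUnit_one
  choose V hV b hb0 hb hbu using hex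
  -- The cover consists of the complement of the fibre, with equation `1`, and a neighbourhood of
  -- each fibre point meeting the fibre only there, with a uniformizer at the points of `T` and `1`
  -- at the others.
  let W : Option {y : Z // f y = x} → Z.Opens :=
    fun i => i.elim (f ⁻¹ᵁ ⟨{x}ᶜ, hx.isOpen_compl⟩) V
  let σ : ∀ i, Γ(Z, W i)
    | none => 1
    | some y => b y
  have hWη : ∀ i, genericPoint Z ∈ W i := by
    rintro (_ | y)
    · exact hη
    · exact genericPoint_mem_of_mem (hV y)
  have hnone (y : Z) (hy : y ∈ W none) : IsUnit (Z.presheaf.germ (W none) y hy (σ none)) :=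
    isUnit_one.map (Z.presheaf.germ (W none) y hy).hom
  refine exists_lineBundle_hasDegree str W (fun y => ?_) hWη σ ?_ ?_ (T.indicator 1) ?_ ?_ ?_
  · by_cases hy : f y = x
    · exact ⟨some ⟨y, hy⟩, hV _⟩
    · exact ⟨none, hy⟩
  · rintro (_ | y)
    · have : Nonempty (W none) := ⟨⟨_, hWη none⟩⟩
      exact one_ne_zero
    · exact hb0 y
  · rintro (_ | y) (_ | y') hij z hi hj
    · exact absurd rfl hij
    · exact hnone z hi
    · refine (hbu y z hi ?_).1
      rintro rfl
      exact hj y.2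
    · refine (hbu y z hi ?_).1
      rintro rfl
      refine (hbu y' y.1 hj fun h => hij ?_).2 y.2
      rw [Subtype.ext h]
  · rintro (_ | y) z hi
    · rw [Ring.ord_of_isUnit (hnone z hi), Set.indicator_of_notMem (fun h => hi (hT h)),
        Nat.cast_zero]
    · by_cases hz : z = y.1
      · subst hz
        exact hb y
      · obtain ⟨h1, h2⟩ := hbu y z hi hz
        rw [Set.indicator_of_notMem (fun h => h2 (hT h)), Nat.cast_zero]
        exact Ring.ord_of_isUnit h1
  · exact hfin.subset (Set.support_indicator_subset.trans hT)
  · refine finsum_congr fun y => ?_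
    by_cases hy : y ∈ T <;> simp [hy]

end LineBundles

end

end ParabolicSpectral



namespace ParabolicSpectral

noncomputable section

/-! ### Rational points and the remaining combinatorics -/

section RationalPoints

/-- A morphism to `Spec k` is determined by its map on global sections, so the composite is the
spectrum of the scalar map `k → κ(y)`. -/
lemma fromSpecResidueField_comp {k : Type u} [Field k] {Z : Scheme.{u}} (f : Z ⟶ Spec (.of k))
    (y : Z) : Z.fromSpecResidueField y ≫ f =
      Spec.map (CommRingCat.ofHom (stalkHom f y) ≫ Z.residue y) := by
  have h1 : f = Z.toSpecΓ ≫ Spec.map ((Scheme.ΓSpecIso (.of k)).inv ≫ f.appTop) := by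
    rw [Spec.map_comp, ← Scheme.toSpecΓ_naturality_assoc, ← SpecMap_ΓSpecIso_hom, ← Spec.map_comp,
      Iso.inv_hom_id, Spec.map_id, Category.comp_id]
  have h2 : Z.fromSpecStalk y ≫ f = Spec.map (CommRingCat.ofHom (stalkHom f y)) := by
    conv_lhs => rw [h1, Scheme.fromSpecStalk_toSpecΓ_assoc, ← Spec.map_comp]
    simp [stalkHom]
  rw [Scheme.fromSpecResidueField, Category.assoc, h2, ← Spec.map_comp]

/-- A point of residue degree one is rational. -/
lemma exists_section_of_residueDegree_eq_one {k : Type u} [Field k] {Z : Scheme.{u}}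
    (f : Z ⟶ Spec (.of k)) {y : Z} (h : f.residueDegree y = 1) :
    ∃ q : Spec (.of k) ⟶ Z, q ≫ f = 𝟙 _ ∧ ∀ p, q p = y := by
  let χ : k →+* Z.residueField y := (CommRingCat.ofHom (stalkHom f y) ≫ Z.residue y).hom
  have hχ : Function.Bijective χ := by
    refine ⟨χ.injective, fun b => ?_⟩
    obtain ⟨b, rfl⟩ := Z.residue_surjective y b
    obtain ⟨a, ha⟩ := exists_sub_stalkHom_mem f h b
    refine ⟨a, (sub_eq_zero.mp ?_).symm⟩
    have h1 : Z.residue y (b - stalkHom f y a) = 0 := Ideal.Quotient.eq_zero_iff_mem.mpr ha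
    rwa [map_sub] at h1
  let e := RingEquiv.ofBijective χ hχ
  refine ⟨Spec.map (CommRingCat.ofHom e.symm.toRingHom) ≫ Z.fromSpecResidueField y, ?_, fun p => ?_⟩
  · rw [Category.assoc, fromSpecResidueField_comp, ← Spec.map_comp, ← Spec.map_id]
    congr 1
    refine CommRingCat.hom_ext (RingHom.ext fun a => ?_)
    exact e.symm_apply_apply a
  · exact Z.fromSpecResidueField_apply y _

end RationalPoints

section Combinatorics

variable {r : ℕ} (m : Composition r)

lemma dualPart_le_length (l : ℕ) : dualPart m l ≤ m.length :=
  List.countP_le_length.trans_eq (sortedParts_length m)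

lemma partMult_eq_zero {i : ℕ} (hi : m.length < i) : partMult m i = 0 := by
  refine Finset.card_eq_zero.mpr (Finset.filter_eq_empty_iff.mpr fun l _ h => ?_)
  exact absurd (dualPart_le_length m l) (by omega)

end Combinatorics

end

end ParabolicSpectral
-- Assembly of the main theorem
theorem mainTheorem5 {k : Type u} [Field k]
    -- a smooth projective geometrically integral curve over `k`
    (X : Scheme.{u}) [X.Over (Spec (.of k))] [IsIntegral X]
    [IsProper (X ↘ Spec (.of k))] [SmoothOfRelativeDimension 1 (X ↘ Spec (.of k))]
    [GeometricallyIntegral (X ↘ Spec (.of k))]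
    -- rational marked points, parabolic types, and a point of the parabolic Hitchin base
    (D : Finset X) (hD : ∀ x ∈ D, (X ↘ Spec (.of k)).residueDegree x = 1)
    (r : ℕ) (hr : 0 < r) (m : X → Composition r)
    (a : ∀ j, RatDiff k X j) (ha : IsHitchinPoint D m a)
    -- the spectral curve is integral
    (δ : Derivation k X.functionField X.functionField) (hδ : δ ≠ 0)
    [IsIntegral (spectralCurve D r a δ)]
    -- a marked point, a formal coordinate, and the local coefficients there
    (x : X) (hx : x ∈ D) (φ : X.presheaf.stalk x →ₐ[k] k⟦X⟧) (c : ℕ → k⟦X⟧)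
    (hc : IsLocalExpansion (m x) a x φ c)
    (hgen : IsGeneric (m x) c) :
    -- `A^{(0)}` is the completion of the local ring of the spectral curve at its point over `x`
    (∃ z : spectralCurve D r a δ, (∀ z', spectralCurveMap D r a δ z' = x ↔ z' = z) ∧
      ∃ ψ : (spectralCurve D r a δ).presheaf.stalk z →+* BlowupRing (m x) c 0,
        IsCompletionMap (S := BlowupRing (m x) c 0) ψ ∧
        ∀ (U : X.Opens) (hU : x ∈ U) (hz : z ∈ spectralCurveMap D r a δ ⁻¹ᵁ U) (f : Γ(X, U)),
          ψ ((spectralCurve D r a δ).presheaf.germ _ z hz ((spectralCurveMap D r a δ).app U f)) =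
            algebraMap k⟦X⟧ _ (φ (X.presheaf.germ U x hU f))) ∧
    -- successive blow-ups
    (∀ i < (m x).length, IsBlowupStep k⟦X⟧ (lam (m x) c i) (uvar (m x) c i)
      (lam (m x) c (i + 1)) (uvar (m x) c (i + 1))) ∧
    -- (a)
    (∀ i ≤ (m x).length, ∀ (p : Ideal (BlowupRing (m x) c i)) [p.IsPrime],
      ¬ IsSmoothAt k (BlowupRing (m x) c i) p ↔
        p = Ideal.span {lam (m x) c i, uvar (m x) c i} ∧ 2 ≤ sortedPart (m x) (i + 1)) ∧
    (∀ (p : Ideal (BlowupRing (m x) c (m x).length)) [p.IsPrime],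
      IsSmoothAt k (BlowupRing (m x) c (m x).length) p) ∧
    -- (b)
    {y | normCurveMap D r a δ y = x}.Finite ∧
    (∀ y, normCurveMap D r a δ y = x →
      IsDiscreteValuationRing ((normCurve D r a δ).presheaf.stalk y) ∧
      IsResiduallySeparable (normCurveStr D r a δ) y) ∧
    {e | ∃ y, normCurveMap D r a δ y = x ∧ ramificationIndex (normCurveMap D r a δ) y = e} =
      {e | 1 ≤ e ∧ ∃ l, 1 ≤ l ∧ dualPart (m x) l = e} ∧
    (∀ i, 1 ≤ i →
      ∑ᶠ y ∈ {y | normCurveMap D r a δ y = x ∧ ramificationIndex (normCurveMap D r a δ) y = i},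
        (normCurveStr D r a δ).residueDegree y = partMult (m x) i) ∧
    -- (c)
    (∀ i, 1 ≤ i → ∃ L : LineBundle (normCurve D r a δ),
      L.HasDegree (normCurveStr D r a δ) (partMult (m x) i)) ∧
    (∀ i, 1 ≤ i → partMult (m x) i = 1 →
      ∃ q : Spec (.of k) ⟶ normCurve D r a δ, q ≫ normCurveStr D r a δ = 𝟙 _ ∧
        ∀ z, normCurveMap D r a δ (q z) = x) := by
  have : IsLocallyNoetherian X := LocallyOfFiniteType.isLocallyNoetherian (X ↘ Spec (.of k))
  obtain ⟨s, β, H, z, hz, huniq, ⟨e, he⟩, ψ, hψ, hψφ⟩ := hc.exists_point hgen hr hD hx hδ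
  have : IsDiscreteValuationRing (X.presheaf.stalk x) :=
    isDiscreteValuationRing_of_maximalIdeal_eq_span H.maximalIdeal_eq H.ne_zero
  obtain ⟨U, hU, hxU, -⟩ := exists_isAffineOpen_mem_and_subset (x := x) (U := ⊤) trivial
  obtain ⟨hfin, hpt, hsum⟩ := H.normalization_fibre (X ↘ Spec (.of k)) (spectralCurveMap D r a δ)
    hz (fun b => (congrArg PowerSeries.constantCoeff (φ.commutes b)).trans (by simp)) e he hU hxU
    (isAffineOpen_spectralCurveMap_preimage D r a δ hU)
  have hsum' (i : ℕ) (hi : 1 ≤ i) :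
      ∑ᶠ y ∈ {y | normCurveMap D r a δ y = x ∧ ramificationIndex (normCurveMap D r a δ) y = i},
        (normCurveStr D r a δ).residueDegree y = partMult (m x) i := by
    -- Beyond `i = σ` both sides vanish: no ramification index and no `μ_ℓ` exceeds `σ`.
    by_cases him : i ≤ (m x).length
    · exact hsum i (Finset.mem_Icc.mpr ⟨hi, him⟩)
    · rw [partMult_eq_zero (m x) (by omega)]
      refine finsum_mem_eq_zero_of_forall_eq_zero ?_
      rintro y ⟨hy, rfl⟩
      exact absurd (Finset.mem_Icc.mp (hpt y hy).2.2.2.1).2 him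
  have hfin' (i : ℕ) :
      {y | normCurveMap D r a δ y = x ∧ ramificationIndex (normCurveMap D r a δ) y = i}.Finite :=
    hfin.subset fun _ h => h.1
  have hex (i : ℕ) (hi : 1 ≤ i) (h : partMult (m x) i ≠ 0) : ∃ y, normCurveMap D r a δ y = x ∧
      ramificationIndex (normCurveMap D r a δ) y = i := by
    rw [← hsum' i hi] at h
    obtain ⟨y, hy, -⟩ := exists_ne_zero_of_finsum_mem_ne_zero h
    exact ⟨y, hy⟩
  -- A degree is bounded by the sum in which it occurs. As degrees are positive, an index that
  -- occurs has nonzero multiplicity, and multiplicity one forces degree one.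
  have hle (y) (hy : normCurveMap D r a δ y = x) : (normCurveStr D r a δ).residueDegree y ≤
      partMult (m x) (ramificationIndex (normCurveMap D r a δ) y) := by
    rw [← hsum' (ramificationIndex (normCurveMap D r a δ) y)
      (Finset.mem_Icc.mp (hpt y hy).2.2.2.1).1, finsum_mem_eq_finite_toFinset_sum _ (hfin' _)]
    exact Finset.single_le_sum (fun _ _ => Nat.zero_le _) ((hfin' _).mem_toFinset.mpr ⟨hy, rfl⟩)
  -- A function near `x` whose only zero is `x`; its pullback supports the construction of the
  -- divisors in (c).
  obtain ⟨V, hxV, b, hb0, hb, hbx⟩ := exists_section_eq_of_not_isUnit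
    (isClosed_of_residueDegree_eq_one _ (hD x hx)) H.maximalIdeal_eq H.ne_zero
  refine ⟨⟨z, huniq, ψ, hψ, fun W hxW hzW f => ?_⟩, fun i hi => hgen.isBlowupStep hr hi,
    fun i hi p _ => hgen.not_isSmoothAt_iff hr hi p, fun p _ => ?_, hfin,
    fun y hy => ⟨(hpt y hy).1, (hpt y hy).2.1⟩, ?_, hsum', fun i hi => ?_, fun i hi h => ?_⟩
  · rw [← fibreHom_germ _ hz hxW hzW, hψφ]
  · by_contra h
    have := ((hgen.not_isSmoothAt_iff hr le_rfl p).mp h).2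
    rw [sortedPart, List.getD_eq_default _ _ (by simp [sortedParts_length])] at this
    omega
  · ext i
    constructor
    · rintro ⟨y, hy, rfl⟩
      have hi := (Finset.mem_Icc.mp (hpt y hy).2.2.2.1).1
      exact ⟨hi, (exists_dualPart_eq_iff (m x) hi).mpr
        ((hpt y hy).2.2.1.trans_le (hle y hy)).ne'⟩
    · rintro ⟨hi, h⟩
      exact hex i hi ((exists_dualPart_eq_iff (m x) hi).mp h)
  · rw [← hsum' i hi]
    exact exists_lineBundle_of_fibre _ hfin (isClosed_of_residueDegree_eq_one _ (hD x hx)) hxV hb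
      hbx (fun y hy => (hpt y hy).1)
      (fun y hy h => hb0 ((hpt y hy).2.2.2.2 (h.trans (map_zero _).symm))) _ fun _ h => h.1
  · obtain ⟨y, hy, rfl⟩ := hex i hi (by omega)
    obtain ⟨q, hq, hqy⟩ := exists_section_of_residueDegree_eq_one (normCurveStr D r a δ)
      (y := y) (le_antisymm (h ▸ hle y hy) (hpt y hy).2.2.1)
    exact ⟨q, hq, fun p => by rw [hqy, hy]⟩
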